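/- Let $k$ be a field of characteristic $0$ and write $[n]=\{0<1<\dots<n\}$. **Disks.** A 2-disk $U$ is a pruned 2-tree: a nonempty finite linearly ordered set $\mathcal F(U)$ of leaves (minimal balls) with a monotone surjection $\pi$ onto a linearly ordered set $\mathcal C(U)$ of columns. Write $a<_0b$ if $\pi(a)<\pi(b)$. A map $P\colon U\to V$ is a surjection $\mathcal F(U)\to\mathcal F(V)$ that is monotone on each column and induces a monotone map $\mathcal C(U)\to\mathcal C(V)$. For $\mu\in\mathcal F(V)$, $P^{-1}(\mu)$ is the pruned fibre: the leaves over $\mu$ and the columns containing them. **The operad $\mathbf{seq}$.** For ordinals $I_\nu=[n_\nu]$ ($\nu\in\mathcal F(U)$) and $J=[j]$, an element of $\mathbf{seq}(U)(\{I_\nu\};J)$ is a total order on $\bigsqcup_\nu I_\nu$ together with a monotone map $W$ from it to $J$, such that: (1) the order restricts to the given one on each $I_\nu$; (2) $I_{\nu_1}<I_{\nu_2}$ if $\pi(\nu_1)=\pi(\nu_2)$ and $\nu_1<\nu_2$; (3) if $\pi(\nu_1)<\pi(\nu_2)$, then $I_{\nu_1}<I_{\nu_2}$, or $I_{\nu_2}<I_{\nu_1}$,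 or $[0,a]<I_{\nu_1}<[a+1,n_{\nu_2}]$ in terms of $I_{\nu_2}=[n_{\nu_2}]$ for some $0\le a<n_{\nu_2}$. These sets are contravariant in the $I_\nu$ (pull-back of orders, points with equal image being ordered as in $I_\nu$) and covariant in $J$. For $P\colon U\to V$, the composite of $y\in\mathbf{seq}(V)(\{J_\mu\};K)$ with $x_\mu\in\mathbf{seq}(P^{-1}(\mu))(\{I_\nu\};J_\mu)$ is the pull-back of the total order of $\bigsqcup_\mu J_\mu$ along the maps $W_\mu$ (ties ordered as in $x_\mu$), with the composite map to $K$. **The condensation $|\mathbf{seq}|$.** $x\in\mathbf{seq}(U)(\{[n_\nu]\};[j])$ has degree $|x|=j-\sum_\nu n_\nu$, and $|\mathbf{seq}|(U)^m=\prod_j\bigoplus_{\{n_\nu\}:\,j-\sum n_\nu=m}k[\mathbf{seq}(U)(\{[n_\nu]\};[j])]$ (non-normalised). The differential is $$dx=\sum_\nu\sum_{i=0}^{n_\nu}(-1)^{\sum_{\kappa<\nu}n_\kappa+i}\,d_i^{\nu}x\;-\;(-1)^{|x|}\sum_{i=0}^{j+1}(-1)^i\delta^ix,$$ with $d^\nu_i$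 the faces in $I_\nu$ (absent if $n_\nu=0$) and $\delta^i$ the cofaces in $J$. The composition $m_P\colon\bigl(\bigotimes_{\mu}|\mathbf{seq}|(P^{-1}(\mu))\bigr)\otimes|\mathbf{seq}|(V)\to|\mathbf{seq}|(U)$ (tensor factors in the order of $\mathcal F(V)$) sends $(\otimes_\mu x_\mu)\otimes y$, for $y$ with arities $J_\mu=[j_\mu]$ and $x_\mu$ with output $J_\mu$, to their composite in $\mathbf{seq}$ times $(-1)^{\varepsilon}$, $\varepsilon=\sum_{\mu<\mu'}|x_{\mu'}|j_\mu+\sum_{\nu<\nu',\,P(\nu)>P(\nu')}n_\nu n_{\nu'}$, and to $0$ if the outputs of the $x_\mu$ do not match the $J_\mu$. The unit is $(\mathrm{id}_{[j]})_j$ on the one-leaf disk. **The complexes $\mathbf{Breq}$ and the whiskering map.** $\mathbf{Breq}(U)$ is the non-normalised total complex of the polysimplicial space $k[\mathbf{seq}(U)(\{I_\nu\};[0])]$, with degrees and differential as above without the cosimplicial part. For $\alpha\in\mathbf{seq}(U)(\{I_\nu\};[0])$ and $J=[j]$ let $S_{\alpha,J}$ be the set of families $s$ of surjective monotone maps $p_\nu\colon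 I'_\nu\to I_\nu$ of ordinals with $\sum_\nu\sum_{i\in I_\nu}(|p_\nu^{-1}(i)|-1)=j$. Call an elementary interval $[b,b+1]$ of some $I'_\nu$ *new* if $p_\nu$ contracts it to a point and *old* otherwise. Let $w_{J,s}(\alpha)\in\mathbf{seq}(U)(\{I'_\nu\};J)$ be the pull-back of $\alpha$ along $\{p_\nu\}$ with the map to $J$ that starts at $0$, increases by $1$ along each new interval and is constant along the other elementary intervals of the total order. For $a<_0b$ let $r_{a,b}$ be the maximal element of $I'_b$ with $[0,r_{a,b}]<I'_a$ in the pulled back order, and $$n_{a,b}=\sum_{i\in I_a}r_{a,b}\,(|p_a^{-1}(i)|-1)+\sum_{i\in[0,p_b(r_{a,b})]}(|p_b^{-1}(i)|-1)\,(|I_a|-1),$$ with $n_{a,b}=0$ if no such element exists. Let $h_s$ be the number of pairs (new interval, old interval) such that the right end of the new one precedes the right end of the old one in the total order, and $N_s=\sum_{a<_0b}n_{a,b}+h_s$. The whiskering map is $$w\colon\mathbf{Breq}(U)\to|\mathbf{seq}|(U),\qquad w(\alpha)=\prod_Jw_J(\alpha),\qquad w_J(\alpha)=\sum_{s\in S_{\alpha,J}}(-1)^{N_s}w_{J,s}(\alpha).$$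 Compositions on $\mathbf{Breq}$ are defined by $M_P\bigl((\otimes_\mu\alpha_\mu)\otimes\beta\bigr)=m_P\bigl((\otimes_\mu w_{J_\mu}(\alpha_\mu))\otimes\beta\bigr)$ for $\beta\in\mathbf{seq}(V)(\{J_\mu\};[0])$, and the unit is $\mathrm{id}_{[0]}$ on the one-leaf disk. **Statement.** $|\mathbf{seq}|$ and $\mathbf{Breq}$, with these differentials, compositions and units, are dg 2-operads (the compositions along all $P$ are maps of complexes, natural for isomorphisms of disks, associative with the Koszul signs, and unital), and $w$ is a map of dg 2-operads: for every $U$ it is a map of complexes $\mathbf{Breq}(U)\to|\mathbf{seq}|(U)$, it preserves the units, and for every $P\colon U\to V$ $$w\bigl(M_P((\otimes_\mu\alpha_\mu)\otimes\beta)\bigr)=m_P\bigl((\otimes_\mu w(\alpha_\mu))\otimes w(\beta)\bigr).$$ -/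

import Mathlib

/-!
Two-dimensional disks (pruned 2-trees), the sets `seq(U)({I_ν}; J)`, the dg condensation `|seq|`,
the complexes `Breq(U)`, the whiskering map, and dg 2-operads.

Throughout, the ordinal `[n]` is `Fin (n + 1)`.
-/

namespace Breq

/-! ### Disks and their maps -/

/-- A 2-disk, i.e. a pruned 2-tree `F → C → pt`: a nonempty finite linearly ordered set `F` of
leaves (the minimal balls), a linearly ordered set `C` of columns (the intervals) and a monotone
surjection `π : F → C`.  For `U = (n₁, …, n_k)`, `C` has `k` elements and the `i`-th fibre of `π`
has `n_i ≥ 1` elements. -/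
structure Disk where
  F : Type
  C : Type
  [fintypeF : Fintype F]
  [linF : LinearOrder F]
  [linC : LinearOrder C]
  [nonemptyF : Nonempty F]
  π : F → C
  mono : Monotone π
  surj : Function.Surjective π

attribute [instance] Disk.fintypeF Disk.linF Disk.linC Disk.nonemptyF

/-- A (surjective) map of pruned 2-trees.  It is determined by its map on leaves: `col` says that
the leaf map induces a well defined monotone map on columns, `mono` that it is monotone on each
column. -/
structure Disk.Hom (U V : Disk) where
  f : U.F → V.F
  col : ∀ x y, U.π x ≤ U.π y → V.π (f x) ≤ V.π (f y)
  mono : ∀ x y, U.π x = U.π y → x ≤ y → f x ≤ f y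
  surj : Function.Surjective f

/-- An isomorphism of pruned 2-trees (it is unique if it exists). -/
structure Disk.Iso (U V : Disk) where
  e : U.F ≃o V.F
  col : ∀ x y, V.π (e x) = V.π (e y) ↔ U.π x = U.π y

namespace Disk

def Iso.refl (U : Disk) : Iso U U := ⟨OrderIso.refl _, fun _ _ => Iff.rfl⟩

def Iso.symm {U V : Disk} (i : Iso U V) : Iso V U :=
  ⟨i.e.symm, fun x y => by simpa using (i.col (i.e.symm x) (i.e.symm y)).symm⟩

def Iso.trans {U V W : Disk} (i : Iso U V) (j : Iso V W) : Iso U W :=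
  ⟨i.e.trans j.e, fun x y => (j.col _ _).trans (i.col x y)⟩

def Hom.id (U : Disk) : Hom U U := ⟨fun x => x, fun _ _ h => h, fun _ _ _ h => h, fun x => ⟨x, rfl⟩⟩

def Hom.comp {T S Q : Disk} (σ : Hom T S) (ρ : Hom S Q) : Hom T Q where
  f x := ρ.f (σ.f x)
  col x y h := ρ.col _ _ (σ.col x y h)
  mono x y h hxy := ρ.mono _ _ (le_antisymm (σ.col x y h.le) (σ.col y x h.ge)) (σ.mono x y h hxy)
  surj := ρ.surj.comp σ.surj

/-- The prunisation of the fibre of a map over a leaf `μ`: the leaves over `μ`, and those columns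
that contain such a leaf. -/
def Hom.fiber {U V : Disk} (P : Hom U V) (μ : V.F) : Disk where
  F := {ν : U.F // P.f ν = μ}
  C := {c : U.C // ∃ ν, P.f ν = μ ∧ U.π ν = c}
  fintypeF := Subtype.fintype _
  nonemptyF := let ⟨ν, h⟩ := P.surj μ; ⟨⟨ν, h⟩⟩
  π ν := ⟨U.π ν.1, ν.1, ν.2, rfl⟩
  mono _ _ h := U.mono h
  surj := by
    rintro ⟨c, ν, h, rfl⟩
    exact ⟨⟨ν, h⟩, rfl⟩

/-- The map induced by `σ` from the fibre of `σ ≫ ρ` over `q` to the fibre of `ρ` over `q`. -/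
def Hom.restrict {T S Q : Disk} (σ : Hom T S) (ρ : Hom S Q) (q : Q.F) :
    Hom ((σ.comp ρ).fiber q) (ρ.fiber q) where
  f x := ⟨σ.f x.1, x.2⟩
  col x y h := σ.col x.1 y.1 h
  mono x y h hxy := σ.mono x.1 y.1 (congrArg Subtype.val h) hxy
  surj := by
    rintro ⟨s, hs⟩
    obtain ⟨x, rfl⟩ := σ.surj s
    exact ⟨⟨x, hs⟩, rfl⟩

/-- The fibre of `σ` over `s` is the fibre of the induced map over `s`. -/
def Hom.restrictFiberIso {T S Q : Disk} (σ : Hom T S) (ρ : Hom S Q) (q : Q.F)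
    (s : (ρ.fiber q).F) : Iso (σ.fiber s.1) ((σ.restrict ρ q).fiber s) where
  e :=
    { toFun := fun x => ⟨⟨x.1, by
        have h1 : σ.f x.1 = s.1 := x.2
        have h2 : ρ.f s.1 = q := s.2
        change ρ.f (σ.f x.1) = q
        rw [h1, h2]⟩, Subtype.ext x.2⟩
      invFun := fun x => ⟨x.1.1, congrArg Subtype.val x.2⟩
      left_inv := fun _ => rfl
      right_inv := fun _ => rfl
      map_rel_iff' := Iff.rfl }
  col x y := by
    constructor
    · intro h
      exact Subtype.ext (congrArg (fun c => c.1.1) h)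
    · intro h
      exact Subtype.ext (Subtype.ext (congrArg (fun c => c.1) h))

/-- Isomorphic maps have isomorphic fibres. -/
def Iso.fiberIso {U V U' V' : Disk} (e : Iso U U') (f : Iso V V') (P : Hom U V) (P' : Hom U' V')
    (h : ∀ x, P'.f (e.e x) = f.e (P.f x)) (μ : V.F) : Iso (P.fiber μ) (P'.fiber (f.e μ)) where
  e :=
    { toFun := fun x => ⟨e.e x.1, by
        have h1 : P.f x.1 = μ := x.2
        exact (h x.1).trans (congrArg f.e h1)⟩
      invFun := fun x => ⟨e.e.symm x.1, by
        have h1 : P'.f x.1 = f.e μ := x.2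
        have h2 := h (e.e.symm x.1)
        rw [OrderIso.apply_symm_apply] at h2
        exact f.e.injective (h2.symm.trans h1)⟩
      left_inv := fun x => Subtype.ext (e.e.symm_apply_apply x.1)
      right_inv := fun x => Subtype.ext (e.e.apply_symm_apply x.1)
      map_rel_iff' := fun {x y} => e.e.map_rel_iff (a := x.1) (b := y.1) }
  col x y := by
    constructor
    · intro h
      exact Subtype.ext ((e.col x.1 y.1).1 (congrArg Subtype.val h))
    · intro h
      exact Subtype.ext ((e.col x.1 y.1).2 (congrArg Subtype.val h))

/-- The final disk: one leaf, one column. -/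
def pt : Disk where
  F := Unit
  C := Unit
  π := fun x => x
  mono := fun _ _ h => h
  surj := fun x => ⟨x, rfl⟩

def Hom.toPt (U : Disk) : Hom U pt where
  f _ := ()
  col _ _ _ := le_refl _
  mono _ _ _ _ := le_refl _
  surj _ := let ⟨x⟩ := U.nonemptyF; ⟨x, rfl⟩

/-- The only fibre of the map to the final disk is the whole disk. -/
def toPtFiberIso (U : Disk) (μ : pt.F) : Iso U ((Hom.toPt U).fiber μ) where
  e :=
    { toFun := fun x => ⟨x, rfl⟩
      invFun := fun x => x.1
      left_inv := fun _ => rfl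
      right_inv := fun _ => rfl
      map_rel_iff' := Iff.rfl }
  col x y := by
    constructor
    · intro h
      exact congrArg Subtype.val h
    · intro h
      exact Subtype.ext h

/-- The fibres of the identity are final disks. -/
def idFiberIso (U : Disk) (μ : U.F) : Iso pt ((Hom.id U).fiber μ) where
  e :=
    { toFun := fun _ => ⟨μ, rfl⟩
      invFun := fun _ => ()
      left_inv := fun _ => rfl
      right_inv := fun x => Subtype.ext (x.2 : x.1 = μ).symm
      map_rel_iff' := fun {_ _} => ⟨fun _ => le_refl _, fun _ => le_refl _⟩ }
  col _ _ := ⟨fun _ => rfl, fun _ => rfl⟩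

end Disk

/-! ### dg 2-operads -/

/-- The data of a dg 2-operad over `k`.  The degree `m` component of the complex attached to a disk
`U` is the submodule `gr U m` of a module `obj U`, which serves only as a container for the
homogeneous elements.  Disks are not taken up to isomorphism, so the (unique) isomorphisms of disks
act by `relabel`.  The composition along `P : U → V` is a map
`(⨂_μ O(P⁻¹ μ)) ⊗ O(V) → O(U)`, the factors `μ` taken in the order of the leaves of `V`. -/
structure DGTwoOperadData (k : Type*) [Field k] where
  obj : Disk → Type*
  [addCommGroup : ∀ U, AddCommGroup (obj U)]
  [module : ∀ U, Module k (obj U)]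
  gr : ∀ U, ℤ → Submodule k (obj U)
  d : ∀ U, obj U →ₗ[k] obj U
  relabel : ∀ {U V : Disk}, U.Iso V → (obj U →ₗ[k] obj V)
  one : obj Disk.pt
  comp : ∀ {U V : Disk} (P : U.Hom V), (∀ μ : V.F, obj (P.fiber μ)) → obj V → obj U

attribute [instance] DGTwoOperadData.addCommGroup DGTwoOperadData.module

/-- The axioms of a dg 2-operad (a pruned 1-terminal 2-operad in complexes with a unit
`one ∈ O(pt)`), with Koszul signs. -/
structure DGTwoOperadData.IsDGTwoOperad {k : Type*} [Field k] (O : DGTwoOperadData k) : Prop where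
  /-- complexes -/
  d_mem : ∀ U m, ∀ x ∈ O.gr U m, O.d U x ∈ O.gr U (m + 1)
  d_d : ∀ U m, ∀ x ∈ O.gr U m, O.d U (O.d U x) = 0
  /-- isomorphisms of disks act functorially by isomorphisms of complexes -/
  relabel_mem : ∀ {U V} (e : Disk.Iso U V) (m), ∀ x ∈ O.gr U m, O.relabel e x ∈ O.gr V m
  relabel_d : ∀ {U V} (e : Disk.Iso U V) (m), ∀ x ∈ O.gr U m,
    O.relabel e (O.d U x) = O.d V (O.relabel e x)
  relabel_refl : ∀ U m, ∀ x ∈ O.gr U m, O.relabel (Disk.Iso.refl U) x = x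
  relabel_trans : ∀ {U V W} (e : Disk.Iso U V) (f : Disk.Iso V W) (m), ∀ x ∈ O.gr U m,
    O.relabel (e.trans f) x = O.relabel f (O.relabel e x)
  /-- the unit is a cycle of degree 0 -/
  one_mem : O.one ∈ O.gr Disk.pt 0
  d_one : O.d Disk.pt O.one = 0
  /-- the composition is multilinear of degree 0 -/
  comp_mem : ∀ {U V} (P : Disk.Hom U V) (α : ∀ μ, O.obj (P.fiber μ)) (β : O.obj V)
    (a : V.F → ℤ) (b : ℤ), (∀ μ, α μ ∈ O.gr _ (a μ)) → β ∈ O.gr V b →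
    O.comp P α β ∈ O.gr U (∑ μ, a μ + b)
  comp_add_left : ∀ {U V} (P : Disk.Hom U V) (α : ∀ μ, O.obj (P.fiber μ)) (β : O.obj V)
    (a : V.F → ℤ) (b : ℤ), (∀ μ, α μ ∈ O.gr _ (a μ)) → β ∈ O.gr V b →
    ∀ μ, ∀ x ∈ O.gr (P.fiber μ) (a μ), ∀ y ∈ O.gr (P.fiber μ) (a μ),
      O.comp P (Function.update α μ (x + y)) β =
        O.comp P (Function.update α μ x) β + O.comp P (Function.update α μ y) β
  comp_smul_left : ∀ {U V} (P : Disk.Hom U V) (α : ∀ μ, O.obj (P.fiber μ)) (β : O.obj V)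
    (a : V.F → ℤ) (b : ℤ), (∀ μ, α μ ∈ O.gr _ (a μ)) → β ∈ O.gr V b →
    ∀ (μ) (c : k), O.comp P (Function.update α μ (c • α μ)) β = c • O.comp P α β
  comp_add_right : ∀ {U V} (P : Disk.Hom U V) (α : ∀ μ, O.obj (P.fiber μ)) (β β' : O.obj V)
    (a : V.F → ℤ) (b : ℤ), (∀ μ, α μ ∈ O.gr _ (a μ)) → β ∈ O.gr V b → β' ∈ O.gr V b →
    O.comp P α (β + β') = O.comp P α β + O.comp P α β'
  comp_smul_right : ∀ {U V} (P : Disk.Hom U V) (α : ∀ μ, O.obj (P.fiber μ)) (β : O.obj V)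
    (a : V.F → ℤ) (b : ℤ), (∀ μ, α μ ∈ O.gr _ (a μ)) → β ∈ O.gr V b →
    ∀ c : k, O.comp P α (c • β) = c • O.comp P α β
  /-- the composition is a map of complexes -/
  d_comp : ∀ {U V} (P : Disk.Hom U V) (α : ∀ μ, O.obj (P.fiber μ)) (β : O.obj V)
    (a : V.F → ℤ) (b : ℤ), (∀ μ, α μ ∈ O.gr _ (a μ)) → β ∈ O.gr V b →
    O.d U (O.comp P α β) =
      ∑ μ, ((-1 : k) ^ (∑ μ' with μ' < μ, a μ')) •
          O.comp P (Function.update α μ (O.d _ (α μ))) β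
        + ((-1 : k) ^ (∑ μ, a μ)) • O.comp P α (O.d V β)
  /-- the composition is natural for isomorphisms of disks -/
  comp_relabel : ∀ {U V U' V'} (e : Disk.Iso U U') (f : Disk.Iso V V') (P : Disk.Hom U V)
    (P' : Disk.Hom U' V') (h : ∀ x, P'.f (e.e x) = f.e (P.f x))
    (α : ∀ μ, O.obj (P.fiber μ)) (α' : ∀ μ, O.obj (P'.fiber μ)) (β : O.obj V)
    (a : V.F → ℤ) (b : ℤ), (∀ μ, α μ ∈ O.gr _ (a μ)) → β ∈ O.gr V b →
    (∀ μ, α' (f.e μ) = O.relabel (Disk.Iso.fiberIso e f P P' h μ) (α μ)) →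
    O.comp P' α' (O.relabel f β) = O.relabel e (O.comp P α β)
  /-- the two unit axioms -/
  comp_one : ∀ V b, ∀ β ∈ O.gr V b,
    O.comp (Disk.Hom.id V) (fun μ => O.relabel (V.idFiberIso μ) O.one) β = β
  one_comp : ∀ U a, ∀ α ∈ O.gr U a,
    O.comp (Disk.Hom.toPt U) (fun μ => O.relabel (U.toPtFiberIso μ) α) O.one = α
  /-- associativity for `σ : T → S`, `ρ : S → Q` -/
  comp_assoc : ∀ {T S Q} (σ : Disk.Hom T S) (ρ : Disk.Hom S Q)
    (α : ∀ s, O.obj (σ.fiber s)) (β : ∀ q, O.obj (ρ.fiber q)) (γ : O.obj Q)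
    (a : S.F → ℤ) (b : Q.F → ℤ) (c : ℤ),
    (∀ s, α s ∈ O.gr _ (a s)) → (∀ q, β q ∈ O.gr _ (b q)) → γ ∈ O.gr Q c →
    O.comp σ α (O.comp ρ β γ) =
      ((-1 : k) ^ (∑ s, ∑ s' with s < s' ∧ ρ.f s' < ρ.f s, a s * a s'
          + ∑ q, ∑ s with q < ρ.f s, b q * a s)) •
        O.comp (σ.comp ρ)
          (fun q => O.comp (σ.restrict ρ q)
            (fun s => O.relabel (σ.restrictFiberIso ρ q s) (α s.1)) (β q)) γ

/-- A family of linear maps is a map of dg 2-operads: it consists of maps of complexes and respects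
isomorphisms of disks, units and compositions. -/
structure IsDGTwoOperadMap {k : Type*} [Field k] (A B : DGTwoOperadData k)
    (φ : ∀ U, A.obj U →ₗ[k] B.obj U) : Prop where
  map_mem : ∀ U m, ∀ x ∈ A.gr U m, φ U x ∈ B.gr U m
  map_d : ∀ U m, ∀ x ∈ A.gr U m, φ U (A.d U x) = B.d U (φ U x)
  map_relabel : ∀ {U V} (e : Disk.Iso U V) (m), ∀ x ∈ A.gr U m,
    φ V (A.relabel e x) = B.relabel e (φ U x)
  map_one : φ Disk.pt A.one = B.one
  map_comp : ∀ {U V} (P : Disk.Hom U V) (α : ∀ μ, A.obj (P.fiber μ)) (β : A.obj V)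
    (a : V.F → ℤ) (b : ℤ), (∀ μ, α μ ∈ A.gr _ (a μ)) → β ∈ A.gr V b →
    φ U (A.comp P α β) = B.comp P (fun μ => φ _ (α μ)) (φ V β)

/-! ### The sets `seq(U)({I_ν}; J)` -/

/-- The disjoint union `⊔_ν I_ν` of the ordinals `I_ν = [n ν]`. -/
abbrev Pts {X : Type} (n : X → ℕ) : Type := Σ ν : X, Fin (n ν + 1)

/-- An element of `seq(U)({[n ν]}_ν; [j])`, together with the arities `n`: a total order `le` on
`⊔_ν [n ν]` subject to the conditions `le_color`, `le_column`, `le_brace`, and a monotone map `W`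
from it to `[j]`. -/
structure SeqElt (U : Disk) (j : ℕ) where
  n : U.F → ℕ
  le : Pts n → Pts n → Prop
  le_total : ∀ x y, le x y ∨ le y x
  le_antisymm : ∀ x y, le x y → le y x → x = y
  le_trans : ∀ x y z, le x y → le y z → le x z
  le_color : ∀ ν (i i' : Fin (n ν + 1)), i ≤ i' → le ⟨ν, i⟩ ⟨ν, i'⟩
  le_column : ∀ ν₁ ν₂, U.π ν₁ = U.π ν₂ → ν₁ < ν₂ → ∀ i i', le ⟨ν₁, i⟩ ⟨ν₂, i'⟩
  le_brace : ∀ ν₁ ν₂, U.π ν₁ < U.π ν₂ →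
    (∀ i i', le ⟨ν₁, i⟩ ⟨ν₂, i'⟩) ∨ (∀ i i', le ⟨ν₂, i'⟩ ⟨ν₁, i⟩) ∨
      ∃ a : ℕ, a < n ν₂ ∧ ∀ i, ∀ i' : Fin (n ν₂ + 1),
        ((i' : ℕ) ≤ a → le ⟨ν₂, i'⟩ ⟨ν₁, i⟩) ∧ (a < (i' : ℕ) → le ⟨ν₁, i⟩ ⟨ν₂, i'⟩)
  W : Pts n → Fin (j + 1)
  W_mono : ∀ x y, le x y → W x ≤ W y

/-- The order pulled back along `t : A → B`, where points with the same image are compared by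
`leF`. -/
def pullLE {A B : Type} (t : A → B) (le : B → B → Prop) (leF : A → A → Prop) (x y : A) : Prop :=
  (t x ≠ t y ∧ le (t x) (t y)) ∨ (t x = t y ∧ leF x y)

section pullLE

variable {A B : Type} {t : A → B} {le : B → B → Prop} {leF : A → A → Prop}

lemma pullLE_of (hF : ∀ x y, t x = t y → leF x y) {x y : A} (h : le (t x) (t y)) :
    pullLE t le leF x y := by
  by_cases e : t x = t y
  · exact Or.inr ⟨e, hF x y e⟩
  · exact Or.inl ⟨e, h⟩

lemma pullLE_total (h1 : ∀ x y, le x y ∨ le y x) (h2 : ∀ x y, t x = t y → leF x y ∨ leF y x)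
    (x y : A) : pullLE t le leF x y ∨ pullLE t le leF y x := by
  by_cases e : t x = t y
  · exact (h2 x y e).imp (fun h => Or.inr ⟨e, h⟩) (fun h => Or.inr ⟨e.symm, h⟩)
  · exact (h1 (t x) (t y)).imp (fun h => Or.inl ⟨e, h⟩) (fun h => Or.inl ⟨Ne.symm e, h⟩)

lemma pullLE_antisymm (h1 : ∀ x y, le x y → le y x → x = y)
    (h2 : ∀ x y, t x = t y → leF x y → leF y x → x = y)
    (x y : A) (hxy : pullLE t le leF x y) (hyx : pullLE t le leF y x) : x = y := by
  rcases hxy with ⟨e, h⟩ | ⟨e, h⟩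
  · rcases hyx with ⟨_, h'⟩ | ⟨e', _⟩
    · exact absurd (h1 _ _ h h') e
    · exact absurd e'.symm e
  · rcases hyx with ⟨e', _⟩ | ⟨_, h'⟩
    · exact absurd e.symm e'
    · exact h2 _ _ e h h'

lemma pullLE_trans (h0 : ∀ x y, le x y → le y x → x = y)
    (h1 : ∀ x y z, le x y → le y z → le x z)
    (h2 : ∀ x y z, t x = t y → t y = t z → leF x y → leF y z → leF x z)
    (x y z : A) (hxy : pullLE t le leF x y) (hyz : pullLE t le leF y z) :
    pullLE t le leF x z := by
  rcases hxy with ⟨e, h⟩ | ⟨e, h⟩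
  · rcases hyz with ⟨e', h'⟩ | ⟨e', _⟩
    · refine Or.inl ⟨fun e'' => ?_, h1 _ _ _ h h'⟩
      rw [← e''] at h'
      exact e (h0 _ _ h h')
    · rw [e'] at e h
      exact Or.inl ⟨e, h⟩
  · rcases hyz with ⟨e', h'⟩ | ⟨e', h'⟩
    · rw [← e] at e' h'
      exact Or.inl ⟨e', h'⟩
    · exact Or.inr ⟨e.trans e', h2 _ _ _ e e' h h'⟩

end pullLE

lemma threshold (N : ℕ) (p : Fin (N + 1) → Prop) (hp : ∀ i i', i ≤ i' → p i → p i') :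
    (∀ i, p i) ∨ (∀ i, ¬ p i) ∨
      ∃ a : ℕ, a < N ∧ ∀ i : Fin (N + 1), ((i : ℕ) ≤ a → ¬ p i) ∧ (a < (i : ℕ) → p i) := by
  classical
  by_cases h : ∃ m : ℕ, ∃ hm : m < N + 1, p ⟨m, hm⟩
  · have hs := Nat.find_spec h
    have hmin := fun m => Nat.find_min h (m := m)
    set m := Nat.find h
    obtain ⟨hm, hpm⟩ := hs
    rcases Nat.eq_zero_or_pos m with h0 | h0
    · left
      intro i
      exact hp _ _ (by simp [h0]) hpm
    · right; right
      refine ⟨m - 1, by omega, fun i => ⟨fun hi hpi => ?_, fun hi => ?_⟩⟩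
      · exact hmin i.1 (by omega) ⟨i.2, hpi⟩
      · exact hp _ _ (by simp only [Fin.le_def]; omega) hpm
  · right; left
    intro i hi
    exact h ⟨i.1, i.2, hi⟩

namespace SeqElt

variable {U V : Disk} {j : ℕ}

/-- Contravariance in the ordinals `I_ν`: the pull-back along monotone maps `φ ν`. -/
def pull (x : SeqElt U j) (n' : U.F → ℕ) (φ : ∀ ν, Fin (n' ν + 1) →o Fin (x.n ν + 1)) :
    SeqElt U j where
  n := n'
  le := pullLE (fun z : Pts n' => (⟨z.1, φ z.1 z.2⟩ : Pts x.n)) x.le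
    (fun z z' => (z.2 : ℕ) ≤ (z'.2 : ℕ))
  le_total := pullLE_total x.le_total (fun _ _ _ => _root_.le_total _ _)
  le_antisymm := pullLE_antisymm x.le_antisymm (by
    rintro ⟨ν, i⟩ ⟨ν', i'⟩ h h1 h2
    have e : ν = ν' := congrArg Sigma.fst h
    subst e
    congr 1
    exact Fin.ext (_root_.le_antisymm h1 h2))
  le_trans := pullLE_trans x.le_antisymm x.le_trans (fun _ _ _ _ _ h h' => _root_.le_trans h h')
  le_color ν i i' h := by
    by_cases e : (φ ν i) = φ ν i'
    · exact Or.inr ⟨by simp [e], h⟩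
    · exact Or.inl ⟨by simpa using e, x.le_color ν _ _ ((φ ν).monotone h)⟩
  le_column ν₁ ν₂ h h' i i' := by
    refine Or.inl ⟨fun e => h'.ne (congrArg Sigma.fst e), x.le_column ν₁ ν₂ h h' _ _⟩
  le_brace ν₁ ν₂ h := by
    have hne : ν₁ ≠ ν₂ := fun e => h.ne (congrArg U.π e)
    have hne' : ∀ i i', (⟨ν₁, φ ν₁ i⟩ : Pts x.n) ≠ ⟨ν₂, φ ν₂ i'⟩ :=
      fun _ _ e => hne (congrArg Sigma.fst e)
    rcases x.le_brace ν₁ ν₂ h with H | H | ⟨a, -, H⟩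
    · exact Or.inl fun i i' => Or.inl ⟨hne' _ _, H _ _⟩
    · exact Or.inr (Or.inl fun i i' => Or.inl ⟨(hne' _ _).symm, H _ _⟩)
    · rcases threshold (n' ν₂) (fun i => a < (φ ν₂ i : ℕ))
        (fun i i' hi h => lt_of_lt_of_le h ((φ ν₂).monotone hi)) with T | T | ⟨b, hb, T⟩
      · exact Or.inl fun i i' => Or.inl ⟨hne' _ _, (H _ _).2 (T _)⟩
      · exact Or.inr (Or.inl fun i i' => Or.inl ⟨(hne' _ _).symm, (H _ _).1 (not_lt.1 (T _))⟩)
      · exact Or.inr (Or.inr ⟨b, hb, fun i i' =>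
          ⟨fun hi => Or.inl ⟨(hne' _ _).symm, (H _ _).1 (not_lt.1 ((T i').1 hi))⟩,
            fun hi => Or.inl ⟨hne' _ _, (H _ _).2 ((T i').2 hi)⟩⟩⟩)
  W z := x.W ⟨z.1, φ z.1 z.2⟩
  W_mono z z' h := by
    rcases h with ⟨_, h⟩ | ⟨e, _⟩
    · exact x.W_mono _ _ h
    · exact (congrArg x.W e).le

/-- Covariance in the ordinal `J`. -/
def push (x : SeqElt U j) {j' : ℕ} (g : Fin (j + 1) →o Fin (j' + 1)) : SeqElt U j' :=
  { x with
    W := fun z => g (x.W z)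
    W_mono := fun z z' h => g.monotone (x.W_mono z z' h) }

/-- Replace the map `W`. -/
def withW (x : SeqElt U j) {j' : ℕ} (W : Pts x.n → Fin (j' + 1))
    (hW : ∀ z z', x.le z z' → W z ≤ W z') : SeqElt U j' :=
  { x with
    W := W
    W_mono := hW }

/-- The action of an isomorphism of disks. -/
def relabel (e : U.Iso V) (x : SeqElt U j) : SeqElt V j where
  n ν := x.n (e.e.symm ν)
  le z z' := x.le ⟨e.e.symm z.1, z.2⟩ ⟨e.e.symm z'.1, z'.2⟩
  le_total _ _ := x.le_total _ _
  le_antisymm := by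
    rintro ⟨ν, i⟩ ⟨ν', i'⟩ h1 h2
    have h := x.le_antisymm _ _ h1 h2
    have h3 : e.e.symm ν = e.e.symm ν' := congrArg Sigma.fst h
    have h4 : ν = ν' := e.e.symm.injective h3
    subst h4
    have h5 : i = i' := eq_of_heq (Sigma.mk.inj h).2
    rw [h5]
  le_trans _ _ _ := x.le_trans _ _ _
  le_color _ _ _ := x.le_color _ _ _
  le_column ν₁ ν₂ h h' := x.le_column _ _ ((e.symm.col ν₁ ν₂).2 h) (e.e.symm.strictMono h')
  le_brace ν₁ ν₂ h := x.le_brace _ _ (by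
    have h1 : ν₁ < ν₂ := by
      by_contra hc
      exact absurd (V.mono (not_lt.1 hc)) (not_le.2 h)
    refine lt_of_le_of_ne (U.mono (e.e.symm.monotone h1.le)) fun hc => h.ne ?_
    exact (e.symm.col ν₁ ν₂).1 hc)
  W z := x.W ⟨e.e.symm z.1, z.2⟩
  W_mono _ _ := x.W_mono _ _

/-- A point of `⊔_ν I_ν` whose colour lies over `μ`, as a point of `⊔_{ν ∈ P⁻¹ μ} I_ν`. -/
def localPt {P : U.Hom V} {c : V.F → ℕ} (x : ∀ μ, SeqElt (P.fiber μ) (c μ))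
    (z : Pts fun ν : U.F => (x (P.f ν)).n ⟨ν, rfl⟩) (μ : V.F) (h : P.f z.1 = μ) :
    Pts (x μ).n :=
  ⟨⟨z.1, h⟩, Fin.cast (by subst h; rfl) z.2⟩

/-- The image in `⊔_μ J_μ` of a point of `⊔_ν I_ν` under the maps `W_μ : I_{μ,tot} → J_μ`. -/
def compPt {P : U.Hom V} (y : SeqElt V j) (x : ∀ μ, SeqElt (P.fiber μ) (y.n μ))
    (z : Pts fun ν : U.F => (x (P.f ν)).n ⟨ν, rfl⟩) : Pts y.n :=
  ⟨P.f z.1, (x (P.f z.1)).W (localPt x z _ rfl)⟩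

/-- The pull-back of the total order of `⊔_μ J_μ` to `⊔_ν I_ν`; points of `I_{μ,tot}` with the same
image in `J_μ` are compared in `I_{μ,tot}`. -/
def compLE {P : U.Hom V} (y : SeqElt V j) (x : ∀ μ, SeqElt (P.fiber μ) (y.n μ)) :
    (Pts fun ν : U.F => (x (P.f ν)).n ⟨ν, rfl⟩) →
      (Pts fun ν : U.F => (x (P.f ν)).n ⟨ν, rfl⟩) → Prop :=
  pullLE (compPt y x) y.le (fun z z' => ∃ μ, ∃ h : P.f z.1 = μ, ∃ h' : P.f z'.1 = μ,
    (x μ).le (localPt x z μ h) (localPt x z' μ h'))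

lemma compLE_of_local {P : U.Hom V} (y : SeqElt V j) (x : ∀ μ, SeqElt (P.fiber μ) (y.n μ))
    (z z' : Pts fun ν : U.F => (x (P.f ν)).n ⟨ν, rfl⟩) (μ : V.F) (h : P.f z.1 = μ)
    (h' : P.f z'.1 = μ) (hle : (x μ).le (localPt x z μ h) (localPt x z' μ h')) :
    compLE y x z z' := by
  by_cases e : compPt y x z = compPt y x z'
  · exact Or.inr ⟨e, μ, h, h', hle⟩
  · refine Or.inl ⟨e, ?_⟩
    have key : ∀ (w : Pts fun ν : U.F => (x (P.f ν)).n ⟨ν, rfl⟩) (hw : P.f w.1 = μ),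
        compPt y x w = ⟨μ, (x μ).W (localPt x w μ hw)⟩ := by
      intro w hw
      subst hw
      rfl
    rw [key z h, key z' h']
    exact y.le_color _ _ _ ((x μ).W_mono _ _ hle)

/-- The composition of the coloured 2-operad `seq`. -/
def comp (P : U.Hom V) (y : SeqElt V j) (x : ∀ μ, SeqElt (P.fiber μ) (y.n μ)) : SeqElt U j where
  n ν := (x (P.f ν)).n ⟨ν, rfl⟩
  le := compLE y x
  le_total := pullLE_total y.le_total (by
    rintro ⟨ν, i⟩ ⟨ν', i'⟩ e
    have e1 : P.f ν = P.f ν' := congrArg Sigma.fst e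
    exact ((x (P.f ν')).le_total (localPt x ⟨ν, i⟩ _ e1) (localPt x ⟨ν', i'⟩ _ rfl)).imp
      (fun h => ⟨_, e1, rfl, h⟩) (fun h => ⟨_, rfl, e1, h⟩))
  le_antisymm := pullLE_antisymm y.le_antisymm (by
    rintro ⟨ν, i⟩ ⟨ν', i'⟩ e ⟨μ, h1, h2, h⟩ ⟨μ', h1', h2', h'⟩
    have hμ : μ' = μ := h2'.symm.trans h1
    subst hμ
    have E := (x μ').le_antisymm _ _ h h'
    have E1 : ν = ν' := congrArg (fun p => p.1.1) E
    subst E1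
    have E2 := congrArg Fin.val (eq_of_heq (Sigma.mk.inj E).2)
    congr 1
    exact Fin.ext E2)
  le_trans := pullLE_trans y.le_antisymm y.le_trans (by
    rintro ⟨ν, i⟩ ⟨ν', i'⟩ ⟨ν'', i''⟩ e e' ⟨μ, h1, h2, h⟩ ⟨μ', h1', h2', h'⟩
    have hμ : μ' = μ := h1'.symm.trans h2
    subst hμ
    exact ⟨μ', h1, h2', (x μ').le_trans _ _ _ h h'⟩)
  le_color ν i i' hi := compLE_of_local y x ⟨ν, i⟩ ⟨ν, i'⟩ _ rfl rfl
    ((x (P.f ν)).le_color ⟨ν, rfl⟩ i i' hi)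
  le_column ν₁ ν₂ h h' i i' := by
    rcases (P.mono ν₁ ν₂ h h'.le).lt_or_eq with hlt | heq
    · exact Or.inl ⟨fun e => hlt.ne (congrArg Sigma.fst e),
        y.le_column _ _ (_root_.le_antisymm (P.col _ _ h.le) (P.col _ _ h.ge)) hlt _ _⟩
    · exact compLE_of_local y x ⟨ν₁, i⟩ ⟨ν₂, i'⟩ _ heq rfl
        ((x (P.f ν₂)).le_column ⟨ν₁, heq⟩ ⟨ν₂, rfl⟩ (Subtype.ext h) h' _ _)
  le_brace ν₁ ν₂ h := by
    by_cases heq : P.f ν₁ = P.f ν₂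
    · rcases (x (P.f ν₂)).le_brace ⟨ν₁, heq⟩ ⟨ν₂, rfl⟩ h with H | H | ⟨a, ha, H⟩
      · exact Or.inl fun i i' => compLE_of_local y x ⟨ν₁, i⟩ ⟨ν₂, i'⟩ _ heq rfl (H _ _)
      · exact Or.inr (Or.inl fun i i' => compLE_of_local y x ⟨ν₂, i'⟩ ⟨ν₁, i⟩ _ rfl heq (H _ _))
      · exact Or.inr (Or.inr ⟨a, ha, fun i i' =>
          ⟨fun hi => compLE_of_local y x ⟨ν₂, i'⟩ ⟨ν₁, i⟩ _ rfl heq ((H _ _).1 hi),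
            fun hi => compLE_of_local y x ⟨ν₁, i⟩ ⟨ν₂, i'⟩ _ heq rfl ((H _ _).2 hi)⟩⟩)
    · have hne' : ∀ (i : Fin (y.n (P.f ν₁) + 1)) (i' : Fin (y.n (P.f ν₂) + 1)),
          (⟨P.f ν₁, i⟩ : Pts y.n) ≠ ⟨P.f ν₂, i'⟩ := fun _ _ e => heq (congrArg Sigma.fst e)
      rcases (P.col ν₁ ν₂ h.le).lt_or_eq with hlt | hc
      · rcases y.le_brace _ _ hlt with H | H | ⟨a, -, H⟩
        · exact Or.inl fun i i' => Or.inl ⟨hne' _ _, H _ _⟩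
        · exact Or.inr (Or.inl fun i i' => Or.inl ⟨(hne' _ _).symm, H _ _⟩)
        · rcases threshold ((x (P.f ν₂)).n ⟨ν₂, rfl⟩)
            (fun i => a < ((x (P.f ν₂)).W ⟨⟨ν₂, rfl⟩, i⟩ : ℕ))
            (fun i i' hi h => lt_of_lt_of_le h
              ((x (P.f ν₂)).W_mono _ _ ((x (P.f ν₂)).le_color _ _ _ hi))) with T | T | ⟨b, hb, T⟩
          · exact Or.inl fun i i' => Or.inl ⟨hne' _ _, (H _ _).2 (T _)⟩
          · exact Or.inr (Or.inl fun i i' =>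
              Or.inl ⟨(hne' _ _).symm, (H _ _).1 (not_lt.1 (T _))⟩)
          · exact Or.inr (Or.inr ⟨b, hb, fun i i' =>
              ⟨fun hi => Or.inl ⟨(hne' _ _).symm, (H _ _).1 (not_lt.1 ((T i').1 hi))⟩,
                fun hi => Or.inl ⟨hne' _ _, (H _ _).2 ((T i').2 hi)⟩⟩⟩)
      · rcases lt_or_gt_of_ne heq with hlt | hlt
        · exact Or.inl fun i i' => Or.inl ⟨hne' _ _, y.le_column _ _ hc hlt _ _⟩
        · exact Or.inr (Or.inl fun i i' =>
            Or.inl ⟨(hne' _ _).symm, y.le_column _ _ hc.symm hlt _ _⟩)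
  W z := y.W (compPt y x z)
  W_mono z z' h := by
    rcases h with ⟨_, h⟩ | ⟨e, _⟩
    · exact y.W_mono _ _ h
    · exact (congrArg y.W e).le

/-- The unit of the coloured 2-operad `seq` of colour `[j]`: the identity map of `[j]`. -/
def unit (j : ℕ) : SeqElt Disk.pt j where
  n _ := j
  le z z' := (z.2 : ℕ) ≤ (z'.2 : ℕ)
  le_total _ _ := _root_.le_total _ _
  le_antisymm := by
    rintro ⟨⟨⟩, i⟩ ⟨⟨⟩, i'⟩ h h'
    exact congrArg (fun i => (⟨(), i⟩ : Pts fun _ : Disk.pt.F => j))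
      (Fin.ext (_root_.le_antisymm h h'))
  le_trans _ _ _ h h' := _root_.le_trans h h'
  le_color _ _ _ h := h
  le_column _ _ _ h := absurd h (lt_irrefl _)
  le_brace _ _ h := absurd h (lt_irrefl _)
  W z := z.2
  W_mono _ _ h := h

/-- The degree of an element in the (polysimplicial, cosimplicial) total complex. -/
def deg (x : SeqElt U j) : ℤ := (j : ℤ) - ∑ ν, (x.n ν : ℤ)

/-- The face `d_i` in the variable `I_ν`, i.e. the pull-back along the injection
`[n ν - 1] → [n ν]` that misses `i` (and the identities of the other `I_κ`). -/
def face (x : SeqElt U j) (ν : U.F) (i : Fin (x.n ν + 1)) (h : 0 < x.n ν) : SeqElt U j :=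
  x.pull (Function.update x.n ν (x.n ν - 1)) fun κ =>
    { toFun := fun b => ⟨if κ = ν ∧ (i : ℕ) ≤ (b : ℕ) then b + 1 else b, by
        have hb : ∀ c : ℕ, c < Function.update x.n ν (x.n ν - 1) κ + 1 →
            (if κ = ν ∧ (i : ℕ) ≤ c then c + 1 else c) < x.n κ + 1 := by
          intro c hc
          by_cases hκ : κ = ν
          · subst hκ
            simp only [Function.update_self] at hc
            split_ifs <;> omega
          · rw [Function.update_of_ne hκ] at hc
            simp only [hκ, false_and, if_false]
            omega
        exact hb b b.2⟩
      monotone' := by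
        intro b b' hb
        have hb' : (b : ℕ) ≤ (b' : ℕ) := hb
        simp only [Fin.le_def]
        split_ifs with h1 h2 h2
        · omega
        · exact absurd ⟨h1.1, h1.2.trans hb'⟩ h2
        · omega
        · omega }

/-- The coface `δ^i` in the variable `J`. -/
def coface (x : SeqElt U j) (i : Fin (j + 2)) : SeqElt U (j + 1) :=
  x.push (Fin.succAboveOrderEmb i).toOrderHom

end SeqElt

/-! ### The whiskering map on generators -/

/-- An element `s` of the set `S_{α, [j]}`: ordinals `I'_ν = [size ν]` and surjections
`p ν : I'_ν → I_ν` of ordinals which insert altogether `j` elementary intervals. -/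
structure Insertion {U : Disk} (x : SeqElt U 0) (j : ℕ) where
  size : U.F → ℕ
  p : ∀ ν, Fin (size ν + 1) →o Fin (x.n ν + 1)
  surj : ∀ ν, Function.Surjective (p ν)
  total : ∑ ν, ∑ i : Fin (x.n ν + 1), ((Finset.univ.filter fun b => p ν b = i).card - 1) = j

namespace Insertion

variable {U : Disk} {x : SeqElt U 0} {j : ℕ}

lemma size_le (s : Insertion x j) (ν : U.F) : s.size ν ≤ j + ∑ κ, x.n κ := by
  have h1 : s.size ν + 1 = ∑ i, (Finset.univ.filter fun b => s.p ν b = i).card := by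
    have := Finset.card_eq_sum_card_fiberwise (f := s.p ν) (s := Finset.univ)
      (t := Finset.univ) (fun _ _ => by simp)
    simpa using this
  have h2 : ∑ i, (Finset.univ.filter fun b => s.p ν b = i).card ≤
      ∑ i, (((Finset.univ.filter fun b => s.p ν b = i).card - 1) + 1) :=
    Finset.sum_le_sum fun i _ => by omega
  rw [Finset.sum_add_distrib] at h2
  have h3 : ∑ i : Fin (x.n ν + 1), ((Finset.univ.filter fun b => s.p ν b = i).card - 1) ≤ j := by
    conv_rhs => rw [← s.total]
    exact Finset.single_le_sum (f := fun ν => ∑ i : Fin (x.n ν + 1),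
      ((Finset.univ.filter fun b => s.p ν b = i).card - 1)) (fun _ _ => Nat.zero_le _)
      (Finset.mem_univ ν)
  have h4 : x.n ν ≤ ∑ κ, x.n κ :=
    Finset.single_le_sum (f := x.n) (fun _ _ => Nat.zero_le _) (Finset.mem_univ ν)
  simp at h2
  omega

instance : Finite (Insertion x j) := by
  let N := j + ∑ κ, x.n κ
  let g : Insertion x j →
      Σ e : U.F → Fin (N + 1), ∀ ν, Fin ((e ν : ℕ) + 1) → Fin (x.n ν + 1) :=
    fun s => ⟨fun ν => ⟨s.size ν, Nat.lt_succ_of_le (s.size_le ν)⟩, fun ν b => s.p ν b⟩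
  apply Finite.of_injective g
  rintro ⟨m, p, hp, ht⟩ ⟨m', p', hp', ht'⟩ h
  have h1 := (Sigma.mk.inj h).1
  have h2 : m = m' := by
    funext ν
    exact congrArg Fin.val (congrFun h1 ν)
  subst h2
  have h3 := eq_of_heq (Sigma.mk.inj h).2
  have h4 : p = p' := by
    funext ν
    ext b
    exact congrArg Fin.val (congrFun (congrFun h3 ν) b)
  subst h4
  rfl

noncomputable instance : Fintype (Insertion x j) := Fintype.ofFinite _

/-- The total order on `⊔_ν I'_ν` pulled back from `x`. -/
def pulled (s : Insertion x j) : SeqElt U 0 := x.pull s.size s.p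

/-- The essential (new) elementary intervals `[b, b + 1]` of the ordinals `I'_ν`: those which `p ν`
contracts to a point. -/
noncomputable def newIntervals (s : Insertion x j) : Finset (Σ ν, Fin (s.size ν)) :=
  Finset.univ.filter fun y => s.p y.1 y.2.castSucc = s.p y.1 y.2.succ

/-- The remaining (old) elementary intervals of the ordinals `I'_ν`. -/
noncomputable def oldIntervals (s : Insertion x j) : Finset (Σ ν, Fin (s.size ν)) :=
  Finset.univ.filter fun y => s.p y.1 y.2.castSucc ≠ s.p y.1 y.2.succ

/-- There are (at most) `j` new intervals. -/
lemma card_newIntervals_le (s : Insertion x j) : s.newIntervals.card ≤ j := by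
  have key : ∀ (ν : U.F) (i : Fin (x.n ν + 1)),
      (Finset.univ.filter fun b : Fin (s.size ν) =>
        s.p ν b.castSucc = i ∧ s.p ν b.succ = i).card ≤
      (Finset.univ.filter fun b => s.p ν b = i).card - 1 := by
    intro ν i
    set A := Finset.univ.filter fun b => s.p ν b = i
    have hA : A.Nonempty := by
      obtain ⟨b, hb⟩ := s.surj ν i
      exact ⟨b, by simp [A, hb]⟩
    rw [← Finset.card_erase_of_mem (A.max'_mem hA)]
    apply Finset.card_le_card_of_injOn (fun b => b.castSucc)
    · intro b hb
      simp only [Finset.coe_filter, Finset.mem_univ, true_and, Set.mem_ofPred_eq] at hb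
      have h1 : b.succ ∈ A := by simp [A, hb.2]
      have h2 : b.castSucc ∈ A := by simp [A, hb.1]
      exact Finset.mem_coe.2 (Finset.mem_erase.2
        ⟨(lt_of_lt_of_le (Fin.castSucc_lt_succ) (A.le_max' _ h1)).ne, h2⟩)
    · intro b _ b' _ h
      exact Fin.castSucc_injective _ h
  have h1 : s.newIntervals.card = ∑ ν, ∑ i, (Finset.univ.filter fun b : Fin (s.size ν) =>
        s.p ν b.castSucc = i ∧ s.p ν b.succ = i).card := by
    have h2 : s.newIntervals = Finset.univ.sigma fun ν => Finset.univ.filter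
        fun b : Fin (s.size ν) => s.p ν b.castSucc = s.p ν b.succ := by
      ext ⟨ν, b⟩
      simp [newIntervals]
    rw [h2, Finset.card_sigma]
    refine Finset.sum_congr rfl fun ν _ => ?_
    rw [Finset.card_eq_sum_card_fiberwise (f := fun b : Fin (s.size ν) => s.p ν b.succ)
      (t := Finset.univ) (fun _ _ => by simp)]
    refine Finset.sum_congr rfl fun i _ => ?_
    rw [Finset.filter_filter]
    congr 1
    ext b
    simp only [Finset.mem_filter, Finset.mem_univ, true_and]
    constructor
    · rintro ⟨h, h'⟩
      exact ⟨h.trans h', h'⟩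
    · rintro ⟨h, h'⟩
      exact ⟨h.trans h'.symm, h'⟩
  rw [h1]
  refine le_trans (Finset.sum_le_sum fun ν _ => Finset.sum_le_sum fun i _ => key ν i) ?_
  exact s.total.le

open Classical in
/-- The element `w_{J,s}(x)` of `seq(U)({I'_ν}; J)`, `J = [j]`.  A new interval is an elementary
interval of the total order on `⊔_ν I'_ν` as well, and the map `W'` to `J` starts at `0`, increases
by one along each new interval and is constant along the other elementary intervals; so its value
at a point `z` is the number of the new intervals that end at or before `z`. -/
noncomputable def whisker (s : Insertion x j) : SeqElt U j :=
  s.pulled.withW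
    (fun z => ⟨(s.newIntervals.filter fun y => s.pulled.le ⟨y.1, y.2.succ⟩ z).card,
      Nat.lt_succ_of_le ((Finset.card_filter_le _ _).trans s.card_newIntervals_le)⟩)
    (fun z z' h => Finset.card_le_card fun y hy => by
      rw [Finset.mem_filter] at hy ⊢
      exact ⟨hy.1, s.pulled.le_trans _ _ _ hy.2 h⟩)

open Classical in
/-- The elements of `I'_b` which precede `I'_a` in the total order. -/
noncomputable def before (s : Insertion x j) (a b : U.F) : Finset (Fin (s.size b + 1)) :=
  Finset.univ.filter fun c => ∀ i, s.pulled.le ⟨b, c⟩ ⟨a, i⟩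

/-- The number `n_{a,b}`.  Here `r = r_{a,b}` is the maximal element of `I'_b` with
`[0, r] < I'_a`; if there is none, i.e. if `I'_a < I'_b`, then `n_{a,b} = 0`. -/
noncomputable def pairSign (s : Insertion x j) (a b : U.F) : ℕ :=
  if h : (s.before a b).Nonempty then
    let r := (s.before a b).max' h
    (∑ i : Fin (x.n a + 1), (r : ℕ) * ((Finset.univ.filter fun c => s.p a c = i).card - 1))
      + ∑ i : Fin (x.n b + 1) with i ≤ s.p b r,
          ((Finset.univ.filter fun c => s.p b c = i).card - 1) * x.n a
  else 0

open Classical in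
/-- The number of pairs (new interval, old interval) such that the new one precedes the old one:
its right end precedes the right end of the old one in the total order. -/
noncomputable def shuffleSign (s : Insertion x j) : ℕ :=
  ((s.newIntervals ×ˢ s.oldIntervals).filter fun y =>
    s.pulled.le ⟨y.1.1, y.1.2.succ⟩ ⟨y.2.1, y.2.2.succ⟩).card

/-- The exponent `N_s` of the sign: the sum of the `n_{a,b}` over `a <₀ b`, i.e. over the pairs of
leaves with the column of `a` to the left of the column of `b`, plus `shuffleSign`. -/
noncomputable def sign (s : Insertion x j) : ℕ :=
  (∑ a, ∑ b with U.π a < U.π b, s.pairSign a b) + s.shuffleSign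

end Insertion

/-! ### The complexes `Breq(U)`, the condensation `|seq|(U)` and the whiskering map -/

section Complexes

variable (k : Type*) [Field k]

/-- The differential of the non-normalised total complex of the polysimplicial vector space
`k[seq(U)({I_ν}; [j])]`, `j` fixed. -/
noncomputable def simplicialD (U : Disk) (j : ℕ) : (SeqElt U j →₀ k) →ₗ[k] (SeqElt U j →₀ k) :=
  Finsupp.linearCombination k fun x : SeqElt U j =>
    ∑ ν, ∑ i : Fin (x.n ν + 1), if h : 0 < x.n ν then
      Finsupp.single (x.face ν i h) ((-1 : k) ^ (∑ κ with κ < ν, x.n κ + (i : ℕ))) else 0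

/-- The cosimplicial part `x ↦ -(-1)^{deg x} ∑_i (-1)^i δ^i x` of the differential of `|seq|`. -/
noncomputable def cosimplicialD (U : Disk) (j : ℕ) :
    (SeqElt U j →₀ k) →ₗ[k] (SeqElt U (j + 1) →₀ k) :=
  Finsupp.linearCombination k fun x : SeqElt U j =>
    ∑ i : Fin (j + 2), Finsupp.single (x.coface i) (-(-1 : k) ^ x.deg * (-1) ^ (i : ℕ))

/-- The differential of `|seq|(U)` on families `(f_j)_j`. -/
noncomputable def condD (U : Disk) :
    (∀ j, SeqElt U j →₀ k) →ₗ[k] (∀ j, SeqElt U j →₀ k) :=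
  LinearMap.pi fun
    | 0 => simplicialD k U 0 ∘ₗ LinearMap.proj 0
    | j + 1 => simplicialD k U (j + 1) ∘ₗ LinearMap.proj (j + 1)
        + cosimplicialD k U j ∘ₗ LinearMap.proj j

variable {k}

/-- The exponent of the sign of a composition.  An element `x` of `seq(U)({I_ν}; J)` stands for a
map `e_J ↦ ⨂_ν e_{I_ν}`, where `e_{[n]}` has degree `-n`, and the composition is
`(⨂_μ x_μ) ∘ y` followed by the permutation of the factors `e_{I_ν}` from the order in which they
are grouped by `μ` to the order of the leaves of `U`. -/
def compSign {U V : Disk} {j : ℕ} (P : U.Hom V) (y : SeqElt V j)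
    (x : ∀ μ, SeqElt (P.fiber μ) (y.n μ)) : ℤ :=
  ∑ μ, ∑ μ' with μ < μ', (x μ').deg * y.n μ
    + ∑ ν, ∑ ν' with ν < ν' ∧ P.f ν' < P.f ν, ((y.comp P x).n ν * (y.comp P x).n ν' : ℤ)

/-- The component in `J = [j]` of the composition of `|seq|`: it depends only on the component
`g` in `[j]` of the last factor. -/
noncomputable def condComp {U V : Disk} (P : U.Hom V)
    (f : ∀ μ, ∀ j, SeqElt (P.fiber μ) j →₀ k) {j : ℕ} (g : SeqElt V j →₀ k) : SeqElt U j →₀ k :=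
  g.sum fun y c => ∑ x ∈ Fintype.piFinset fun μ => (f μ (y.n μ)).support,
    Finsupp.single (y.comp P x) ((-1 : k) ^ compSign P y x * (∏ μ, f μ (y.n μ) (x μ)) * c)

variable (k)

/-- The whiskering map `w : Breq(U) → |seq|(U)`, with components
`w_J(x) = ∑_{s ∈ S_{x,J}} (-1)^{N_s} w_{J,s}(x)`. -/
noncomputable def whisker (U : Disk) : (SeqElt U 0 →₀ k) →ₗ[k] (∀ j, SeqElt U j →₀ k) :=
  LinearMap.pi fun j => Finsupp.linearCombination k fun x : SeqElt U 0 =>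
    ∑ s : Insertion x j, Finsupp.single s.whisker ((-1 : k) ^ s.sign)

/-- The condensation `|seq|`.  Its degree `m` component at `U` is the product over `j` of the
spaces spanned by the elements of `seq(U)({[n ν]}; [j])` with `j - ∑ n ν = m`. -/
noncomputable def condSeq : DGTwoOperadData k where
  obj U := ∀ j, SeqElt U j →₀ k
  gr _ m := Submodule.pi Set.univ fun _ => Finsupp.supported k k {x | x.deg = m}
  d U := condD k U
  relabel e := LinearMap.pi fun j => Finsupp.lmapDomain k k (SeqElt.relabel e) ∘ₗ LinearMap.proj j
  one j := Finsupp.single (SeqElt.unit j) 1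
  comp P f g j := condComp P f (g j)

/-- The complexes `Breq(U)`, the non-normalised total complexes of `seq(U)({I_ν}; [0])`, with the
composition `(⨂_μ α_μ) ⊗ β ↦ m_P((⨂_μ w α_μ) ⊗ β)`, where `m_P` is the composition of `|seq|` and
only the component of `w α_μ` in the ordinal `J_μ` of `β` contributes. -/
noncomputable def breq : DGTwoOperadData k where
  obj U := SeqElt U 0 →₀ k
  gr _ m := Finsupp.supported k k {x | x.deg = m}
  d U := simplicialD k U 0
  relabel e := Finsupp.lmapDomain k k (SeqElt.relabel e)
  one := Finsupp.single (SeqElt.unit 0) 1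
  comp P α β := condComp P (fun μ => whisker k _ (α μ)) β

end Complexes

end Breq

/-! ### Words of generators and embeddings of totally ordered sets of points -/

namespace Breq
namespace SeqElt
variable {U V : Disk} {j : ℕ}

/-! The proof replaces generators by words. A generator over `J = [j]` is determined by the list of
its points in the total order, each point recorded by its leaf and its co-level `j - W z`
(`SeqElt.word_injective`). Together with the sign exponent `eta` (inversions of leaves, ranks of
leaves, levels, and a normalisation depending on `j` and the number of leaves) this gives an
injective linear map `hat` into the span of all words in leaves and co-levels. Co-levels count from
the end, so the tail of a word is a word of the same kind, and every structure becomes recursive in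
the first entry: the faces become the alternating deletion of entries (`wordDel`), followed by the
projection `fullL` that discards words in which a leaf has disappeared; the cofaces become the
alternating raising of co-levels (`cofL`); the whiskering becomes `stretch`, the sum with no signs
at all over the ways to repeat entries, because `N_s` is exactly the difference of the values of
`eta` (`Insertion.sign_add_eta`); the composition becomes the substitution of blocks (`compWord`),
up to a sign `degSign` that depends only on the disks and the degrees (`compSign_add_eta`,
`hat_multi`).

On words the claims are short inductions. The squares of deletion and of raising vanish and the two
commute (`delL_delL`, `cofL_cofL`, `delL_cofL`), which gives `d² = 0`. That `w` is a map of
complexes is `delL_stretch`. That `w` respects compositions is `stretchL_compStretch`, an induction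
on the outer word, on the inner word of its first letter and on `j`; the signs stay under control
because all summands of a whiskered input give the same value `tau` of the sign sums
(`eSum_eq_tau`), and `degSign` cancels because `w` preserves degrees.

The other axioms for the condensation are checked on generators, without words. Equalities in `seq`
follow from order embeddings with the same image (`SeqElt.eq_of_emb`), and signs are compared as
sums in `ZMod 2`. For the Leibniz rule, the faces of a composite are faces of the inner factors
(`SeqElt.comp_face`), its cofaces are cofaces of the outer factor, and the remaining terms, cofaces
of inner factors and faces of the outer one, cancel by dinaturality (`cosPart_add_faceSum`).
Associativity is `SeqElt.comp_assoc` with the sign identity `assoc_sign`.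

Finally `Breq` inherits its structure. The component of `w` in `[0]` is the identity
(`whisker_zero`), so its Leibniz rule is a component of that of the condensation, and its
associativity follows from associativity in the condensation together with the compatibility of `w`
with compositions. -/

lemma le_rfl' (x : SeqElt U j) (z : Pts x.n) : x.le z z := (x.le_total z z).elim id id

open Classical in
/-- The points of `⊔_ν I_ν` listed in the total order of `x`. -/
noncomputable def pts (x : SeqElt U j) : List (Pts x.n) :=
  haveI : IsTrans _ x.le := ⟨x.le_trans⟩
  haveI : Std.Antisymm x.le := ⟨x.le_antisymm⟩
  haveI : Std.Total x.le := ⟨x.le_total⟩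
  Finset.univ.sort x.le

lemma mem_pts (x : SeqElt U j) (z : Pts x.n) : z ∈ x.pts := by
  classical
  simp [pts]

lemma nodup_pts (x : SeqElt U j) : x.pts.Nodup := by
  classical
  simp [pts]

lemma pairwise_pts (x : SeqElt U j) : x.pts.Pairwise x.le := by
  classical
  simp [pts]

/-- Sorted lists of distinct points are determined by their members. -/
lemma list_eq (x : SeqElt U j) {l₁ l₂ : List (Pts x.n)} (h₁ : l₁.Pairwise x.le)
    (h₂ : l₂.Pairwise x.le) (d₁ : l₁.Nodup) (d₂ : l₂.Nodup) (h : ∀ z, z ∈ l₁ ↔ z ∈ l₂) :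
    l₁ = l₂ := by
  have : Std.Antisymm x.le := ⟨x.le_antisymm⟩
  exact List.Perm.eq_of_pairwise' h₁ h₂ ((List.perm_ext_iff_of_nodup d₁ d₂).2 h)

lemma eq_pts (x : SeqElt U j) {l : List (Pts x.n)} (h : l.Pairwise x.le) (d : l.Nodup)
    (hm : ∀ z, z ∈ l) : l = x.pts :=
  x.list_eq h x.pairwise_pts d x.nodup_pts fun z => ⟨fun _ => x.mem_pts z, fun _ => hm z⟩

lemma mem_after (x : SeqElt U j) {l₁ l₂ : List (Pts x.n)} {z : Pts x.n}
    (h : x.pts = l₁ ++ z :: l₂) (z' : Pts x.n) : z' ∈ l₂ ↔ x.le z z' ∧ z ≠ z' := by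
  have hp := x.pairwise_pts
  have hd := x.nodup_pts
  have hm := x.mem_pts z'
  rw [h] at hp hd hm
  rw [List.pairwise_append] at hp
  rw [List.nodup_append] at hd
  obtain ⟨-, hp2, hp3⟩ := hp
  obtain ⟨-, hd2, hd3⟩ := hd
  rw [List.pairwise_cons] at hp2
  rw [List.nodup_cons] at hd2
  constructor
  · intro hz
    exact ⟨hp2.1 z' hz, fun e => hd2.1 (e ▸ hz)⟩
  · rintro ⟨hle, hne⟩
    rcases List.mem_append.1 hm with h1 | h1
    · exact absurd (x.le_antisymm _ _ hle (hp3 z' h1 z (by simp))) hne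
    · rcases List.mem_cons.1 h1 with h2 | h2
      · exact absurd h2.symm hne
      · exact h2

lemma mem_before (x : SeqElt U j) {l₁ l₂ : List (Pts x.n)} {z : Pts x.n}
    (h : x.pts = l₁ ++ z :: l₂) (z' : Pts x.n) : z' ∈ l₁ ↔ x.le z' z ∧ z' ≠ z := by
  have hp := x.pairwise_pts
  have hd := x.nodup_pts
  have hm := x.mem_pts z'
  rw [h] at hp hd hm
  rw [List.pairwise_append] at hp
  rw [List.nodup_append] at hd
  obtain ⟨-, hp2, hp3⟩ := hp
  obtain ⟨-, hd2, hd3⟩ := hd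
  rw [List.pairwise_cons] at hp2
  constructor
  · intro hz
    exact ⟨hp3 z' hz z (by simp), hd3 z' hz z (by simp)⟩
  · rintro ⟨hle, hne⟩
    rcases List.mem_append.1 hm with h1 | h1
    · exact h1
    · rcases List.mem_cons.1 h1 with h2 | h2
      · exact absurd h2 hne
      · exact absurd (x.le_antisymm _ _ hle (hp2.1 _ h2)) hne

lemma le_color_iff (x : SeqElt U j) (ν : U.F) (i i' : Fin (x.n ν + 1)) :
    x.le ⟨ν, i⟩ ⟨ν, i'⟩ ↔ i ≤ i' := by
  constructor
  · intro h
    by_contra hc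
    have := x.le_antisymm _ _ h (x.le_color ν i' i (not_le.1 hc).le)
    have h2 : i = i' := eq_of_heq (Sigma.mk.inj this).2
    exact hc h2.le
  · exact x.le_color ν i i'

lemma count_eq_card (x : SeqElt U j) {l : List (Pts x.n)} (hd : l.Nodup) (ν : U.F) :
    (l.map Sigma.fst).count ν =
      (Finset.univ.filter fun i : Fin (x.n ν + 1) => (⟨ν, i⟩ : Pts x.n) ∈ l).card := by
  classical
  have h1 : (l.map Sigma.fst).count ν = (l.filter fun z => z.1 = ν).length := by
    rw [List.count_eq_countP, List.countP_map, List.countP_eq_length_filter]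
    congr 1
  rw [h1, ← List.toFinset_card_of_nodup (hd.filter _)]
  symm
  apply Finset.card_bij (fun i _ => (⟨ν, i⟩ : Pts x.n))
  · intro i hi
    simpa using hi
  · intro i _ i' _ h
    exact eq_of_heq (Sigma.mk.inj h).2
  · rintro ⟨ν', i⟩ h
    simp only [List.toFinset_filter, decide_eq_true_eq, Finset.mem_filter, List.mem_toFinset] at h
    obtain ⟨h, rfl⟩ := h
    exact ⟨i, by simpa using h, rfl⟩

/-- The number of points of a colour after a point of that colour. -/
lemma count_after (x : SeqElt U j) {l₁ l₂ : List (Pts x.n)} {z : Pts x.n}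
    (h : x.pts = l₁ ++ z :: l₂) : (l₂.map Sigma.fst).count z.1 = x.n z.1 - z.2 := by
  have hd := x.nodup_pts
  rw [h, List.nodup_append, List.nodup_cons] at hd
  rw [x.count_eq_card hd.2.1.2]
  have : (Finset.univ.filter fun i : Fin (x.n z.1 + 1) => (⟨z.1, i⟩ : Pts x.n) ∈ l₂) =
      Finset.Ioi z.2 := by
    ext i
    obtain ⟨ν, i'⟩ := z
    simp only [x.mem_after h, x.le_color_iff, Finset.mem_filter, Finset.mem_univ, true_and,
      Finset.mem_Ioi, ne_eq, Sigma.mk.injEq, heq_eq_eq]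
    exact lt_iff_le_and_ne.symm
  rw [this, Fin.card_Ioi]
  omega

/-- The number of points of a colour before a point of that colour. -/
lemma count_before (x : SeqElt U j) {l₁ l₂ : List (Pts x.n)} {z : Pts x.n}
    (h : x.pts = l₁ ++ z :: l₂) : (l₁.map Sigma.fst).count z.1 = z.2 := by
  have hd := x.nodup_pts
  rw [h, List.nodup_append] at hd
  rw [x.count_eq_card hd.1]
  have : (Finset.univ.filter fun i : Fin (x.n z.1 + 1) => (⟨z.1, i⟩ : Pts x.n) ∈ l₁) =
      Finset.Iio z.2 := by
    ext i
    obtain ⟨ν, i'⟩ := z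
    simp only [x.mem_before h, x.le_color_iff, Finset.mem_filter, Finset.mem_univ, true_and,
      Finset.mem_Iio, ne_eq, Sigma.mk.injEq, heq_eq_eq]
    exact lt_iff_le_and_ne.symm
  rw [this, Fin.card_Iio]

lemma count_pts (x : SeqElt U j) (ν : U.F) : (x.pts.map Sigma.fst).count ν = x.n ν + 1 := by
  rw [x.count_eq_card x.nodup_pts]
  simp [mem_pts]

/-- The letter and the co-level `j - W z` of a point. -/
def entry (x : SeqElt U j) (z : Pts x.n) : U.F × ℕ := (z.1, j - x.W z)

/-- The word of `x`: the letters and co-levels of its points in the total order.  It determines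
`x`. -/
noncomputable def word (x : SeqElt U j) : List (U.F × ℕ) := x.pts.map x.entry

lemma word_fst (x : SeqElt U j) : x.word.map Prod.fst = x.pts.map Sigma.fst := by
  simp [word, Function.comp_def, entry]

lemma count_word (x : SeqElt U j) (ν : U.F) : (x.word.map Prod.fst).count ν = x.n ν + 1 := by
  rw [word_fst, count_pts]

/-- The position of a point within its ordinal is the number of earlier occurrences of its leaf, so
the sequence of leaves already determines the points. -/
lemma pts_eq_of_fst_eq {n : U.F → ℕ} {l₁ l₂ : List (Pts n)}
    (h : l₁.map Sigma.fst = l₂.map Sigma.fst)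
    (k₁ : ∀ a z b, l₁ = a ++ z :: b → (a.map Sigma.fst).count z.1 = z.2)
    (k₂ : ∀ a z b, l₂ = a ++ z :: b → (a.map Sigma.fst).count z.1 = z.2) : l₁ = l₂ := by
  apply List.ext_getElem
  · simpa using congrArg List.length h
  intro i h1 h2
  have e1 : l₁ = l₁.take i ++ l₁[i] :: l₁.drop (i + 1) := by simp
  have e2 : l₂ = l₂.take i ++ l₂[i] :: l₂.drop (i + 1) := by simp
  have c1 := k₁ _ _ _ e1
  have c2 := k₂ _ _ _ e2
  have h3 : l₁[i].1 = l₂[i].1 := by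
    have := List.getElem_of_eq h (i := i) (by simpa using h1)
    simpa using this
  rw [List.map_take, h, ← List.map_take] at c1
  generalize l₁[i] = z₁ at *
  generalize l₂[i] = z₂ at *
  obtain ⟨ν, a⟩ := z₁
  obtain ⟨ν', a'⟩ := z₂
  obtain rfl : ν = ν' := h3
  have h4 : a = a' := Fin.ext (c1.symm.trans c2 : (a : ℕ) = a')
  rw [h4]

lemma rel_iff_of_pairwise {A : Type*} {l : List A} {r r' : A → A → Prop} (h : l.Pairwise r)
    (h' : l.Pairwise r') (hr : ∀ x y, r x y → r y x → x = y)
    (hr' : ∀ x, r' x x) {a b : A} (ha : a ∈ l) (hb : b ∈ l) (hab : r a b) : r' a b := by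
  obtain ⟨i, hi, rfl⟩ := List.getElem_of_mem ha
  obtain ⟨k, hk, rfl⟩ := List.getElem_of_mem hb
  rcases lt_trichotomy i k with h1 | rfl | h1
  · exact List.pairwise_iff_getElem.1 h' _ _ hi hk h1
  · exact hr' _
  · rw [hr _ _ hab (List.pairwise_iff_getElem.1 h _ _ hk hi h1)]
    exact hr' _

/-- The multiplicities of the leaves give the arities, the sequence of leaves gives the total order,
and the co-levels give `W`; the subtraction `j - W z` loses nothing, because `W z ≤ j`. -/
lemma word_injective : Function.Injective (word : SeqElt U j → List (U.F × ℕ)) := by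
  intro x y h
  have hn : x.n = y.n := by
    funext ν
    have := congrArg (fun l => (l.map Prod.fst).count ν) h
    simp only [count_word] at this
    omega
  -- These facts are recorded before `x` and `y` are taken apart; afterwards the arities can be
  -- identified by substitution, and both orders live on the same type.
  have hx := @count_before _ _ x
  have hy := @count_before _ _ y
  have px := x.pairwise_pts
  have py := y.pairwise_pts
  have hf := congrArg (List.map Prod.fst) h
  rw [word_fst, word_fst] at hf
  have mx := x.mem_pts
  have ax := x.le_antisymm
  have ay := y.le_antisymm
  have rx := x.le_rfl'
  have ry := y.le_rfl'
  obtain ⟨n, le, h1, h2, h3, h4, h5, h6, W, h7⟩ := x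
  obtain ⟨n', le', h1', h2', h3', h4', h5', h6', W', h7'⟩ := y
  obtain rfl : n = n' := hn
  have hp := pts_eq_of_fst_eq hf (fun _ _ _ e => hx e) (fun _ _ _ e => hy e)
  have hle : le = le' := by
    rw [← hp] at py
    funext a b
    exact propext ⟨fun hab => rel_iff_of_pairwise px py ax ry (mx a) (mx b) hab,
      fun hab => rel_iff_of_pairwise py px ay rx (mx a) (mx b) hab⟩
  subst hle
  have hW : W = W' := by
    funext z
    unfold word at h
    rw [← hp] at h
    have := List.map_inj_left.1 h z (mx z)
    have h8 : j - (W z : ℕ) = j - (W' z : ℕ) := congrArg Prod.snd this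
    ext
    have := (W z).2
    have := (W' z).2
    omega
  subst hW
  rfl

/-- `t` embeds the ordered set of points of `x'` into that of `x`. -/
structure Emb {U' : Disk} {j' : ℕ} (x' : SeqElt U' j') (x : SeqElt U j)
    (t : Pts x'.n → Pts x.n) : Prop where
  inj : Function.Injective t
  mono : ∀ z z', x'.le z z' → x.le (t z) (t z')

lemma Emb.le_iff {U' : Disk} {j' : ℕ} {x' : SeqElt U' j'} {x : SeqElt U j}
    {t : Pts x'.n → Pts x.n} (h : Emb x' x t) (z z' : Pts x'.n) :
    x.le (t z) (t z') ↔ x'.le z z' := by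
  refine ⟨fun hz => ?_, h.mono z z'⟩
  rcases x'.le_total z z' with h1 | h1
  · exact h1
  · rw [h.inj (x.le_antisymm _ _ hz (h.mono _ _ h1))]
    exact x'.le_rfl' _

open Classical in
lemma Emb.map_pts {U' : Disk} {j' : ℕ} {x' : SeqElt U' j'} {x : SeqElt U j}
    {t : Pts x'.n → Pts x.n} (h : Emb x' x t) :
    x'.pts.map t = x.pts.filter (· ∈ Set.range t) := by
  apply x.list_eq
  · rw [List.pairwise_map]
    exact x'.pairwise_pts.imp fun {a b} hab => h.mono a b hab
  · exact x.pairwise_pts.filter _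
  · exact x'.nodup_pts.map h.inj
  · exact x.nodup_pts.filter _
  · intro z
    simp [mem_pts]

lemma Emb.map_pts_of_surj {U' : Disk} {j' : ℕ} {x' : SeqElt U' j'} {x : SeqElt U j}
    {t : Pts x'.n → Pts x.n} (h : Emb x' x t) (hs : Function.Surjective t) :
    x'.pts.map t = x.pts := by
  rw [h.map_pts, List.filter_eq_self]
  intro z _
  simpa using hs z

/-- Two elements with embeddings into the same ordered set that have the same image, preserve the
letters and are compatible with the maps to `J` agree. -/
lemma eq_of_emb {U' : Disk} {j' : ℕ} {x₁ x₂ : SeqElt U j} {x : SeqElt U' j'}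
    {t₁ : Pts x₁.n → Pts x.n} {t₂ : Pts x₂.n → Pts x.n} (h₁ : Emb x₁ x t₁) (h₂ : Emb x₂ x t₂)
    (hr : Set.range t₁ = Set.range t₂)
    (he : ∀ z z', t₁ z = t₂ z' → z.1 = z'.1 ∧ x₁.W z = x₂.W z') : x₁ = x₂ := by
  apply word_injective
  have h : x₁.pts.map t₁ = x₂.pts.map t₂ := by
    rw [h₁.map_pts, h₂.map_pts]
    refine List.filter_congr fun z _ => ?_
    have hz : z ∈ Set.range t₁ ↔ z ∈ Set.range t₂ := by rw [hr]
    simp only [hz]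
  unfold word
  apply List.ext_getElem
  · simpa using congrArg List.length h
  intro i h1 h2
  have h3 := List.getElem_of_eq h (i := i) (by simpa using h1)
  simp only [List.getElem_map] at h3 ⊢
  obtain ⟨h4, h5⟩ := he _ _ h3
  unfold entry
  rw [h4, h5]

lemma eq_of_emb_surj {x₁ x₂ : SeqElt U j} {t : Pts x₁.n → Pts x₂.n} (h : Emb x₁ x₂ t)
    (hs : Function.Surjective t) (he : ∀ z, z.1 = (t z).1 ∧ x₁.W z = x₂.W (t z)) : x₁ = x₂ := by
  refine eq_of_emb (x := x₂) (t₂ := id) h ⟨Function.injective_id, fun _ _ h => h⟩ ?_ ?_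
  · simpa using hs.range_eq
  · rintro z z' rfl
    exact he z

end SeqElt
end Breq

namespace Breq
namespace SeqElt
variable {U V : Disk} {j : ℕ}

/-! ### Embeddings between the operations on `seq` -/

lemma Emb.comp_emb {U₁ U₂ U₃ : Disk} {j₁ j₂ j₃ : ℕ} {x₁ : SeqElt U₁ j₁} {x₂ : SeqElt U₂ j₂}
    {x₃ : SeqElt U₃ j₃} {t : Pts x₁.n → Pts x₂.n} {t' : Pts x₂.n → Pts x₃.n} (h : Emb x₁ x₂ t)
    (h' : Emb x₂ x₃ t') : Emb x₁ x₃ (t' ∘ t) :=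
  ⟨h'.inj.comp h.inj, fun _ _ hz => h'.mono _ _ (h.mono _ _ hz)⟩

lemma Emb.surjInv {U' : Disk} {j' : ℕ} {x' : SeqElt U' j'} {x : SeqElt U j}
    {t : Pts x'.n → Pts x.n} (h : Emb x' x t) (hs : Function.Surjective t) :
    Emb x x' (Function.surjInv hs) :=
  ⟨Function.injective_surjInv hs, fun z z' hz => by
    rw [← h.le_iff, Function.surjInv_eq hs, Function.surjInv_eq hs]
    exact hz⟩

/-- Two elements onto which the same ordered set maps, compatibly with letters and maps to `J`,
agree. -/
lemma eq_of_emb_of_surj {U' : Disk} {j' : ℕ} {x : SeqElt U' j'} {x₁ x₂ : SeqElt U j}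
    {t₁ : Pts x.n → Pts x₁.n} {t₂ : Pts x.n → Pts x₂.n} (h₁ : Emb x x₁ t₁) (h₂ : Emb x x₂ t₂)
    (s₁ : Function.Surjective t₁) (s₂ : Function.Surjective t₂)
    (he : ∀ z, (t₁ z).1 = (t₂ z).1 ∧ x₁.W (t₁ z) = x₂.W (t₂ z)) : x₁ = x₂ := by
  refine eq_of_emb_surj ((h₁.surjInv s₁).comp_emb h₂) (s₂.comp ?_) ?_
  · intro z
    exact ⟨t₁ z, h₁.inj (Function.surjInv_eq s₁ _)⟩
  · intro z
    obtain ⟨z, rfl⟩ := s₁ z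
    have : Function.surjInv s₁ (t₁ z) = z := h₁.inj (Function.surjInv_eq s₁ _)
    simpa [this] using he z

lemma pull_emb (x : SeqElt U j) (n' : U.F → ℕ) (φ : ∀ ν, Fin (n' ν + 1) →o Fin (x.n ν + 1))
    (hφ : ∀ ν, Function.Injective (φ ν)) :
    Emb (x.pull n' φ) x (fun z => ⟨z.1, φ z.1 z.2⟩) := by
  have hi : Function.Injective (fun z : Pts n' => (⟨z.1, φ z.1 z.2⟩ : Pts x.n)) := by
    rintro ⟨ν, i⟩ ⟨ν', i'⟩ h
    have e : ν = ν' := congrArg Sigma.fst h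
    subst e
    have h2 : i = i' := hφ ν (eq_of_heq (Sigma.mk.inj h).2)
    rw [h2]
  refine ⟨hi, ?_⟩
  rintro z z' (⟨_, h⟩ | ⟨e, _⟩)
  · exact h
  · rw [show z = z' from hi e]
    exact x.le_rfl' _

/-- The inclusion of the points of a face. -/
def facePt (x : SeqElt U j) (ν : U.F) (i : Fin (x.n ν + 1)) (h : 0 < x.n ν)
    (z : Pts (x.face ν i h).n) : Pts x.n :=
  ⟨z.1, ⟨if z.1 = ν ∧ (i : ℕ) ≤ (z.2 : ℕ) then z.2 + 1 else z.2, by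
    have hb : ∀ c : ℕ, c < Function.update x.n ν (x.n ν - 1) z.1 + 1 →
        (if z.1 = ν ∧ (i : ℕ) ≤ c then c + 1 else c) < x.n z.1 + 1 := by
      intro c hc
      by_cases hκ : z.1 = ν
      · rw [hκ] at hc ⊢
        simp only [Function.update_self] at hc
        split_ifs <;> omega
      · rw [Function.update_of_ne hκ] at hc
        simp only [hκ, false_and, if_false]
        omega
    exact hb z.2 z.2.2⟩⟩

lemma face_emb (x : SeqElt U j) (ν : U.F) (i : Fin (x.n ν + 1)) (h : 0 < x.n ν) :
    Emb (x.face ν i h) x (x.facePt ν i h) := by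
  apply pull_emb
  intro κ b b' hb
  have := congrArg Fin.val hb
  change (if κ = ν ∧ (i : ℕ) ≤ (b : ℕ) then (b : ℕ) + 1 else b) =
    if κ = ν ∧ (i : ℕ) ≤ (b' : ℕ) then (b' : ℕ) + 1 else b' at this
  ext
  by_cases hκ : κ = ν
  · simp only [hκ, true_and] at this
    split_ifs at this <;> omega
  · simpa only [hκ, false_and, if_false] using this

lemma face_W (x : SeqElt U j) (ν : U.F) (i : Fin (x.n ν + 1)) (h : 0 < x.n ν)
    (z : Pts (x.face ν i h).n) : (x.face ν i h).W z = x.W (x.facePt ν i h z) := rfl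

lemma range_facePt (x : SeqElt U j) (ν : U.F) (i : Fin (x.n ν + 1)) (h : 0 < x.n ν) :
    Set.range (x.facePt ν i h) = {⟨ν, i⟩}ᶜ := by
  ext ⟨κ, b⟩
  simp only [Set.mem_range, Set.mem_compl_iff, Set.mem_singleton_iff]
  by_cases hκ : κ = ν
  · subst hκ
    simp only [Sigma.mk.injEq, heq_eq_eq, true_and]
    constructor
    · rintro ⟨⟨κ', c⟩, hc⟩
      have h1 : κ' = κ := congrArg Sigma.fst hc
      subst h1
      have h2 := congrArg Fin.val (eq_of_heq (Sigma.mk.inj hc).2)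
      simp only [true_and] at h2
      rintro rfl
      split_ifs at h2 <;> omega
    · intro hb
      have hb' : (b : ℕ) ≠ i := fun h => hb (Fin.ext h)
      have hn : (x.face κ i h).n κ = x.n κ - 1 := Function.update_self ..
      -- The preimage of a point `b ≠ i`: points beyond `i` are shifted down by one.
      refine ⟨⟨κ, ⟨if (b : ℕ) < i then b else b - 1, ?_⟩⟩, ?_⟩
      · rw [hn]
        split_ifs <;> omega
      · simp only [facePt, true_and, Sigma.mk.injEq, heq_eq_eq]
        ext
        simp only
        split_ifs <;> omega
  · have hn : (x.face ν i h).n κ = x.n κ := Function.update_of_ne hκ ..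
    refine iff_of_true ⟨⟨κ, Fin.cast (by rw [hn]) b⟩, ?_⟩ fun e => hκ (congrArg Sigma.fst e)
    simp [facePt, hκ]

/-- The map of points underlying `relabel`. -/
def relabelPt (e : U.Iso V) (x : SeqElt U j) (z : Pts (x.relabel e).n) : Pts x.n :=
  ⟨e.e.symm z.1, z.2⟩

lemma relabel_emb (e : U.Iso V) (x : SeqElt U j) : Emb (x.relabel e) x (relabelPt e x) := by
  refine ⟨?_, fun _ _ h => h⟩
  rintro ⟨ν, i⟩ ⟨ν', i'⟩ h
  have h1 : ν = ν' := e.e.symm.injective (congrArg Sigma.fst h)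
  subst h1
  have h2 : i = i' := eq_of_heq (Sigma.mk.inj h).2
  rw [h2]

lemma relabelPt_surjective (e : U.Iso V) (x : SeqElt U j) :
    Function.Surjective (relabelPt e x) := by
  rintro ⟨ν, i⟩
  obtain ⟨κ, rfl⟩ := e.e.symm.surjective ν
  exact ⟨⟨κ, i⟩, rfl⟩

/-! ### Composition -/

section comp

variable {P : U.Hom V}

/-- A point of `⊔_{ν ∈ P⁻¹ μ} I_ν` as a point of `⊔_ν I_ν`. -/
def globalPt {c : V.F → ℕ} (x : ∀ μ, SeqElt (P.fiber μ) (c μ)) (μ : V.F) (w : Pts (x μ).n) :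
    Pts fun ν : U.F => (x (P.f ν)).n ⟨ν, rfl⟩ :=
  ⟨w.1.1, Fin.cast (by obtain ⟨⟨ν, rfl⟩, i⟩ := w; rfl) w.2⟩

variable {c : V.F → ℕ} (x : ∀ μ, SeqElt (P.fiber μ) (c μ))

lemma f_globalPt (μ : V.F) (w : Pts (x μ).n) : P.f (globalPt x μ w).1 = μ := w.1.2

lemma localPt_globalPt (μ : V.F) (w : Pts (x μ).n) (h : P.f (globalPt x μ w).1 = μ) :
    localPt x (globalPt x μ w) μ h = w := by
  -- Once `μ` is replaced by `P.f ν`, all casts are definitionally trivial.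
  obtain ⟨⟨ν, rfl⟩, i⟩ := w
  rfl

variable (y : SeqElt V j) (x : ∀ μ, SeqElt (P.fiber μ) (y.n μ))

/-- The points of a composite are the points of the factors `x μ`. -/
def compEquiv : (Σ μ, Pts (x μ).n) ≃ Pts (y.comp P x).n where
  toFun p := globalPt x p.1 p.2
  invFun z := ⟨P.f z.1, localPt x z _ rfl⟩
  left_inv := by
    rintro ⟨μ, ⟨⟨ν, rfl⟩, i⟩⟩
    rfl
  right_inv _ := rfl

lemma compEquiv_fst (μ : V.F) (w : Pts (x μ).n) : (compEquiv y x ⟨μ, w⟩).1 = w.1.1 := rfl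

lemma comp_n (μ : V.F) (ν : (P.fiber μ).F) : (y.comp P x).n ν.1 = (x μ).n ν := by
  obtain ⟨ν, rfl⟩ := ν
  rfl

lemma compPt_compEquiv (μ : V.F) (w : Pts (x μ).n) :
    compPt y x (compEquiv y x ⟨μ, w⟩) = ⟨μ, (x μ).W w⟩ := by
  obtain ⟨⟨ν, rfl⟩, i⟩ := w
  rfl

lemma comp_le_iff {μ μ' : V.F} (w : Pts (x μ).n) (w' : Pts (x μ').n) :
    (y.comp P x).le (compEquiv y x ⟨μ, w⟩) (compEquiv y x ⟨μ', w'⟩) ↔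
      ((⟨μ, (x μ).W w⟩ : Pts y.n) ≠ ⟨μ', (x μ').W w'⟩ ∧
        y.le ⟨μ, (x μ).W w⟩ ⟨μ', (x μ').W w'⟩) ∨
      ((⟨μ, (x μ).W w⟩ : Pts y.n) = ⟨μ', (x μ').W w'⟩ ∧
        ∃ κ, ∃ h : μ = κ, ∃ h' : μ' = κ, (x κ).le (h ▸ w) (h' ▸ w')) := by
  change compLE y x (compEquiv y x ⟨μ, w⟩) (compEquiv y x ⟨μ', w'⟩) ↔ _
  unfold compLE pullLE
  rw [compPt_compEquiv, compPt_compEquiv]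
  refine or_congr Iff.rfl (and_congr Iff.rfl ?_)
  constructor
  · rintro ⟨κ, h, h', hle⟩
    have e : μ = κ := (f_globalPt x μ w).symm.trans h
    have e' : μ' = κ := (f_globalPt x μ' w').symm.trans h'
    subst e
    subst e'
    have h1 := localPt_globalPt x _ w h
    have h2 := localPt_globalPt x _ w' h'
    refine ⟨_, rfl, rfl, ?_⟩
    have h3 : (x μ').le (localPt x (globalPt x μ' w) μ' h)
      (localPt x (globalPt x μ' w') μ' h') := hle
    rw [h1, h2] at h3
    exact h3
  · rintro ⟨κ, rfl, rfl, hle⟩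
    refine ⟨_, f_globalPt x _ w, f_globalPt x _ w', ?_⟩
    have h1 := localPt_globalPt x _ w (f_globalPt x _ w)
    have h2 := localPt_globalPt x _ w' (f_globalPt x _ w')
    change (x μ').le (localPt x (globalPt x μ' w) μ' _)
      (localPt x (globalPt x μ' w') μ' _)
    rw [h1, h2]
    exact hle

lemma comp_W (μ : V.F) (w : Pts (x μ).n) :
    (y.comp P x).W (compEquiv y x ⟨μ, w⟩) = y.W ⟨μ, (x μ).W w⟩ := by
  change y.W (compPt y x _) = _
  rw [compPt_compEquiv]

lemma comp_le_iff_of_eq {μ : V.F} {w w' : Pts (x μ).n} (h : (x μ).W w = (x μ).W w') :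
    (y.comp P x).le (compEquiv y x ⟨μ, w⟩) (compEquiv y x ⟨μ, w'⟩) ↔ (x μ).le w w' := by
  rw [comp_le_iff, h]
  simp only [ne_eq, not_true, false_and, true_and, false_or]
  exact ⟨fun ⟨_, e, e', hle⟩ => by subst e; exact hle, fun hle => ⟨μ, rfl, rfl, hle⟩⟩

lemma comp_le_iff_of_ne {μ μ' : V.F} {w : Pts (x μ).n} {w' : Pts (x μ').n}
    (h : (⟨μ, (x μ).W w⟩ : Pts y.n) ≠ ⟨μ', (x μ').W w'⟩) :
    (y.comp P x).le (compEquiv y x ⟨μ, w⟩) (compEquiv y x ⟨μ', w'⟩) ↔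
      y.le ⟨μ, (x μ).W w⟩ ⟨μ', (x μ').W w'⟩ := by
  rw [comp_le_iff]
  simp [h]

/-- Ties in `J_μ` are resolved by `x μ` itself, and a strict inequality of levels is turned into an
inequality in `y` by `le_color`; so the composite restricts to the order of `x μ`. The converse
direction follows from totality. -/
lemma comp_le_same {μ : V.F} {w w' : Pts (x μ).n} :
    (y.comp P x).le (compEquiv y x ⟨μ, w⟩) (compEquiv y x ⟨μ, w'⟩) ↔ (x μ).le w w' := by
  have key : ∀ {w w' : Pts (x μ).n}, (x μ).le w w' →
      (y.comp P x).le (compEquiv y x ⟨μ, w⟩) (compEquiv y x ⟨μ, w'⟩) := by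
    intro w w' h
    by_cases e : (x μ).W w = (x μ).W w'
    · rwa [comp_le_iff_of_eq y x e]
    · rw [comp_le_iff_of_ne y x (by simpa using e)]
      exact y.le_color _ _ _ ((x μ).W_mono _ _ h)
  refine ⟨fun h => ?_, key⟩
  rcases (x μ).le_total w w' with h1 | h1
  · exact h1
  · have := (compEquiv y x).injective ((y.comp P x).le_antisymm _ _ h (key h1))
    rw [eq_of_heq (Sigma.mk.inj this).2]
    exact (x μ).le_rfl' _

end comp

section

variable {U' V' : Disk} {j' : ℕ} {P : U.Hom V} {P' : U'.Hom V'} {y : SeqElt V j}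
  {y' : SeqElt V' j'} {x : ∀ μ, SeqElt (P.fiber μ) (y.n μ)}
  {x' : ∀ μ, SeqElt (P'.fiber μ) (y'.n μ)} {t : Pts y'.n → Pts y.n} {g : V'.F → V.F}

/-- The map of points of composites induced by maps of points of the factors. -/
def compMap (τ : ∀ μ, Pts (x' μ).n → Pts (x (g μ)).n) (z : Pts (y'.comp P' x').n) :
    Pts (y.comp P x).n :=
  compEquiv y x ⟨g ((compEquiv y' x').symm z).1, τ _ ((compEquiv y' x').symm z).2⟩

lemma compMap_apply (τ : ∀ μ, Pts (x' μ).n → Pts (x (g μ)).n) (μ : V'.F) (w : Pts (x' μ).n) :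
    compMap (y := y) (y' := y') τ (compEquiv y' x' ⟨μ, w⟩) = compEquiv y x ⟨g μ, τ μ w⟩ := by
  unfold compMap
  rw [Equiv.symm_apply_apply]

/-- Compositions are functorial for embeddings of all the factors. -/
lemma comp_emb (ht : Emb y' y t) (hg : Function.Injective g)
    {τ : ∀ μ, Pts (x' μ).n → Pts (x (g μ)).n} (hτ : ∀ μ, Emb (x' μ) (x (g μ)) (τ μ))
    (hW : ∀ μ w, t ⟨μ, (x' μ).W w⟩ = ⟨g μ, (x (g μ)).W (τ μ w)⟩) :
    Emb (y'.comp P' x') (y.comp P x) (compMap τ) := by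
  constructor
  · intro z z' h
    obtain ⟨⟨μ, w⟩, rfl⟩ := (compEquiv y' x').surjective z
    obtain ⟨⟨μ', w'⟩, rfl⟩ := (compEquiv y' x').surjective z'
    rw [compMap_apply, compMap_apply, (compEquiv y x).injective.eq_iff] at h
    have e : μ = μ' := hg (congrArg Sigma.fst h)
    subst e
    have e2 := eq_of_heq (Sigma.mk.inj h).2
    rw [(hτ μ).inj e2]
  · intro z z' h
    obtain ⟨⟨μ, w⟩, rfl⟩ := (compEquiv y' x').surjective z
    obtain ⟨⟨μ', w'⟩, rfl⟩ := (compEquiv y' x').surjective z'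
    rw [compMap_apply, compMap_apply]
    rw [comp_le_iff] at h ⊢
    rw [← hW, ← hW]
    rcases h with ⟨h1, h2⟩ | ⟨h1, κ, e, e', h2⟩
    · exact Or.inl ⟨fun e => h1 (ht.inj e), ht.mono _ _ h2⟩
    · subst e
      subst e'
      exact Or.inr ⟨congrArg t h1, _, rfl, rfl, (hτ _).mono _ _ h2⟩

lemma compMap_surjective (hg : Function.Surjective g)
    {τ : ∀ μ, Pts (x' μ).n → Pts (x (g μ)).n} (hτ : ∀ μ, Function.Surjective (τ μ)) :
    Function.Surjective (compMap (y := y) (y' := y') (x := x) (x' := x') τ) := by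
  intro z
  obtain ⟨⟨μ, w⟩, rfl⟩ := (compEquiv y x).surjective z
  obtain ⟨μ, rfl⟩ := hg μ
  obtain ⟨w, rfl⟩ := hτ μ w
  exact ⟨_, compMap_apply τ μ w⟩

end

/-! ### Identities between the operations -/

/-- Both sides embed into `y.comp P x` and miss exactly the point `i'` of colour `ν`. The indices
`i` and `i'` are related by value only, because the arities of the factor and of the composite agree
propositionally. -/
lemma comp_face {P : U.Hom V} {y : SeqElt V j} {x x' : ∀ μ, SeqElt (P.fiber μ) (y.n μ)} (μ : V.F)
    (ν : (P.fiber μ).F) (i : Fin ((x μ).n ν + 1)) (h : 0 < (x μ).n ν)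
    (hμ : x' μ = (x μ).face ν i h) (hx : ∀ κ, κ ≠ μ → x' κ = x κ)
    (i' : Fin ((y.comp P x).n ν.1 + 1)) (hi : (i' : ℕ) = i) (h' : 0 < (y.comp P x).n ν.1) :
    y.comp P x' = (y.comp P x).face ν.1 i' h' := by
  have : ∀ κ, ∃ τ : Pts (x' κ).n → Pts (x κ).n, Emb (x' κ) (x κ) τ ∧
      (∀ w, (τ w).1 = w.1 ∧ (x' κ).W w = (x κ).W (τ w)) ∧
      ∀ w, w ∈ Set.range τ ↔ compEquiv y x ⟨κ, w⟩ ≠ ⟨ν.1, i'⟩ := by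
    intro κ
    have e0 : (⟨ν.1, i'⟩ : Pts (y.comp P x).n) = compEquiv y x ⟨μ, ⟨ν, i⟩⟩ := by
      obtain ⟨ν, rfl⟩ := ν
      exact Sigma.ext rfl (heq_of_eq (Fin.ext hi))
    simp only [e0, ne_eq, (compEquiv y x).injective.eq_iff]
    by_cases hκ : κ = μ
    · subst hκ
      rw [hμ]
      refine ⟨_, (x κ).face_emb ν i h, fun w => ⟨rfl, rfl⟩, fun w => ?_⟩
      rw [range_facePt]
      simp
    · rw [hx κ hκ]
      refine ⟨id, ⟨Function.injective_id, fun _ _ h => h⟩, fun w => ⟨rfl, rfl⟩, fun w => ?_⟩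
      simp [hκ]
  choose τ h1 h2 h3 using this
  have E := comp_emb (y := y) (y' := y) (x := x) (x' := x') (t := id) (g := id)
    ⟨Function.injective_id, fun _ _ h => h⟩ Function.injective_id h1
    (fun κ w => by rw [(h2 κ w).2]; rfl)
  refine eq_of_emb E ((y.comp P x).face_emb ν.1 i' h') ?_ ?_
  · rw [range_facePt]
    ext z
    obtain ⟨⟨κ, w⟩, rfl⟩ := (compEquiv y x).surjective z
    simp only [Set.mem_compl_iff, Set.mem_singleton_iff]
    rw [← ne_eq, ← h3, Set.mem_range, Set.mem_range]
    constructor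
    · rintro ⟨z, hz⟩
      obtain ⟨⟨κ', w'⟩, rfl⟩ := (compEquiv y x').surjective z
      rw [compMap_apply, (compEquiv y x).injective.eq_iff] at hz
      have e : κ' = κ := congrArg Sigma.fst hz
      subst e
      exact ⟨w', eq_of_heq (Sigma.mk.inj hz).2⟩
    · rintro ⟨w', rfl⟩
      exact ⟨_, compMap_apply (g := id) τ κ w'⟩
  · intro z z' hz
    obtain ⟨⟨κ, w⟩, rfl⟩ := (compEquiv y x').surjective z
    rw [compMap_apply] at hz
    rw [face_W, ← hz, comp_W, comp_W]
    refine ⟨?_, by rw [(h2 κ w).2]; rfl⟩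
    rw [compEquiv_fst, ← congrArg Subtype.val (h2 κ w).1]
    exact congrArg Sigma.fst hz

lemma deg_coface (x : SeqElt U j) (i : Fin (j + 2)) : (x.coface i).deg = x.deg + 1 := by
  change ((j + 1 : ℕ) : ℤ) - ∑ ν, (x.n ν : ℤ) = (j : ℤ) - ∑ ν, (x.n ν : ℤ) + 1
  push_cast
  ring

lemma sum_face_n {M : Type*} [AddCommMonoid M] (x : SeqElt U j) (ν : U.F) (i : Fin (x.n ν + 1))
    (h : 0 < x.n ν) (f : ℕ → U.F → M) (c : M) (hc : f (x.n ν) ν = f (x.n ν - 1) ν + c) :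
    ∑ κ, f (x.n κ) κ = ∑ κ, f ((x.face ν i h).n κ) κ + c := by
  rw [← Finset.add_sum_erase _ _ (Finset.mem_univ ν),
    ← Finset.add_sum_erase (Finset.univ) (fun κ => f ((x.face ν i h).n κ) κ) (Finset.mem_univ ν)]
  have h1 : (x.face ν i h).n ν = x.n ν - 1 := Function.update_self ..
  rw [h1, hc, add_right_comm]
  congr 2
  refine Finset.sum_congr rfl fun κ hκ => ?_
  rw [show (x.face ν i h).n κ = x.n κ from Function.update_of_ne (Finset.ne_of_mem_erase hκ) ..]

lemma deg_face (x : SeqElt U j) (ν : U.F) (i : Fin (x.n ν + 1)) (h : 0 < x.n ν) :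
    (x.face ν i h).deg = x.deg + 1 := by
  have := x.sum_face_n ν i h (fun m _ => (m : ℤ)) 1 (by omega)
  unfold deg
  rw [this]
  ring

lemma deg_relabel (e : U.Iso V) (x : SeqElt U j) : (x.relabel e).deg = x.deg := by
  unfold deg
  congr 1
  exact Equiv.sum_comp e.e.symm.toEquiv fun ν => (x.n ν : ℤ)

lemma sum_comp_n {M : Type*} [AddCommMonoid M] {P : U.Hom V} (y : SeqElt V j)
    (x : ∀ μ, SeqElt (P.fiber μ) (y.n μ)) (f : ℕ → U.F → M) :
    ∑ ν, f ((y.comp P x).n ν) ν = ∑ μ, ∑ ν : (P.fiber μ).F, f ((x μ).n ν) ν.1 := by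
  rw [← Equiv.sum_comp (Equiv.sigmaFiberEquiv P.f), Fintype.sum_sigma]
  refine Finset.sum_congr rfl fun μ _ => ?_
  refine Finset.sum_congr rfl fun ν _ => ?_
  rw [← comp_n y x μ ν]
  rfl

lemma deg_comp {P : U.Hom V} (y : SeqElt V j) (x : ∀ μ, SeqElt (P.fiber μ) (y.n μ)) :
    (y.comp P x).deg = ∑ μ, (x μ).deg + y.deg := by
  have := sum_comp_n y x (fun m _ => (m : ℤ))
  unfold deg
  rw [this, Finset.sum_sub_distrib]
  ring

end SeqElt
end Breq

/-! ### Dinaturality, associativity, naturality and units for the composition of `seq` -/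

namespace Breq
namespace SeqElt
variable {U V : Disk} {j : ℕ}

lemma pts_ext {X : Type} {n : X → ℕ} {z z' : Pts n} (h : z.1 = z'.1) (h' : (z.2 : ℕ) = z'.2) :
    z = z' := by
  obtain ⟨ν, i⟩ := z
  obtain ⟨ν', i'⟩ := z'
  obtain rfl : ν = ν' := h
  obtain rfl : i = i' := Fin.ext h'
  rfl

/-- Dinaturality of the composition in the ordinals `J_μ`. -/
lemma comp_push {P : U.Hom V} (y : SeqElt V j) (n' : V.F → ℕ)
    (φ : ∀ ν, Fin (n' ν + 1) →o Fin (y.n ν + 1)) (hφ : ∀ ν, Function.Injective (φ ν))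
    (x : ∀ μ, SeqElt (P.fiber μ) (n' μ)) :
    y.comp P (fun μ => (x μ).push (φ μ)) = (y.pull n' φ).comp P x := by
  symm
  have E := comp_emb (y := y) (y' := y.pull n' φ) (x := fun μ => (x μ).push (φ μ)) (x' := x)
    (y.pull_emb n' φ hφ) (g := id) Function.injective_id (τ := fun μ => id)
    (fun μ => ⟨Function.injective_id, fun _ _ h => h⟩) (fun _ _ => rfl)
  refine eq_of_emb_surj E (compMap_surjective Function.surjective_id
    fun _ => Function.surjective_id) fun z => ⟨rfl, rfl⟩

/-- A point of either side is a triple: a leaf `q`, a leaf `s` over `q`, and a point of `α s`. Both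
orders compare first in `γ`, then in `β q`, then in `α s`. The relabelled family `α'` is prescribed
only at `⟨s, rfl⟩`, where the arities agree by definition. -/
lemma comp_assoc {T S Q : Disk} {σ : T.Hom S} {ρ : S.Hom Q} (γ : SeqElt Q j)
    (β : ∀ q, SeqElt (ρ.fiber q) (γ.n q))
    (α : ∀ s, SeqElt (σ.fiber s) ((γ.comp ρ β).n s))
    (α' : ∀ q, ∀ s : (ρ.fiber q).F, SeqElt ((σ.restrict ρ q).fiber s) ((β q).n s))
    (hα : ∀ s, α' (ρ.f s) ⟨s, rfl⟩ =
      relabel (σ.restrictFiberIso ρ (ρ.f s) ⟨s, rfl⟩) (α s)) :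
    (γ.comp ρ β).comp σ α =
      γ.comp (σ.comp ρ) (fun q => (β q).comp (σ.restrict ρ q) (α' q)) := by
  have : ∀ q, ∀ s : (ρ.fiber q).F, ∃ τ : Pts (α' q s).n → Pts (α s.1).n,
      Emb (α' q s) (α s.1) τ ∧ Function.Surjective τ ∧
      ∀ w, (τ w).1.1 = w.1.1.1 ∧ ((α s.1).W (τ w) : ℕ) = (α' q s).W w := by
    rintro q ⟨s, rfl⟩
    rw [hα]
    exact ⟨_, relabel_emb _ _, relabelPt_surjective _ _, fun w => ⟨rfl, rfl⟩⟩
  choose τ h1 h2 h3 using this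
  let B : ∀ q, SeqElt ((σ.comp ρ).fiber q) (γ.n q) := fun q => (β q).comp (σ.restrict ρ q) (α' q)
  let Φ : (Σ q, Σ s, Pts (α' q s).n) → Pts (γ.comp (σ.comp ρ) B).n := fun p =>
    compEquiv γ B ⟨p.1, compEquiv (β p.1) (α' p.1) p.2⟩
  have hΦ : Function.Bijective Φ := by
    constructor
    · rintro ⟨q, p⟩ ⟨q', p'⟩ h
      have h4 := (compEquiv γ B).injective h
      have e : q = q' := congrArg Sigma.fst h4
      subst e
      have h5 : p = p' := (compEquiv (β q) (α' q)).injective (eq_of_heq (Sigma.mk.inj h4).2)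
      rw [h5]
    · intro z
      obtain ⟨⟨q, w⟩, rfl⟩ := (compEquiv γ B).surjective z
      obtain ⟨p, rfl⟩ := (compEquiv (β q) (α' q)).surjective w
      exact ⟨⟨q, p⟩, rfl⟩
  let Φe := Equiv.ofBijective Φ hΦ
  let t : Pts (γ.comp (σ.comp ρ) B).n → Pts ((γ.comp ρ β).comp σ α).n := fun z =>
    compEquiv (γ.comp ρ β) α ⟨(Φe.symm z).2.1.1, τ _ _ (Φe.symm z).2.2⟩
  have ht : ∀ q s w, t (Φ ⟨q, s, w⟩) = compEquiv (γ.comp ρ β) α ⟨s.1, τ q s w⟩ := by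
    intro q s w
    have : Φe.symm (Φ ⟨q, s, w⟩) = ⟨q, s, w⟩ := Φe.symm_apply_apply _
    simp only [t]
    rw [this]
  have hpt : ∀ q s w, (⟨s.1, (α s.1).W (τ q s w)⟩ : Pts (γ.comp ρ β).n) =
      compEquiv γ β ⟨q, ⟨s, (α' q s).W w⟩⟩ := fun q s w => pts_ext rfl (h3 q s w).2
  have hE : Emb (γ.comp (σ.comp ρ) B) ((γ.comp ρ β).comp σ α) t := by
    constructor
    · intro z z' h
      obtain ⟨⟨q, s, w⟩, rfl⟩ := hΦ.2 z
      obtain ⟨⟨q', s', w'⟩, rfl⟩ := hΦ.2 z'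
      rw [ht, ht, (compEquiv (γ.comp ρ β) α).injective.eq_iff] at h
      obtain ⟨s, rfl⟩ := s
      obtain ⟨s', rfl⟩ := s'
      have e : s = s' := congrArg Sigma.fst h
      subst e
      rw [(h1 _ _).inj (eq_of_heq (Sigma.mk.inj h).2)]
    · intro z z' h
      obtain ⟨⟨q, s, w⟩, rfl⟩ := hΦ.2 z
      obtain ⟨⟨q', s', w'⟩, rfl⟩ := hΦ.2 z'
      rw [ht, ht, comp_le_iff, hpt, hpt, ne_eq, (compEquiv γ β).injective.eq_iff]
      simp only [Φ] at h
      rw [comp_le_iff, comp_W, comp_W] at h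
      -- Either the images in `γ` differ, or they coincide and the comparison takes place over one
      -- `q`, where the same dichotomy repeats for `β q`.
      rcases h with ⟨h4, h5⟩ | ⟨h4, κ, e, e', h5⟩
      · left
        refine ⟨?_, (comp_le_iff_of_ne γ β h4).2 h5⟩
        intro e
        apply h4
        have e1 : q = q' := congrArg Sigma.fst e
        subst e1
        have e2 := eq_of_heq (Sigma.mk.inj e).2
        rw [e2]
      · subst e
        subst e'
        rw [comp_le_iff] at h5
        rcases h5 with ⟨h6, h7⟩ | ⟨h6, κ, e, e', h7⟩
        · left
          refine ⟨fun e => h6 (eq_of_heq (Sigma.mk.inj e).2), ?_⟩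
          rw [comp_le_same]
          exact h7
        · subst e
          subst e'
          right
          exact ⟨by rw [h6], _, rfl, rfl, (h1 _ _).mono _ _ h7⟩
  symm
  refine eq_of_emb_surj hE ?_ ?_
  · intro z
    obtain ⟨⟨s, w⟩, rfl⟩ := (compEquiv (γ.comp ρ β) α).surjective z
    obtain ⟨w, rfl⟩ := h2 (ρ.f s) ⟨s, rfl⟩ w
    exact ⟨_, ht _ _ _⟩
  · intro z
    obtain ⟨⟨q, s, w⟩, rfl⟩ := hΦ.2 z
    rw [ht]
    refine ⟨(h3 q s w).1.symm, (comp_W γ B q _).trans ?_⟩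
    refine Eq.trans ?_ (comp_W (γ.comp ρ β) α s.1 (τ q s w)).symm
    rw [hpt, comp_W γ β]
    exact congrArg (fun i => γ.W ⟨q, i⟩) (comp_W (β q) (α' q) s w)

/-- The factors of the relabelled composite enter only through order isomorphisms `τ` that respect
leaves and values, so that no equality of dependent families is required. -/
lemma comp_relabel {U' V' : Disk} (e : U.Iso U') (f : V.Iso V') {P : U.Hom V} {P' : U'.Hom V'}
    (y : SeqElt V j) (x : ∀ μ, SeqElt (P.fiber μ) (y.n μ))
    (x' : ∀ μ, SeqElt (P'.fiber μ) ((y.relabel f).n μ))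
    (hx : ∀ μ, ∃ τ : Pts (x μ).n → Pts (x' (f.e μ)).n, Emb (x μ) (x' (f.e μ)) τ ∧
      Function.Surjective τ ∧ ∀ w, (τ w).1.1 = e.e w.1.1 ∧
        ((x' (f.e μ)).W (τ w) : ℕ) = (x μ).W w) :
    (y.relabel f).comp P' x' = (y.comp P x).relabel e := by
  choose τ h1 h2 h3 using hx
  have Ey := (relabel_emb f y).surjInv (relabelPt_surjective f y)
  have Ec := (relabel_emb e (y.comp P x)).surjInv (relabelPt_surjective e (y.comp P x))
  have hs : ∀ {U₁ U₂ : Disk} (e : U₁.Iso U₂) {j : ℕ} (x : SeqElt U₁ j),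
      Function.Surjective (Function.surjInv (relabelPt_surjective e x)) := fun e j x z =>
    ⟨relabelPt e x z, (relabel_emb e x).inj (Function.surjInv_eq _ _)⟩
  have hfst : ∀ {U₁ U₂ : Disk} (e : U₁.Iso U₂) {j : ℕ} (x : SeqElt U₁ j) (z : Pts x.n),
      (Function.surjInv (relabelPt_surjective e x) z).1 = e.e z.1 ∧
      ((Function.surjInv (relabelPt_surjective e x) z).2 : ℕ) = z.2 := by
    intro U₁ U₂ e j x z
    have := Function.surjInv_eq (relabelPt_surjective e x) z
    generalize Function.surjInv (relabelPt_surjective e x) z = z' at *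
    subst this
    exact ⟨(e.e.apply_symm_apply _).symm, rfl⟩
  have hW : ∀ {U₁ U₂ : Disk} (e : U₁.Iso U₂) {j : ℕ} (x : SeqElt U₁ j) (z : Pts x.n),
      (x.relabel e).W (Function.surjInv (relabelPt_surjective e x) z) = x.W z := by
    intro U₁ U₂ e j x z
    exact congrArg x.W (Function.surjInv_eq (relabelPt_surjective e x) z)
  have hcompat : ∀ μ w, Function.surjInv (relabelPt_surjective f y) ⟨μ, (x μ).W w⟩ =
      ⟨f.e μ, (x' (f.e μ)).W (τ μ w)⟩ := by
    intro μ w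
    exact pts_ext (hfst f y _).1 ((hfst f y _).2.trans (h3 μ w).2.symm)
  refine eq_of_emb_of_surj (comp_emb (x := x') (x' := x) Ey f.e.injective h1 hcompat) Ec
    (compMap_surjective f.e.surjective h2) (hs e _) ?_
  intro z
  rw [hW, (hfst e _ z).1]
  obtain ⟨⟨μ, w⟩, rfl⟩ := (compEquiv y x).surjective z
  rw [compMap_apply, comp_W, comp_W, ← hcompat, hW]
  exact ⟨(h3 μ w).1, rfl⟩

lemma unit_comp (x : SeqElt U j)
    (x' : ∀ μ, SeqElt ((Disk.Hom.toPt U).fiber μ) ((unit j).n μ))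
    (hx : ∀ μ, x' μ = x.relabel (U.toPtFiberIso μ)) : (unit j).comp (Disk.Hom.toPt U) x' = x := by
  have : ∀ μ, ∃ τ : Pts (x' μ).n → Pts x.n, Emb (x' μ) x τ ∧ Function.Surjective τ ∧
      ∀ w, (τ w).1 = w.1.1 ∧ x.W (τ w) = (x' μ).W w := by
    intro μ
    rw [hx]
    exact ⟨_, relabel_emb _ x, relabelPt_surjective _ x, fun w => ⟨rfl, rfl⟩⟩
  choose τ h1 h2 h3 using this
  let t : Pts ((unit j).comp (Disk.Hom.toPt U) x').n → Pts x.n := fun z =>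
    τ _ ((compEquiv (unit j) x').symm z).2
  have ht : ∀ μ w, t (compEquiv (unit j) x' ⟨μ, w⟩) = τ μ w := fun μ w => by
    simp only [t]
    rw [Equiv.symm_apply_apply]
  have hE : Emb ((unit j).comp (Disk.Hom.toPt U) x') x t := by
    constructor
    · intro z z' h
      obtain ⟨⟨μ, w⟩, rfl⟩ := (compEquiv (unit j) x').surjective z
      obtain ⟨⟨μ', w'⟩, rfl⟩ := (compEquiv (unit j) x').surjective z'
      have e : μ = μ' := Subsingleton.elim (α := Unit) _ _
      subst e
      rw [ht, ht] at h
      rw [(h1 μ).inj h]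
    · intro z z' h
      obtain ⟨⟨μ, w⟩, rfl⟩ := (compEquiv (unit j) x').surjective z
      obtain ⟨⟨μ', w'⟩, rfl⟩ := (compEquiv (unit j) x').surjective z'
      have e : μ = μ' := Subsingleton.elim (α := Unit) _ _
      subst e
      rw [comp_le_same] at h
      rw [ht, ht]
      exact (h1 μ).mono _ _ h
  refine eq_of_emb_surj hE ?_ ?_
  · intro z
    obtain ⟨w, rfl⟩ := h2 () z
    exact ⟨_, ht _ w⟩
  · intro z
    obtain ⟨⟨μ, w⟩, rfl⟩ := (compEquiv (unit j) x').surjective z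
    rw [ht, comp_W, (h3 μ w).2, (h3 μ w).1]
    exact ⟨rfl, rfl⟩

lemma comp_unit (y : SeqElt V j) :
    y.comp (Disk.Hom.id V) (fun μ => (unit (y.n μ)).relabel (V.idFiberIso μ)) = y := by
  set x : ∀ μ, SeqElt ((Disk.Hom.id V).fiber μ) (y.n μ) :=
    fun μ => (unit (y.n μ)).relabel (V.idFiberIso μ)
  have hfst : ∀ μ (w : Pts (x μ).n), w.1.1 = μ := fun μ w => w.1.2
  have hE : Emb (y.comp (Disk.Hom.id V) x) y (compPt y x) := by
    constructor
    · intro z z' h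
      obtain ⟨⟨μ, w⟩, rfl⟩ := (compEquiv y x).surjective z
      obtain ⟨⟨μ', w'⟩, rfl⟩ := (compEquiv y x).surjective z'
      rw [compPt_compEquiv, compPt_compEquiv] at h
      have e : μ = μ' := congrArg Sigma.fst h
      subst e
      have e2 : (x μ).W w = (x μ).W w' := eq_of_heq (Sigma.mk.inj h).2
      have : w = w' := pts_ext (Subtype.ext ((hfst μ w).trans (hfst μ w').symm))
        (congrArg Fin.val e2)
      rw [this]
    · intro z z' h
      rcases h with ⟨_, h⟩ | ⟨h, _⟩
      · exact h
      · rw [h]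
        exact y.le_rfl' _
  refine eq_of_emb_surj hE ?_ ?_
  · rintro ⟨μ, i⟩
    refine ⟨compEquiv y x ⟨μ, ⟨⟨μ, rfl⟩, i⟩⟩, ?_⟩
    rw [compPt_compEquiv]
    rfl
  · intro z
    exact ⟨rfl, rfl⟩

lemma face_relabel (e : U.Iso V) (x : SeqElt U j) (ν : U.F) (i : Fin (x.n ν + 1))
    (h : 0 < x.n ν) (i' : Fin ((x.relabel e).n (e.e ν) + 1)) (hi : (i' : ℕ) = i)
    (h' : 0 < (x.relabel e).n (e.e ν)) :
    (x.relabel e).face (e.e ν) i' h' = (x.face ν i h).relabel e := by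
  refine eq_of_emb (x := x) (((x.relabel e).face_emb _ _ _).comp_emb (relabel_emb e x))
    ((relabel_emb e (x.face ν i h)).comp_emb (x.face_emb ν i h)) ?_ ?_
  · rw [Set.range_comp, range_facePt, Set.range_comp, (relabelPt_surjective e _).range_eq,
      Set.image_univ, range_facePt, Set.image_compl_eq
        ⟨(relabel_emb e x).inj, relabelPt_surjective e x⟩, Set.image_singleton]
    congr 2
    exact pts_ext (e.e.symm_apply_apply ν) hi
  · intro z z' hz
    refine ⟨e.e.symm.injective (congrArg Sigma.fst hz), ?_⟩
    exact congrArg x.W hz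

lemma coface_relabel (e : U.Iso V) (x : SeqElt U j) (i : Fin (j + 2)) :
    (x.relabel e).coface i = (x.coface i).relabel e := rfl

lemma relabel_refl (x : SeqElt U j) : x.relabel (Disk.Iso.refl U) = x := rfl

lemma relabel_trans {W : Disk} (e : U.Iso V) (f : V.Iso W) (x : SeqElt U j) :
    x.relabel (e.trans f) = (x.relabel e).relabel f := rfl

end SeqElt
end Breq

namespace Breq

/-! ### Signs -/

section sg

variable (k : Type*) [Field k]

/-- The sign `(-1) ^ z`. -/
def sg (z : ZMod 2) : k := if z = 0 then 1 else -1

lemma sg_zero : sg k 0 = 1 := by simp [sg]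

lemma sg_one : sg k 1 = -1 := by simp [sg]

/-- Signs are carried as exponents in `ZMod 2`, so that identities of signs become linear identities
in characteristic two. -/
lemma sg_add (a b : ZMod 2) : sg k (a + b) = sg k a * sg k b := by
  have h : ∀ z : ZMod 2, z = 0 ∨ z = 1 := by decide
  rcases h a with rfl | rfl <;> rcases h b with rfl | rfl <;>
    simp [sg_zero, sg_one, show (1 + 1 : ZMod 2) = 0 from by decide]

lemma sg_mul_self (a : ZMod 2) : sg k a * sg k a = 1 := by
  rw [← sg_add, CharTwo.add_self_eq_zero, sg_zero]

lemma neg_sg (a : ZMod 2) : -sg k a = sg k (a + 1) := by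
  rw [sg_add, sg_one]
  ring

lemma neg_one_pow_eq_sg (n : ℕ) : (-1 : k) ^ n = sg k n := by
  induction n with
  | zero => simp [sg]
  | succ n ih => rw [pow_succ, ih, Nat.cast_succ, sg_add, sg_one]

lemma neg_one_zpow_eq_sg (z : ℤ) : (-1 : k) ^ z = sg k z := by
  obtain ⟨n, rfl | rfl⟩ := z.eq_nat_or_neg
  · simp [neg_one_pow_eq_sg]
  · rw [zpow_neg, zpow_natCast, neg_one_pow_eq_sg, Int.cast_neg, Int.cast_natCast,
      CharTwo.neg_eq, inv_eq_of_mul_eq_one_left (sg_mul_self k _)]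

lemma sg_smul_smul {N : Type*} [AddCommGroup N] [Module k N] (a b : ZMod 2) (x : N) :
    sg k a • sg k b • x = sg k (a + b) • x := by rw [smul_smul, sg_add]

end sg

/-! ### Multilinear maps on free modules -/

section multi

variable {k : Type*} [Field k] {ι : Type*} [Fintype ι] [DecidableEq ι] {B : ι → Type*}
  {N : Type*} [AddCommGroup N] [Module k N]

/-- Families outside the supports contribute zero. Enlarging the supports to a common family of
finite sets is what allows the values at different arguments to be compared term by term. -/
lemma sum_piFinset_support (Ψ : (∀ i, B i) → N) (f : ∀ i, B i →₀ k) (S : ∀ i, Finset (B i))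
    (hS : ∀ i, (f i).support ⊆ S i) :
    ∑ x ∈ Fintype.piFinset (fun i => (f i).support), (∏ i, f i (x i)) • Ψ x =
      ∑ x ∈ Fintype.piFinset S, (∏ i, f i (x i)) • Ψ x := by
  apply Finset.sum_subset
  · exact Fintype.piFinset_subset _ _ hS
  · intro x _ hx
    simp only [Fintype.mem_piFinset, not_forall] at hx
    obtain ⟨i, hi⟩ := hx
    have h0 : f i (x i) = 0 := Finsupp.notMem_support_iff.1 hi
    rw [Finset.prod_eq_zero (f := fun i => f i (x i)) (Finset.mem_univ i) h0, zero_smul]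

/-- The multilinear extension of a function on families of basis elements. -/
noncomputable def multi (Ψ : (∀ i, B i) → N) : MultilinearMap k (fun i => B i →₀ k) N :=
  MultilinearMap.mk'
    (fun f => ∑ x ∈ Fintype.piFinset (fun i => (f i).support), (∏ i, f i (x i)) • Ψ x)
    (by
      classical
      intro f i a b
      let S : ∀ κ, Finset (B κ) := fun κ => (f κ).support ∪ (Function.update f i a κ).support ∪
        (Function.update f i b κ).support
      have hs : ∀ c : B i →₀ k, c.support ⊆ a.support ∪ b.support →
          ∀ κ, (Function.update f i c κ).support ⊆ S κ := by
        intro c hc κ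
        by_cases h : κ = i
        · subst h
          simp only [S, Function.update_self]
          exact hc.trans (by intro z; simp; tauto)
        · simp only [S, Function.update_of_ne h]
          intro z
          simp
      rw [sum_piFinset_support _ _ S (hs _ Finsupp.support_add),
        sum_piFinset_support _ _ S (hs _ Finset.subset_union_left),
        sum_piFinset_support _ _ S (hs _ Finset.subset_union_right), ← Finset.sum_add_distrib]
      refine Finset.sum_congr rfl fun x _ => ?_
      rw [← add_smul]
      congr 1
      exact ((MultilinearMap.mkPiAlgebra k ι k).compLinearMap
        (fun i => Finsupp.lapply (x i))).map_update_add f i a b)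
    (by
      classical
      intro f i c a
      let S : ∀ κ, Finset (B κ) := fun κ => (f κ).support ∪ (Function.update f i a κ).support
      have hs : ∀ c : B i →₀ k, c.support ⊆ a.support →
          ∀ κ, (Function.update f i c κ).support ⊆ S κ := by
        intro c hc κ
        by_cases h : κ = i
        · subst h
          simp only [S, Function.update_self]
          exact hc.trans Finset.subset_union_right
        · simp only [S, Function.update_of_ne h]
          intro z
          simp
      rw [sum_piFinset_support _ _ S (hs _ Finsupp.support_smul),
        sum_piFinset_support _ _ S (hs _ subset_rfl), Finset.smul_sum]
      refine Finset.sum_congr rfl fun x _ => ?_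
      rw [smul_smul]
      congr 1
      exact ((MultilinearMap.mkPiAlgebra k ι k).compLinearMap
        (fun i => Finsupp.lapply (x i))).map_update_smul f i c a)

lemma multi_apply (Ψ : (∀ i, B i) → N) (f : ∀ i, B i →₀ k) :
    multi Ψ f = ∑ x ∈ Fintype.piFinset (fun i => (f i).support), (∏ i, f i (x i)) • Ψ x := rfl

lemma multi_single (Ψ : (∀ i, B i) → N) (x : ∀ i, B i) :
    multi Ψ (fun i => Finsupp.single (x i) (1 : k)) = Ψ x := by
  rw [multi_apply, sum_piFinset_support _ _ (fun i => {x i})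
    (fun i => Finsupp.support_single_subset)]
  have : Fintype.piFinset (fun i => ({x i} : Finset (B i))) = {x} := by
    ext y
    simp [funext_iff]
  rw [this]
  simp

lemma map_eq_sum_single (L : MultilinearMap k (fun i => B i →₀ k) N) (F : ∀ i, B i →₀ k) :
    L F = ∑ x ∈ Fintype.piFinset (fun i => (F i).support),
      (∏ i, F i (x i)) • L (fun i => Finsupp.single (x i) 1) := by
  have h : F = fun i => ∑ b ∈ (F i).support, F i b • Finsupp.single b (1 : k) := by
    funext i
    conv_lhs => rw [← Finsupp.sum_single (F i)]
    exact Finset.sum_congr rfl fun b _ => by simp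
  conv_lhs => rw [h]
  rw [MultilinearMap.map_sum_finset]
  refine Finset.sum_congr rfl fun x _ => ?_
  rw [MultilinearMap.map_smul_univ]

/-- Multilinear maps that agree on families of basis elements taken from `S` agree on families
supported in `S`. -/
lemma multilinear_ext {L L' : MultilinearMap k (fun i => B i →₀ k) N} {F : ∀ i, B i →₀ k}
    (S : ∀ i, Set (B i)) (hF : ∀ i, F i ∈ Finsupp.supported k k (S i))
    (h : ∀ x : ∀ i, B i, (∀ i, x i ∈ S i) → L (fun i => Finsupp.single (x i) 1) =
      L' (fun i => Finsupp.single (x i) 1)) : L F = L' F := by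
  rw [map_eq_sum_single L, map_eq_sum_single L']
  refine Finset.sum_congr rfl fun x hx => ?_
  rw [h x fun i => hF i (Fintype.mem_piFinset.1 hx i)]

lemma linear_ext {A : Type*} {L L' : (A →₀ k) →ₗ[k] N} {f : A →₀ k} {S : Set A}
    (hf : f ∈ Finsupp.supported k k S)
    (h : ∀ x ∈ S, L (Finsupp.single x 1) = L' (Finsupp.single x 1)) : L f = L' f := by
  rw [← Finsupp.sum_single f, Finsupp.sum, map_sum, map_sum]
  refine Finset.sum_congr rfl fun x hx => ?_
  have := h x (hf hx)
  rw [← mul_one (f x), ← smul_eq_mul, ← Finsupp.smul_single, map_smul, map_smul, this]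

lemma multi_update_single (Ψ : (∀ i, B i) → N) (x : ∀ i, B i) (i : ι) (z : B i) (c : k) :
    multi Ψ (Function.update (fun i => Finsupp.single (x i) (1 : k)) i (Finsupp.single z c)) =
      c • Ψ (Function.update x i z) := by
  have h1 : Finsupp.single z c = c • Finsupp.single z (1 : k) := by simp
  have h2 : Function.update (fun i => Finsupp.single (x i) (1 : k)) i (Finsupp.single z 1) =
      fun κ => Finsupp.single (Function.update x i z κ) 1 := by
    funext κ
    by_cases h : κ = i
    · subst h
      simp
    · simp [h]
  rw [h1, MultilinearMap.map_update_smul, h2, multi_single]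

lemma multi_mapDomain {B' : ι → Type*} (Ψ : (∀ i, B' i) → N) (e : ∀ i, B i → B' i)
    (f : ∀ i, B i →₀ k) :
    multi Ψ (fun i => Finsupp.mapDomain (e i) (f i)) = multi (fun x => Ψ fun i => e i (x i)) f := by
  refine multilinear_ext
    (L := (multi Ψ).compLinearMap (fun i => Finsupp.lmapDomain k k (e i)))
    (L' := multi (fun x => Ψ fun i => e i (x i))) (fun _ => Set.univ) (fun i => by simp) ?_
  intro x _
  rw [multi_single, MultilinearMap.compLinearMap_apply]
  simp only [Finsupp.lmapDomain_apply, Finsupp.mapDomain_single]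
  exact multi_single Ψ fun i => e i (x i)

end multi

/-! ### The composition of the condensation on generators -/

section condComp

variable {k : Type*} [Field k] {U V : Disk} {j : ℕ}

/-- The signed composite of generators. -/
noncomputable def compTerm (k : Type*) [Field k] (P : U.Hom V) (y : SeqElt V j)
    (x : ∀ μ, SeqElt (P.fiber μ) (y.n μ)) : SeqElt U j →₀ k :=
  Finsupp.single (y.comp P x) (sg k (compSign P y x))

lemma condComp_eq (P : U.Hom V) (f : ∀ μ, ∀ j, SeqElt (P.fiber μ) j →₀ k) (g : SeqElt V j →₀ k) :
    condComp P f g = Finsupp.linearCombination k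
      (fun y => multi (compTerm k P y) (fun μ => f μ (y.n μ))) g := by
  rw [Finsupp.linearCombination_apply]
  unfold condComp
  refine Finsupp.sum_congr fun y _ => ?_
  rw [multi_apply, Finset.smul_sum]
  refine Finset.sum_congr rfl fun x _ => ?_
  rw [compTerm, Finsupp.smul_single, Finsupp.smul_single, neg_one_zpow_eq_sg]
  congr 1
  simp only [smul_eq_mul]
  ring

lemma condComp_single (P : U.Hom V) (f : ∀ μ, ∀ j, SeqElt (P.fiber μ) j →₀ k) (y : SeqElt V j)
    (c : k) : condComp P f (Finsupp.single y c) =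
      c • multi (compTerm k P y) (fun μ => f μ (y.n μ)) := by
  rw [condComp_eq, Finsupp.linearCombination_single]

/-- The composition as a linear map of the last factor. -/
noncomputable def condCompL (P : U.Hom V) (f : ∀ μ, ∀ j, SeqElt (P.fiber μ) j →₀ k) (j : ℕ) :
    (SeqElt V j →₀ k) →ₗ[k] (SeqElt U j →₀ k) :=
  Finsupp.linearCombination k fun y => multi (compTerm k P y) (fun μ => f μ (y.n μ))

lemma condCompL_apply (P : U.Hom V) (f : ∀ μ, ∀ j, SeqElt (P.fiber μ) j →₀ k)
    (g : SeqElt V j →₀ k) : condCompL P f j g = condComp P f g := (condComp_eq P f g).symm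

lemma update_family {P : U.Hom V} (f : ∀ μ, ∀ j, SeqElt (P.fiber μ) j →₀ k) (μ : V.F)
    (X : ∀ j, SeqElt (P.fiber μ) j →₀ k) (n : V.F → ℕ) :
    (fun κ => Function.update f μ X κ (n κ)) =
      Function.update (fun κ => f κ (n κ)) μ (X (n μ)) := by
  funext κ
  by_cases h : κ = μ
  · subst h
    simp
  · simp [h]

lemma condComp_update_add (P : U.Hom V) (f : ∀ μ, ∀ j, SeqElt (P.fiber μ) j →₀ k) (μ : V.F)
    (X Y : ∀ j, SeqElt (P.fiber μ) j →₀ k) (g : SeqElt V j →₀ k) :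
    condComp P (Function.update f μ (X + Y)) g = condComp P (Function.update f μ X) g +
      condComp P (Function.update f μ Y) g := by
  simp only [condComp_eq, Finsupp.linearCombination_apply, update_family, Pi.add_apply,
    MultilinearMap.map_update_add, smul_add, Finsupp.sum_add]

lemma condComp_update_smul (P : U.Hom V) (f : ∀ μ, ∀ j, SeqElt (P.fiber μ) j →₀ k) (μ : V.F)
    (c : k) (X : ∀ j, SeqElt (P.fiber μ) j →₀ k) (g : SeqElt V j →₀ k) :
    condComp P (Function.update f μ (c • X)) g = c • condComp P (Function.update f μ X) g := by
  simp only [condComp_eq, Finsupp.linearCombination_apply, update_family, Pi.smul_apply,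
    MultilinearMap.map_update_smul, Finsupp.smul_sum]
  refine Finsupp.sum_congr fun y _ => ?_
  rw [smul_comm]

lemma condComp_mem (P : U.Hom V) (f : ∀ μ, ∀ j, SeqElt (P.fiber μ) j →₀ k) (g : SeqElt V j →₀ k)
    (a : V.F → ℤ) (b : ℤ)
    (hf : ∀ μ j, f μ j ∈ Finsupp.supported k k {x | x.deg = a μ})
    (hg : g ∈ Finsupp.supported k k {x | x.deg = b}) :
    condComp P f g ∈ Finsupp.supported k k {x | x.deg = ∑ μ, a μ + b} := by
  rw [condComp_eq, Finsupp.linearCombination_apply, Finsupp.sum]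
  refine Submodule.sum_mem _ fun y hy => Submodule.smul_mem _ _ ?_
  rw [multi_apply]
  refine Submodule.sum_mem _ fun x hx => Submodule.smul_mem _ _ ?_
  rw [compTerm]
  refine Finsupp.single_mem_supported k _ ?_
  change (y.comp P x).deg = _
  rw [SeqElt.deg_comp, show y.deg = b from hg hy]
  congr 1
  refine Finset.sum_congr rfl fun μ _ => ?_
  exact hf μ _ (Fintype.mem_piFinset.1 hx μ)

end condComp

end Breq

namespace Breq

/-! ### Sign sums -/

section sums

variable {F G : Type} [Fintype F] [DecidableEq F] [Fintype G] [DecidableEq G]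

/-- Raising one variable of a quadratic form by one adds the polarisation at that variable, the
diagonal term being zero by `hR`. This is how the permutation part of `compSign` reacts to a face.
-/
lemma quad_add_single (R : F → F → ZMod 2) (N N' : F → ZMod 2) (a : F) (hR : R a a = 0)
    (hN : ∀ b, N' b = N b + if b = a then 1 else 0) :
    ∑ b, ∑ c, R b c * (N' b * N' c) =
      ∑ b, ∑ c, R b c * (N b * N c) + ∑ c, (R a c + R c a) * N c := by
  have : ∀ b c, R b c * (N' b * N' c) = R b c * (N b * N c) + ((if b = a then R a c * N c else 0) +
      ((if c = a then R b a * N b else 0) + if b = a then if c = a then R a a else 0 else 0)) := by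
    intro b c
    rw [hN, hN]
    split_ifs with h h' h'
    · subst h
      subst h'
      ring
    · subst h
      ring
    · subst h'
      ring
    · ring
  simp only [this, Finset.sum_add_distrib, Finset.sum_ite_eq', Finset.mem_univ, if_true, hR]
  rw [Finset.sum_comm]
  simp [add_mul, Finset.sum_add_distrib]

lemma bilin_add_single (R : G → G → ZMod 2) (D D' y : G → ZMod 2) (a : G)
    (hD : ∀ b, D' b = D b + if b = a then 1 else 0) :
    ∑ b, ∑ c, R b c * (D' c * y b) = ∑ b, ∑ c, R b c * (D c * y b) + ∑ b, R b a * y b := by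
  rw [← Finset.sum_add_distrib]
  refine Finset.sum_congr rfl fun b _ => ?_
  simp only [hD, add_mul, mul_add, Finset.sum_add_distrib, ite_mul, one_mul, zero_mul, mul_ite,
    mul_zero, Finset.sum_ite_eq', Finset.mem_univ, if_true]

end sums

/-- The truth value of a proposition. -/
def iv (p : Prop) [Decidable p] : ZMod 2 := if p then 1 else 0

lemma iv_mul (p : Prop) [Decidable p] (z : ZMod 2) : iv p * z = if p then z else 0 := by
  unfold iv
  split_ifs <;> simp

lemma sum_filter_iv {F : Type*} (s : Finset F) (p : F → Prop) [DecidablePred p] (f : F → ZMod 2) :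
    ∑ a ∈ s with p a, f a = ∑ a ∈ s, iv (p a) * f a := by
  simp only [iv_mul, Finset.sum_filter]

namespace SeqElt

variable {U V : Disk} {j : ℕ}

lemma deg_cast (x : SeqElt U j) : (x.deg : ZMod 2) = j + ∑ ν, (x.n ν : ZMod 2) := by
  simp [deg, CharTwo.sub_eq_add]

lemma face_n_self (x : SeqElt U j) (ν : U.F) (i : Fin (x.n ν + 1)) (h : 0 < x.n ν) :
    (x.face ν i h).n ν = x.n ν - 1 := Function.update_self ..

lemma face_n_of_ne (x : SeqElt U j) (ν : U.F) (i : Fin (x.n ν + 1)) (h : 0 < x.n ν) {κ : U.F}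
    (hκ : κ ≠ ν) : (x.face ν i h).n κ = x.n κ := Function.update_of_ne hκ ..

end SeqElt

/-! ### The Leibniz rule for the composition of the condensation -/

section d_comp

variable {k : Type*} [Field k] {U V : Disk} {j : ℕ}

lemma compSign_cast {P : U.Hom V} (y : SeqElt V j) (x : ∀ μ, SeqElt (P.fiber μ) (y.n μ)) :
    (compSign P y x : ZMod 2) =
      ∑ μ, ∑ μ', iv (μ < μ') * (((x μ').deg : ZMod 2) * (y.n μ : ZMod 2)) +
      ∑ ν, ∑ ν', iv (ν < ν' ∧ P.f ν' < P.f ν) *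
        (((y.comp P x).n ν : ZMod 2) * ((y.comp P x).n ν' : ZMod 2)) := by
  simp only [compSign, Int.cast_add, Int.cast_sum, Int.cast_mul, Int.cast_natCast, sum_filter_iv]

/-- Modulo 2 the degree of `x μ` is its output arity plus its input arities, and the latter are the
arities of the composite at the leaves over `μ`. -/
lemma sum_comp_cast {P : U.Hom V} (y : SeqElt V j) (x : ∀ μ, SeqElt (P.fiber μ) (y.n μ))
    (c : V.F → ZMod 2) :
    ∑ μ, c μ * ((x μ).deg : ZMod 2) = ∑ μ, c μ * (y.n μ : ZMod 2) +
      ∑ ν, c (P.f ν) * ((y.comp P x).n ν : ZMod 2) := by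
  rw [SeqElt.sum_comp_n y x (fun m ν => c (P.f ν) * (m : ZMod 2)), ← Finset.sum_add_distrib]
  refine Finset.sum_congr rfl fun μ _ => ?_
  rw [SeqElt.deg_cast, mul_add, Finset.mul_sum]
  congr 1
  refine Finset.sum_congr rfl fun ν _ => ?_
  rw [show P.f ν.1 = μ from ν.2]

lemma sum_fiber_iv {P : U.Hom V} (y : SeqElt V j) (x : ∀ μ, SeqElt (P.fiber μ) (y.n μ))
    (μ : V.F) (c : U.F → ZMod 2) :
    ∑ ν : (P.fiber μ).F, c ν.1 * ((x μ).n ν : ZMod 2) =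
      ∑ ν, (iv (P.f ν = μ) * c ν) * ((y.comp P x).n ν : ZMod 2) := by
  rw [SeqElt.sum_comp_n y x (fun m ν => (iv (P.f ν = μ) * c ν) * (m : ZMod 2)),
    Finset.sum_eq_single μ]
  · refine Finset.sum_congr rfl fun ν _ => ?_
    rw [iv, if_pos (show P.f ν.1 = μ from ν.2), one_mul]
  · intro μ' _ h
    refine Finset.sum_eq_zero fun ν _ => ?_
    rw [iv, if_neg (fun e => h ((show P.f ν.1 = μ' from ν.2).symm.trans e)), zero_mul, zero_mul]
  · simp

/-- A face at `ν` changes both `n ν` and the degree of `x μ` by one. When degrees are expressed by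
arities, the claim becomes a count of leaves `c`: those in an earlier fibre, together with the
earlier ones in the same fibre and corrected by the pairs that `P` transposes, are exactly the
leaves before `ν`. -/
lemma compSign_face {P : U.Hom V} (y : SeqElt V j) (x : ∀ μ, SeqElt (P.fiber μ) (y.n μ))
    (μ : V.F) (ν : (P.fiber μ).F) (i : Fin ((x μ).n ν + 1)) (h : 0 < (x μ).n ν) :
    (compSign P y (Function.update x μ ((x μ).face ν i h)) : ZMod 2) +
        (∑ κ with κ < ν, ((x μ).n κ : ZMod 2)) + ∑ μ' with μ' < μ, ((x μ').deg : ZMod 2) =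
      compSign P y x + ∑ κ with κ < ν.1, ((y.comp P x).n κ : ZMod 2) := by
  have hn : ∀ b, ((y.comp P (Function.update x μ ((x μ).face ν i h))).n b : ZMod 2) =
      (y.comp P x).n b + if b = ν.1 then 1 else 0 := by
    intro b
    obtain ⟨μ', q, rfl⟩ : ∃ μ', ∃ q : (P.fiber μ').F, q.1 = b := ⟨P.f b, ⟨b, rfl⟩, rfl⟩
    rw [SeqElt.comp_n, SeqElt.comp_n]
    by_cases hb : μ' = μ
    · subst hb
      rw [Function.update_self]
      by_cases hbν : q = ν
      · subst hbν
        rw [SeqElt.face_n_self, if_pos rfl, Nat.cast_sub h, Nat.cast_one, CharTwo.sub_eq_add]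
      · rw [SeqElt.face_n_of_ne _ _ _ _ hbν, if_neg (fun e => hbν (Subtype.ext e)), add_zero]
    · have hq : q.1 ≠ ν.1 := fun e =>
        hb ((show P.f q.1 = μ' from q.2).symm.trans ((congrArg P.f e).trans ν.2))
      rw [Function.update_of_ne hb, if_neg hq, add_zero]
  have hd : ∀ b, ((Function.update x μ ((x μ).face ν i h) b).deg : ZMod 2) =
      (x b).deg + if b = μ then 1 else 0 := by
    intro b
    by_cases hb : b = μ
    · subst hb
      rw [Function.update_self, SeqElt.deg_face]
      simp
    · rw [Function.update_of_ne hb, if_neg hb, add_zero]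
  rw [compSign_cast, compSign_cast, quad_add_single _ _ _ ν.1 (by simp [iv]) hn,
    bilin_add_single _ _ _ _ μ hd]
  simp only [sum_filter_iv]
  have e3 : ∑ c : (P.fiber μ).F, iv (c < ν) * ((x μ).n c : ZMod 2) =
      ∑ c, iv (P.f c = μ) * iv (c < ν.1) * ((y.comp P x).n c : ZMod 2) :=
    sum_fiber_iv y x μ (fun κ => iv (κ < ν.1))
  rw [sum_comp_cast y x (fun μ' => iv (μ' < μ)), e3]
  have key : ∑ c, (iv (ν.1 < c ∧ P.f c < P.f ν.1) + iv (c < ν.1 ∧ P.f ν.1 < P.f c)) *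
      ((y.comp P x).n c : ZMod 2) + (∑ c, iv (P.f c = μ) * iv (c < ν.1) * ((y.comp P x).n c : ZMod 2)
      + ∑ c, iv (P.f c < μ) * ((y.comp P x).n c : ZMod 2)) =
      ∑ c, iv (c < ν.1) * ((y.comp P x).n c : ZMod 2) := by
    rw [← Finset.sum_add_distrib, ← Finset.sum_add_distrib]
    refine Finset.sum_congr rfl fun c _ => ?_
    rw [show P.f ν.1 = μ from ν.2, ← add_mul, ← add_mul]
    congr 1
    have h2 : c = ν.1 → P.f c = μ := fun e => e ▸ ν.2
    unfold iv
    clear hn hd e3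
    generalize P.f c = m at *
    grind
  have e2 : (2 : ZMod 2) = 0 := by decide
  linear_combination key + (∑ b, iv (b < μ) * (y.n b : ZMod 2)) * e2

/-- The part of the simplicial differential of a generator that belongs to the leaf `ν`. -/
noncomputable def faceSum (k : Type*) [Field k] (x : SeqElt U j) (ν : U.F) : SeqElt U j →₀ k :=
  ∑ i : Fin (x.n ν + 1), if h : 0 < x.n ν then
    Finsupp.single (x.face ν i h) (sg k ((∑ κ with κ < ν, (x.n κ : ZMod 2)) + (i : ℕ))) else 0

lemma simplicialD_single (k : Type*) [Field k] (x : SeqElt U j) :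
    simplicialD k U j (Finsupp.single x 1) = ∑ ν, faceSum k x ν := by
  rw [simplicialD, Finsupp.linearCombination_single, one_smul]
  simp only [faceSum, neg_one_pow_eq_sg, Nat.cast_add, Nat.cast_sum]

lemma cosimplicialD_single (k : Type*) [Field k] (x : SeqElt U j) :
    cosimplicialD k U j (Finsupp.single x 1) =
      ∑ i : Fin (j + 2), Finsupp.single (x.coface i) (sg k ((x.deg : ZMod 2) + (i : ℕ) + 1)) := by
  rw [cosimplicialD, Finsupp.linearCombination_single, one_smul]
  simp only [neg_one_pow_eq_sg, neg_one_zpow_eq_sg, ← sg_add, neg_sg, add_right_comm]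

/-- A coface changes only `W`, hence a coface of a composite is by definition the composite with a
coface of the outer factor. The sign is the difference between the degrees of the composite and of
`y`. -/
lemma cosimplicialD_condComp (P : U.Hom V) (α : ∀ μ, ∀ j, SeqElt (P.fiber μ) j →₀ k)
    (g : SeqElt V j →₀ k) (a : V.F → ℤ) (b : ℤ)
    (hα : ∀ μ j, α μ j ∈ Finsupp.supported k k {x | x.deg = a μ})
    (hg : g ∈ Finsupp.supported k k {x | x.deg = b}) :
    cosimplicialD k U j (condComp P α g) =
      sg k (∑ μ, (a μ : ZMod 2)) • condComp P α (cosimplicialD k V j g) := by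
  simp only [← condCompL_apply]
  refine linear_ext (L := cosimplicialD k U j ∘ₗ condCompL P α j)
    (L' := sg k (∑ μ, (a μ : ZMod 2)) • condCompL P α (j + 1) ∘ₗ cosimplicialD k V j) hg ?_
  intro y hy
  rw [LinearMap.comp_apply, LinearMap.smul_apply, LinearMap.comp_apply, cosimplicialD_single,
    map_sum]
  simp only [condCompL_apply, condComp_single, one_smul]
  refine multilinear_ext
    (L := (cosimplicialD k U j).compMultilinearMap (multi (compTerm k P y)))
    (L' := sg k (∑ μ, (a μ : ZMod 2)) •
      ∑ i : Fin (j + 2), sg k ((y.deg : ZMod 2) + (i : ℕ) + 1) •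
        multi (B := fun μ => SeqElt (P.fiber μ) (y.n μ)) (fun x =>
          Finsupp.single ((y.comp P x).coface i) (sg k (compSign P y x))))
    (fun μ => {x | x.deg = a μ}) (fun μ => hα μ _) ?_ |>.trans ?_
  · intro x hx
    rw [LinearMap.compMultilinearMap_apply, smul_apply, sum_apply,
      multi_single, compTerm, ← mul_one (sg k _), ← smul_eq_mul, ← Finsupp.smul_single, map_smul,
      cosimplicialD_single, Finset.smul_sum, Finset.smul_sum]
    refine Finset.sum_congr rfl fun i _ => ?_
    rw [smul_apply, multi_single]
    simp only [Finsupp.smul_single, smul_eq_mul, ← sg_add]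
    congr 2
    have hd := SeqElt.deg_comp y x
    rw [hd, Finset.sum_congr rfl fun μ _ => show (x μ).deg = a μ from hx μ]
    push_cast
    ring
  · rw [smul_apply, sum_apply]
    rfl

/-- Every face of a composite is a face of exactly one inner factor; the faces are regrouped by the
leaf of `V` under which they lie. -/
lemma simplicialD_multi (P : U.Hom V) (y : SeqElt V j)
    (f : ∀ μ, SeqElt (P.fiber μ) (y.n μ) →₀ k) (a : V.F → ℤ)
    (hf : ∀ μ, f μ ∈ Finsupp.supported k k {x | x.deg = a μ}) :
    simplicialD k U j (multi (compTerm k P y) f) =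
      ∑ μ, sg k (∑ μ' with μ' < μ, (a μ' : ZMod 2)) •
        multi (compTerm k P y) (Function.update f μ (simplicialD k _ _ (f μ))) := by
  -- The differential in the slot `μ` and the identity in the other slots; with these operators each
  -- term is visibly multilinear in `f`.
  let D : ∀ μ κ, (SeqElt (P.fiber κ) (y.n κ) →₀ k) →ₗ[k] (SeqElt (P.fiber κ) (y.n κ) →₀ k) :=
    fun μ κ => if κ = μ then simplicialD k _ _ else LinearMap.id
  have hD : ∀ μ f, (fun κ => D μ κ (f κ)) = Function.update f μ (simplicialD k _ _ (f μ)) := by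
    intro μ f
    funext κ
    simp only [D]
    by_cases h : κ = μ
    · subst h
      rw [if_pos rfl, Function.update_self]
    · rw [if_neg h, Function.update_of_ne h, LinearMap.id_apply]
  simp only [← hD]
  refine multilinear_ext
    (L := (simplicialD k U j).compMultilinearMap (multi (compTerm k P y)))
    (L' := ∑ μ, sg k (∑ μ' with μ' < μ, (a μ' : ZMod 2)) •
      (multi (compTerm k P y)).compLinearMap (D μ))
    (fun μ => {x | x.deg = a μ}) hf ?_ |>.trans ?_
  · intro x hx
    rw [LinearMap.compMultilinearMap_apply, sum_apply, multi_single, compTerm,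
      ← mul_one (sg k _), ← smul_eq_mul, ← Finsupp.smul_single, map_smul, simplicialD_single,
      ← Equiv.sum_comp (Equiv.sigmaFiberEquiv P.f), Fintype.sum_sigma, Finset.smul_sum]
    refine Finset.sum_congr rfl fun μ _ => ?_
    rw [smul_apply, MultilinearMap.compLinearMap_apply, hD, simplicialD_single]
    have e : ∀ z, multi (compTerm k P y)
        (Function.update (fun κ => Finsupp.single (x κ) (1 : k)) μ z) =
      (multi (compTerm k P y)).toLinearMap (fun κ => Finsupp.single (x κ) (1 : k)) μ z := fun _ => rfl
    rw [e, map_sum, Finset.smul_sum, Finset.smul_sum]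
    refine Finset.sum_congr rfl fun (ν : (P.fiber μ).F) _ => ?_
    change sg k _ • faceSum k (y.comp P x) ν.1 = _
    rw [faceSum, faceSum, map_sum, Finset.smul_sum, Finset.smul_sum]
    have hn : (y.comp P x).n ν.1 = (x μ).n ν := SeqElt.comp_n y x μ ν
    rw [← Equiv.sum_comp (finCongr (congrArg (· + 1) hn))]
    refine Finset.sum_congr rfl fun i _ => ?_
    by_cases h : 0 < (x μ).n ν
    · rw [dif_pos h, dif_pos (show 0 < (y.comp P x).n ν.1 from hn ▸ h), ← e, multi_update_single,
        compTerm, Finsupp.smul_single, Finsupp.smul_single, Finsupp.smul_single]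
      have E := SeqElt.comp_face (y := y) (x := x) μ ν (finCongr (congrArg (· + 1) hn) i) h
        (x' := Function.update x μ ((x μ).face ν _ h)) (Function.update_self ..)
        (fun κ hκ => Function.update_of_ne hκ ..) i rfl (hn ▸ h)
      rw [E]
      simp only [smul_eq_mul, ← sg_add]
      refine congrArg _ (congrArg _ ?_)
      have E2 := compSign_face y x μ ν (finCongr (congrArg (· + 1) hn) i) h
      rw [Finset.sum_congr rfl fun μ' _ => show (((x μ').deg : ℤ) : ZMod 2) = a μ' by
        rw [show (x μ').deg = a μ' from hx μ']] at E2
      change _ + (_ + ((i : ℕ) : ZMod 2)) = _ + (_ + ((i : ℕ) : ZMod 2) + _)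
      linear_combination -E2
    · rw [dif_neg h, dif_neg (show ¬ 0 < (y.comp P x).n ν.1 from hn ▸ h), map_zero]
      simp
  · rw [sum_apply]
    rfl

/-- The cosimplicial part of the differential of `|seq|`. -/
noncomputable def cosPart (f : ∀ j, SeqElt U j →₀ k) : ∀ j, SeqElt U j →₀ k
  | 0 => 0
  | j + 1 => cosimplicialD k U j (f j)

lemma condD_apply (f : ∀ j, SeqElt U j →₀ k) (j : ℕ) :
    condD k U f j = simplicialD k U j (f j) + cosPart f j := by
  cases j with
  | zero => exact (add_zero _).symm
  | succ j => rfl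

lemma cosPart_zero (f : ∀ j, SeqElt U j →₀ k) {n : ℕ} (h : n = 0) : cosPart f n = 0 := by
  subst h
  rfl

lemma cosimplicialD_eq {m : ℕ} (f : SeqElt U m →₀ k) (d : ℤ)
    (hf : f ∈ Finsupp.supported k k {x | x.deg = d}) : cosimplicialD k U m f =
      ∑ i : Fin (m + 2), sg k ((d : ZMod 2) + (i : ℕ) + 1) •
        Finsupp.mapDomain (fun x => x.coface i) f := by
  refine linear_ext (L' := ∑ i : Fin (m + 2), sg k ((d : ZMod 2) + (i : ℕ) + 1) •
        Finsupp.lmapDomain k k (fun x : SeqElt U m => x.coface i)) hf ?_ |>.trans ?_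
  · intro x hx
    rw [cosimplicialD_single, LinearMap.sum_apply]
    refine Finset.sum_congr rfl fun i _ => ?_
    rw [LinearMap.smul_apply, Finsupp.lmapDomain_apply, Finsupp.mapDomain_single,
      Finsupp.smul_single, smul_eq_mul, mul_one, show x.deg = d from hx]
  · rw [LinearMap.sum_apply]
    rfl

/-- The coface maps `φ` are characterised by their values and `n = m + 1` is a hypothesis, because
in the application `m` is a value of `Function.update`. -/
lemma cosPart_eq (f : ∀ j, SeqElt U j →₀ k) (d : ℤ)
    (hf : ∀ j, f j ∈ Finsupp.supported k k {x | x.deg = d}) {n m : ℕ} (h : n = m + 1)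
    (φ : Fin (n + 1) → (Fin (m + 1) →o Fin (n + 1)))
    (hφ : ∀ i b, (φ i b : ℕ) = if (i : ℕ) ≤ (b : ℕ) then (b : ℕ) + 1 else b) :
    cosPart f n = ∑ i : Fin (n + 1), sg k ((d : ZMod 2) + (i : ℕ) + 1) •
        Finsupp.mapDomain (fun x => x.push (φ i)) (f m) := by
  subst h
  have : ∀ i, φ i = (Fin.succAboveOrderEmb i).toOrderHom := by
    intro i
    ext b
    rw [hφ]
    change _ = (Fin.succAbove i b : ℕ)
    rw [Fin.succAbove]
    split_ifs with h1 h2 h2 <;> simp_all [Fin.lt_def] <;> omega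
  simp only [this]
  exact cosimplicialD_eq (f m) d (hf m)

lemma mapDomain_push_eq (f : ∀ j, SeqElt U j →₀ k) {n m : ℕ} (h : n = m)
    (φ : Fin (m + 1) →o Fin (n + 1)) (hφ : ∀ b, (φ b : ℕ) = b) :
    Finsupp.mapDomain (fun x => x.push φ) (f m) = f n := by
  subst h
  have : φ = OrderHom.id := by
    ext b
    exact hφ b
  subst this
  exact Finsupp.mapDomain_id

namespace SeqElt

/-- The monotone maps `[n'_κ] → [n_κ]` along which a face is pulled back. -/
def faceHom (x : SeqElt U j) (ν : U.F) (i : Fin (x.n ν + 1)) (h : 0 < x.n ν) (κ : U.F) :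
    Fin (Function.update x.n ν (x.n ν - 1) κ + 1) →o Fin (x.n κ + 1) where
  toFun b := (x.facePt ν i h ⟨κ, b⟩).2
  monotone' b b' hb := by
    have hb' : (b : ℕ) ≤ (b' : ℕ) := hb
    simp only [facePt, Fin.le_def]
    split_ifs with h1 h2 h2
    · omega
    · exact absurd ⟨h1.1, h1.2.trans hb'⟩ h2
    · omega
    · omega

lemma faceHom_apply (x : SeqElt U j) (ν : U.F) (i : Fin (x.n ν + 1)) (h : 0 < x.n ν) (κ : U.F)
    (b : Fin (Function.update x.n ν (x.n ν - 1) κ + 1)) :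
    (x.faceHom ν i h κ b : ℕ) = if κ = ν ∧ (i : ℕ) ≤ (b : ℕ) then (b : ℕ) + 1 else b := rfl

lemma faceHom_injective (x : SeqElt U j) (ν : U.F) (i : Fin (x.n ν + 1)) (h : 0 < x.n ν)
    (κ : U.F) : Function.Injective (x.faceHom ν i h κ) := by
  intro b b' e
  have := congrArg Fin.val e
  rw [faceHom_apply, faceHom_apply] at this
  refine Fin.ext ?_
  split_ifs at this with h1 h2 h2
  · omega
  · have : ¬ (i : ℕ) ≤ (b' : ℕ) := fun h3 => h2 ⟨h1.1, h3⟩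
    omega
  · have : ¬ (i : ℕ) ≤ (b : ℕ) := fun h3 => h1 ⟨h2.1, h3⟩
    omega
  · exact this

end SeqElt

/-- Passing from pushed factors over `y` to the original factors over a face of `y` changes the
arity at `μ` and the degree of the factor at `μ` by one. The bilinear part of the sign then changes
by the degrees after `μ` and the arities before `μ`; the part that permutes the leaves of `U` does
not change. -/
lemma compSign_push {P : U.Hom V} (y : SeqElt V j) (μ : V.F) (i : Fin (y.n μ + 1))
    (h : 0 < y.n μ) (x : ∀ κ, SeqElt (P.fiber κ) ((y.face μ i h).n κ)) :
    (compSign P y (fun κ => (x κ).push (y.faceHom μ i h κ)) : ZMod 2) +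
        (∑ κ with κ < μ, ((x κ).deg : ZMod 2)) + (x μ).deg =
      compSign P (y.face μ i h) x + (∑ κ, ((x κ).deg : ZMod 2)) +
        ∑ κ with κ < μ, (y.n κ : ZMod 2) := by
  have hn : ∀ κ, (y.n κ : ZMod 2) = ((y.face μ i h).n κ : ZMod 2) + iv (κ = μ) := by
    intro κ
    unfold iv
    by_cases e : κ = μ
    · subst e
      rw [SeqElt.face_n_self, if_pos rfl, Nat.cast_sub h]
      simp
    · rw [SeqElt.face_n_of_ne _ _ _ _ e, if_neg e, add_zero]
  have hd : ∀ κ, (((x κ).push (y.faceHom μ i h κ)).deg : ZMod 2) = (x κ).deg + iv (κ = μ) := by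
    intro κ
    rw [SeqElt.deg_cast, SeqElt.deg_cast]
    rw [hn, add_right_comm]
    rfl
  rw [compSign_cast, compSign_cast]
  have e1 : ∑ κ, ∑ κ', iv (κ < κ') *
      ((((x κ').push (y.faceHom μ i h κ')).deg : ZMod 2) * (y.n κ : ZMod 2)) =
      ∑ κ, ∑ κ', iv (κ < κ') * (((x κ').deg : ZMod 2) * ((y.face μ i h).n κ : ZMod 2)) +
      (∑ κ, iv (μ < κ) * ((x κ).deg : ZMod 2) + ∑ κ, iv (κ < μ) * (y.n κ : ZMod 2)) := by
    have : ∀ κ κ', iv (κ < κ') *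
      ((((x κ').push (y.faceHom μ i h κ')).deg : ZMod 2) * (y.n κ : ZMod 2)) =
      iv (κ < κ') * (((x κ').deg : ZMod 2) * ((y.face μ i h).n κ : ZMod 2)) +
      (iv (κ = μ) * (iv (μ < κ') * ((x κ').deg : ZMod 2)) +
        iv (κ' = μ) * (iv (κ < μ) * (y.n κ : ZMod 2))) := by
      intro κ κ'
      rw [hn, hd]
      unfold iv
      by_cases e : κ = μ
      · subst e
        by_cases e' : κ' = κ
        · subst e'
          simp
        · simp [e']
          split_ifs <;> ring
      · by_cases e' : κ' = μ
        · subst e'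
          simp [e]
          split_ifs <;> ring
        · simp [e, e']
    simp only [this, Finset.sum_add_distrib]
    congr 2
    · rw [Finset.sum_eq_single μ]
      · simp [iv]
      · intro b _ hb
        simp [iv, hb]
      · simp
    · refine Finset.sum_congr rfl fun κ _ => ?_
      rw [Finset.sum_eq_single μ]
      · simp [iv]
      · intro b _ hb
        simp [iv, hb]
      · simp
  have e2 : (∑ κ, iv (κ < μ) * ((x κ).deg : ZMod 2)) + (x μ).deg +
      ∑ κ, iv (μ < κ) * ((x κ).deg : ZMod 2) = ∑ κ, ((x κ).deg : ZMod 2) := by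
    have : ((x μ).deg : ZMod 2) = ∑ κ, iv (κ = μ) * ((x κ).deg : ZMod 2) := by
      rw [Finset.sum_eq_single μ]
      · simp [iv]
      · intro b _ hb
        simp [iv, hb]
      · simp
    rw [this, ← Finset.sum_add_distrib, ← Finset.sum_add_distrib]
    refine Finset.sum_congr rfl fun κ _ => ?_
    generalize ((x κ).deg : ZMod 2) = z
    rcases lt_trichotomy κ μ with h | h | h
    · simp [iv, h, h.ne, h.not_gt]
    · subst h
      simp [iv]
    · simp [iv, h, h.ne', h.not_gt]
  rw [e1]
  simp only [sum_filter_iv]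
  rw [← e2]
  have hs : ∀ ν, (y.comp P fun κ => (x κ).push (y.faceHom μ i h κ)).n ν =
    ((y.face μ i h).comp P x).n ν := fun _ => rfl
  simp only [hs]
  ring

/-- Substituting a coface of the factor at `μ` into `y` gives the same composite as substituting the
factor into the corresponding face of `y` (`SeqElt.comp_push`), and the two occur with opposite
signs. If `y.n μ = 0`, both terms are empty. -/
lemma cosPart_add_faceSum (P : U.Hom V) (α : ∀ μ, ∀ j, SeqElt (P.fiber μ) j →₀ k)
    (y : SeqElt V j) (a : V.F → ℤ)
    (hα : ∀ μ j, α μ j ∈ Finsupp.supported k k {x | x.deg = a μ}) (μ : V.F) :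
    sg k (∑ μ' with μ' < μ, (a μ' : ZMod 2)) • multi (compTerm k P y)
        (Function.update (fun κ => α κ (y.n κ)) μ (cosPart (α μ) (y.n μ))) +
      sg k (∑ μ, (a μ : ZMod 2)) • condComp P α (faceSum k y μ) = 0 := by
  rcases Nat.eq_zero_or_pos (y.n μ) with h | h
  · rw [cosPart_zero _ h, MultilinearMap.map_update_zero, smul_zero, zero_add]
    have : faceSum k y μ = 0 := Finset.sum_eq_zero fun i _ => by rw [dif_neg (by omega)]
    rw [this, ← condCompL_apply, map_zero, smul_zero]
  · have h1 : faceSum k y μ = ∑ i : Fin (y.n μ + 1), Finsupp.single (y.face μ i h)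
        (sg k ((∑ κ with κ < μ, (y.n κ : ZMod 2)) + (i : ℕ))) :=
      Finset.sum_congr rfl fun i _ => dif_pos h
    have h2 : cosPart (α μ) (y.n μ) = ∑ i : Fin (y.n μ + 1), sg k ((a μ : ZMod 2) + (i : ℕ) + 1) •
        Finsupp.mapDomain (fun x => x.push (y.faceHom μ i h μ)) (α μ _) :=
      cosPart_eq (α μ) (a μ) (hα μ) (by rw [Function.update_self]; omega)
        (fun i => y.faceHom μ i h μ) (fun i b => by simp [SeqElt.faceHom_apply])
    have h3 : ∀ z, multi (compTerm k P y) (Function.update (fun κ => α κ (y.n κ)) μ z) =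
      (multi (compTerm k P y)).toLinearMap (fun κ => α κ (y.n κ)) μ z := fun _ => rfl
    rw [h1, h2, h3, map_sum, ← condCompL_apply, map_sum, Finset.smul_sum, Finset.smul_sum,
      ← Finset.sum_add_distrib]
    refine Finset.sum_eq_zero fun i _ => ?_
    rw [map_smul, ← h3, condCompL_apply, condComp_single]
    have h4 : Function.update (fun κ => α κ (y.n κ)) μ
        (Finsupp.mapDomain (fun x => x.push (y.faceHom μ i h μ)) (α μ _)) =
        fun κ => Finsupp.mapDomain (fun x => x.push (y.faceHom μ i h κ))
          (α κ ((y.face μ i h).n κ)) := by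
      funext κ
      by_cases e : κ = μ
      · subst e
        rw [Function.update_self]
        rfl
      · rw [Function.update_of_ne e]
        refine (mapDomain_push_eq (α κ) (SeqElt.face_n_of_ne _ _ _ _ e).symm _ fun b => ?_).symm
        exact if_neg fun h => e h.1
    rw [h4, multi_mapDomain, add_eq_zero_iff_eq_neg, smul_smul, smul_smul, ← neg_smul, ← sg_add,
      ← sg_add, neg_sg]
    refine multilinear_ext
      (L := sg k _ • multi fun x : ∀ κ, SeqElt (P.fiber κ) ((y.face μ i h).n κ) =>
        compTerm k P y fun κ => (x κ).push (y.faceHom μ i h κ))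
      (L' := sg k _ • multi (compTerm k P (y.face μ i h)))
      (fun κ => {x : SeqElt (P.fiber κ) ((y.face μ i h).n κ) | x.deg = a κ})
      (fun μ => hα μ _) ?_
    intro x hx
    have E0 : y.comp P (fun κ => (x κ).push (y.faceHom μ i h κ)) = (y.face μ i h).comp P x :=
      SeqElt.comp_push y _ _ (y.faceHom_injective μ i h) x
    rw [smul_apply, smul_apply, multi_single, multi_single, compTerm, compTerm, E0, Finsupp.smul_single, Finsupp.smul_single]
    refine congrArg _ ?_
    rw [smul_eq_mul, smul_eq_mul, ← sg_add, ← sg_add]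
    congr 1
    have E := compSign_push y μ i h x
    have e : ∀ κ, (a κ : ZMod 2) = (((x κ).deg : ℤ) : ZMod 2) := fun κ => by
      rw [show (x κ).deg = a κ from hx κ]
    simp only [e]
    linear_combination E

/-- The composition of `|seq|` is a map of complexes. -/
lemma condD_condComp (P : U.Hom V) (α : ∀ μ, ∀ j, SeqElt (P.fiber μ) j →₀ k)
    (β : ∀ j, SeqElt V j →₀ k) (a : V.F → ℤ) (b : ℤ)
    (hα : ∀ μ j, α μ j ∈ Finsupp.supported k k {x | x.deg = a μ})
    (hβ : ∀ j, β j ∈ Finsupp.supported k k {x | x.deg = b}) (j : ℕ) :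
    condD k U (fun j => condComp P α (β j)) j =
      ∑ μ, sg k (∑ μ' with μ' < μ, (a μ' : ZMod 2)) •
          condComp P (Function.update α μ (condD k _ (α μ))) (β j)
        + sg k (∑ μ, (a μ : ZMod 2)) • condComp P α (condD k V β j) := by
  have h1 : cosPart (fun j => condComp P α (β j)) j =
      sg k (∑ μ, (a μ : ZMod 2)) • condComp P α (cosPart β j) := by
    cases j with
    | zero =>
      change 0 = _ • condComp P α 0
      rw [← condCompL_apply, map_zero, smul_zero]
    | succ j => exact cosimplicialD_condComp P α (β j) a b hα (hβ j)
  have h2 : simplicialD k U j (condComp P α (β j)) =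
      ∑ μ, sg k (∑ μ' with μ' < μ, (a μ' : ZMod 2)) •
          condComp P (Function.update α μ (condD k _ (α μ))) (β j)
        + sg k (∑ μ, (a μ : ZMod 2)) • condComp P α (simplicialD k V j (β j)) := by
    simp only [← condCompL_apply]
    refine linear_ext (L := simplicialD k U j ∘ₗ condCompL P α j)
      (L' := ∑ μ, sg k (∑ μ' with μ' < μ, (a μ' : ZMod 2)) •
          condCompL P (Function.update α μ (condD k _ (α μ))) j
        + sg k (∑ μ, (a μ : ZMod 2)) • condCompL P α j ∘ₗ simplicialD k V j) (hβ j) ?_ |>.trans ?_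
    · intro y hy
      rw [LinearMap.add_apply, LinearMap.sum_apply, LinearMap.smul_apply, LinearMap.comp_apply,
        LinearMap.comp_apply, simplicialD_single, map_sum, Finset.smul_sum,
        ← Finset.sum_add_distrib, condCompL_apply, condComp_single, one_smul,
        simplicialD_multi P y _ a fun μ => hα μ _]
      refine Finset.sum_congr rfl fun μ _ => ?_
      rw [LinearMap.smul_apply, condCompL_apply, condCompL_apply, condComp_single, one_smul,
        update_family, condD_apply, MultilinearMap.map_update_add, smul_add, add_assoc,
        cosPart_add_faceSum P α y a hα μ, add_zero]
    · simp only [LinearMap.add_apply, LinearMap.sum_apply, LinearMap.smul_apply,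
        LinearMap.comp_apply]
  rw [condD_apply, condD_apply, h1, h2, ← condCompL_apply, ← condCompL_apply, ← condCompL_apply,
    map_add, smul_add, add_assoc]

end d_comp
end Breq

namespace Breq

/-! ### Isomorphisms of disks and units -/

section relabel

variable {k : Type*} [Field k] {U V : Disk} {j : ℕ}

lemma mapDomain_mem_supported {A B : Type*} (t : A → B) {S : Set A} {S' : Set B} {f : A →₀ k}
    (hf : f ∈ Finsupp.supported k k S) (h : ∀ x ∈ S, t x ∈ S') :
    Finsupp.mapDomain t f ∈ Finsupp.supported k k S' := by
  classical
  rw [Finsupp.mem_supported] at hf ⊢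
  intro z hz
  obtain ⟨x, hx, rfl⟩ := Finset.mem_image.1 (Finsupp.mapDomain_support hz)
  exact h x (hf hx)

lemma simplicialD_relabel (e : U.Iso V) (f : SeqElt U j →₀ k) :
    Finsupp.mapDomain (SeqElt.relabel e) (simplicialD k U j f) =
      simplicialD k V j (Finsupp.mapDomain (SeqElt.relabel e) f) := by
  refine linear_ext (L := Finsupp.lmapDomain k k (SeqElt.relabel e) ∘ₗ simplicialD k U j)
    (L' := simplicialD k V j ∘ₗ Finsupp.lmapDomain k k (SeqElt.relabel e)) (S := Set.univ)
    (by simp) fun x _ => ?_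
  rw [LinearMap.comp_apply, LinearMap.comp_apply, Finsupp.lmapDomain_apply,
    Finsupp.lmapDomain_apply, Finsupp.mapDomain_single, simplicialD_single, simplicialD_single,
    ← Equiv.sum_comp e.e.toEquiv, ← Finsupp.lmapDomain_apply k k, map_sum]
  refine Finset.sum_congr rfl fun ν _ => ?_
  have hn : (x.relabel e).n (e.e ν) = x.n ν := congrArg x.n (e.e.symm_apply_apply ν)
  change _ = faceSum k (x.relabel e) (e.e ν)
  rw [faceSum, faceSum, map_sum, ← Equiv.sum_comp (finCongr (congrArg (· + 1) hn))]
  refine Finset.sum_congr rfl fun i _ => ?_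
  by_cases h : 0 < x.n ν
  · rw [dif_pos h, dif_pos (hn ▸ h), Finsupp.lmapDomain_apply, Finsupp.mapDomain_single,
      SeqElt.face_relabel e x ν (finCongr (congrArg (· + 1) hn) i) h i rfl (hn ▸ h)]
    congr 3
    simp only [sum_filter_iv]
    rw [← Equiv.sum_comp e.e.toEquiv]
    refine Finset.sum_congr rfl fun κ _ => ?_
    change _ = iv (e.e κ < e.e ν) * ((x.n (e.e.symm (e.e κ)) : ℕ) : ZMod 2)
    rw [e.e.symm_apply_apply]
    simp [iv]
  · rw [dif_neg h, dif_neg (hn ▸ h), map_zero]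

lemma cosimplicialD_relabel (e : U.Iso V) (f : SeqElt U j →₀ k) :
    Finsupp.mapDomain (SeqElt.relabel e) (cosimplicialD k U j f) =
      cosimplicialD k V j (Finsupp.mapDomain (SeqElt.relabel e) f) := by
  refine linear_ext (L := Finsupp.lmapDomain k k (SeqElt.relabel e) ∘ₗ cosimplicialD k U j)
    (L' := cosimplicialD k V j ∘ₗ Finsupp.lmapDomain k k (SeqElt.relabel e)) (S := Set.univ)
    (by simp) fun x _ => ?_
  rw [LinearMap.comp_apply, LinearMap.comp_apply, Finsupp.lmapDomain_apply,
    Finsupp.lmapDomain_apply, Finsupp.mapDomain_single, cosimplicialD_single, cosimplicialD_single,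
    ← Finsupp.lmapDomain_apply k k, map_sum]
  refine Finset.sum_congr rfl fun i _ => ?_
  rw [Finsupp.lmapDomain_apply, Finsupp.mapDomain_single, SeqElt.coface_relabel, SeqElt.deg_relabel]

lemma condD_relabel (e : U.Iso V) (f : ∀ j, SeqElt U j →₀ k) (j : ℕ) :
    Finsupp.mapDomain (SeqElt.relabel e) (condD k U f j) =
      condD k V (fun j => Finsupp.mapDomain (SeqElt.relabel e) (f j)) j := by
  rw [condD_apply, condD_apply, Finsupp.mapDomain_add, simplicialD_relabel]
  congr 1
  cases j with
  | zero => exact Finsupp.mapDomain_zero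
  | succ j => exact cosimplicialD_relabel e _

lemma SeqElt.relabel_symm (e : U.Iso V) (x : SeqElt U j) : (x.relabel e).relabel e.symm = x := by
  have h : e.trans e.symm = Disk.Iso.refl U := by
    unfold Disk.Iso.trans Disk.Iso.symm Disk.Iso.refl
    congr 1
    ext x
    exact e.e.symm_apply_apply x
  rw [← SeqElt.relabel_trans, h, SeqElt.relabel_refl]

/-- Relabelling as a bijection. -/
def relabelEquiv (e : U.Iso V) (j : ℕ) : SeqElt U j ≃ SeqElt V j where
  toFun := SeqElt.relabel e
  invFun := SeqElt.relabel e.symm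
  left_inv := SeqElt.relabel_symm e
  right_inv := SeqElt.relabel_symm e.symm

lemma multi_piCongr {ι ι' : Type*} [Fintype ι] [DecidableEq ι] [Fintype ι'] [DecidableEq ι']
    {B : ι → Type*} {B' : ι' → Type*} {N : Type*} [AddCommGroup N] [Module k N] (σ : ι ≃ ι')
    (e : ∀ i, B i ≃ B' (σ i)) (Ψ : (∀ i, B' i) → N) (F : ∀ i, B i →₀ k) (F' : ∀ i, B' i →₀ k)
    (h : ∀ i, F' (σ i) = Finsupp.mapDomain (e i) (F i)) :
    multi Ψ F' = multi (fun x => Ψ (σ.piCongr e x)) F := by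
  rw [multi_apply, multi_apply]
  symm
  have key : ∀ x i, F' (σ i) (σ.piCongr e x (σ i)) = F i (x i) := by
    intro x i
    rw [h, Equiv.piCongr_apply_apply, Finsupp.mapDomain_apply (e i).injective]
  refine Finset.sum_equiv (σ.piCongr e) (fun x => ?_) (fun x _ => ?_)
  · simp only [Fintype.mem_piFinset, Finsupp.mem_support_iff]
    rw [← σ.forall_congr_right (q := fun i => F' i (σ.piCongr e x i) ≠ 0)]
    simp only [key]
  · rw [← Equiv.prod_comp σ]
    simp only [key]

/-- The isomorphisms `g` run backwards, from the fibre over `μ'` to the fibre over `f.e.symm μ'`: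
the arity of `y.relabel f` at `μ'` is by definition that of `y` at `f.e.symm μ'`, so in this
direction no transport is needed. The sign is unchanged because isomorphisms of disks preserve the
order of leaves. -/
lemma compTerm_relabel {U' V' : Disk} (e : U.Iso U') (f : V.Iso V') (P : U.Hom V)
    (P' : U'.Hom V') (h : ∀ x, P'.f (e.e x) = f.e (P.f x)) (y : SeqElt V j)
    (g : ∀ μ', Disk.Iso (P'.fiber μ') (P.fiber (f.e.symm μ')))
    (hg : ∀ μ' w, ((g μ').e.symm w).1 = e.e w.1)
    (x : ∀ μ, SeqElt (P.fiber μ) (y.n μ)) (x' : ∀ μ', SeqElt (P'.fiber μ') ((y.relabel f).n μ'))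
    (hx : ∀ μ', x (f.e.symm μ') = (x' μ').relabel (g μ')) :
    compTerm k P' (y.relabel f) x' =
      Finsupp.mapDomain (SeqElt.relabel e) (compTerm k P y x) := by
  have E : (y.relabel f).comp P' x' = (y.comp P x).relabel e := by
    refine SeqElt.comp_relabel e f y x x' fun μ => ?_
    generalize hμ : f.e μ = μ'
    obtain rfl : f.e.symm μ' = μ := (f.e.symm_apply_eq).2 hμ.symm
    rw [hx]
    exact ⟨_, SeqElt.relabel_emb _ _, SeqElt.relabelPt_surjective _ _,
      fun w => ⟨hg μ' w.1, rfl⟩⟩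
  have hd : ∀ μ', (x' μ').deg = (x (f.e.symm μ')).deg := fun μ' => by
    rw [hx]
    exact (SeqElt.deg_relabel _ _).symm
  have S : (compSign P' (y.relabel f) x' : ZMod 2) = compSign P y x := by
    rw [compSign_cast, compSign_cast]
    congr 1
    · rw [← Equiv.sum_comp f.e.symm.toEquiv]
      refine Finset.sum_congr rfl fun μ _ => ?_
      rw [← Equiv.sum_comp f.e.symm.toEquiv]
      refine Finset.sum_congr rfl fun μ' _ => ?_
      change iv (μ < μ') * (((x' μ').deg : ZMod 2) * ((y.n (f.e.symm μ) : ℕ) : ZMod 2)) =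
        iv (f.e.symm μ < f.e.symm μ') * (((x (f.e.symm μ')).deg : ZMod 2) * _)
      rw [hd]
      simp [iv]
    · rw [E, ← Equiv.sum_comp e.e.toEquiv]
      refine Finset.sum_congr rfl fun μ _ => ?_
      rw [← Equiv.sum_comp e.e.toEquiv]
      refine Finset.sum_congr rfl fun μ' _ => ?_
      change iv (e.e μ < e.e μ' ∧ P'.f (e.e μ') < P'.f (e.e μ)) *
        (((y.comp P x).n (e.e.symm (e.e μ)) : ZMod 2) *
          ((y.comp P x).n (e.e.symm (e.e μ')) : ZMod 2)) = _
      rw [h, h, e.e.symm_apply_apply, e.e.symm_apply_apply]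
      simp [iv]
  rw [compTerm, compTerm, Finsupp.mapDomain_single, E, S]

lemma map_multi {ι : Type*} [Fintype ι] [DecidableEq ι] {B : ι → Type*} {N N' : Type*}
    [AddCommGroup N] [Module k N] [AddCommGroup N'] [Module k N'] (L : N →ₗ[k] N')
    (Ψ : (∀ i, B i) → N) (F : ∀ i, B i →₀ k) : L (multi Ψ F) = multi (fun x => L (Ψ x)) F := by
  rw [multi_apply, multi_apply, map_sum]
  simp only [map_smul]

lemma condComp_relabel {U' V' : Disk} (e : U.Iso U') (f : V.Iso V') (P : U.Hom V) (P' : U'.Hom V')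
    (h : ∀ x, P'.f (e.e x) = f.e (P.f x)) (α : ∀ μ, ∀ j, SeqElt (P.fiber μ) j →₀ k)
    (α' : ∀ μ, ∀ j, SeqElt (P'.fiber μ) j →₀ k)
    (hα : ∀ μ j, α' (f.e μ) j =
      Finsupp.mapDomain (SeqElt.relabel (Disk.Iso.fiberIso e f P P' h μ)) (α μ j))
    (β : SeqElt V j →₀ k) :
    condComp P' α' (Finsupp.mapDomain (SeqElt.relabel f) β) =
      Finsupp.mapDomain (SeqElt.relabel e) (condComp P α β) := by
  have hg : ∀ μ', ∃ g : Disk.Iso (P'.fiber μ') (P.fiber (f.e.symm μ')),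
      (∀ w, (g.e.symm w).1 = e.e w.1) ∧
      ∀ n, α (f.e.symm μ') n = Finsupp.mapDomain (SeqElt.relabel g) (α' μ' n) := by
    intro μ'
    generalize hμ : f.e.symm μ' = μ
    obtain rfl : μ' = f.e μ := (f.e.symm_apply_eq).1 hμ
    refine ⟨(Disk.Iso.fiberIso e f P P' h μ).symm, fun w => rfl, fun n => ?_⟩
    rw [hα, ← Finsupp.mapDomain_comp]
    conv_lhs => rw [← Finsupp.mapDomain_id (v := α μ n)]
    congr 1
    funext x
    exact (SeqElt.relabel_symm _ x).symm
  choose g hg1 hg2 using hg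
  simp only [← condCompL_apply]
  refine linear_ext (L := condCompL P' α' j ∘ₗ Finsupp.lmapDomain k k (SeqElt.relabel f))
    (L' := Finsupp.lmapDomain k k (SeqElt.relabel e) ∘ₗ condCompL P α j) (S := Set.univ)
    (by simp) fun y _ => ?_
  rw [LinearMap.comp_apply, LinearMap.comp_apply, Finsupp.lmapDomain_apply,
    Finsupp.mapDomain_single, condCompL_apply, condCompL_apply, condComp_single, condComp_single,
    one_smul, one_smul]
  rw [multi_piCongr (B := fun μ' => SeqElt (P'.fiber μ') (y.n (f.e.symm μ'))) f.e.symm.toEquiv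
    (fun μ' => relabelEquiv (g μ') _) (compTerm k P y) (fun μ' => α' μ' (y.n (f.e.symm μ'))) _
    fun μ' => hg2 μ' _, map_multi]
  refine congrArg (fun Ψ => multi (B := fun μ' => SeqElt (P'.fiber μ') (y.n (f.e.symm μ'))) Ψ
    fun μ' => α' μ' (y.n (f.e.symm μ'))) (funext fun x' => ?_)
  exact compTerm_relabel e f P P' h y g hg1 _ x' fun μ' =>
    Equiv.piCongr_apply_apply (Z := fun μ => SeqElt (P.fiber μ) (y.n μ)) f.e.symm.toEquiv
      (fun μ' => relabelEquiv (g μ') (y.n (f.e.symm μ'))) x' μ'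

end relabel

section units

variable {k : Type*} [Field k] {U V : Disk} {j : ℕ}

lemma SeqElt.deg_unit (j : ℕ) : (SeqElt.unit j).deg = 0 := by
  change (j : ℤ) - ∑ _ν : Unit, (j : ℤ) = 0
  simp

lemma condComp_unit (β : SeqElt V j →₀ k) :
    condComp (Disk.Hom.id V) (fun μ j => Finsupp.mapDomain (SeqElt.relabel (V.idFiberIso μ))
      (Finsupp.single (SeqElt.unit j) 1)) β = β := by
  rw [← condCompL_apply]
  refine linear_ext (L := condCompL (Disk.Hom.id V) _ j)
    (L' := (LinearMap.id : (SeqElt V j →₀ k) →ₗ[k] (SeqElt V j →₀ k))) (S := Set.univ)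
    (by simp) fun y _ => ?_
  rw [condCompL_apply, condComp_single, one_smul]
  simp only [Finsupp.mapDomain_single]
  rw [multi_single (compTerm k (Disk.Hom.id V) y), compTerm, SeqElt.comp_unit, LinearMap.id_apply,
    compSign_cast]
  have h1 : ∀ μ, ((SeqElt.unit (y.n μ)).relabel (V.idFiberIso μ)).deg = 0 := fun μ => by
    rw [SeqElt.deg_relabel, SeqElt.deg_unit]
  have h2 : ∀ ν ν' : V.F, ¬ (ν < ν' ∧ (Disk.Hom.id V).f ν' < (Disk.Hom.id V).f ν) :=
    fun ν ν' h => h.1.not_gt h.2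
  simp [h1, iv, h2, sg_zero]

lemma unit_condComp (α : ∀ j, SeqElt U j →₀ k) (j : ℕ) :
    condComp (Disk.Hom.toPt U)
      (fun μ j => Finsupp.mapDomain (SeqElt.relabel (U.toPtFiberIso μ)) (α j))
      (Finsupp.single (SeqElt.unit j) 1) = α j := by
  rw [condComp_single, one_smul]
  refine (multi_mapDomain (compTerm k (Disk.Hom.toPt U) (SeqElt.unit j))
      (fun μ => SeqElt.relabel (U.toPtFiberIso μ)) (fun _ => α j)).trans ?_
  let Ψ : (Disk.pt.F → SeqElt U j) → (SeqElt U j →₀ k) := fun x =>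
    compTerm k (Disk.Hom.toPt U) (SeqElt.unit j) fun μ => (x μ).relabel (U.toPtFiberIso μ)
  -- The final disk has a single leaf, so a multilinear map indexed by its leaves is a linear map in
  -- one variable; the next lines make this identification.
  have hu : ∀ z : SeqElt U j →₀ k, Function.update (fun _ : Disk.pt.F => (0 : SeqElt U j →₀ k)) () z =
      fun _ => z := by
    intro z
    funext μ
    obtain rfl : μ = () := Subsingleton.elim (α := Unit) _ _
    exact Function.update_self ..
  have hL : ∀ z, (multi Ψ).toLinearMap (fun _ => 0) () z = multi Ψ fun _ => z := fun z => by
    rw [← hu]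
    rfl
  refine (hL (α j)).symm.trans ?_
  refine linear_ext (L' := (LinearMap.id : (SeqElt U j →₀ k) →ₗ[k] (SeqElt U j →₀ k))) (S := Set.univ) (by simp) fun x _ => ?_
  rw [hL, multi_single Ψ fun _ => x]
  let x' : ∀ μ, SeqElt ((Disk.Hom.toPt U).fiber μ) ((SeqElt.unit j).n μ) :=
    fun μ => x.relabel (U.toPtFiberIso μ)
  have E : (SeqElt.unit j).comp (Disk.Hom.toPt U) x' = x := SeqElt.unit_comp x x' fun _ => rfl
  have S : (compSign (Disk.Hom.toPt U) (SeqElt.unit j) x' : ZMod 2) = 0 := by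
    have h1 : ∀ a b : Disk.pt.F, ¬ a < b := fun a b => lt_irrefl (α := Unit) _
    rw [compSign_cast]
    simp [iv, h1]
  refine (congrArg₂ Finsupp.single E ((congrArg (sg k) S).trans (sg_zero k))).trans rfl

/-- The injection of `[j]` into `[j + 1]` that misses `i` can be read as a face of one identity or
as a coface of another. This makes the two halves of the differential of the unit cancel. -/
lemma face_unit (j : ℕ) (i : Fin (j + 2)) (h : 0 < j + 1) :
    (SeqElt.unit (j + 1)).face () i h = (SeqElt.unit j).coface i := by
  have hn : ((SeqElt.unit (j + 1)).face () i h).n () = j := SeqElt.face_n_self _ _ _ _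
  refine SeqElt.eq_of_emb_surj (t := fun z => ⟨(), ⟨z.2, by
    have := z.2.2
    exact this.trans_eq (congrArg (· + 1) hn)⟩⟩) ⟨?_, ?_⟩ ?_ ?_
  · rintro ⟨⟨⟩, b⟩ ⟨⟨⟩, b'⟩ e
    have e2 : (b : ℕ) = b' := congrArg (fun z => (z.2 : ℕ)) e
    exact SeqElt.pts_ext rfl e2
  · rintro ⟨⟨⟩, b⟩ ⟨⟨⟩, b'⟩ e
    change (b : ℕ) ≤ b'
    have h2 := ((SeqElt.unit (j + 1)).face () i h).le_color_iff () b b'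
    exact h2.1 e
  · rintro ⟨⟨⟩, b⟩
    exact ⟨⟨(), ⟨b, b.2.trans_eq (congrArg (· + 1) hn).symm⟩⟩, rfl⟩
  · rintro ⟨⟨⟩, b⟩
    refine ⟨rfl, ?_⟩
    refine Fin.ext ?_
    change (if () = () ∧ (i : ℕ) ≤ (b : ℕ) then (b : ℕ) + 1 else b) =
      (Fin.succAbove i ⟨(b : ℕ), _⟩ : ℕ)
    rw [Fin.succAbove]
    simp only [Fin.lt_def, true_and]
    change _ = ((if (b : ℕ) < i then _ else _ : Fin (j + 2)) : ℕ)
    split_ifs <;> first | rfl | omega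

lemma condD_one (j : ℕ) : condD k Disk.pt (fun j => Finsupp.single (SeqElt.unit j) 1) j = 0 := by
  have h0 : ∀ m, ∑ ν : Disk.pt.F, faceSum k (SeqElt.unit m) ν = faceSum k (SeqElt.unit m) () :=
    fun m => Finset.sum_eq_single (M := SeqElt Disk.pt m →₀ k) (ι := Unit) ()
      (fun _ _ h => absurd rfl h) (fun h => absurd (Finset.mem_univ _) h)
  rw [condD_apply, simplicialD_single, h0]
  cases j with
  | zero =>
    rw [cosPart_zero _ rfl, add_zero]
    exact Finset.sum_eq_zero fun i _ => dif_neg (lt_irrefl 0)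
  | succ j =>
    change _ + cosimplicialD k Disk.pt j (Finsupp.single (SeqElt.unit j) 1) = 0
    rw [cosimplicialD_single]
    change (∑ i : Fin (j + 2), _) + _ = _
    rw [← Finset.sum_add_distrib]
    refine Finset.sum_eq_zero fun i _ => ?_
    refine (congrArg (· + _) (dif_pos (Nat.succ_pos j))).trans ?_
    rw [SeqElt.deg_unit]
    have h1 : ∀ a b : Disk.pt.F, ¬ a < b := fun a b => lt_irrefl (α := Unit) _
    refine (congrArg (fun z => Finsupp.single z _ + _) (face_unit j i (Nat.succ_pos j))).trans ?_
    rw [← Finsupp.single_add]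
    have h2 : ∀ s : Disk.pt.F, (∑ κ with κ < s, ((SeqElt.unit (j + 1)).n κ : ZMod 2)) = 0 :=
      fun s => Finset.sum_eq_zero fun κ hκ => absurd (Finset.mem_filter.1 hκ).2 (h1 κ s)
    refine (Finsupp.single_eq_zero).2 ?_
    refine (congrArg (fun z : ZMod 2 => sg k (z + ((i : ℕ) : ZMod 2)) + _) (h2 ())).trans ?_
    simp [← neg_sg]

end units
end Breq

namespace Breq

/-! ### Associativity -/

section assoc

lemma symm_sum {T : Type} [Fintype T] [LinearOrder T] (c : T → T → ZMod 2) (n : T → ZMod 2)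
    (hc : ∀ t, c t t = 0) : ∑ t, ∑ t', c t t' * (n t * n t') =
      ∑ t, ∑ t', iv (t < t') * (c t t' + c t' t) * (n t * n t') := by
  have h1 : ∀ t t', c t t' * (n t * n t') = iv (t < t') * c t t' * (n t * n t') +
      iv (t' < t) * c t t' * (n t * n t') := by
    intro t t'
    rcases lt_trichotomy t t' with h | h | h
    · simp [iv, h, h.not_gt]
    · subst h
      simp [hc]
    · simp [iv, h, h.not_gt]
  simp only [h1, Finset.sum_add_distrib]
  rw [Finset.sum_comm (f := fun t t' => iv (t' < t) * c t t' * (n t * n t')),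
    ← Finset.sum_add_distrib]
  refine Finset.sum_congr rfl fun t _ => ?_
  rw [← Finset.sum_add_distrib]
  refine Finset.sum_congr rfl fun t' _ => ?_
  ring

lemma sum_mul_sum_fiber {S T : Type} [Fintype S] [Fintype T] [DecidableEq S] (f : T → S)
    (n : T → ZMod 2) (c : S → S → ZMod 2) :
    ∑ s, ∑ s', c s s' * ((∑ t, iv (f t = s) * n t) * ∑ t, iv (f t = s') * n t) =
      ∑ t, ∑ t', c (f t) (f t') * (n t * n t') := by
  have h1 : ∀ (g : S → ZMod 2), ∑ s, g s * ∑ t, iv (f t = s) * n t = ∑ t, g (f t) * n t := by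
    intro g
    simp only [Finset.mul_sum]
    rw [Finset.sum_comm]
    refine Finset.sum_congr rfl fun t _ => ?_
    rw [Finset.sum_eq_single (f t)]
    · simp [iv]
    · intro s _ hs
      simp [iv, hs.symm]
    · simp
  have h2 : ∀ s, ∑ s', c s s' * ((∑ t, iv (f t = s) * n t) * ∑ t, iv (f t = s') * n t) =
      (∑ t', c s (f t') * n t') * ∑ t, iv (f t = s) * n t := by
    intro s
    rw [← h1, Finset.sum_mul]
    refine Finset.sum_congr rfl fun s' _ => ?_
    ring
  simp only [h2]
  rw [h1 fun s => ∑ t', c s (f t') * n t']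
  refine Finset.sum_congr rfl fun t _ => ?_
  rw [Finset.sum_mul]
  refine Finset.sum_congr rfl fun t' _ => ?_
  ring

lemma sum_iv_eq {S : Type} [Fintype S] [DecidableEq S] (q : S) (g : S → ZMod 2) :
    ∑ s, iv (q = s) * g s = g q := by
  rw [Finset.sum_eq_single q]
  · simp [iv]
  · intro s _ hs
    simp [iv, hs.symm]
  · simp

/-- The sign in the associativity law. -/
lemma assoc_sign {T S Q : Type} [Fintype T] [Fintype S] [Fintype Q] [LinearOrder T]
    [LinearOrder S] [LinearOrder Q] (f : T → S) (r : S → Q) (m b : Q → ZMod 2) (l a : S → ZMod 2)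
    (n : T → ZMod 2) (hb : ∀ q, b q = m q + ∑ s, iv (r s = q) * l s)
    (ha : ∀ s, a s = l s + ∑ t, iv (f t = s) * n t) :
    (∑ q, ∑ q', iv (q < q') * (b q' * m q) + ∑ s, ∑ s', iv (s < s' ∧ r s' < r s) * (l s * l s')) +
      (∑ s, ∑ s', iv (s < s') * (a s' * l s) +
        ∑ t, ∑ t', iv (t < t' ∧ f t' < f t) * (n t * n t')) =
    (∑ q, ∑ q', iv (q < q') * ((∑ s, iv (r s = q') * a s + b q') * m q) +
        ∑ t, ∑ t', iv (t < t' ∧ r (f t') < r (f t)) * (n t * n t')) +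
      ∑ q, (∑ s, iv (r s = q) * ∑ s', iv (r s' = q) * (iv (s < s') * (a s' * l s)) +
        ∑ t, iv (r (f t) = q) * ∑ t', iv (r (f t') = q) *
          (iv (t < t' ∧ f t' < f t) * (n t * n t'))) +
      (∑ s, ∑ s', iv (s < s' ∧ r s' < r s) * (a s * a s') + ∑ q, ∑ s, iv (q < r s) * (b q * a s)) := by
  -- Here `n`, `l`, `m` are the arities at the leaves of `T`, `S`, `Q`, while `a` and `b` are the
  -- degrees of the factors over `S` and `Q`. The identity splits by type of pair: `e1` and `e2`
  -- isolate the pairs of a leaf of `Q` and a leaf of `S`, `e4` treats the mixed products over pairs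
  -- in `S`, `e6` moves the pairs in `S` to pairs in `T`, and `e7` compares pairs in `T`.
  have e1 : ∑ q, ∑ q', iv (q < q') * ((∑ s, iv (r s = q') * a s + b q') * m q) =
      ∑ q, ∑ q', iv (q < q') * (b q' * m q) + ∑ q, ∑ s, iv (q < r s) * (m q * a s) := by
    rw [← Finset.sum_add_distrib]
    refine Finset.sum_congr rfl fun q _ => ?_
    have : ∑ s, iv (q < r s) * (m q * a s) =
        ∑ q', iv (q < q') * ((∑ s, iv (r s = q') * a s) * m q) := by
      simp only [Finset.sum_mul, Finset.mul_sum]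
      rw [Finset.sum_comm]
      refine Finset.sum_congr rfl fun s _ => ?_
      rw [← sum_iv_eq (r s) fun q' => iv (q < q') * (m q * a s)]
      refine Finset.sum_congr rfl fun q' _ => ?_
      ring
    rw [this, ← Finset.sum_add_distrib]
    refine Finset.sum_congr rfl fun q' _ => ?_
    ring
  have e2 : ∑ q, ∑ s, iv (q < r s) * (b q * a s) = ∑ q, ∑ s, iv (q < r s) * (m q * a s) +
      ∑ s', ∑ s, iv (r s' < r s) * (l s' * a s) := by
    have : ∑ s', ∑ s, iv (r s' < r s) * (l s' * a s) =
        ∑ q, ∑ s, iv (q < r s) * ((∑ s', iv (r s' = q) * l s') * a s) := by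
      simp only [Finset.sum_mul, Finset.mul_sum]
      rw [Finset.sum_comm]
      rw [Finset.sum_comm (s := Finset.univ) (t := Finset.univ)
        (f := fun q s => ∑ i, iv (q < r s) * (iv (r i = q) * l i * a s))]
      refine Finset.sum_congr rfl fun s _ => ?_
      rw [Finset.sum_comm]
      refine Finset.sum_congr rfl fun s' _ => ?_
      rw [← sum_iv_eq (r s') fun q => iv (q < r s) * (l s' * a s)]
      refine Finset.sum_congr rfl fun q _ => ?_
      ring
    rw [this, ← Finset.sum_add_distrib]
    refine Finset.sum_congr rfl fun q _ => ?_
    rw [← Finset.sum_add_distrib]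
    refine Finset.sum_congr rfl fun s _ => ?_
    rw [hb]
    ring
  have e3 : ∀ {X : Type} [Fintype X] (g : X → Q) (h : X → X → ZMod 2),
      ∑ q, ∑ s, iv (g s = q) * ∑ s', iv (g s' = q) * h s s' =
        ∑ s, ∑ s', iv (g s' = g s) * h s s' := by
    intro X _ g h
    rw [Finset.sum_comm]
    refine Finset.sum_congr rfl fun s _ => ?_
    exact sum_iv_eq (g s) fun q => ∑ s', iv (g s' = q) * h s s'
  rw [e1, e2]
  simp only [Finset.sum_add_distrib (f := fun q => ∑ s, iv (r s = q) * ∑ s', iv (r s' = q) *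
    (iv (s < s') * (a s' * l s)))]
  rw [e3 r, e3 fun t => r (f t)]
  have e4 : ∑ s, ∑ s', iv (s < s') * (a s' * l s) + ∑ s, ∑ s', iv (r s' = r s) *
      (iv (s < s') * (a s' * l s)) + ∑ s', ∑ s, iv (r s' < r s) * (l s' * a s) =
      ∑ s, ∑ s', iv (s < s' ∧ r s' < r s) * (a s' * l s + a s * l s') := by
    have e5 : ∑ s', ∑ s, iv (r s' < r s) * (l s' * a s) = ∑ s, ∑ s', (iv (s < s' ∧ r s < r s') *
        (a s' * l s) + iv (s < s' ∧ r s' < r s) * (a s * l s')) := by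
      have : ∀ s' s, iv (r s' < r s) * (l s' * a s) = iv (s' < s ∧ r s' < r s) * (l s' * a s) +
          iv (s < s' ∧ r s' < r s) * (l s' * a s) := by
        intro s' s
        rcases lt_trichotomy s s' with h | h | h
        · simp [iv, h, h.not_gt]
        · subst h
          simp [iv]
        · simp [iv, h, h.not_gt]
      simp only [this, Finset.sum_add_distrib]
      congr 1
      · refine Finset.sum_congr rfl fun s' _ => Finset.sum_congr rfl fun s _ => ?_
        ring
      · rw [Finset.sum_comm]
        refine Finset.sum_congr rfl fun s' _ => Finset.sum_congr rfl fun s _ => ?_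
        ring
    rw [e5, ← Finset.sum_add_distrib, ← Finset.sum_add_distrib]
    refine Finset.sum_congr rfl fun s _ => ?_
    rw [← Finset.sum_add_distrib, ← Finset.sum_add_distrib]
    refine Finset.sum_congr rfl fun s' _ => ?_
    unfold iv
    generalize r s = u
    generalize r s' = v
    grind
  -- The mixed products complete `l s * l s' + a s * a s'` to `(a s + l s) * (a s' + l s')`, and `a
  -- s + l s` is the sum of the `n t` over the fibre of `s`.
  have e6 : ∑ s, ∑ s', iv (s < s' ∧ r s' < r s) * (a s' * l s + a s * l s') +
      ∑ s, ∑ s', iv (s < s' ∧ r s' < r s) * (l s * l s') +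
      ∑ s, ∑ s', iv (s < s' ∧ r s' < r s) * (a s * a s') =
      ∑ t, ∑ t', iv (f t < f t' ∧ r (f t') < r (f t)) * (n t * n t') := by
    rw [← sum_mul_sum_fiber f n fun s s' => iv (s < s' ∧ r s' < r s), ← Finset.sum_add_distrib,
      ← Finset.sum_add_distrib]
    refine Finset.sum_congr rfl fun s _ => ?_
    rw [← Finset.sum_add_distrib, ← Finset.sum_add_distrib]
    refine Finset.sum_congr rfl fun s' _ => ?_
    have h1 : ∀ s, ∑ t, iv (f t = s) * n t = a s + l s := by
      intro s
      rw [ha]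
      grind
    rw [h1, h1]
    ring
  rw [symm_sum (fun t t' => iv (f t < f t' ∧ r (f t') < r (f t))) n fun t => by simp [iv]] at e6
  have e7 : ∑ t, ∑ t', iv (t < t') * (iv (f t < f t' ∧ r (f t') < r (f t)) +
      iv (f t' < f t ∧ r (f t) < r (f t'))) * (n t * n t') +
      ∑ t, ∑ t', iv (t < t' ∧ f t' < f t) * (n t * n t') =
      ∑ t, ∑ t', iv (t < t' ∧ r (f t') < r (f t)) * (n t * n t') +
      ∑ t, ∑ t', iv (r (f t') = r (f t)) * (iv (t < t' ∧ f t' < f t) * (n t * n t')) := by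
    rw [← Finset.sum_add_distrib, ← Finset.sum_add_distrib]
    refine Finset.sum_congr rfl fun t _ => ?_
    rw [← Finset.sum_add_distrib, ← Finset.sum_add_distrib]
    refine Finset.sum_congr rfl fun t' _ => ?_
    have h1 : f t = f t' → r (f t) = r (f t') := fun h => by rw [h]
    generalize r (f t) = u at *
    generalize r (f t') = v at *
    generalize f t = p at *
    generalize f t' = p' at *
    unfold iv
    grind
  -- The rest is linear in the double sums; giving them names leaves a small problem in
  -- characteristic two.
  clear e1 e2 e3 ha hb
  generalize ∑ t, ∑ t', iv (t < t') * (iv (f t < f t' ∧ r (f t') < r (f t)) +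
      iv (f t' < f t ∧ r (f t) < r (f t'))) * (n t * n t') = z at *
  generalize ∑ q, ∑ q', iv (q < q') * (b q' * m q) = z1 at *
  generalize ∑ q, ∑ s, iv (q < r s) * (m q * a s) = z2 at *
  generalize ∑ s', ∑ s, iv (r s' < r s) * (l s' * a s) = z3 at *
  generalize ∑ s, ∑ s', iv (s < s') * (a s' * l s) = z4 at *
  generalize ∑ s, ∑ s', iv (r s' = r s) * (iv (s < s') * (a s' * l s)) = z5 at *
  generalize ∑ s, ∑ s', iv (s < s' ∧ r s' < r s) * (a s' * l s + a s * l s') = z6 at *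
  generalize ∑ s, ∑ s', iv (s < s' ∧ r s' < r s) * (l s * l s') = z7 at *
  generalize ∑ s, ∑ s', iv (s < s' ∧ r s' < r s) * (a s * a s') = z8 at *
  generalize ∑ t, ∑ t', iv (t < t' ∧ f t' < f t) * (n t * n t') = z9 at *
  generalize ∑ t, ∑ t', iv (t < t' ∧ r (f t') < r (f t)) * (n t * n t') = z10 at *
  generalize ∑ t, ∑ t', iv (r (f t') = r (f t)) * (iv (t < t' ∧ f t' < f t) * (n t * n t')) =
    z11 at *
  grind

variable {k : Type*} [Field k]

lemma multi_multi {I : Type*} [Fintype I] [DecidableEq I] {J : I → Type*} [∀ i, Fintype (J i)]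
    [∀ i, DecidableEq (J i)] {B : ∀ i, J i → Type*} {M : I → Type*} [∀ i, AddCommGroup (M i)]
    [∀ i, Module k (M i)] {N : Type*} [AddCommGroup N] [Module k N] (Ψ : MultilinearMap k M N)
    (Φ : ∀ i, (∀ s, B i s) → M i) (F : ∀ i, ∀ s, B i s →₀ k) :
    Ψ (fun i => multi (Φ i) (F i)) =
      multi (fun X : ∀ p : Σ i, J i, B p.1 p.2 => Ψ fun i => Φ i fun s => X ⟨i, s⟩)
        (fun p => F p.1 p.2) := by
  simp only [multi_apply]
  rw [MultilinearMap.map_sum_finset]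
  symm
  refine Finset.sum_equiv (Equiv.piCurry B) (fun X => ?_) (fun X _ => ?_)
  · simp only [Fintype.mem_piFinset, Sigma.forall]
    rfl
  · rw [MultilinearMap.map_smul_univ, Fintype.prod_sigma]
    rfl

lemma sum_fiber {U V : Disk} (P : U.Hom V) (μ : V.F) (c : U.F → ZMod 2) :
    ∑ ν : (P.fiber μ).F, c ν.1 = ∑ ν, iv (P.f ν = μ) * c ν := by
  simp only [iv_mul]
  rw [← Finset.sum_filter]
  exact (Finset.sum_subtype _ (fun x => by simp) c).symm

lemma prod_sg {I : Type*} (s : Finset I) (c : I → ZMod 2) :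
    ∏ i ∈ s, sg k (c i) = sg k (∑ i ∈ s, c i) := by
  classical
  induction s using Finset.induction_on with
  | empty => simp [sg_zero]
  | insert a s h ih => rw [Finset.prod_insert h, Finset.sum_insert h, ih, sg_add]

lemma compSign_assoc {T S Q : Disk} {j : ℕ} (σ : T.Hom S) (ρ : S.Hom Q) (g : SeqElt Q j)
    (b : ∀ q, SeqElt (ρ.fiber q) (g.n q)) (x : ∀ s, SeqElt (σ.fiber s) ((g.comp ρ b).n s))
    (α' : ∀ q, ∀ s : (ρ.fiber q).F, SeqElt ((σ.restrict ρ q).fiber s) ((b q).n s))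
    (hα : ∀ s, α' (ρ.f s) ⟨s, rfl⟩ =
      SeqElt.relabel (σ.restrictFiberIso ρ (ρ.f s) ⟨s, rfl⟩) (x s)) :
    (compSign ρ g b : ZMod 2) + compSign σ (g.comp ρ b) x =
      compSign (σ.comp ρ) g (fun q => (b q).comp (σ.restrict ρ q) (α' q)) +
        ∑ q, (compSign (σ.restrict ρ q) (b q) (α' q) : ZMod 2) +
      (∑ s, ∑ s', iv (s < s' ∧ ρ.f s' < ρ.f s) * (((x s).deg : ZMod 2) * ((x s').deg : ZMod 2)) +
        ∑ q, ∑ s, iv (q < ρ.f s) * (((b q).deg : ZMod 2) * ((x s).deg : ZMod 2))) := by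
  have hd : ∀ q (s : (ρ.fiber q).F), (α' q s).deg = (x s.1).deg := by
    rintro q ⟨s, rfl⟩
    rw [hα]
    exact SeqElt.deg_relabel _ _
  have hn : ∀ q (s : (ρ.fiber q).F), (b q).n s = (g.comp ρ b).n s.1 := fun q s =>
    (SeqElt.comp_n g b q s).symm
  have E := SeqElt.comp_assoc g b x α' hα
  have ht : ∀ q (t : ((σ.comp ρ).fiber q).F), ((b q).comp (σ.restrict ρ q) (α' q)).n t =
      ((g.comp ρ b).comp σ x).n t.1 := fun q t => by
    rw [E, SeqElt.comp_n g (fun q => (b q).comp (σ.restrict ρ q) (α' q)) q t]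
  have key := assoc_sign σ.f ρ.f (fun q => (g.n q : ZMod 2)) (fun q => ((b q).deg : ZMod 2))
    (fun s => ((g.comp ρ b).n s : ZMod 2)) (fun s => ((x s).deg : ZMod 2))
    (fun t => (((g.comp ρ b).comp σ x).n t : ZMod 2))
    (fun q => by
      rw [SeqElt.deg_cast, ← sum_fiber]
      congr 1
      exact Finset.sum_congr rfl fun s _ => congrArg Nat.cast (hn q s))
    (fun s => by
      rw [SeqElt.deg_cast, ← sum_fiber]
      congr 1
      exact Finset.sum_congr rfl fun t _ =>
        congrArg Nat.cast (SeqElt.comp_n (g.comp ρ b) x s t).symm)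
  rw [compSign_cast, compSign_cast, compSign_cast, key, ← E]
  congr 2
  · congr 1
    refine Finset.sum_congr rfl fun q _ => Finset.sum_congr rfl fun q' _ => ?_
    congr 2
    rw [SeqElt.deg_comp, ← sum_fiber]
    push_cast
    congr 1
    exact Finset.sum_congr rfl fun s _ => congrArg Int.cast (hd q' s).symm
  · refine Finset.sum_congr rfl fun q _ => ?_
    rw [compSign_cast]
    refine congrArg₂ (· + ·) ?_ ?_
    · refine (sum_fiber ρ q _).symm.trans ?_
      refine Finset.sum_congr rfl fun s _ => ?_
      refine (sum_fiber ρ q _).symm.trans ?_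
      refine Finset.sum_congr rfl fun s' _ => ?_
      rw [hd, hn]
      rfl
    · refine Eq.trans (sum_fiber (σ.comp ρ) q _).symm ?_
      refine Finset.sum_congr rfl fun t _ => ?_
      refine Eq.trans (sum_fiber (σ.comp ρ) q _).symm ?_
      refine Finset.sum_congr rfl fun t' _ => ?_
      rw [ht, ht]
      rfl

/-- On generators this is `SeqElt.comp_assoc` with the sign comparison `compSign_assoc`. To reach
generators, the family over the leaves of `S` is regrouped along the bijection of `S` with the pairs
of a leaf `q` and a leaf of the fibre over `q`. -/
lemma condComp_assoc {T S Q : Disk} {j : ℕ} (σ : T.Hom S) (ρ : S.Hom Q)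
    (α : ∀ s, ∀ j, SeqElt (σ.fiber s) j →₀ k) (β : ∀ q, ∀ j, SeqElt (ρ.fiber q) j →₀ k)
    (γ : SeqElt Q j →₀ k) (a : S.F → ℤ) (b : Q.F → ℤ)
    (hα : ∀ s j, α s j ∈ Finsupp.supported k k {x | x.deg = a s})
    (hβ : ∀ q j, β q j ∈ Finsupp.supported k k {x | x.deg = b q}) :
    condComp σ α (condComp ρ β γ) =
      sg k (∑ s, ∑ s', iv (s < s' ∧ ρ.f s' < ρ.f s) * ((a s : ZMod 2) * (a s' : ZMod 2)) +
        ∑ q, ∑ s, iv (q < ρ.f s) * ((b q : ZMod 2) * (a s : ZMod 2))) •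
      condComp (σ.comp ρ) (fun q j => condComp (σ.restrict ρ q)
        (fun s j => Finsupp.mapDomain (SeqElt.relabel (σ.restrictFiberIso ρ q s)) (α s.1 j))
        (β q j)) γ := by
  simp only [← condCompL_apply]
  refine linear_ext (L := condCompL σ α j ∘ₗ condCompL ρ β j)
    (L' := sg k _ • condCompL (σ.comp ρ) _ j) (S := Set.univ) (by simp) fun g _ => ?_
  rw [LinearMap.comp_apply, LinearMap.smul_apply, condCompL_apply ρ, condComp_single, one_smul,
    condCompL_apply, condCompL_apply, condComp_single, one_smul, ← condCompL_apply]
  refine multilinear_ext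
    (L := (condCompL σ α j).compMultilinearMap (multi (compTerm k ρ g)))
    (L' := sg k _ • (multi (compTerm k (σ.comp ρ) g)).compLinearMap (fun q =>
      condCompL (σ.restrict ρ q)
        (fun s j => Finsupp.mapDomain (SeqElt.relabel (σ.restrictFiberIso ρ q s)) (α s.1 j))
        (g.n q)))
    (fun q => {x | x.deg = b q}) (fun q => hβ q _) fun b0 hb0 => ?_
  rw [LinearMap.compMultilinearMap_apply, smul_apply, MultilinearMap.compLinearMap_apply,
    multi_single, compTerm, condCompL_apply, condComp_single]
  simp only [condCompL_apply, condComp_single, one_smul]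
  rw [multi_multi]
  let e : ∀ s : S.F, SeqElt (σ.fiber s) ((g.comp ρ b0).n s) ≃
      SeqElt ((σ.restrict ρ (ρ.f s)).fiber ⟨s, rfl⟩) ((b0 (ρ.f s)).n ⟨s, rfl⟩) :=
    fun s => relabelEquiv (σ.restrictFiberIso ρ (ρ.f s) ⟨s, rfl⟩) _
  let E : (∀ s, SeqElt (σ.fiber s) ((g.comp ρ b0).n s)) ≃
      ∀ p : Σ q, (ρ.fiber q).F, SeqElt ((σ.restrict ρ p.1).fiber p.2) ((b0 p.1).n p.2) :=
    (Equiv.sigmaFiberEquiv ρ.f).symm.piCongr e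
  have M := multi_piCongr (k := k) (Equiv.sigmaFiberEquiv ρ.f).symm e
    (fun X : ∀ p : Σ q, (ρ.fiber q).F, SeqElt ((σ.restrict ρ p.1).fiber p.2) ((b0 p.1).n p.2) =>
      multi (compTerm k (σ.comp ρ) g) fun q => compTerm k (σ.restrict ρ q) (b0 q) fun s => X ⟨q, s⟩)
    (fun s => α s ((g.comp ρ b0).n s))
    (fun p => Finsupp.mapDomain (SeqElt.relabel (σ.restrictFiberIso ρ p.1 p.2))
      (α p.2.1 ((b0 p.1).n p.2))) fun s => rfl
  refine Eq.trans ?_ (congrArg (fun z => sg k _ • z) M.symm)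
  refine multilinear_ext
    (L := sg k _ • multi (compTerm k σ (g.comp ρ b0)))
    (L' := sg k _ • multi fun x => multi (compTerm k (σ.comp ρ) g) fun q =>
      compTerm k (σ.restrict ρ q) (b0 q) fun s => E x ⟨q, s⟩)
    (fun s => {x : SeqElt (σ.fiber s) ((g.comp ρ b0).n s) | x.deg = a s}) (fun s => hα s _) fun x hx => ?_
  rw [smul_apply, smul_apply, multi_single, multi_single]
  have hE : ∀ s, E x ⟨ρ.f s, ⟨s, rfl⟩⟩ =
      SeqElt.relabel (σ.restrictFiberIso ρ (ρ.f s) ⟨s, rfl⟩) (x s) := fun s =>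
    Equiv.piCongr_apply_apply
      (Z := fun p : Σ q, (ρ.fiber q).F => SeqElt ((σ.restrict ρ p.1).fiber p.2) ((b0 p.1).n p.2))
      (Equiv.sigmaFiberEquiv ρ.f).symm e x s
  have A := SeqElt.comp_assoc g b0 x (fun q s => E x ⟨q, s⟩) hE
  have A' := compSign_assoc σ ρ g b0 x (fun q s => E x ⟨q, s⟩) hE
  have hm : (fun q => compTerm k (σ.restrict ρ q) (b0 q) fun s => E x ⟨q, s⟩) = fun q =>
      sg k (compSign (σ.restrict ρ q) (b0 q) fun s => E x ⟨q, s⟩) •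
        Finsupp.single ((b0 q).comp (σ.restrict ρ q) fun s => E x ⟨q, s⟩) (1 : k) := by
    funext q
    rw [Finsupp.smul_single, smul_eq_mul, mul_one, compTerm]
  rw [hm, MultilinearMap.map_smul_univ, multi_single, prod_sg, sg_smul_smul, compTerm, compTerm,
    A, Finsupp.smul_single, Finsupp.smul_single]
  refine congrArg _ ?_
  simp only [smul_eq_mul, ← sg_add]
  refine congrArg _ ?_
  have h1 : ∀ s, (a s : ZMod 2) = (((x s).deg : ℤ) : ZMod 2) := fun s => by
    rw [show (x s).deg = a s from hx s]
  have h2 : ∀ q, (b q : ZMod 2) = (((b0 q).deg : ℤ) : ZMod 2) := fun q => by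
    rw [show (b0 q).deg = b q from hb0 q]
  simp only [h1, h2]
  rw [A']
  ring

end assoc
end Breq

namespace Breq

/-! ### Differentials on words

Words in pairs (letter, co-level), where the co-level of a point `z` over `J = [j]` is `j - W z`. -/

section words

variable (k : Type*) [Field k] {A : Type*}

/-- Prefixing an entry. -/
noncomputable def consL {X : Type*} (p : X) : (List X →₀ k) →ₗ[k] (List X →₀ k) :=
  Finsupp.lmapDomain k k (List.cons p)

@[simp] lemma consL_single {X : Type*} (p : X) (l : List X) (c : k) :
    consL k p (Finsupp.single l c) = Finsupp.single (p :: l) c := by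
  rw [consL, Finsupp.lmapDomain_apply, Finsupp.mapDomain_single]

/-- The sum of the words with one entry deleted. -/
noncomputable def wordDel : List (A × ℕ) → (List (A × ℕ) →₀ k)
  | [] => 0
  | p :: l => Finsupp.single l (sg k p.2) - consL k p (wordDel l)

/-- The linear extension of `wordDel`. -/
noncomputable def delL : (List (A × ℕ) →₀ k) →ₗ[k] (List (A × ℕ) →₀ k) :=
  Finsupp.linearCombination k (wordDel k)

/-- Raising the co-levels from `i` on. -/
def raise (i : ℕ) (l : List (A × ℕ)) : List (A × ℕ) :=
  l.map fun p => (p.1, p.2 + if i ≤ p.2 then 1 else 0)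

lemma raise_cons (i : ℕ) (p : A × ℕ) (l : List (A × ℕ)) :
    raise i (p :: l) = (p.1, p.2 + if i ≤ p.2 then 1 else 0) :: raise i l := rfl

/-- The number of entries of co-level at least `i`. -/
def numGE (i : ℕ) (l : List (A × ℕ)) : ZMod 2 := (l.map fun p => iv (i ≤ p.2)).sum

/-- The alternating sum of the first `m` operations `raise`. -/
noncomputable def cofL (m : ℕ) : (List (A × ℕ) →₀ k) →ₗ[k] (List (A × ℕ) →₀ k) :=
  Finsupp.linearCombination k fun l =>
    ∑ i ∈ Finset.range m, Finsupp.single (raise i l) (sg k (i + numGE i l))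

variable {k}

lemma list_linear_ext {X N : Type*} [AddCommGroup N] [Module k N] {L L' : (List X →₀ k) →ₗ[k] N}
    (h : ∀ l, L (Finsupp.single l 1) = L' (Finsupp.single l 1)) (f : List X →₀ k) : L f = L' f :=
  linear_ext (S := Set.univ) (by simp) fun l _ => h l

lemma delL_single (l : List (A × ℕ)) : delL k (Finsupp.single l 1) = wordDel k l := by
  rw [delL, Finsupp.linearCombination_single, one_smul]

lemma cofL_single (m : ℕ) (l : List (A × ℕ)) : cofL k m (Finsupp.single l 1) =
    ∑ i ∈ Finset.range m, Finsupp.single (raise i l) (sg k (i + numGE i l)) := by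
  rw [cofL, Finsupp.linearCombination_single, one_smul]

lemma delL_consL (p : A × ℕ) (f : List (A × ℕ) →₀ k) :
    delL k (consL k p f) = sg k p.2 • f - consL k p (delL k f) := by
  refine list_linear_ext (L := delL k ∘ₗ consL k p)
    (L' := sg k p.2 • LinearMap.id - consL k p ∘ₗ delL k) (fun l => ?_) f
  simp only [LinearMap.comp_apply, LinearMap.sub_apply, LinearMap.smul_apply, LinearMap.id_apply,
    consL_single, delL_single, Finsupp.smul_single, smul_eq_mul, mul_one]
  rfl

/-- The two ways to delete the head together with a later entry come with opposite signs; everything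
else is the same statement for the tail. -/
lemma delL_delL (f : List (A × ℕ) →₀ k) : delL k (delL k f) = 0 := by
  refine list_linear_ext (L := delL k ∘ₗ delL k) (L' := 0) (fun l => ?_) f
  rw [LinearMap.comp_apply, LinearMap.zero_apply, delL_single]
  induction l with
  | nil => exact map_zero _
  | cons p l ih =>
    rw [wordDel, map_sub, delL_consL, ih, map_zero, sub_zero, ← mul_one (sg k _), ← smul_eq_mul,
      ← Finsupp.smul_single, map_smul, delL_single, smul_eq_mul, mul_one, sub_self]

lemma numGE_cons (i : ℕ) (p : A × ℕ) (l : List (A × ℕ)) :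
    numGE i (p :: l) = iv (i ≤ p.2) + numGE i l := by simp [numGE]

/-- One of the summands of `cofL`. -/
noncomputable def raiseL (k : Type*) [Field k] (i : ℕ) :
    (List (A × ℕ) →₀ k) →ₗ[k] (List (A × ℕ) →₀ k) :=
  Finsupp.linearCombination k fun l => Finsupp.single (raise i l) (sg k (i + numGE i l))

lemma raiseL_single (i : ℕ) (l : List (A × ℕ)) (c : k) :
    raiseL k i (Finsupp.single l c) = Finsupp.single (raise i l) (c * sg k (i + numGE i l)) := by
  rw [raiseL, Finsupp.linearCombination_single, Finsupp.smul_single, smul_eq_mul]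

lemma cofL_eq_sum (m : ℕ) (f : List (A × ℕ) →₀ k) :
    cofL k m f = ∑ i ∈ Finset.range m, raiseL k i f := by
  refine (list_linear_ext (L := cofL k m) (L' := ∑ i ∈ Finset.range m, raiseL k i)
    (fun l => ?_) f).trans (LinearMap.sum_apply ..)
  rw [cofL_single, LinearMap.sum_apply]
  simp only [raiseL_single, one_mul]

lemma raiseL_consL (i : ℕ) (p : A × ℕ) (f : List (A × ℕ) →₀ k) : raiseL k i (consL k p f) =
    sg k (iv (i ≤ p.2)) • consL k (p.1, p.2 + if i ≤ p.2 then 1 else 0) (raiseL k i f) := by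
  refine list_linear_ext (L := raiseL k i ∘ₗ consL k p)
    (L' := sg k (iv (i ≤ p.2)) • consL k _ ∘ₗ raiseL k i) (fun l => ?_) f
  simp only [LinearMap.comp_apply, LinearMap.smul_apply, consL_single, raiseL_single, one_mul,
    Finsupp.smul_single, smul_eq_mul, numGE_cons, ← sg_add, raise_cons]
  congr 2
  ring

/-- Raising an entry changes the sign of its deletion, and losing that entry changes the parity of
`numGE i`; the two effects agree. This is the purpose of `numGE` in the sign of `cofL`. -/
lemma delL_raiseL (i : ℕ) (f : List (A × ℕ) →₀ k) :
    delL k (raiseL k i f) = raiseL k i (delL k f) := by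
  refine list_linear_ext (L := delL k ∘ₗ raiseL k i) (L' := raiseL k i ∘ₗ delL k) (fun l => ?_) f
  rw [LinearMap.comp_apply, LinearMap.comp_apply]
  induction l with
  | nil =>
    rw [raiseL_single, delL_single]
    simp [raise, wordDel, delL]
  | cons p l ih =>
    rw [← consL_single, raiseL_consL, map_smul, delL_consL, delL_consL, ih, map_sub, map_smul,
      raiseL_consL, smul_sub, sg_smul_smul]
    congr 3
    by_cases h : i ≤ p.2
    · simp only [iv, h, if_true, Nat.cast_add, Nat.cast_one]
      have : (2 : ZMod 2) = 0 := by decide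
      linear_combination this
    · simp [iv, h]

lemma delL_cofL (m : ℕ) (f : List (A × ℕ) →₀ k) :
    delL k (cofL k m f) = cofL k m (delL k f) := by
  simp only [cofL_eq_sum, map_sum, delL_raiseL]

/-- This is a cosimplicial identity. The entries of the word contribute equally to the signs of both
sides, so the factor `-1` comes from `i + 1` against `i`. -/
lemma raiseL_raiseL {i i' : ℕ} (h : i' ≤ i) (f : List (A × ℕ) →₀ k) :
    raiseL k (i + 1) (raiseL k i' f) = -raiseL k i' (raiseL k i f) := by
  refine list_linear_ext (L := raiseL k (i + 1) ∘ₗ raiseL k i') (L' := -(raiseL k i' ∘ₗ raiseL k i))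
    (fun l => ?_) f
  rw [LinearMap.comp_apply, LinearMap.neg_apply, LinearMap.comp_apply]
  induction l with
  | nil =>
    simp [raiseL_single, raise, numGE, ← sg_add, ← Finsupp.single_neg, neg_sg, ← add_assoc,
      add_comm]
  | cons p l ih =>
    rw [← consL_single]
    simp only [raiseL_consL, map_smul, ih, map_neg, smul_neg, sg_smul_smul]
    congr 1
    by_cases h1 : i ≤ p.2
    · have h2 : i' ≤ p.2 := h.trans h1
      simp [h1, h2, h2.trans (Nat.le_succ _)]
    · by_cases h2 : i' ≤ p.2
      · simp [h1, h2, add_comm]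
      · have h3 : ¬ i + 1 ≤ p.2 := by omega
        simp [h1, h2, h3]

lemma cofL_cofL (m : ℕ) (f : List (A × ℕ) →₀ k) : cofL k (m + 1) (cofL k m f) = 0 := by
  simp only [cofL_eq_sum, map_sum]
  rw [Finset.sum_comm, ← Finset.sum_product' (f := fun a b => raiseL k a (raiseL k b f))]
  -- A pair `a ≤ b` is matched with the pair `(b + 1, a)`, whose first member exceeds the second;
  -- `raiseL_raiseL` says that the two terms cancel.
  refine Finset.sum_involution (fun p _ => if p.1 ≤ p.2 then (p.2 + 1, p.1) else (p.2, p.1 - 1))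
    ?_ ?_ ?_ ?_
  · rintro ⟨a, b⟩ h
    by_cases hab : a ≤ b
    · simp only [hab, if_true]
      rw [raiseL_raiseL hab, add_neg_cancel]
    · simp only [hab, if_false]
      obtain ⟨a, rfl⟩ : ∃ c, a = c + 1 := ⟨a - 1, by omega⟩
      rw [raiseL_raiseL (by omega), Nat.add_sub_cancel, neg_add_cancel]
  · rintro ⟨a, b⟩ h _ e
    by_cases hab : a ≤ b
    · simp only [hab, if_true, Prod.mk.injEq] at e
      omega
    · simp only [hab, if_false, Prod.mk.injEq] at e
      omega
  · rintro ⟨a, b⟩ h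
    simp only [Finset.mem_product, Finset.mem_range] at h ⊢
    split_ifs <;> simp only <;> omega
  · rintro ⟨a, b⟩ h
    by_cases hab : a ≤ b
    · have : ¬ b + 1 ≤ a := by omega
      simp [hab, this]
    · have : b ≤ a - 1 := by omega
      simp only [hab, if_false, this, if_true, Prod.mk.injEq, and_true]
      omega

end words

/-! ### Whiskering of words -/

section stretch

variable (k : Type*) [Field k] {A : Type*}

/-- The sum of the words obtained from a list of letters by inserting `j` repetitions of entries;
the co-levels drop along the repetitions. -/
noncomputable def stretch : List A → ℕ → (List (A × ℕ) →₀ k)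
  | [], 0 => Finsupp.single [] 1
  | [], _ + 1 => 0
  | a :: l, 0 => consL k (a, 0) (stretch l 0)
  | a :: l, d + 1 => consL k (a, d + 1) (stretch l (d + 1) + stretch (a :: l) d)
termination_by l j => (l.length, j)

/-- The linear extension of `stretch`. -/
noncomputable def stretchL (j : ℕ) : (List A →₀ k) →ₗ[k] (List (A × ℕ) →₀ k) :=
  Finsupp.linearCombination k fun l => stretch k l j

/-- The alternating sum of the lists with one letter deleted. -/
noncomputable def listDel : List A → (List A →₀ k)
  | [] => 0
  | a :: l => Finsupp.single l 1 - consL k a (listDel l)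

variable {k}

lemma stretchL_single (j : ℕ) (l : List A) (c : k) :
    stretchL k j (Finsupp.single l c) = c • stretch k l j := by
  rw [stretchL, Finsupp.linearCombination_single]

lemma consL_mem {X : Type*} {p : X} {S S' : Set (List X)} {f : List X →₀ k}
    (hf : f ∈ Finsupp.supported k k S) (h : ∀ l ∈ S, p :: l ∈ S') :
    consL k p f ∈ Finsupp.supported k k S' :=
  mapDomain_mem_supported _ hf h

/-- All summands share three features: the bound on co-levels controls the top coface, the length
enters the signs of compositions, and the set of letters is what `fullL` and `tau` see. -/
lemma stretch_mem (l : List A) (j : ℕ) : stretch k l j ∈ Finsupp.supported k k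
    {u | (∀ p ∈ u, p.2 ≤ j) ∧ u.length = l.length + j ∧ ∀ a, a ∈ u.map Prod.fst ↔ a ∈ l} := by
  induction l generalizing j with
  | nil =>
    cases j with
    | zero =>
      rw [stretch]
      exact Finsupp.single_mem_supported k _ (by simp)
    | succ j =>
      rw [stretch]
      exact Submodule.zero_mem _
  | cons a l ih =>
    induction j with
    | zero =>
      rw [stretch]
      refine consL_mem (ih 0) ?_
      rintro u ⟨h1, h2, h3⟩
      refine ⟨List.forall_mem_cons.2 ⟨le_rfl, h1⟩, by simp [h2], fun b => ?_⟩
      rw [List.map_cons, List.mem_cons, List.mem_cons, h3]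
    | succ j ihj =>
      rw [stretch, map_add]
      refine Submodule.add_mem _ (consL_mem (ih (j + 1)) ?_) (consL_mem ihj ?_)
      · rintro u ⟨h1, h2, h3⟩
        refine ⟨List.forall_mem_cons.2 ⟨le_rfl, h1⟩, by simp [h2]; omega, fun b => ?_⟩
        rw [List.map_cons, List.mem_cons, List.mem_cons, h3]
      · rintro u ⟨h1, h2, h3⟩
        refine ⟨List.forall_mem_cons.2 ⟨le_rfl, fun p h => (h1 p h).trans (Nat.le_succ j)⟩,
          by simp [h2]; omega, fun b => ?_⟩
        rw [List.map_cons, List.mem_cons, h3, List.mem_cons]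
        tauto

lemma raiseL_of_lt {i : ℕ} {f : List (A × ℕ) →₀ k}
    (hf : f ∈ Finsupp.supported k k {u | ∀ p ∈ u, p.2 < i}) : raiseL k i f = sg k i • f := by
  refine linear_ext (L' := sg k i • (LinearMap.id : _ →ₗ[k] (List (A × ℕ) →₀ k))) hf fun u hu => ?_
  have h1 : raise i u = u := by
    rw [raise]
    conv_rhs => rw [← List.map_id u]
    refine List.map_congr_left fun p hp => ?_
    simp [(hu p hp).not_ge]
  have h2 : numGE i u = 0 := by
    rw [numGE]
    refine List.sum_eq_zero fun z hz => ?_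
    obtain ⟨p, hp, rfl⟩ := List.mem_map.1 hz
    simp [iv, (hu p hp).not_ge]
  rw [raiseL_single, h1, h2, LinearMap.smul_apply, LinearMap.id_apply, Finsupp.smul_single]
  simp

/-- The last index `d + 1` exceeds every co-level and acts by a scalar. Each smaller index raises
the head from `d` to `d + 1` and picks up the sign `-1` through `numGE`. -/
lemma cofL_consL {a : A} {d : ℕ} {f : List (A × ℕ) →₀ k}
    (hf : f ∈ Finsupp.supported k k {u | ∀ p ∈ u, p.2 ≤ d}) : cofL k (d + 2) (consL k (a, d) f) =
      sg k (d + 1) • consL k (a, d) f - consL k (a, d + 1) (cofL k (d + 1) f) := by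
  have h1 : raiseL k (d + 1) (consL k (a, d) f) = sg k ((d + 1 : ℕ) : ZMod 2) • consL k (a, d) f :=
    raiseL_of_lt (consL_mem hf fun u hu => List.forall_mem_cons.2
      ⟨Nat.lt_succ_self d, fun p h => Nat.lt_succ_of_le (hu p h)⟩)
  rw [cofL_eq_sum, Finset.sum_range_succ, h1, cofL_eq_sum, map_sum, sub_eq_neg_add,
    ← Finset.sum_neg_distrib, Nat.cast_succ]
  congr 1
  refine Finset.sum_congr rfl fun i hi => ?_
  have hi' : i ≤ d := Nat.lt_succ_iff.1 (Finset.mem_range.1 hi)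
  rw [raiseL_consL]
  simp [iv, hi', sg_one]

lemma stretchL_consL_succ (a : A) (d : ℕ) (f : List A →₀ k) : stretchL k (d + 1) (consL k a f) =
    consL k (a, d + 1) (stretchL k (d + 1) f + stretchL k d (consL k a f)) := by
  refine list_linear_ext (L := stretchL k (d + 1) ∘ₗ consL k a)
    (L' := consL k (a, d + 1) ∘ₗ (stretchL k (d + 1) + stretchL k d ∘ₗ consL k a)) (fun l => ?_) f
  simp only [LinearMap.comp_apply, LinearMap.add_apply, consL_single, stretchL_single, one_smul]
  rw [stretch]

lemma stretchL_consL_zero (a : A) (f : List A →₀ k) : stretchL k 0 (consL k a f) =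
    consL k (a, 0) (stretchL k 0 f) := by
  refine list_linear_ext (L := stretchL k 0 ∘ₗ consL k a)
    (L' := consL k (a, 0) ∘ₗ stretchL k 0) (fun l => ?_) f
  simp only [LinearMap.comp_apply, consL_single, stretchL_single, one_smul]
  rw [stretch]

/-- The coface term in the differential of a whiskered word. -/
noncomputable def stretchCof (k : Type*) [Field k] (l : List A) : ℕ → (List (A × ℕ) →₀ k)
  | 0 => 0
  | d + 1 => cofL k (d + 2) (stretch k l d)

/-- This peels the head off both summands of the recursion for `stretch`. Behind the head the
cofaces run over one index fewer than in `stretchCof k l (d + 1)`; the missing top index acts as the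
scalar `sg k (d + 1)`, which explains the correction term. -/
lemma stretchCof_cons (a : A) (l : List A) (d : ℕ) : stretchCof k (a :: l) (d + 1) =
    sg k (d + 1) • stretch k (a :: l) d - consL k (a, d + 1) (stretchCof k l (d + 1) -
      sg k (d + 1) • stretch k l d + stretchCof k (a :: l) d) := by
  have h0 : stretch k l d ∈ Finsupp.supported k k {u | ∀ p ∈ u, p.2 ≤ d} :=
    Finsupp.supported_mono (fun u hu => hu.1) (stretch_mem l d)
  have h1 : cofL k (d + 1) (stretch k l d) =
      stretchCof k l (d + 1) - sg k (d + 1) • stretch k l d := by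
    have h2 : raiseL k (d + 1) (stretch k l d) = sg k ((d + 1 : ℕ) : ZMod 2) • stretch k l d :=
      raiseL_of_lt (Finsupp.supported_mono
        (show {u : List (A × ℕ) | ∀ p ∈ u, p.2 ≤ d} ⊆ {u | ∀ p ∈ u, p.2 < d + 1} from
          fun u hu p hp => Nat.lt_succ_of_le (hu p hp)) h0)
    rw [stretchCof, cofL_eq_sum (d + 2), Finset.sum_range_succ, ← cofL_eq_sum, h2, Nat.cast_succ,
      add_sub_cancel_right]
  cases d with
  | zero =>
    change cofL k (0 + 2) _ = _
    rw [stretch]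
    refine (cofL_consL h0).trans ?_
    rw [h1]
    simp [stretchCof]
  | succ d =>
    rw [stretchCof, stretch, cofL_consL, map_add (cofL k (d + 1 + 1)), h1]
    · rfl
    · exact Submodule.add_mem _ h0 (Finsupp.supported_mono
        (fun u hu p hp => (hu.1 p hp).trans (Nat.le_succ d)) (stretch_mem (a :: l) d))

/-- Whiskering of words is compatible with the differentials. -/
lemma delL_stretch (l : List A) (j : ℕ) : delL k (stretch k l j) - stretchCof k l j =
    sg k j • stretchL k j (listDel k l) := by
  induction l generalizing j with
  | nil =>
    rw [listDel, map_zero, smul_zero]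
    cases j with
    | zero => simp [stretch, stretchCof, delL, wordDel]
    | succ j =>
      rw [stretch, map_zero, zero_sub, neg_eq_zero, stretchCof]
      cases j with
      | zero =>
        rw [stretch, cofL_single, Finset.sum_range_succ, Finset.sum_range_one]
        simp [raise, numGE, sg_zero, sg_one]
      | succ j => rw [stretch, map_zero]
  | cons a l ih =>
    induction j with
    | zero =>
      have h := ih 0
      rw [stretchCof, sub_zero, Nat.cast_zero, sg_zero, one_smul] at h ⊢
      rw [stretch, delL_consL, h, listDel, map_sub, stretchL_consL_zero, stretchL_single]
      simp [sg_zero]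
    | succ d ihd =>
      -- Deleting the head from words with a repeated first letter gives `stretch k (a :: l) d`,
      -- which cancels against the top coface. The terms `stretch k l d` from the recursion for
      -- cofaces and from the induction on `d` cancel as well. What remains is the recursion of
      -- `stretchL` applied to `listDel`.
      have h1 := ih (d + 1)
      have h2 : ∀ x : List (A × ℕ) →₀ k, sg k (d + 1) • x = -(sg k d • x) := by
        intro x
        rw [sg_add, sg_one]
        simp
      have h3 : sg k d • sg k d • stretchL k d (consL k a (listDel k l)) =
        stretchL k d (consL k a (listDel k l)) := by rw [smul_smul, sg_mul_self, one_smul]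
      rw [listDel, map_sub, stretchL_single, one_smul, smul_sub, sub_eq_iff_eq_add] at ihd
      rw [sub_eq_iff_eq_add] at h1
      rw [stretchCof_cons, stretch, delL_consL, listDel, map_sub, stretchL_consL_succ,
        stretchL_single, one_smul, map_add (delL k), h1, ihd]
      simp only [Nat.cast_add, Nat.cast_one, h2, map_add, map_sub, map_neg, map_smul, smul_sub,
        smul_add]
      abel

end stretch
end Breq

namespace Breq

/-! ### Composition of words -/

section compWord

variable {A B : Type} [Fintype B] [LinearOrder B]

/-- The number of entries with a given letter. -/
def cnt (κ : B) (y : List (B × ℕ)) : ℕ := (y.map Prod.fst).count κ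

/-- The composite of a word `y` with words `u κ`: each entry of `y` is replaced by the entries of
`u κ` over it. -/
def compWord : List (B × ℕ) → (B → List (A × ℕ)) → List (A × ℕ)
  | [], _ => []
  | q :: y, u => ((u q.1).filter fun p => p.2 = cnt q.1 y).map (fun p => (p.1, q.2)) ++ compWord y u

/-- The parity of one plus the number of the entries of co-level `v` of a word. -/
def blk (u : List (A × ℕ)) (v : ℕ) : ZMod 2 := ((u.filter fun p => p.2 = v).length : ZMod 2) + 1

/-- A weighted sum of block parities. -/
def eSum (c : B → ZMod 2) : List (B × ℕ) → (B → List (A × ℕ)) → ZMod 2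
  | [], _ => 0
  | q :: y, u => c q.1 * blk (u q.1) (cnt q.1 y) + eSum c y u

/-- The sign exponent of the composition of words. -/
def wSign (j : ℕ) : List (B × ℕ) → (B → List (A × ℕ)) → ZMod 2
  | [], _ => 0
  | q :: y, u => blk (u q.1) (cnt q.1 y) * (j + q.2 + eSum (fun κ => iv (κ < q.1)) y u) +
      eSum (fun _ => 1) y u + wSign j y u

/-- The value of `eSum` on the words that occur in a whiskering. -/
def tau (c : B → ZMod 2) (α : B → List A) (L : List B) : ZMod 2 :=
  ∑ κ, c κ * (iv (κ ∈ L) * ((α κ).length + 1))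

lemma cnt_cons (κ : B) (q : B × ℕ) (y : List (B × ℕ)) :
    cnt κ (q :: y) = cnt κ y + if q.1 = κ then 1 else 0 := by
  simp [cnt, List.count_cons]

lemma cnt_pos {κ : B} {y : List (B × ℕ)} : 0 < cnt κ y ↔ κ ∈ y.map Prod.fst :=
  List.count_pos_iff

/-- The successive occurrences of `κ` in `y` use the co-levels from `cnt κ y - 1` down to `0`, so
their blocks together contain the entries of `u κ` of co-level below `cnt κ y`. -/
lemma eSum_eq_sum (c : B → ZMod 2) (y : List (B × ℕ)) (u : B → List (A × ℕ)) :
    eSum c y u = ∑ κ, c κ * ((((u κ).filter fun p => p.2 < cnt κ y).length : ZMod 2) + cnt κ y) := by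
  induction y with
  | nil => simp [eSum, cnt]
  | cons q y ih =>
    have h : ∀ κ, c κ * ((((u κ).filter fun p => p.2 < cnt κ (q :: y)).length : ZMod 2) +
        cnt κ (q :: y)) = (if q.1 = κ then c κ * blk (u κ) (cnt κ y) else 0) +
        c κ * ((((u κ).filter fun p => p.2 < cnt κ y).length : ZMod 2) + cnt κ y) := by
      intro κ
      rw [cnt_cons]
      by_cases hκ : q.1 = κ
      · simp only [hκ, if_true, Nat.cast_add, Nat.cast_one]
        have : ∀ l : List (A × ℕ), (l.filter fun p => p.2 < cnt κ y + 1).length =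
            (l.filter fun p => p.2 = cnt κ y).length + (l.filter fun p => p.2 < cnt κ y).length := by
          intro l
          induction l with
          | nil => rfl
          | cons p l ih =>
            rw [List.filter_cons, List.filter_cons, List.filter_cons]
            simp only [decide_eq_true_eq]
            split_ifs <;> (try simp only [List.length_cons]) <;> omega
        rw [this, blk]
        push_cast
        ring
      · simp [hκ]
    simp only [h, Finset.sum_add_distrib, Finset.sum_ite_eq, Finset.mem_univ, if_true]
    rw [eSum, ih]

/-- Every entry of a whiskered input lies in some block, and in the length `(α κ).length + (cnt κ y
- 1)` the count `cnt κ y` cancels modulo 2 against the number of blocks. So the sign does not depend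
on the chosen repetitions and can be taken out of the sum over them. -/
lemma eSum_eq_tau {c : B → ZMod 2} {α : B → List A} {y : List (B × ℕ)} {u : B → List (A × ℕ)}
    (h : ∀ κ, c κ ≠ 0 → (∀ p ∈ u κ, p.2 ≤ cnt κ y - 1) ∧
      (u κ).length = (α κ).length + (cnt κ y - 1)) :
    eSum c y u = tau c α (y.map Prod.fst) := by
  rw [eSum_eq_sum, tau]
  refine Finset.sum_congr rfl fun κ _ => ?_
  by_cases hc : c κ = 0
  · rw [hc, zero_mul, zero_mul]
  · obtain ⟨h1, h2⟩ := h κ hc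
    congr 1
    by_cases h0 : 0 < cnt κ y
    · rw [iv, if_pos (cnt_pos.1 h0), List.filter_eq_self.2 fun p hp => by
        have := h1 p hp
        simpa using (by omega : p.2 < cnt κ y), h2]
      obtain ⟨n, hn⟩ : ∃ n, cnt κ y = n + 1 := ⟨cnt κ y - 1, by omega⟩
      rw [hn]
      simp only [Nat.add_sub_cancel]
      push_cast
      have : (2 : ZMod 2) = 0 := by decide
      linear_combination (n : ZMod 2) * this
    · rw [iv, if_neg fun h => h0 (cnt_pos.2 h), show cnt κ y = 0 by omega]
      simp

lemma tau_congr {c : B → ZMod 2} {α α' : B → List A} {L L' : List B}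
    (h : ∀ κ, c κ ≠ 0 → ((κ ∈ L ↔ κ ∈ L') ∧ α κ = α' κ)) : tau c α L = tau c α' L' := by
  refine Finset.sum_congr rfl fun κ _ => ?_
  by_cases hc : c κ = 0
  · rw [hc, zero_mul, zero_mul]
  · obtain ⟨h1, h2⟩ := h κ hc
    simp [iv, h1, h2]

section pre

variable {μ : B} {a : A} {c : ℕ} (u : B → List (A × ℕ))

lemma blk_update_cons (κ : B) (v : ℕ) (h : κ = μ → v < c) :
    blk (Function.update u μ ((a, c) :: u μ) κ) v = blk (u κ) v := by
  by_cases hκ : κ = μ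
  · subst hκ
    rw [Function.update_self, blk, blk, List.filter_cons_of_neg]
    have := h rfl
    simp only [decide_eq_true_eq]
    omega
  · rw [Function.update_of_ne hκ]

/-- For the letter `μ` the blocks of `y` use only co-levels below `cnt μ y ≤ c`, so an entry
prepended at co-level `c` is invisible to `y`. The same reason applies to `wSign_update_cons` and
`compWord_update_cons`. -/
lemma eSum_update_cons (w : B → ZMod 2) (y : List (B × ℕ)) (h : cnt μ y ≤ c) :
    eSum w y (Function.update u μ ((a, c) :: u μ)) = eSum w y u := by
  induction y with
  | nil => rfl
  | cons q y ih =>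
    rw [cnt_cons] at h
    rw [eSum, eSum, ih (by omega), blk_update_cons]
    rintro rfl
    simp only [if_true] at h
    omega

lemma wSign_update_cons (j : ℕ) (y : List (B × ℕ)) (h : cnt μ y ≤ c) :
    wSign j y (Function.update u μ ((a, c) :: u μ)) = wSign j y u := by
  induction y with
  | nil => rfl
  | cons q y ih =>
    rw [cnt_cons] at h
    rw [wSign, wSign, ih (by omega), blk_update_cons, eSum_update_cons, eSum_update_cons]
    · omega
    · omega
    · rintro rfl
      simp only [if_true] at h
      omega

lemma compWord_update_cons (y : List (B × ℕ)) (h : cnt μ y ≤ c) :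
    compWord y (Function.update u μ ((a, c) :: u μ)) = compWord y u := by
  induction y with
  | nil => rfl
  | cons q y ih =>
    rw [cnt_cons] at h
    rw [compWord, compWord, ih (by omega)]
    congr 2
    by_cases hκ : q.1 = μ
    · rw [← hκ, Function.update_self, List.filter_cons_of_neg]
      simp only [hκ, if_true] at h
      rw [hκ]
      simp only [decide_eq_true_eq]
      omega
    · rw [Function.update_of_ne hκ]

end pre

variable {k : Type*} [Field k]

/-- The multilinear composition of words. -/
noncomputable def compM (k : Type*) [Field k] (j : ℕ) (y : List (B × ℕ)) :
    MultilinearMap k (fun _ : B => List (A × ℕ) →₀ k) (List (A × ℕ) →₀ k) :=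
  multi fun u => Finsupp.single (compWord y u) (sg k (wSign j y u))

/-- The new entry has the co-level of the head `μ` of the outer word, so it opens the first block
and becomes the first entry `(a, w)` of the composite. The block grows by one, which adds the
coefficient of `blk` in `wSign`; `ht` makes this the same sign for all summands. -/
lemma compM_update_cons {j w : ℕ} {μ : B} {y : List (B × ℕ)} {a : A}
    (F : B → (List (A × ℕ) →₀ k)) (S : B → Set (List (A × ℕ))) (t : ZMod 2)
    (hF : ∀ κ, F κ ∈ Finsupp.supported k k (S κ))
    (ht : ∀ u : B → List (A × ℕ), (∀ κ, u κ ∈ S κ) → eSum (fun κ => iv (κ < μ)) y u = t) :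
    compM k j ((μ, w) :: y) (Function.update F μ (consL k (a, cnt μ y) (F μ))) =
      sg k (j + w + t) • consL k (a, w) (compM k j ((μ, w) :: y) F) := by
  have h1 : Function.update F μ (consL k (a, cnt μ y) (F μ)) = fun κ =>
      Finsupp.mapDomain (fun l => Function.update (fun _ => l) μ ((a, cnt μ y) :: l) κ) (F κ) := by
    funext κ
    by_cases h : κ = μ
    · subst h
      simp only [Function.update_self]
      rfl
    · simp only [Function.update_of_ne h]
      exact Finsupp.mapDomain_id.symm
  rw [h1, compM, multi_mapDomain]
  refine multilinear_ext
    (L' := sg k (j + w + t) • (consL k (a, w)).compMultilinearMap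
      (multi fun u => Finsupp.single (compWord ((μ, w) :: y) u) (sg k (wSign j ((μ, w) :: y) u))))
    S hF fun u hu => ?_
  have h2 : (fun κ => Function.update (fun _ => u κ) μ ((a, cnt μ y) :: u κ) κ) =
      Function.update u μ ((a, cnt μ y) :: u μ) := by
    funext κ
    by_cases h : κ = μ
    · subst h
      simp only [Function.update_self]
    · simp only [Function.update_of_ne h]
  rw [smul_apply, LinearMap.compMultilinearMap_apply, multi_single, multi_single, h2, consL_single,
    Finsupp.smul_single, smul_eq_mul, ← sg_add]
  congr 1
  · rw [compWord, compWord, compWord_update_cons _ _ le_rfl, Function.update_self,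
      List.filter_cons_of_pos (by simp)]
    rfl
  · congr 1
    rw [wSign, wSign, wSign_update_cons _ _ _ le_rfl, eSum_update_cons _ _ _ le_rfl,
      eSum_update_cons _ _ _ le_rfl, ht u hu, Function.update_self]
    simp only [blk]
    rw [List.filter_cons_of_pos (by simp), List.length_cons]
    push_cast
    ring

/-- When the first block is empty, the head of the outer word leaves no entry in the composite. It
still leaves a sign, since `blk` of an empty block is one. -/
lemma compM_of_empty {j w : ℕ} {μ : B} {y : List (B × ℕ)} (F : B → (List (A × ℕ) →₀ k))
    (S : B → Set (List (A × ℕ))) (t t' : ZMod 2) (hF : ∀ κ, F κ ∈ Finsupp.supported k k (S κ))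
    (h0 : ∀ u ∈ S μ, ∀ p ∈ u, p.2 ≠ cnt μ y)
    (ht : ∀ u : B → List (A × ℕ), (∀ κ, u κ ∈ S κ) → eSum (fun κ => iv (κ < μ)) y u = t)
    (ht' : ∀ u : B → List (A × ℕ), (∀ κ, u κ ∈ S κ) → eSum (fun _ => 1) y u = t') :
    compM k j ((μ, w) :: y) F = sg k (j + w + t + t') • compM k j y F := by
  refine multilinear_ext (L' := sg k (j + w + t + t') • compM k j y) S hF fun u hu => ?_
  have h1 : (u μ).filter (fun p => p.2 = cnt μ y) = [] :=
    List.filter_eq_nil_iff.2 fun p hp => by simpa using h0 _ (hu μ) p hp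
  rw [smul_apply, compM, compM, multi_single, multi_single, Finsupp.smul_single, smul_eq_mul,
    ← sg_add, wSign, compWord, ht u hu, ht' u hu, blk, h1]
  simp [add_assoc]

/-- The whiskered inputs of a composition of words. -/
noncomputable def inputs (k : Type*) [Field k] (α : B → List A) (y : List (B × ℕ)) (κ : B) :
    List (A × ℕ) →₀ k := stretch k (α κ) (cnt κ y - 1)

/-- The composition of a word with whiskered words. -/
noncomputable def compStretch (k : Type*) [Field k] (j : ℕ) (α : B → List A) (y : List (B × ℕ)) :
    List (A × ℕ) →₀ k := compM k j y (inputs k α y)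

/-- The words that occur in `inputs`. -/
def inputSet (α : B → List A) (y : List (B × ℕ)) (κ : B) : Set (List (A × ℕ)) :=
  {u | (∀ p ∈ u, p.2 ≤ cnt κ y - 1) ∧ u.length = (α κ).length + (cnt κ y - 1)}

lemma inputs_mem (α : B → List A) (y : List (B × ℕ)) (κ : B) :
    inputs k α y κ ∈ Finsupp.supported k k (inputSet α y κ) := by
  refine Finsupp.supported_mono ?_ (stretch_mem (α κ) (cnt κ y - 1))
  rintro u ⟨h1, h2, -⟩
  exact ⟨h1, h2⟩

/-- The sum over the shorter insertions in the recursion for `stretch`. -/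
noncomputable def stretchPrev (k : Type*) [Field k] (l : List A) : ℕ → (List (A × ℕ) →₀ k)
  | 0 => 0
  | d + 1 => stretch k l d

lemma stretch_cons (a : A) (l : List A) (j : ℕ) : stretch k (a :: l) j =
    consL k (a, j) (stretch k l j + stretchPrev k (a :: l) j) := by
  cases j with
  | zero => rw [stretch, stretchPrev, add_zero]
  | succ j => rw [stretch, stretchPrev]

/-- The first letter `a` of the input opens the first block. If it is not repeated, the remaining
letters `l` are stretched over the same outer word. If it is repeated, the repetition sits at the
next lower co-level, so it belongs to the next occurrence of `μ`: the first block is `a` alone and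
the outer word loses its head. The latter requires `μ` to occur again, and there the sign `j + w +
tau` for the letters below `μ` arises twice and cancels. -/
lemma compStretch_cons {j w : ℕ} {μ : B} {y : List (B × ℕ)} {a : A} {l : List A} (α : B → List A)
    (hα : α μ = a :: l) : compStretch k j α ((μ, w) :: y) =
      sg k (j + w + tau (fun κ => iv (κ < μ)) α (y.map Prod.fst)) •
        consL k (a, w) (compStretch k j (Function.update α μ l) ((μ, w) :: y)) +
      if μ ∈ y.map Prod.fst then sg k (tau (fun _ => 1) α (y.map Prod.fst)) •
        consL k (a, w) (compStretch k j α y) else 0 := by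
  have hc : cnt μ ((μ, w) :: y) - 1 = cnt μ y := by simp [cnt_cons]
  have hc' : ∀ κ, κ ≠ μ → cnt κ ((μ, w) :: y) = cnt κ y := fun κ h => by
    simp [cnt_cons, Ne.symm h]
  have h1 : inputs k α ((μ, w) :: y) = Function.update (inputs k α ((μ, w) :: y)) μ
      (consL k (a, cnt μ y) (stretch k l (cnt μ y)) +
        consL k (a, cnt μ y) (stretchPrev k (a :: l) (cnt μ y))) := by
    rw [← map_add, ← stretch_cons, eq_comm, Function.update_eq_self_iff, inputs, hc, hα]
  have hlt : ∀ κ, iv (κ < μ) ≠ 0 → κ ≠ μ := by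
    rintro κ h rfl
    simp [iv] at h
  rw [compStretch, h1, MultilinearMap.map_update_add]
  congr 1
  · have h2 : inputs k (Function.update α μ l) ((μ, w) :: y) =
        Function.update (inputs k α ((μ, w) :: y)) μ (stretch k l (cnt μ y)) := by
      funext κ
      by_cases h : κ = μ
      · subst h
        simp [inputs, hc]
      · simp [inputs, h]
    have h3 := compM_update_cons (j := j) (w := w) (μ := μ) (y := y) (a := a)
      (inputs k (Function.update α μ l) ((μ, w) :: y)) _
      (tau (fun κ => iv (κ < μ)) α (y.map Prod.fst)) (inputs_mem _ _) fun u hu => by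
        refine eSum_eq_tau fun κ h => ?_
        have := hu κ
        rw [inputSet, Function.update_of_ne (hlt κ h), hc' κ (hlt κ h)] at this
        exact this
    rw [compStretch, ← h3, h2]
    simp
  · by_cases hμ : μ ∈ y.map Prod.fst
    · obtain ⟨n, hn⟩ : ∃ n, cnt μ y = n + 1 := ⟨cnt μ y - 1, by have := cnt_pos.2 hμ; omega⟩
      have h2 : inputs k α y =
          Function.update (inputs k α ((μ, w) :: y)) μ (stretchPrev k (a :: l) (cnt μ y)) := by
        funext κ
        by_cases h : κ = μ
        · subst h
          simp [inputs, hn, hα, stretchPrev]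
        · simp [inputs, h, hc' κ h]
      have h3 := compM_update_cons (j := j) (w := w) (μ := μ) (y := y) (a := a)
        (inputs k α y) _ (tau (fun κ => iv (κ < μ)) α (y.map Prod.fst)) (inputs_mem _ _)
        fun u hu => eSum_eq_tau fun κ h => hu κ
      have h4 := compM_of_empty (j := j) (w := w) (μ := μ) (y := y)
        (inputs k α y) _ (tau (fun κ => iv (κ < μ)) α (y.map Prod.fst))
        (tau (fun _ => 1) α (y.map Prod.fst)) (inputs_mem _ _)
        (fun u hu p hp => by
          have := hu.1 p hp
          omega)
        (fun u hu => eSum_eq_tau fun κ h => hu κ) (fun u hu => eSum_eq_tau fun κ h => hu κ)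
      rw [if_pos hμ, compStretch]
      have h5 := h3
      rw [h4, map_smul, sg_smul_smul] at h5
      have h6 : ∀ x y : ZMod 2, x + (x + y) = y := fun x y => by
        rw [← add_assoc, CharTwo.add_self_eq_zero, zero_add]
      rw [h6] at h5
      rw [← h5, h2]
      simp
    · have hn : cnt μ y = 0 := by
        have := mt cnt_pos.1 hμ
        omega
      rw [if_neg hμ, hn, stretchPrev, map_zero, MultilinearMap.map_update_zero]

/-- Another occurrence of `μ` asks for a repetition, which an empty list cannot provide. Empty
inputs do not come from generators; they arise in the recursion when an input has been used up. -/
lemma compStretch_nil_of_mem {j w : ℕ} {μ : B} {y : List (B × ℕ)} (α : B → List A)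
    (hα : α μ = []) (hμ : μ ∈ y.map Prod.fst) : compStretch k j α ((μ, w) :: y) = 0 := by
  obtain ⟨n, hn⟩ : ∃ n, cnt μ y = n + 1 := ⟨cnt μ y - 1, by have := cnt_pos.2 hμ; omega⟩
  refine MultilinearMap.map_coord_zero _ μ ?_
  rw [inputs, hα, cnt_cons, hn]
  simp [stretch]

lemma compStretch_nil_of_notMem {j w : ℕ} {μ : B} {y : List (B × ℕ)} (α : B → List A)
    (hα : α μ = []) (hμ : μ ∉ y.map Prod.fst) : compStretch k j α ((μ, w) :: y) =
      sg k (j + w + tau (fun κ => iv (κ < μ)) α (y.map Prod.fst) +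
        tau (fun _ => 1) α (y.map Prod.fst)) • compStretch k j α y := by
  have hn : cnt μ y = 0 := by
    have := mt cnt_pos.1 hμ
    omega
  have h : inputs k α ((μ, w) :: y) = inputs k α y := by
    funext κ
    by_cases h : κ = μ
    · subst h
      simp [inputs, cnt_cons, hn]
    · simp [inputs, cnt_cons, Ne.symm h]
  rw [compStretch, h, compStretch]
  refine compM_of_empty _ _ _ _ (inputs_mem _ _) (fun u hu p hp => ?_)
    (fun u hu => eSum_eq_tau fun κ h => hu κ) (fun u hu => eSum_eq_tau fun κ h => hu κ)
  have := hu.2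
  rw [hα, hn] at this
  simp only [List.length_nil, Nat.zero_sub, Nat.add_zero] at this
  rw [List.length_eq_zero_iff.1 this] at hp
  simp at hp

/-- In `wSign` the number `j` is multiplied by the block parities, whose total is `tau` with
constant weight one. -/
lemma compStretch_succ (j : ℕ) (α : B → List A) (y : List (B × ℕ)) : compStretch k (j + 1) α y =
    sg k (tau (fun _ => 1) α (y.map Prod.fst)) • compStretch k j α y := by
  have h : ∀ (y : List (B × ℕ)) (u : B → List (A × ℕ)),
      wSign (j + 1) y u = wSign j y u + eSum (fun _ => 1) y u := by
    intro y u
    induction y with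
    | nil => simp [wSign, eSum]
    | cons q y ih =>
      rw [wSign, wSign, eSum, ih]
      push_cast
      ring
  refine multilinear_ext (L' := sg k _ • compM k j y) _ (inputs_mem (k := k) α y) fun u hu => ?_
  rw [smul_apply, compM, compM, multi_single, multi_single, h, Finsupp.smul_single, smul_eq_mul,
    ← sg_add, add_comm, eSum_eq_tau fun κ _ => hu κ]

/-- The compositions of the words in a combination with whiskered words. -/
noncomputable def compStretchL (k : Type*) [Field k] (j : ℕ) (α : B → List A) :
    (List (B × ℕ) →₀ k) →ₗ[k] (List (A × ℕ) →₀ k) :=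
  Finsupp.linearCombination k (compStretch k j α)

lemma compStretchL_single (j : ℕ) (α : B → List A) (y : List (B × ℕ)) :
    compStretchL k j α (Finsupp.single y 1) = compStretch k j α y := by
  rw [compStretchL, Finsupp.linearCombination_single, one_smul]

/-- Forgetting co-levels. -/
noncomputable def lettersL (k : Type*) [Field k] :
    (List (A × ℕ) →₀ k) →ₗ[k] (List A →₀ k) := Finsupp.lmapDomain k k (List.map Prod.fst)

lemma lettersL_consL (p : A × ℕ) (f : List (A × ℕ) →₀ k) :
    lettersL k (consL k p f) = consL k p.1 (lettersL k f) := by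
  refine list_linear_ext (L := lettersL k ∘ₗ consL k p) (L' := consL k p.1 ∘ₗ lettersL k)
    (fun l => ?_) f
  simp [lettersL]

lemma stretch_zero (l : List A) :
    stretch k l 0 = Finsupp.single (l.map fun a => (a, 0)) 1 := by
  induction l with
  | nil => rw [stretch]; rfl
  | cons a l ih => rw [stretch, ih, consL_single]; rfl

lemma compStretch_nil (j : ℕ) (α : B → List A) :
    compStretch k j α [] = Finsupp.single [] 1 := by
  have h : inputs k α [] = fun κ => Finsupp.single ((α κ).map fun a => (a, 0)) (1 : k) := by
    funext κ
    rw [← stretch_zero]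
    rfl
  rw [compStretch, compM, h, multi_single]
  simp [compWord, wSign, sg_zero]

/-- The value of `stretchL` in the previous degree. -/
noncomputable def stretchPrevL (k : Type*) [Field k] (f : List A →₀ k) : ℕ → (List (A × ℕ) →₀ k)
  | 0 => 0
  | d + 1 => stretchL k d f

lemma stretchL_consL (a : A) (j : ℕ) (f : List A →₀ k) : stretchL k j (consL k a f) =
    consL k (a, j) (stretchL k j f + stretchPrevL k (consL k a f) j) := by
  cases j with
  | zero => rw [stretchL_consL_zero, stretchPrevL, add_zero]
  | succ j => rw [stretchL_consL_succ, stretchPrevL]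

/-- The recursion for single outer words passes to combinations whose words all have the same set
`L` of letters, because the signs `tau` are then uniform. -/
lemma compStretchL_consL {j w : ℕ} {μ : B} {a : A} {l : List A} (α : B → List A)
    (hα : α μ = a :: l) (L : List B) {f : List (B × ℕ) →₀ k}
    (hf : f ∈ Finsupp.supported k k {y | ∀ κ, κ ∈ y.map Prod.fst ↔ κ ∈ L}) :
    compStretchL k j α (consL k (μ, w) f) =
      sg k (j + w + tau (fun κ => iv (κ < μ)) α L) •
        consL k (a, w) (compStretchL k j (Function.update α μ l) (consL k (μ, w) f)) +
      if μ ∈ L then sg k (tau (fun _ => 1) α L) • consL k (a, w) (compStretchL k j α f) else 0 := by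
  have h : (if μ ∈ L then sg k (tau (fun _ => 1) α L) • consL k (a, w) (compStretchL k j α f)
      else 0) = (if μ ∈ L then sg k (tau (fun _ => 1) α L) • consL k (a, w) ∘ₗ compStretchL k j α
      else 0) f := by
    split_ifs <;> rfl
  rw [h]
  refine linear_ext (L := compStretchL k j α ∘ₗ consL k (μ, w))
    (L' := sg k (j + w + tau (fun κ => iv (κ < μ)) α L) •
        consL k (a, w) ∘ₗ compStretchL k j (Function.update α μ l) ∘ₗ consL k (μ, w) +
      if μ ∈ L then sg k (tau (fun _ => 1) α L) • consL k (a, w) ∘ₗ compStretchL k j α else 0)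
    hf fun y hy => ?_
  have ht : ∀ c, tau c α (y.map Prod.fst) = tau c α L := fun c => tau_congr fun κ _ => ⟨hy κ, rfl⟩
  rw [LinearMap.comp_apply, consL_single, compStretchL_single, compStretch_cons α hα, ht, ht,
    LinearMap.add_apply]
  congr 1
  · simp only [LinearMap.smul_apply, LinearMap.comp_apply, consL_single, compStretchL_single]
  · by_cases h : μ ∈ L
    · rw [if_pos h, if_pos ((hy μ).2 h)]
      simp only [LinearMap.smul_apply, LinearMap.comp_apply, compStretchL_single]
    · rw [if_neg h, if_neg (mt (hy μ).1 h), LinearMap.zero_apply]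

lemma stretch_letters (l : List B) (j : ℕ) : stretch k l j ∈
    Finsupp.supported k k {y | ∀ κ, κ ∈ y.map Prod.fst ↔ κ ∈ l} :=
  Finsupp.supported_mono (fun _ h => h.2.2) (stretch_mem l j)

lemma stretchPrev_letters (l : List B) (j : ℕ) : stretchPrev k l j ∈
    Finsupp.supported k k {y | ∀ κ, κ ∈ y.map Prod.fst ↔ κ ∈ l} := by
  cases j with
  | zero => exact Submodule.zero_mem _
  | succ j => exact stretch_letters l j

/-- Whiskering of words is compatible with compositions. -/
theorem stretchL_compStretch (β : List B) (α : B → List A) (j : ℕ) :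
    stretchL k j (lettersL k (compStretch k 0 α (β.map fun μ => (μ, 0)))) =
      compStretchL k j α (stretch k β j) := by
  induction β generalizing α j with
  | nil =>
    rw [List.map_nil, compStretch_nil, lettersL, Finsupp.lmapDomain_apply,
      Finsupp.mapDomain_single, stretchL_single, one_smul]
    cases j with
    | zero =>
      rw [List.map_nil, stretch, stretch, compStretchL_single, compStretch_nil]
    | succ j =>
      rw [List.map_nil, stretch, stretch, map_zero]
  | cons μ β ihβ =>
    have hm : (β.map fun μ => (μ, 0)).map Prod.fst = β := by
      rw [List.map_map]
      exact List.map_id _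
    generalize hl : α μ = l
    -- Three nested inductions: on the outer word, on the input at its first letter, and on `j`. The
    -- family `α` varies, since the recursion replaces `α μ` by its tail.
    induction l generalizing α j with
    | nil =>
      rw [List.map_cons]
      -- When the outer letter `μ` is repeated, it occurs again behind the head, and the empty input
      -- kills the composite.
      have h0 : compStretchL k j α (consL k (μ, j) (stretchPrev k (μ :: β) j)) = 0 := by
        refine linear_ext (L := compStretchL k j α ∘ₗ consL k (μ, j)) (L' := 0)
          (stretchPrev_letters (μ :: β) j) fun y hy => ?_
        rw [LinearMap.comp_apply, consL_single, compStretchL_single, LinearMap.zero_apply]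
        exact compStretch_nil_of_mem α hl ((hy μ).2 List.mem_cons_self)
      rw [stretch_cons, map_add, map_add, h0, add_zero]
      by_cases hμ : μ ∈ β
      · rw [compStretch_nil_of_mem α hl (hm.symm ▸ hμ), map_zero, map_zero]
        refine (linear_ext (L := compStretchL k j α ∘ₗ consL k (μ, j)) (L' := 0)
          (stretch_letters β j) fun y hy => ?_).symm
        rw [LinearMap.comp_apply, consL_single, compStretchL_single, LinearMap.zero_apply]
        exact compStretch_nil_of_mem α hl ((hy μ).2 hμ)
      · rw [compStretch_nil_of_notMem α hl (by rwa [hm]), map_smul, map_smul, ihβ, hm]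
        refine (linear_ext (L := compStretchL k j α ∘ₗ consL k (μ, j))
          (L' := sg k (((0 : ℕ) : ZMod 2) + ((0 : ℕ) : ZMod 2) + tau (fun κ => iv (κ < μ)) α β +
            tau (fun _ => 1) α β) • compStretchL k j α)
          (stretch_letters β j) fun y hy => ?_).symm
        have ht : ∀ c, tau c α (y.map Prod.fst) = tau c α β :=
          fun c => tau_congr fun κ _ => ⟨hy κ, rfl⟩
        rw [LinearMap.comp_apply, consL_single, compStretchL_single, LinearMap.smul_apply,
          compStretch_nil_of_notMem α hl (mt (hy μ).1 hμ), compStretchL_single, ht, ht,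
          CharTwo.add_self_eq_zero, CharTwo.add_self_eq_zero]
    | cons a l ihl =>
      induction j using Nat.strong_induction_on with
      | _ j ih =>
      have ihl' := fun j => ihl (Function.update α μ l) j (Function.update_self ..)
      rw [List.map_cons] at ihl' ⊢
      have ht : tau (fun κ => iv (κ < μ)) α (μ :: β) = tau (fun κ => iv (κ < μ)) α β := by
        refine tau_congr fun κ h => ⟨?_, rfl⟩
        rw [List.mem_cons, or_iff_right]
        rintro rfl
        simp [iv] at h
      have e := compStretch_cons (k := k) (j := 0) (w := 0) (y := β.map fun μ => (μ, 0)) α hl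
      rw [hm, Nat.cast_zero, zero_add, zero_add] at e
      have e' : (if μ ∈ β then sg k (tau (fun _ => 1) α β) •
          consL k (a, 0) (compStretch k 0 α (β.map fun μ => (μ, 0))) else 0) =
          consL k (a, 0) (if μ ∈ β then sg k (tau (fun _ => 1) α β) •
          (compStretch k 0 α (β.map fun μ => (μ, 0))) else 0) := by
        split_ifs
        · rw [map_smul]
        · rw [map_zero]
      rw [e', ← map_smul, ← map_add] at e
      -- The right-hand side sorted by what follows the first entry: go on within the input of `μ`,
      -- move on in the outer word without repeating `μ`, or repeat `μ`. The first choice occurs in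
      -- both summands of `stretch_cons`, and these recombine to `stretch k (μ :: β) j`.
      have hR : ∀ j, compStretchL k j α (stretch k (μ :: β) j) = consL k (a, j)
          (sg k (tau (fun κ => iv (κ < μ)) α β) •
            compStretchL k j (Function.update α μ l) (stretch k (μ :: β) j) +
          ((if μ ∈ β then sg k (tau (fun _ => 1) α β) • compStretchL k j α (stretch k β j) else 0) +
          sg k (tau (fun _ => 1) α (μ :: β)) • compStretchL k j α (stretchPrev k (μ :: β) j))) := by
        intro j
        rw [stretch_cons, map_add, map_add, compStretchL_consL α hl β (stretch_letters β j),
          compStretchL_consL α hl (μ :: β) (stretchPrev_letters (μ :: β) j), ht,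
          CharTwo.add_self_eq_zero, zero_add, if_pos List.mem_cons_self]
        simp only [map_add, map_smul, smul_add]
        split_ifs
        · rw [map_smul]
          abel
        · rw [map_zero]
          abel
      -- Repeating the outer letter corresponds to repeating the first letter of the composite on
      -- the left-hand side. The sign is the one of `compStretch_succ`, so the induction on `j`
      -- applies.
      have hprev : sg k (tau (fun _ => 1) α (μ :: β)) •
          compStretchL k j α (stretchPrev k (μ :: β) j) =
          stretchPrevL k (lettersL k (compStretch k 0 α ((μ, 0) :: β.map fun μ => (μ, 0)))) j := by
        cases j with
        | zero => rw [stretchPrev, stretchPrevL, map_zero, smul_zero]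
        | succ j =>
          rw [stretchPrev, stretchPrevL, ← List.map_cons (f := fun μ => (μ, 0)),
            ih j (Nat.lt_succ_self j)]
          refine linear_ext (L := sg k (tau (fun _ => 1) α (μ :: β)) • compStretchL k (j + 1) α)
            (L' := compStretchL k j α) (stretch_letters (μ :: β) j) fun y hy => ?_
          rw [LinearMap.smul_apply, compStretchL_single, compStretchL_single, compStretch_succ,
            tau_congr fun κ _ => ⟨hy κ, rfl⟩, sg_smul_smul, CharTwo.add_self_eq_zero, sg_zero,
            one_smul]
      rw [hR, ← ihl', ← ihβ, hprev, e, lettersL_consL, stretchL_consL]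
      congr 1
      rw [← add_assoc]
      congr 1
      rw [map_add, map_add, map_smul, map_smul]
      congr 1
      split_ifs
      · rw [map_smul, map_smul]
      · rw [map_zero, map_zero]

end compWord
end Breq

namespace Breq

/-! ### Words that contain all letters -/

section full

variable {k : Type*} [Field k] {X A : Type*}

open Classical in
/-- The projection to the lists in which all letters occur. -/
noncomputable def fullL (k : Type*) [Field k] (f : X → A) : (List X →₀ k) →ₗ[k] (List X →₀ k) :=
  Finsupp.linearCombination k fun l => if ∀ a, a ∈ l.map f then Finsupp.single l 1 else 0

lemma fullL_of_mem {f : X → A} {g : List X →₀ k}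
    (h : g ∈ Finsupp.supported k k {l | ∀ a, a ∈ l.map f}) : fullL k f g = g := by
  refine linear_ext (L := fullL k f) (L' := LinearMap.id) h fun l hl => ?_
  rw [fullL, Finsupp.linearCombination_single, if_pos (show ∀ a, a ∈ l.map f from hl),
    one_smul, LinearMap.id_apply]

lemma fullL_of_notMem {f : X → A} {g : List X →₀ k}
    (h : g ∈ Finsupp.supported k k {l | ¬ ∀ a, a ∈ l.map f}) : fullL k f g = 0 := by
  refine linear_ext (L := fullL k f) (L' := 0) h fun l hl => ?_
  rw [fullL, Finsupp.linearCombination_single, if_neg (show ¬ ∀ a, a ∈ l.map f from hl), smul_zero, LinearMap.zero_apply]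

lemma fullL_single_of_mem {f : X → A} {l : List X} (h : ∀ a, a ∈ l.map f) (c : k) :
    fullL k f (Finsupp.single l c) = Finsupp.single l c :=
  fullL_of_mem (Finsupp.single_mem_supported k _ h)

lemma fullL_single_of_notMem {f : X → A} {l : List X} {a : A} (h : a ∉ l.map f) (c : k) :
    fullL k f (Finsupp.single l c) = 0 :=
  fullL_of_notMem (Finsupp.single_mem_supported k _ fun h' => h (h' a))

lemma wordDel_mem (l : List (A × ℕ)) : wordDel k l ∈
    Finsupp.supported k k {u | ∀ a, a ∈ u.map Prod.fst → a ∈ l.map Prod.fst} := by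
  induction l with
  | nil => exact Submodule.zero_mem _
  | cons p l ih =>
    rw [wordDel]
    refine Submodule.sub_mem _ (Finsupp.single_mem_supported k _ fun a ha => ?_)
      (consL_mem ih fun u hu a ha => ?_)
    · exact List.mem_cons_of_mem _ ha
    · rw [List.map_cons, List.mem_cons] at ha ⊢
      exact ha.imp id (hu a)

/-- A deletion never brings back a missing letter, so the words lacking some letter span a
subcomplex, and `fullL` computes modulo it. -/
lemma fullL_delL_fullL (g : List (A × ℕ) →₀ k) :
    fullL k Prod.fst (delL k (fullL k Prod.fst g)) = fullL k Prod.fst (delL k g) := by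
  refine list_linear_ext (L := fullL k Prod.fst ∘ₗ delL k ∘ₗ fullL k Prod.fst)
    (L' := fullL k Prod.fst ∘ₗ delL k) (fun l => ?_) g
  simp only [LinearMap.comp_apply]
  by_cases h : ∀ a, a ∈ l.map Prod.fst
  · rw [fullL_single_of_mem h]
  · have h' := h
    push Not at h
    obtain ⟨a, ha⟩ := h
    rw [fullL_single_of_notMem ha, map_zero, map_zero, delL_single, fullL_of_notMem]
    refine Finsupp.supported_mono ?_ (wordDel_mem l)
    exact fun u (hu : ∀ a, a ∈ u.map Prod.fst → a ∈ l.map Prod.fst) (e : ∀ _, _) => ha (hu a (e a))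

lemma fullL_cofL (m : ℕ) (g : List (A × ℕ) →₀ k) :
    fullL k Prod.fst (cofL k m g) = cofL k m (fullL k Prod.fst g) := by
  refine list_linear_ext (L := fullL k Prod.fst ∘ₗ cofL k m) (L' := cofL k m ∘ₗ fullL k Prod.fst)
    (fun l => ?_) g
  have hr : ∀ i, (raise i l).map Prod.fst = l.map Prod.fst := fun i => by
    simp [raise, Function.comp_def]
  simp only [LinearMap.comp_apply]
  rw [cofL_single, map_sum]
  by_cases h : ∀ a, a ∈ l.map Prod.fst
  · rw [fullL_single_of_mem h, cofL_single]
    exact Finset.sum_congr rfl fun i _ => fullL_single_of_mem (by rwa [hr]) _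
  · push Not at h
    obtain ⟨a, ha⟩ := h
    rw [fullL_single_of_notMem ha, map_zero]
    exact Finset.sum_eq_zero fun i _ => fullL_single_of_notMem (by rwa [hr]) _

lemma fullL_stretchL (j : ℕ) (g : List A →₀ k) :
    fullL k Prod.fst (stretchL k j g) = stretchL k j (fullL k id g) := by
  refine list_linear_ext (L := fullL k Prod.fst ∘ₗ stretchL k j) (L' := stretchL k j ∘ₗ fullL k id)
    (fun l => ?_) g
  simp only [LinearMap.comp_apply]
  rw [stretchL_single, one_smul]
  by_cases h : ∀ a, a ∈ l.map id
  · rw [fullL_single_of_mem h, stretchL_single, one_smul, fullL_of_mem]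
    exact Finsupp.supported_mono (fun u hu a => (hu.2.2 a).2 (by simpa using h a)) (stretch_mem l j)
  · push Not at h
    obtain ⟨a, ha⟩ := h
    rw [fullL_single_of_notMem ha, map_zero, fullL_of_notMem]
    refine Finsupp.supported_mono ?_ (stretch_mem l j)
    exact fun u hu (e : ∀ _, _) => ha (by simpa using (hu.2.2 a).1 (e a))

/-- Each head that the recursion passes contributes `-1`, so a deletion is weighted by the co-level
of the entry and its position. -/
lemma wordDel_map [DecidableEq X] (f : X → A × ℕ) (l : List X) (hd : l.Nodup) : wordDel k (l.map f) =
    (l.map fun z => Finsupp.single ((l.filter (· ≠ z)).map f)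
      (sg k ((f z).2 + l.idxOf z))).sum := by
  induction l with
  | nil => rfl
  | cons a l ih =>
    rw [List.nodup_cons] at hd
    have h1 : l.filter (· ≠ a) = l := List.filter_eq_self.2 fun z hz => by
      simpa using fun e : z = a => hd.1 (e ▸ hz)
    rw [List.map_cons, wordDel, ih hd.2, List.map_cons, List.sum_cons, sub_eq_add_neg]
    congr 1
    · rw [List.filter_cons_of_neg (by simp), h1, List.idxOf_cons_self, Nat.cast_zero, add_zero]
    · rw [← LinearMap.neg_apply, map_list_sum, List.map_map]
      refine congrArg _ (List.map_congr_left fun z hz => ?_)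
      have hne : a ≠ z := fun e => hd.1 (e ▸ hz)
      simp only [Function.comp_apply, LinearMap.neg_apply, consL_single]
      rw [List.filter_cons_of_pos (by simpa using hne), List.idxOf_cons_ne _ hne, List.map_cons,
        ← Finsupp.single_neg, neg_sg, Nat.cast_succ, add_assoc]

end full

/-! ### A change of basis -/

lemma iv_congr {p q : Prop} [Decidable p] [Decidable q] (h : p ↔ q) : iv p = iv q := by
  simp [iv, h]

namespace SeqElt

variable {U : Disk} {j : ℕ}

open Classical in
/-- The parity of the number of inversions of letters in the total order. -/
noncomputable def inversions (x : SeqElt U j) : ZMod 2 :=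
  ∑ z, ∑ z', iv (x.le z z' ∧ z'.1 < z.1)

/-- The parity of the number of leaves before a leaf. -/
def rank (a : U.F) : ZMod 2 := ∑ κ, iv (κ < a)

/-- The sign exponent that relates generators to words. -/
noncomputable def eta (x : SeqElt U j) : ZMod 2 :=
  x.inversions + ∑ z : Pts x.n, (rank z.1 + ((x.W z : ℕ) : ZMod 2)) + (j.choose 2 : ℕ) +
    j * Fintype.card U.F

lemma sum_pts_fst (n : U.F → ℕ) (c : U.F → ZMod 2) :
    ∑ z : Pts n, c z.1 = ∑ ν, c ν * (n ν + 1) := by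
  rw [Fintype.sum_sigma]
  simp [mul_comm]

lemma card_pts_cast (n : U.F → ℕ) :
    (Fintype.card (Pts n) : ZMod 2) = ∑ ν, (n ν : ZMod 2) + Fintype.card U.F := by
  rw [Fintype.card_sigma]
  simp [Finset.sum_add_distrib]

lemma mem_word (x : SeqElt U j) (a : U.F) : a ∈ x.word.map Prod.fst := by
  rw [word_fst, List.mem_map]
  exact ⟨⟨a, 0⟩, x.mem_pts _, rfl⟩

lemma idxOf_pts (x : SeqElt U j) [DecidableEq (Pts x.n)]
    [∀ z z', Decidable (x.le z' z ∧ z' ≠ z)] (z : Pts x.n) :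
    (x.pts.idxOf z : ZMod 2) = ∑ z', iv (x.le z' z ∧ z' ≠ z) := by
  obtain ⟨l₁, l₂, h⟩ := List.append_of_mem (x.mem_pts z)
  have hd := x.nodup_pts
  rw [h, List.nodup_append] at hd
  have h1 : z ∉ l₁ := fun hz => ((x.mem_before h z).1 hz).2 rfl
  have h2 : x.pts.idxOf z = l₁.length := by
    rw [h, List.idxOf_append_of_notMem h1, List.idxOf_cons_self, add_zero]
  rw [h2, ← List.toFinset_card_of_nodup hd.1,
    show l₁.toFinset = Finset.univ.filter fun z' => x.le z' z ∧ z' ≠ z by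
      ext z'
      simp [x.mem_before h]]
  simp [iv]

lemma sum_facePt (x : SeqElt U j) (ν : U.F) (i : Fin (x.n ν + 1)) (h : 0 < x.n ν)
    (g : Pts x.n → ZMod 2) : ∑ z, g (x.facePt ν i h z) = ∑ z, g z + g ⟨ν, i⟩ := by
  classical
  have h1 : ∑ z, g (x.facePt ν i h z) = ∑ z ∈ {⟨ν, i⟩}ᶜ, g z := by
    rw [← Finset.sum_image (s := Finset.univ) (f := g) fun a _ b _ e => (x.face_emb ν i h).inj e]
    refine Finset.sum_congr ?_ fun _ _ => rfl
    ext z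
    have := Set.ext_iff.1 (x.range_facePt ν i h) z
    simpa using this
  rw [h1, ← Finset.sum_compl_add_sum {⟨ν, i⟩} g, Finset.sum_singleton, add_assoc,
    CharTwo.add_self_eq_zero, add_zero]

lemma face_word (x : SeqElt U j) (ν : U.F) (i : Fin (x.n ν + 1)) (h : 0 < x.n ν)
    [∀ z, Decidable (z ≠ (⟨ν, i⟩ : Pts x.n))] :
    (x.face ν i h).word = (x.pts.filter (· ≠ ⟨ν, i⟩)).map x.entry := by
  have h1 := (x.face_emb ν i h).map_pts
  have h2 : x.pts.filter (· ≠ ⟨ν, i⟩) = (x.face ν i h).pts.map (x.facePt ν i h) := by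
    rw [h1]
    refine List.filter_congr fun z _ => ?_
    have := Set.ext_iff.1 (x.range_facePt ν i h) z
    rw [Bool.eq_iff_iff, decide_eq_true_eq, decide_eq_true_eq, this]
    rfl
  rw [h2, List.map_map]
  rfl

open Classical in
lemma inversions_face (x : SeqElt U j) (ν : U.F) (i : Fin (x.n ν + 1)) (h : 0 < x.n ν) :
    (x.face ν i h).inversions = x.inversions +
      ∑ z, (iv (x.le z ⟨ν, i⟩ ∧ ν < z.1) + iv (x.le ⟨ν, i⟩ z ∧ z.1 < ν)) := by
  have h1 : (x.face ν i h).inversions = ∑ z, ∑ z',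
      iv (x.le (x.facePt ν i h z) (x.facePt ν i h z') ∧
        (x.facePt ν i h z').1 < (x.facePt ν i h z).1) := by
    refine Finset.sum_congr rfl fun z _ => Finset.sum_congr rfl fun z' _ => iv_congr ?_
    rw [(x.face_emb ν i h).le_iff]
    rfl
  have h0 : ∀ a c, ∑ z', iv (x.le a (x.facePt ν i h z') ∧ (x.facePt ν i h z').1 < c) =
      ∑ w, iv (x.le a w ∧ w.1 < c) + iv (x.le a ⟨ν, i⟩ ∧ ν < c) :=
    fun a c => x.sum_facePt ν i h fun w => iv (x.le a w ∧ w.1 < c)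
  rw [h1, inversions, Finset.sum_congr rfl fun z _ => h0 _ _]
  rw [x.sum_facePt ν i h fun w => (∑ w', iv (x.le w w' ∧ w'.1 < w.1) +
    iv (x.le w ⟨ν, i⟩ ∧ ν < w.1)), Finset.sum_add_distrib, Finset.sum_add_distrib]
  have h2 : iv (x.le ⟨ν, i⟩ ⟨ν, i⟩ ∧ ν < ν) = 0 := by simp [iv]
  change _ + _ + (_ + iv (x.le ⟨ν, i⟩ ⟨ν, i⟩ ∧ ν < ν)) = _
  rw [h2]
  abel

open Classical in
lemma sum_same_color (x : SeqElt U j) (z : Pts x.n) :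
    ∑ z', iv (z'.1 = z.1 ∧ x.le z' z ∧ z' ≠ z) = ((z.2 : ℕ) : ZMod 2) := by
  obtain ⟨ν, i⟩ := z
  rw [Fintype.sum_sigma, Finset.sum_eq_single ν]
  · have : ∀ b : Fin (x.n ν + 1), iv ((⟨ν, b⟩ : Pts x.n).1 = ν ∧
        x.le ⟨ν, b⟩ ⟨ν, i⟩ ∧ (⟨ν, b⟩ : Pts x.n) ≠ ⟨ν, i⟩) = iv (b < i) := by
      intro b
      refine iv_congr ?_
      rw [le_color_iff]
      simp [lt_iff_le_and_ne]
    rw [Finset.sum_congr rfl fun b _ => this b]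
    simp only [iv, Finset.sum_boole]
    rw [show (Finset.univ.filter fun b => b < i) = Finset.Iio i by ext; simp, Fin.card_Iio]
  · intro κ _ hκ
    exact Finset.sum_eq_zero fun b _ => by simp [iv, hκ]
  · simp

open Classical in
-- Compare the other points with the deleted one. The inversions it takes part in, plus the points
-- before it, agree modulo 2 with the points of smaller leaf plus the earlier points of the same
-- leaf. The former are counted by the arities of the smaller leaves up to `rank ν`, which is the
-- term of the deleted point in `eta`; the latter are counted by `i`.
lemma eta_face (x : SeqElt U j) (ν : U.F) (i : Fin (x.n ν + 1)) (h : 0 < x.n ν) :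
    (∑ κ with κ < ν, (x.n κ : ZMod 2)) + ((i : ℕ) : ZMod 2) + (x.face ν i h).eta =
      j + x.eta + ((x.entry ⟨ν, i⟩).2 + x.pts.idxOf ⟨ν, i⟩) := by
  have h1 := x.sum_facePt ν i h fun z => rank z.1 + ((x.W z : ℕ) : ZMod 2)
  have h2 : ((x.entry ⟨ν, i⟩).2 : ZMod 2) = j + (x.W ⟨ν, i⟩ : ℕ) := by
    rw [entry, Nat.cast_sub (Nat.le_of_lt_succ (x.W ⟨ν, i⟩).2), CharTwo.sub_eq_add]
  have h3 : ∑ z : Pts (x.face ν i h).n,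
      (rank z.1 + (((x.face ν i h).W z : ℕ) : ZMod 2)) = _ := h1
  rw [idxOf_pts, h2, eta, eta, h3, inversions_face, sum_filter_iv]
  have h4 : ((i : ℕ) : ZMod 2) = ∑ z : Pts x.n, iv (z.1 = ν ∧ x.le z ⟨ν, i⟩ ∧ z ≠ ⟨ν, i⟩) :=
    (x.sum_same_color ⟨ν, i⟩).symm
  have h5 := sum_pts_fst x.n fun κ => iv (κ < ν)
  have h6 : ∑ κ, iv (κ < ν) * ((x.n κ : ZMod 2) + 1) =
      ∑ κ, iv (κ < ν) * (x.n κ : ZMod 2) + rank ν := by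
    simp [mul_add, Finset.sum_add_distrib, rank]
  have key : ∑ z : Pts x.n, (iv (x.le z ⟨ν, i⟩ ∧ ν < z.1) + iv (x.le ⟨ν, i⟩ z ∧ z.1 < ν)) +
      ∑ z : Pts x.n, iv (x.le z ⟨ν, i⟩ ∧ z ≠ ⟨ν, i⟩) = ∑ z : Pts x.n, iv (z.1 < ν) +
      ∑ z : Pts x.n, iv (z.1 = ν ∧ x.le z ⟨ν, i⟩ ∧ z ≠ ⟨ν, i⟩) := by
    rw [← Finset.sum_add_distrib, ← Finset.sum_add_distrib]
    refine Finset.sum_congr rfl fun z _ => ?_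
    have a1 := x.le_total z ⟨ν, i⟩
    have a2 := x.le_antisymm z ⟨ν, i⟩
    have a3 : z = ⟨ν, i⟩ → z.1 = ν := fun e => congrArg Sigma.fst e
    have a4 := lt_trichotomy z.1 ν
    have a5 : z.1 < ν → ¬ ν < z.1 := fun h => h.asymm
    have a6 : z.1 = ν → ¬ ν < z.1 ∧ ¬ z.1 < ν := fun h => ⟨h.not_gt, h.not_lt⟩
    unfold iv
    generalize z.1 = m at *
    generalize x.le z ⟨ν, i⟩ = p at *
    generalize x.le ⟨ν, i⟩ z = q at *
    clear h1 h2 h3 h4 h5 h6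
    grind
  rw [← h4, h5, h6] at key
  have e2 : (2 : ZMod 2) = 0 := by decide
  simp only [mul_add, mul_one, Finset.sum_add_distrib] at *
  linear_combination key + (j + ∑ κ, iv (κ < ν) * (x.n κ : ZMod 2)+ rank ν + ((i : ℕ) : ZMod 2) -
    (2 * j + ∑ z', iv (x.le z' ⟨ν, i⟩ ∧ z' ≠ ⟨ν, i⟩))) * e2

/-- Points below `i` keep their level while the top of `J` moves up by one, so their co-levels,
which are at least `j + 1 - i`, are raised; the other points move up together with the top. -/
lemma word_coface (x : SeqElt U j) (i : Fin (j + 2)) :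
    (x.coface i).word = raise (j + 1 - i) x.word := by
  have h1 : (x.coface i).pts = x.pts := rfl
  rw [word, h1, word, raise, List.map_map]
  refine List.map_congr_left fun z _ => ?_
  have h2 : ((x.coface i).W z : ℕ) = if (x.W z : ℕ) < i then (x.W z : ℕ) else x.W z + 1 := by
    change (Fin.succAbove i (x.W z) : ℕ) = _
    rw [Fin.succAbove]
    simp only [Fin.lt_def, Fin.val_castSucc]
    split_ifs <;> simp
  have h3 := (x.W z).2
  have h4 := i.2
  change (z.1, j + 1 - ((x.coface i).W z : ℕ)) =
    (z.1, j - (x.W z : ℕ) + if j + 1 - (i : ℕ) ≤ j - (x.W z : ℕ) then 1 else 0)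
  rw [h2]
  congr 1
  split_ifs <;> omega

lemma numGE_word (x : SeqElt U j) (m : ℕ) :
    numGE m x.word = ∑ z, iv (m ≤ j - (x.W z : ℕ)) := by
  classical
  rw [numGE, word, List.map_map, ← List.sum_toFinset _ x.nodup_pts,
    Finset.eq_univ_of_forall fun z => List.mem_toFinset.2 (x.mem_pts z)]
  rfl

/-- The level changes exactly at the points whose co-level is not raised. Their number is the number
of all points minus the one counted by `numGE`, and the former is the degree plus `j` plus the
number of leaves modulo 2. The terms `j.choose 2` and `j * Fintype.card U.F` of `eta` are there to
absorb this. -/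
lemma eta_coface (x : SeqElt U j) (i : Fin (j + 2)) :
    (x.deg : ZMod 2) + ((i : ℕ) : ZMod 2) + 1 + (x.coface i).eta =
      j + x.eta + (((j + 1 - i : ℕ) : ZMod 2) + numGE (j + 1 - i) x.word) := by
  have h2 : ∀ z : Pts x.n, (((x.coface i).W z : ℕ) : ZMod 2) = ((x.W z : ℕ) : ZMod 2) +
      iv (j + 1 - (i : ℕ) ≤ j - (x.W z : ℕ)) + 1 := by
    intro z
    have h2 : ((x.coface i).W z : ℕ) = if (x.W z : ℕ) < i then (x.W z : ℕ) else x.W z + 1 := by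
      change (Fin.succAbove i (x.W z) : ℕ) = _
      rw [Fin.succAbove]
      simp only [Fin.lt_def, Fin.val_castSucc]
      split_ifs <;> simp
    have h3 := (x.W z).2
    have h4 := i.2
    rw [h2, iv]
    split_ifs
    · rw [add_assoc, CharTwo.add_self_eq_zero, add_zero]
    · omega
    · omega
    · rw [add_zero]
      push_cast
      rfl
  have h5 : (x.coface i).inversions = x.inversions := rfl
  have h6 : ∑ z : Pts (x.coface i).n, (rank z.1 + (((x.coface i).W z : ℕ) : ZMod 2)) =
      ∑ z : Pts x.n, (rank z.1 + ((x.W z : ℕ) : ZMod 2)) +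
        ∑ z, iv (j + 1 - (i : ℕ) ≤ j - (x.W z : ℕ)) + Fintype.card (Pts x.n) := by
    change ∑ z : Pts x.n, (rank z.1 + (((x.coface i).W z : ℕ) : ZMod 2)) = _
    rw [Finset.sum_congr rfl fun z _ => congrArg (rank z.1 + ·) (h2 z)]
    simp only [Finset.sum_add_distrib]
    rw [Finset.sum_const, Finset.card_univ, nsmul_eq_mul, mul_one]
    ring
  have h7 : (((j + 1).choose 2 : ℕ) : ZMod 2) = j + (j.choose 2 : ℕ) := by
    rw [Nat.choose_succ_succ', Nat.choose_one_right, Nat.cast_add]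
  have h8 : ((j + 1 - i : ℕ) : ZMod 2) = j + 1 + (i : ℕ) := by
    rw [Nat.cast_sub (Nat.le_of_lt_succ i.2), CharTwo.sub_eq_add]
    push_cast
    rfl
  have e2 : (2 : ZMod 2) = 0 := by decide
  rw [eta, eta, h5, h6, numGE_word, h7, h8, card_pts_cast, deg_cast]
  push_cast
  linear_combination (∑ ν, (x.n ν : ZMod 2) + Fintype.card U.F) * e2

end SeqElt

/-! ### The signed embedding of generators into words -/

section hat

variable {k : Type*} [Field k] {U : Disk} {j : ℕ}

/-- The signed words of generators, extended linearly. -/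
noncomputable def hat (k : Type*) [Field k] (U : Disk) (j : ℕ) :
    (SeqElt U j →₀ k) →ₗ[k] (List (U.F × ℕ) →₀ k) :=
  Finsupp.linearCombination k fun x => Finsupp.single x.word (sg k x.eta)

lemma hat_single (x : SeqElt U j) (c : k) :
    hat k U j (Finsupp.single x c) = Finsupp.single x.word (c * sg k x.eta) := by
  rw [hat, Finsupp.linearCombination_single, Finsupp.smul_single, smul_eq_mul]

/-- The coefficient of a generator is recovered, up to its sign, as the coefficient of its word. -/
lemma hat_injective : Function.Injective (hat k U j) := by
  rw [← LinearMap.ker_eq_bot, LinearMap.ker_eq_bot']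
  intro f hf
  ext x
  have h : ∀ f : SeqElt U j →₀ k, hat k U j f x.word = f x * sg k x.eta := by
    intro f
    refine linear_ext (L := Finsupp.lapply x.word ∘ₗ hat k U j)
      (L' := LinearMap.toSpanSingleton k k (sg k x.eta) ∘ₗ Finsupp.lapply x) (S := Set.univ)
      (f := f) (by simp) fun y _ => ?_
    simp only [LinearMap.comp_apply, hat_single, Finsupp.lapply_apply, one_mul,
      LinearMap.toSpanSingleton_apply, smul_eq_mul]
    by_cases e : y = x
    · subst e
      simp
    · rw [Finsupp.single_eq_of_ne (fun h => e (SeqElt.word_injective h).symm),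
        Finsupp.single_eq_of_ne (Ne.symm e), zero_mul]
  have h1 := h f
  rw [hf, Finsupp.zero_apply, zero_eq_mul] at h1
  refine h1.resolve_right fun e => ?_
  have := sg_mul_self k x.eta
  rw [e, zero_mul] at this
  exact zero_ne_one this

/-- Deleting a point is a face, except when it is the only point of its leaf: then the face is
absent, and the word is removed by `fullL`. -/
lemma hat_simplicialD (f : SeqElt U j →₀ k) : hat k U j (simplicialD k U j f) =
    sg k j • fullL k Prod.fst (delL k (hat k U j f)) := by
  classical
  refine linear_ext (L := hat k U j ∘ₗ simplicialD k U j)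
    (L' := sg k j • fullL k Prod.fst ∘ₗ delL k ∘ₗ hat k U j) (S := Set.univ) (by simp) fun x _ => ?_
  rw [LinearMap.smul_apply, LinearMap.comp_apply, LinearMap.comp_apply, LinearMap.comp_apply,
    simplicialD_single, hat_single, one_mul, ← mul_one (sg k x.eta), ← smul_eq_mul,
    ← Finsupp.smul_single, map_smul, map_smul, sg_smul_smul, delL_single, SeqElt.word,
    wordDel_map _ _ x.nodup_pts, ← List.sum_toFinset _ x.nodup_pts,
    Finset.eq_univ_of_forall fun z => List.mem_toFinset.2 (x.mem_pts z), Fintype.sum_sigma,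
    map_sum, map_sum, Finset.smul_sum]
  refine Finset.sum_congr rfl fun ν _ => ?_
  rw [faceSum, map_sum, map_sum, Finset.smul_sum]
  refine Finset.sum_congr rfl fun i _ => ?_
  by_cases h : 0 < x.n ν
  · rw [dif_pos h, hat_single, ← sg_add, x.eta_face ν i h, ← @SeqElt.face_word U j x ν i h _,
      fullL_single_of_mem (x.face ν i h).mem_word, Finsupp.smul_single, smul_eq_mul, ← sg_add]
  · rw [dif_neg h, map_zero, fullL_single_of_notMem (a := ν), smul_zero]
    rw [List.map_map, List.mem_map]
    rintro ⟨⟨κ, b⟩, hz, e⟩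
    have e' : κ = ν := e
    subst e'
    refine of_decide_eq_true (List.mem_filter.1 hz).2 (congrArg (Sigma.mk κ) (Fin.ext ?_))
    omega

/-- The coface with index `i` matches the raising from `j + 1 - i` on, so the summation is reversed.
-/
lemma hat_cosimplicialD (f : SeqElt U j →₀ k) : hat k U (j + 1) (cosimplicialD k U j f) =
    sg k j • cofL k (j + 2) (hat k U j f) := by
  refine linear_ext (L := hat k U (j + 1) ∘ₗ cosimplicialD k U j)
    (L' := sg k j • cofL k (j + 2) ∘ₗ hat k U j) (S := Set.univ) (by simp) fun x _ => ?_
  rw [LinearMap.smul_apply, LinearMap.comp_apply, LinearMap.comp_apply, cosimplicialD_single,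
    hat_single, one_mul, ← mul_one (sg k x.eta), ← smul_eq_mul, ← Finsupp.smul_single, map_smul,
    sg_smul_smul, cofL_single, map_sum, ← Finset.sum_range_reflect, ← Fin.sum_univ_eq_sum_range
      (fun i => Finsupp.single (raise (j + 2 - 1 - i) x.word)
        (sg k ((j + 2 - 1 - i : ℕ) + numGE (j + 2 - 1 - i) x.word))), Finset.smul_sum]
  refine Finset.sum_congr rfl fun i _ => ?_
  rw [hat_single, ← sg_add, x.eta_coface, x.word_coface, Finsupp.smul_single, smul_eq_mul, ← sg_add]
  rfl

lemma hat_condD_succ (f : ∀ j, SeqElt U j →₀ k) (d : ℕ) : hat k U (d + 1) (condD k U f (d + 1)) =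
    sg k d • (cofL k (d + 2) (hat k U d (f d)) -
      fullL k Prod.fst (delL k (hat k U (d + 1) (f (d + 1))))) := by
  rw [condD_apply, map_add, hat_simplicialD, cosPart, hat_cosimplicialD, Nat.cast_succ, sg_add,
    sg_one, smul_sub]
  module

lemma hat_condD_zero (f : ∀ j, SeqElt U j →₀ k) : hat k U 0 (condD k U f 0) =
    fullL k Prod.fst (delL k (hat k U 0 (f 0))) := by
  rw [condD_apply, cosPart, add_zero, hat_simplicialD, Nat.cast_zero, sg_zero, one_smul]

lemma simplicialD_simplicialD (f : SeqElt U j →₀ k) :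
    simplicialD k U j (simplicialD k U j f) = 0 := by
  apply hat_injective
  rw [hat_simplicialD, hat_simplicialD, map_smul, map_smul, fullL_delL_fullL, delL_delL, map_zero,
    smul_zero, smul_zero, map_zero]

/-- Deletions and raisings square to zero. They commute, and the mixed terms cancel because the sign
`sg k d` in `hat_condD_succ` alternates with `d`. -/
lemma condD_condD (f : ∀ j, SeqElt U j →₀ k) : condD k U (condD k U f) = 0 := by
  funext j
  rw [Pi.zero_apply]
  apply hat_injective
  rw [map_zero]
  cases j with
  | zero =>
    rw [hat_condD_zero, hat_condD_zero, fullL_delL_fullL, delL_delL, map_zero]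
  | succ d =>
    rw [hat_condD_succ, hat_condD_succ, map_smul, map_smul, map_sub, map_sub, fullL_delL_fullL,
      delL_delL, map_zero, sub_zero, delL_cofL, fullL_cofL]
    cases d with
    | zero =>
      rw [hat_condD_zero, Nat.cast_zero, sg_zero, one_smul, one_smul, sub_self]
    | succ d =>
      rw [hat_condD_succ, map_smul, map_sub, cofL_cofL, zero_sub, Nat.cast_succ, sg_add, sg_one]
      module

end hat

end Breq

namespace Breq

/-! ### Stretched words as sums over multiplicities -/

section levels

variable {A X : Type*}

/-- Add to every entry of a list the number of marked entries after it. -/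
def withLevels : List (A × Bool) → List (A × ℕ)
  | [] => []
  | p :: l => (p.1, l.countP fun q => q.2) :: withLevels l

/-- Repeat the entries of a list, and mark the repetitions. -/
def repeated (f : X → A) (m : X → ℕ) (l : List X) : List (A × Bool) :=
  l.flatMap fun z => (f z, false) :: List.replicate (m z) (f z, true)

lemma countP_repeated (f : X → A) (m : X → ℕ) (l : List X) :
    (repeated f m l).countP (fun q => q.2) = (l.map m).sum := by
  induction l with
  | nil => rfl
  | cons z l ih =>
    rw [repeated, List.flatMap_cons, List.countP_append, ← repeated, ih, List.map_cons,
      List.sum_cons, List.countP_cons_of_neg (by simp), List.countP_replicate, if_pos rfl]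

variable {k : Type*} [Field k]

/-- Prefixing a block of equal letters. -/
noncomputable def consBlock (k : Type*) [Field k] (a : A) :
    ℕ → ℕ → ((List (A × ℕ) →₀ k) →ₗ[k] (List (A × ℕ) →₀ k))
  | 0, q => consL k (a, q)
  | p + 1, q => consL k (a, p + 1 + q) ∘ₗ consBlock k a p q

lemma consBlock_single (a : A) (p : ℕ) (L : List (A × Bool)) :
    consBlock k a p (L.countP fun q => q.2) (Finsupp.single (withLevels L) 1) =
      Finsupp.single (withLevels ((a, false) :: List.replicate p (a, true) ++ L)) 1 := by
  induction p with
  | zero => rw [consBlock, consL_single]; rfl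
  | succ p ih =>
    rw [consBlock, LinearMap.comp_apply, ih, consL_single]
    simp only [List.cons_append, withLevels, List.replicate_succ, List.countP_append,
      List.countP_replicate, List.countP_cons]
    simp [add_right_comm]

/-- The recursion is unrolled along the repetitions of the first letter: `q.1` of them are spent
there and `q.2` are left for the rest. -/
lemma stretch_cons_sum (a : A) (l : List A) (j : ℕ) : stretch k (a :: l) j =
    ∑ q ∈ Finset.HasAntidiagonal.antidiagonal j, consBlock k a q.1 q.2 (stretch k l q.2) := by
  induction j with
  | zero => rw [stretch]; simp [consBlock]
  | succ j ih =>
    rw [stretch, ih, Finset.Nat.antidiagonal_succ, Finset.sum_cons, Finset.sum_map, map_add,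
      map_sum]
    congr 1
    refine Finset.sum_congr rfl fun q hq => ?_
    have h : q.1 + 1 + q.2 = j + 1 := by
      have := Finset.HasAntidiagonal.mem_antidiagonal.1 hq
      omega
    simp only [Function.Embedding.prodMap, Function.Embedding.coeFn_mk, Prod.map,
      Function.Embedding.refl_apply, Nat.succ_eq_add_one, consBlock, LinearMap.comp_apply, h]

/-- Choosing the number of repetitions entry by entry amounts to choosing a multiplicity function of
total `j`. The absence of duplicates gives each entry its own multiplicity, even if `f` identifies
letters. -/
lemma stretch_map [DecidableEq X] (f : X → A) (l : List X) (hd : l.Nodup) (j : ℕ) :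
    stretch k (l.map f) j = ∑ m ∈ Finset.piAntidiag l.toFinset j,
      Finsupp.single (withLevels (repeated f m l)) 1 := by
  induction l generalizing j with
  | nil =>
    cases j with
    | zero => rw [List.map_nil, stretch]; simp [repeated, withLevels]
    | succ j => rw [List.map_nil, stretch]; simp
  | cons a l ih =>
    rw [List.nodup_cons] at hd
    have ha : a ∉ l.toFinset := by simpa using hd.1
    rw [List.map_cons, stretch_cons_sum, List.toFinset_cons, ← Finset.cons_eq_insert a _ ha,
      Finset.piAntidiag_cons, Finset.sum_disjiUnion]
    refine Finset.sum_congr rfl fun q _ => ?_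
    rw [ih hd.2, map_sum, Finset.sum_map]
    refine Finset.sum_congr rfl fun m hm => ?_
    rw [Finset.mem_piAntidiag] at hm
    have h1 : m a = 0 := by
      by_contra h
      exact ha (hm.2 a h)
    have h2 : (repeated f m l).countP (fun q => q.2) = q.2 := by
      rw [countP_repeated, ← List.sum_toFinset _ hd.2, hm.1]
    have h3 : repeated f (m + fun t => if t = a then q.1 else 0) l = repeated f m l := by
      refine List.flatMap_congr fun z hz => ?_
      have : z ≠ a := fun e => hd.1 (e ▸ hz)
      simp [this]
    rw [← h2, consBlock_single]
    simp only [addRightEmbedding_apply]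
    have h4 : ∀ m, repeated f m (a :: l) =
        (f a, false) :: List.replicate (m a) (f a, true) ++ repeated f m l := fun m => rfl
    rw [h4, h3]
    simp [h1]

end levels

/-! ### Monotone surjections of ordinals -/

section monotone

variable {n m : ℕ} (p : Fin (n + 1) →o Fin (m + 1))

open Classical in
-- A fibre of a monotone map is an interval. Its first element is not the right end of a contracted
-- interval, while every later one is, because its predecessor lies in the same fibre.
lemma map_fiber_list (hp : Function.Surjective p) (i : Fin (m + 1)) :
    ((List.finRange (n + 1)).filter (p · = i)).map
        (fun b => decide (∃ c : Fin n, b = c.succ ∧ p c.castSucc = p c.succ)) =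
      false :: List.replicate ((Finset.univ.filter fun b => p b = i).card - 1) true := by
  have hc : ((List.finRange (n + 1)).filter (p · = i)).length =
      (Finset.univ.filter fun b => p b = i).card := by
    rw [← List.toFinset_card_of_nodup ((List.nodup_finRange _).filter _)]
    congr 1
    ext b
    simp
  have hs : ((List.finRange (n + 1)).filter (p · = i)).Pairwise (· < ·) :=
    (List.pairwise_lt_finRange _).filter _
  have hm : ∀ b, b ∈ (List.finRange (n + 1)).filter (p · = i) ↔ p b = i := fun b => by simp
  obtain ⟨b₀, hb₀⟩ := hp i
  rw [← hc]
  cases hL : (List.finRange (n + 1)).filter (p · = i) with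
  | nil =>
    rw [hL] at hm
    exact absurd ((hm b₀).2 hb₀) (by simp)
  | cons a L =>
    rw [hL] at hm hs
    rw [List.pairwise_cons] at hs
    have ha := (hm a).1 List.mem_cons_self
    rw [List.map_cons, List.length_cons, Nat.add_sub_cancel]
    congr 1
    · rw [decide_eq_false_iff_not]
      rintro ⟨c, rfl, h⟩
      rcases List.mem_cons.1 ((hm c.castSucc).2 (h.trans ha)) with h | h
      · exact (Fin.castSucc_lt_succ).ne h
      · exact (hs.1 _ h).asymm Fin.castSucc_lt_succ
    · rw [List.eq_replicate_iff, List.length_map]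
      refine ⟨rfl, ?_⟩
      intro v hv
      obtain ⟨b, hb, rfl⟩ := List.mem_map.1 hv
      rw [decide_eq_true_eq]
      have hab := hs.1 b hb
      have hpb := (hm b).1 (List.mem_cons_of_mem _ hb)
      obtain ⟨c, rfl⟩ := Fin.exists_succ_eq.2 (Fin.ne_zero_of_lt hab)
      refine ⟨c, rfl, le_antisymm (p.monotone Fin.castSucc_lt_succ.le) ?_⟩
      rw [hpb, ← ha]
      exact p.monotone (Fin.le_castSucc_iff.2 hab)

lemma card_new_fiber (hp : Function.Surjective p) (i : Fin (m + 1)) :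
    (Finset.univ.filter fun c : Fin n => p c.castSucc = p c.succ ∧ p c.succ = i).card =
      (Finset.univ.filter fun b => p b = i).card - 1 := by
  classical
  have h := congrArg (List.count true) (map_fiber_list p hp i)
  rw [List.count_cons_of_ne (by simp), List.count_replicate_self, List.count_eq_countP,
    List.countP_map, List.countP_filter, List.countP_eq_length_filter,
    ← List.toFinset_card_of_nodup ((List.nodup_finRange _).filter _)] at h
  rw [← h, ← Finset.card_map (Fin.succEmb n)]
  congr 1
  ext b
  simp only [Finset.mem_map, Finset.mem_filter, Finset.mem_univ, true_and, Fin.coe_succEmb,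
    List.mem_toFinset, List.mem_filter, List.mem_finRange, Bool.and_eq_true, decide_eq_true_eq,
    Function.comp_apply, beq_iff_eq]
  constructor
  · rintro ⟨c, ⟨h1, h2⟩, rfl⟩
    exact ⟨⟨c, rfl, h1⟩, h2⟩
  · rintro ⟨⟨c, rfl, h1⟩, h2⟩
    exact ⟨c, ⟨h1, h2⟩, rfl⟩

lemma sum_mult (hp : Function.Surjective p) (g : Fin (m + 1) → ZMod 2) :
    ∑ i, (((Finset.univ.filter fun b => p b = i).card - 1 : ℕ) : ZMod 2) * g i =
      ∑ c : Fin n, iv (p c.castSucc = p c.succ) * g (p c.succ) := by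
  have h : ∀ i, (((Finset.univ.filter fun b => p b = i).card - 1 : ℕ) : ZMod 2) * g i =
      ∑ c : Fin n, iv (p c.castSucc = p c.succ ∧ p c.succ = i) * g i := by
    intro i
    rw [← card_new_fiber p hp, ← Finset.sum_mul]
    simp [iv]
  simp only [h]
  rw [Finset.sum_comm]
  refine Finset.sum_congr rfl fun c _ => ?_
  rw [Finset.sum_eq_single (p c.succ)]
  · simp
  · intro i _ hi
    simp [iv, hi.symm]
  · simp

lemma sum_comp_mono (hp : Function.Surjective p) (g : Fin (m + 1) → ZMod 2) :
    ∑ b, g (p b) = ∑ i, g i + ∑ c : Fin n, iv (p c.castSucc = p c.succ) * g (p c.succ) := by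
  have h : ∑ b, g (p b) = ∑ i, ((Finset.univ.filter fun b => p b = i).card : ZMod 2) * g i := by
    rw [← Finset.sum_fiberwise Finset.univ p]
    refine Finset.sum_congr rfl fun i _ => ?_
    rw [Finset.sum_congr rfl fun b hb => congrArg g (Finset.mem_filter.1 hb).2, Finset.sum_const,
      nsmul_eq_mul]
  rw [h, ← sum_mult p hp, ← Finset.sum_add_distrib]
  refine Finset.sum_congr rfl fun i _ => ?_
  obtain ⟨b, hb⟩ := hp i
  have : 0 < (Finset.univ.filter fun b => p b = i).card :=
    Finset.card_pos.2 ⟨b, by simpa using hb⟩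
  rw [Nat.cast_sub this]
  ring

end monotone

/-! ### The words of the whiskerings -/

namespace Insertion

variable {U : Disk} {x : SeqElt U 0} {j : ℕ} (s : Insertion x j)

/-- The multiplicities of the points of `x`. -/
def mult (z : Pts x.n) : ℕ := (Finset.univ.filter fun b => s.p z.1 b = z.2).card - 1

/-- The points over a point of `x`. -/
def fib (z : Pts x.n) : List (Pts s.size) :=
  ((List.finRange (s.size z.1 + 1)).filter (s.p z.1 · = z.2)).map (Sigma.mk z.1)

open Classical in
/-- Whether a point is the right end of a new interval. -/
noncomputable def isNew (w : Pts s.size) : Bool :=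
  decide (∃ c : Fin (s.size w.1), w.2 = c.succ ∧ s.p w.1 c.castSucc = s.p w.1 c.succ)

lemma mem_fib (z : Pts x.n) (w : Pts s.size) : w ∈ s.fib z ↔ (⟨w.1, s.p w.1 w.2⟩ : Pts x.n) = z := by
  obtain ⟨ν, b⟩ := w
  obtain ⟨κ, i⟩ := z
  rw [fib, List.mem_map]
  constructor
  · rintro ⟨c, hc, e⟩
    have e1 : κ = ν := congrArg Sigma.fst e
    subst e1
    have e2 : c = b := eq_of_heq (Sigma.mk.inj e).2
    subst e2
    exact congrArg (Sigma.mk κ) (by simpa using hc)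
  · intro e
    have e1 : ν = κ := congrArg Sigma.fst e
    subst e1
    have e2 : s.p ν b = i := eq_of_heq (Sigma.mk.inj e).2
    exact ⟨b, by simpa using e2, rfl⟩

lemma map_fib (z : Pts x.n) : (s.fib z).map (fun w => (w.1, s.isNew w)) =
    (z.1, false) :: List.replicate (s.mult z) (z.1, true) := by
  have h := congrArg (List.map (Prod.mk z.1)) (map_fiber_list (s.p z.1) (s.surj z.1) z.2)
  rw [List.map_cons, List.map_replicate, List.map_map] at h
  rw [fib, List.map_map]
  exact h

/-- The order of the points of a whiskering. -/
def rel : Pts s.size → Pts s.size → Prop := s.pulled.le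

lemma rel_refl (w : Pts s.size) : s.rel w w := s.pulled.le_rfl' w

lemma rel_total (w w' : Pts s.size) : s.rel w w' ∨ s.rel w' w := s.pulled.le_total w w'

lemma rel_antisymm {w w' : Pts s.size} (h : s.rel w w') (h' : s.rel w' w) : w = w' :=
  s.pulled.le_antisymm w w' h h'

lemma rel_color (ν : U.F) (c c' : Fin (s.size ν + 1)) : s.rel ⟨ν, c⟩ ⟨ν, c'⟩ ↔ c ≤ c' :=
  s.pulled.le_color_iff ν c c'

lemma rel_of_ne {a b : U.F} (h : a ≠ b) (c : Fin (s.size a + 1)) (c' : Fin (s.size b + 1)) :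
    s.rel ⟨a, c⟩ ⟨b, c'⟩ ↔ x.le ⟨a, s.p a c⟩ ⟨b, s.p b c'⟩ := by
  have hne : (⟨a, s.p a c⟩ : Pts x.n) ≠ ⟨b, s.p b c'⟩ := fun e => h (congrArg Sigma.fst e)
  constructor
  · rintro (⟨-, h⟩ | ⟨e, -⟩)
    · exact h
    · exact absurd e hne
  · exact fun h => Or.inl ⟨hne, h⟩

/-- The pulled back order runs through the fibres in the order of `x`, and through each fibre in its
own order. -/
lemma pts_whisker : s.whisker.pts = x.pts.flatMap s.fib := by
  have h1 : (x.pts.flatMap s.fib).Pairwise s.rel := by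
    rw [List.pairwise_flatMap]
    constructor
    · intro z _
      rw [fib, List.pairwise_map]
      exact ((List.pairwise_lt_finRange _).filter _).imp fun {b b'} h =>
        s.pulled.le_color _ _ _ h.le
    · rw [List.pairwise_iff_forall_sublist]
      intro z z' hz w hw w' hw'
      have h1 := (List.pairwise_iff_forall_sublist.1 x.pairwise_pts) hz
      have h2 := (List.pairwise_iff_forall_sublist.1 x.nodup_pts) hz
      rw [mem_fib] at hw hw'
      subst hw
      subst hw'
      exact Or.inl ⟨h2, h1⟩
  have h2 : (x.pts.flatMap s.fib).Nodup := by
    rw [List.nodup_flatMap]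
    constructor
    · intro z _
      exact ((List.nodup_finRange _).filter _).map fun b b' e => eq_of_heq (Sigma.mk.inj e).2
    · refine x.nodup_pts.imp fun {z z'} h w hw hw' => h ?_
      rw [mem_fib] at hw hw'
      exact hw.symm.trans hw'
  have h3 : ∀ w, w ∈ x.pts.flatMap s.fib := by
    intro w
    rw [List.mem_flatMap]
    exact ⟨⟨w.1, s.p w.1 w.2⟩, x.mem_pts _, (s.mem_fib _ w).2 rfl⟩
  exact (s.whisker.eq_pts h1 h2 h3).symm

lemma card_newIntervals : s.newIntervals.card = j := by
  have h2 : s.newIntervals = Finset.univ.sigma fun ν => Finset.univ.filter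
      fun b : Fin (s.size ν) => s.p ν b.castSucc = s.p ν b.succ := by
    ext ⟨ν, b⟩
    simp [newIntervals]
  rw [h2, Finset.card_sigma]
  refine Eq.trans ?_ s.total
  refine Finset.sum_congr rfl fun ν _ => ?_
  rw [Finset.card_eq_sum_card_fiberwise (f := fun b : Fin (s.size ν) => s.p ν b.succ)
    (t := Finset.univ) (fun _ _ => by simp)]
  refine Finset.sum_congr rfl fun i _ => ?_
  rw [Finset.filter_filter, card_new_fiber _ (s.surj ν)]

/-- There are `j` new intervals altogether and `W` counts those that end at or before the point; the
co-level therefore counts those that end after it. -/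
lemma whisker_level {l₁ l₂ : List (Pts s.size)} {w : Pts s.size}
    (h : s.whisker.pts = l₁ ++ w :: l₂) : l₂.countP s.isNew = j - (s.whisker.W w : ℕ) := by
  classical
  have hd : (l₁ ++ w :: l₂ : List (Pts s.size)).Nodup := h ▸ s.whisker.nodup_pts
  have hm : ∀ w' : Pts s.size, w' ∈ l₂ ↔ s.rel w w' ∧ w ≠ w' := s.whisker.mem_after h
  rw [List.nodup_append, List.nodup_cons] at hd
  have h1 : (s.whisker.W w : ℕ) =
      (s.newIntervals.filter fun y => s.rel ⟨y.1, y.2.succ⟩ w).card := rfl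
  have h2 := Finset.card_filter_add_card_filter_not
    (s := s.newIntervals) (fun y => s.rel ⟨y.1, y.2.succ⟩ w)
  rw [card_newIntervals] at h2
  have h3 : l₂.countP s.isNew =
      (s.newIntervals.filter fun y => ¬ s.rel ⟨y.1, y.2.succ⟩ w).card := by
    rw [List.countP_eq_length_filter, ← List.toFinset_card_of_nodup (hd.2.1.2.filter _)]
    symm
    apply Finset.card_bij fun y _ => (⟨y.1, y.2.succ⟩ : Pts s.size)
    · rintro ⟨ν, c⟩ hy
      rw [Finset.mem_filter] at hy
      rw [List.mem_toFinset, List.mem_filter, hm]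
      refine ⟨⟨(s.rel_total _ _).resolve_right hy.2, fun e => hy.2 ?_⟩, ?_⟩
      · rw [← e]
        exact s.rel_refl _
      · rw [isNew, decide_eq_true_eq]
        exact ⟨c, rfl, (Finset.mem_filter.1 hy.1).2⟩
    · rintro ⟨ν, c⟩ _ ⟨ν', c'⟩ _ e
      have e1 : ν = ν' := congrArg Sigma.fst e
      subst e1
      have e2 : c.succ = c'.succ := eq_of_heq (Sigma.mk.inj e).2
      rw [Fin.succ_injective _ e2]
    · rintro ⟨ν, b⟩ hb
      rw [List.mem_toFinset, List.mem_filter, hm, isNew, decide_eq_true_eq] at hb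
      obtain ⟨⟨hle, hne⟩, hb⟩ := hb
      obtain ⟨c, rfl, hc⟩ : ∃ c : Fin (s.size ν), b = c.succ ∧ s.p ν c.castSucc = s.p ν c.succ := hb
      refine ⟨⟨ν, c⟩, ?_, rfl⟩
      rw [Finset.mem_filter, newIntervals, Finset.mem_filter]
      exact ⟨⟨Finset.mem_univ _, hc⟩, fun h => hne (s.rel_antisymm hle h)⟩
  omega

lemma word_whisker : s.whisker.word = withLevels (repeated Sigma.fst s.mult x.pts) := by
  have h1 : repeated Sigma.fst s.mult x.pts =
      s.whisker.pts.map fun w : Pts s.size => (w.1, s.isNew w) := by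
    rw [pts_whisker, List.map_flatMap, repeated]
    exact List.flatMap_congr fun z _ => (s.map_fib z).symm
  have h2 : ∀ l₂ l₁ : List (Pts s.size), s.whisker.pts = l₁ ++ l₂ →
      l₂.map s.whisker.entry = withLevels (l₂.map fun w => (w.1, s.isNew w)) := by
    intro l₂
    induction l₂ with
    | nil => exact fun _ _ => rfl
    | cons w l₂ ih =>
      intro l₁ h
      have h' : s.whisker.pts = (l₁ ++ [w] ++ l₂ : List (Pts s.size)) := by
        rw [List.append_assoc]
        exact h
      have e : s.whisker.entry w = (w.1, l₂.countP s.isNew) :=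
        congrArg (Prod.mk w.1) (s.whisker_level h).symm
      refine Eq.trans (congrArg₂ List.cons e (ih (l₁ ++ [w]) h')) ?_
      rw [List.map_cons, withLevels, List.countP_map]
      rfl
  rw [h1, SeqElt.word]
  exact h2 _ [] rfl

end Insertion
end Breq

namespace Breq

/-! ### The signs of the whiskerings -/

namespace SeqElt

variable {U : Disk} {j : ℕ}

/-- By `le_brace` all of `I_a` lies before `I_b`, after it, or in one gap of it, so the points of
`I_a` cannot be told apart by comparison with a point of `I_b`. -/
lemma le_right_iff (y : SeqElt U j) {a b : U.F} (h : U.π a < U.π b) (c : Fin (y.n b + 1))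
    (i i' : Fin (y.n a + 1)) : y.le ⟨b, c⟩ ⟨a, i⟩ ↔ y.le ⟨b, c⟩ ⟨a, i'⟩ := by
  have hne : a ≠ b := fun e => h.ne (congrArg U.π e)
  have hn : ∀ i, y.le ⟨a, i⟩ ⟨b, c⟩ → ¬ y.le ⟨b, c⟩ ⟨a, i⟩ := fun i h1 h2 =>
    hne (congrArg Sigma.fst (y.le_antisymm _ _ h1 h2))
  rcases y.le_brace a b h with H | H | ⟨m, -, H⟩
  · exact iff_of_false (hn _ (H _ _)) (hn _ (H _ _))
  · exact iff_of_true (H _ _) (H _ _)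
  · by_cases hc : (c : ℕ) ≤ m
    · exact iff_of_true ((H _ _).1 hc) ((H _ _).1 hc)
    · exact iff_of_false (hn _ ((H _ _).2 (not_le.1 hc))) (hn _ ((H _ _).2 (not_le.1 hc)))

open Classical in
-- Leaves in one column are never inverted, by `le_column`, so only pairs `a <₀ b` contribute. By
-- `le_right_iff` all points of `I_a` have the same predecessors in `I_b`, which makes the base
-- points `i₀` arbitrary.
lemma inversions_eq (y : SeqElt U j) (i₀ : ∀ a, Fin (y.n a + 1)) : y.inversions =
    ∑ a, ∑ b, iv (U.π a < U.π b) * ((y.n a + 1) * ∑ c, iv (y.le ⟨b, c⟩ ⟨a, i₀ a⟩)) := by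
  rw [inversions, Fintype.sum_sigma]
  have h : ∀ (b : U.F) (c : Fin (y.n b + 1)), ∑ z' : Pts y.n, iv (y.le ⟨b, c⟩ z' ∧ z'.1 < b) =
      ∑ a, iv (U.π a < U.π b) * ((y.n a + 1) * iv (y.le ⟨b, c⟩ ⟨a, i₀ a⟩)) := by
    intro b c
    rw [Fintype.sum_sigma]
    refine Finset.sum_congr rfl fun a _ => ?_
    by_cases hab : U.π a < U.π b
    · have h1 : a < b := by
        by_contra h
        exact absurd (U.mono (not_lt.1 h)) (not_le.2 hab)
      have h2 : ∀ i, iv (y.le ⟨b, c⟩ ⟨a, i⟩ ∧ a < b) = iv (y.le ⟨b, c⟩ ⟨a, i₀ a⟩) := fun i =>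
        iv_congr ((and_iff_left h1).trans (y.le_right_iff hab c i (i₀ a)))
      rw [Finset.sum_congr rfl fun i _ => h2 i, Finset.sum_const, Finset.card_univ,
        Fintype.card_fin, nsmul_eq_mul]
      simp [iv, hab]
    · have h2 : ∀ i, iv (y.le ⟨b, c⟩ ⟨a, i⟩ ∧ a < b) = 0 := by
        intro i
        rw [iv, if_neg]
        rintro ⟨hle, hlt⟩
        have hc := _root_.le_antisymm (U.mono hlt.le) (not_lt.1 hab)
        have := y.le_antisymm _ _ hle (y.le_column a b hc hlt i c)
        exact hlt.ne (congrArg Sigma.fst this).symm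
      rw [Finset.sum_congr rfl fun i _ => h2 i]
      simp [iv, hab]
  have h' : ∀ b, ∑ c, ∑ z' : Pts y.n, iv (y.le ⟨b, c⟩ z' ∧ z'.1 < b) =
      ∑ a, iv (U.π a < U.π b) * ((y.n a + 1) * ∑ c, iv (y.le ⟨b, c⟩ ⟨a, i₀ a⟩)) := by
    intro b
    rw [Finset.sum_congr rfl fun c _ => h b c, Finset.sum_comm]
    simp only [Finset.mul_sum]
  exact (Finset.sum_congr rfl fun b _ => h' b).trans Finset.sum_comm

end SeqElt

/-- The number of the ordered pairs of elements of a totally ordered finite set. -/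
lemma sum_total_order {T : Type*} (S : Finset T) (r : T → T → Prop) [∀ a b, Decidable (r a b)]
    (hr : ∀ a, r a a) (ht : ∀ a b, r a b ∨ r b a) (ha : ∀ a b, r a b → r b a → a = b) :
    ∑ a ∈ S, ∑ b ∈ S, iv (r a b) = ((S.card + 1).choose 2 : ℕ) := by
  classical
  induction S using Finset.induction_on with
  | empty => simp
  | insert t S hS ih =>
    have h1 : ∀ a ∈ S, iv (r a t) + iv (r t a) = 1 := by
      intro a hm
      have h2 := ht a t
      have h3 : ¬ (r a t ∧ r t a) := fun h => hS (ha a t h.1 h.2 ▸ hm)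
      unfold iv
      grind
    rw [Finset.sum_insert hS, Finset.sum_insert hS, Finset.card_insert_of_notMem hS,
      Finset.sum_congr rfl fun a _ => Finset.sum_insert hS, Finset.sum_add_distrib, ih]
    have h2 := Finset.sum_congr rfl h1
    rw [Finset.sum_add_distrib, Finset.sum_const, nsmul_eq_mul, mul_one] at h2
    have h4 : iv (r t t) = 1 := by simp [iv, hr]
    rw [h4, Nat.choose_succ_succ' (S.card + 1), Nat.choose_one_right]
    push_cast
    linear_combination h2

namespace Insertion

variable {U : Disk} {x : SeqElt U 0} {j : ℕ} (s : Insertion x j)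

/-- The truth value of an elementary interval being new. -/
def nw (y : Σ ν, Fin (s.size ν)) : ZMod 2 := iv (s.p y.1 y.2.castSucc = s.p y.1 y.2.succ)

/-- The parity of the number of the new intervals of a letter. -/
def nwSum (a : U.F) : ZMod 2 := ∑ c : Fin (s.size a), s.nw ⟨a, c⟩

open Classical in
/-- The parity of the number of the new intervals of `I'_b` that precede `I'_a`. -/
noncomputable def nwBefore (a b : U.F) : ZMod 2 :=
  ∑ c : Fin (s.size b), s.nw ⟨b, c⟩ * iv (s.rel ⟨b, c.succ⟩ ⟨a, 0⟩)

lemma sum_pts_succ (n : U.F → ℕ) (g : Pts n → ZMod 2) :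
    ∑ w, g w = ∑ c, g ⟨c, 0⟩ + ∑ y : Σ ν, Fin (n ν), g ⟨y.1, y.2.succ⟩ := by
  rw [Fintype.sum_sigma, Fintype.sum_sigma, ← Finset.sum_add_distrib]
  exact Finset.sum_congr rfl fun ν _ => Fin.sum_univ_succ _

lemma size_cast (a : U.F) : (s.size a : ZMod 2) = x.n a + s.nwSum a := by
  have h := sum_comp_mono (s.p a) (s.surj a) fun _ => 1
  simp only [mul_one, Finset.sum_const, Finset.card_univ, Fintype.card_fin, nsmul_eq_mul] at h
  push_cast at h
  change _ = _ + s.nwSum a at h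
  linear_combination h

lemma sum_mult_eq (a : U.F) :
    ∑ i, (((Finset.univ.filter fun c => s.p a c = i).card - 1 : ℕ) : ZMod 2) = s.nwSum a := by
  have h := sum_mult (s.p a) (s.surj a) fun _ => 1
  simp only [mul_one] at h
  exact h

open Classical in
lemma mem_before {a b : U.F} (h : U.π a < U.π b) (c : Fin (s.size b + 1)) :
    c ∈ s.before a b ↔ s.rel ⟨b, c⟩ ⟨a, 0⟩ := by
  rw [before, Finset.mem_filter, and_iff_right (Finset.mem_univ _)]
  exact ⟨fun h => h 0, fun h' i => (s.pulled.le_right_iff h c 0 i).1 h'⟩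

open Classical in
-- The number of elements of `I'_b` before `I'_a` is `r + 1`. Up to the last bracket, `n_{a,b}` is
-- the change that the insertion makes to the inversions between `a` and `b`. The bracket is linear
-- in the new intervals: those of `a`, when some point of `I'_b` comes before `I'_a`, and those of
-- `b` before `I'_a`.
lemma pairSign_eq {a b : U.F} (h : U.π a < U.π b) : (s.pairSign a b : ZMod 2) =
    (s.size a + 1) * ∑ c, iv (s.rel ⟨b, c⟩ ⟨a, 0⟩) +
      (x.n a + 1) * ∑ c, iv (x.le ⟨b, c⟩ ⟨a, s.p a 0⟩) +
      (iv (s.rel ⟨b, 0⟩ ⟨a, 0⟩) * s.nwSum a + s.nwBefore a b) := by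
  have hne : b ≠ a := fun e => h.ne (congrArg U.π e.symm)
  have hq : ∑ c, iv (s.rel ⟨b, c⟩ ⟨a, 0⟩) =
      ∑ c, iv (x.le ⟨b, c⟩ ⟨a, s.p a 0⟩) + s.nwBefore a b := by
    have h1 := sum_comp_mono (s.p b) (s.surj b) fun i => iv (x.le ⟨b, i⟩ ⟨a, s.p a 0⟩)
    rw [nwBefore, Finset.sum_congr rfl fun c _ => iv_congr (s.rel_of_ne hne c 0), h1]
    congr 1
    refine Finset.sum_congr rfl fun c _ => ?_
    rw [iv_congr (s.rel_of_ne hne c.succ 0)]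
    rfl
  have hm := fun c => s.mem_before h c
  rw [s.size_cast, hq, pairSign]
  by_cases hb : (s.before a b).Nonempty
  · rw [dif_pos hb]
    set r := (s.before a b).max' hb with hr
    have hIic : s.before a b = Finset.Iic r := by
      ext c
      rw [Finset.mem_Iic]
      refine ⟨fun hc => Finset.le_max' _ _ hc, fun hc => (hm c).2 ?_⟩
      exact s.pulled.le_trans _ _ _ (s.pulled.le_color b c r hc) ((hm r).1 (Finset.max'_mem _ hb))
    have hrc : ∑ c, iv (s.rel ⟨b, c⟩ ⟨a, 0⟩) = (r : ℕ) + 1 := by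
      rw [Finset.sum_congr rfl fun c _ => iv_congr (hm c).symm, hIic]
      simp only [iv, Finset.sum_boole]
      rw [Finset.filter_mem_eq_inter, Finset.univ_inter, Fin.card_Iic]
      push_cast
      rfl
    have h0 : iv (s.rel ⟨b, 0⟩ ⟨a, 0⟩) = 1 := by
      rw [iv, if_pos]
      rw [← hm, hIic, Finset.mem_Iic]
      exact Fin.zero_le _
    have hB : ∑ i : Fin (x.n b + 1) with i ≤ s.p b r,
        (((Finset.univ.filter fun c => s.p b c = i).card - 1 : ℕ) : ZMod 2) = s.nwBefore a b := by
      have h1 := sum_mult (s.p b) (s.surj b) fun i => iv (i ≤ s.p b r)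
      rw [sum_filter_iv, Finset.sum_congr rfl fun i _ => mul_comm _ _, h1, nwBefore]
      refine Finset.sum_congr rfl fun c _ => ?_
      congr 1
      refine iv_congr ?_
      rw [s.rel_of_ne hne]
      constructor
      · intro hle
        refine x.le_trans _ _ _ (x.le_color b _ _ hle) ?_
        rw [← s.rel_of_ne hne, ← hm]
        exact Finset.max'_mem _ hb
      · intro hle
        refine (s.p b).monotone ?_
        rw [← Finset.mem_Iic, ← hIic, hm, s.rel_of_ne hne]
        exact hle
    rw [hrc] at hq
    push_cast
    rw [← Finset.sum_mul, hB, ← Finset.mul_sum, s.sum_mult_eq, h0]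
    have e2 : (2 : ZMod 2) = 0 := by decide
    linear_combination (s.nwSum a) * hq - ((x.n a + 1) * ∑ c, iv (x.le ⟨b, c⟩ ⟨a, s.p a 0⟩) +
      s.nwSum a + s.nwBefore a b) * e2
  · rw [dif_neg hb]
    have h1 : ∀ c, ¬ s.rel ⟨b, c⟩ ⟨a, 0⟩ := fun c hc => hb ⟨c, (hm c).2 hc⟩
    have h2 : s.nwBefore a b = 0 := Finset.sum_eq_zero fun c _ => by
      rw [iv, if_neg (h1 _), mul_zero]
    have h3 : ∑ c, iv (s.rel ⟨b, c⟩ ⟨a, 0⟩) = 0 := Finset.sum_eq_zero fun c _ => by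
      rw [iv, if_neg (h1 _)]
    rw [h3, h2, add_zero] at hq
    rw [← hq, h2, iv, if_neg (h1 0)]
    simp

lemma sum_newIntervals (g : (Σ ν, Fin (s.size ν)) → ZMod 2) :
    ∑ y ∈ s.newIntervals, g y = ∑ y, s.nw y * g y := by
  rw [newIntervals, sum_filter_iv]
  rfl

lemma sum_nw : ∑ y, s.nw y = j := by
  have h := s.sum_newIntervals fun _ => 1
  rw [Finset.sum_const, s.card_newIntervals, nsmul_eq_mul, mul_one] at h
  simpa using h.symm

open Classical in
-- Replacing the old intervals by all intervals adds the ordered pairs of new ones. Each new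
-- interval is also compared with itself, hence `(j + 1).choose 2` rather than `j.choose 2`.
lemma shuffleSign_eq : (s.shuffleSign : ZMod 2) =
    ∑ y, s.nw y * ∑ y' : Σ ν, Fin (s.size ν), iv (s.rel ⟨y.1, y.2.succ⟩ ⟨y'.1, y'.2.succ⟩) +
      ((j + 1).choose 2 : ℕ) := by
  have h1 := sum_total_order s.newIntervals
    (fun y y' => s.rel ⟨y.1, y.2.succ⟩ ⟨y'.1, y'.2.succ⟩) (fun _ => s.rel_refl _)
    (fun _ _ => s.rel_total _ _) (by
      rintro ⟨ν, c⟩ ⟨ν', c'⟩ h h'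
      have e := s.rel_antisymm h h'
      have e1 : ν = ν' := congrArg Sigma.fst e
      subst e1
      have e2 : c.succ = c'.succ := eq_of_heq (Sigma.mk.inj e).2
      rw [Fin.succ_injective _ e2])
  rw [s.card_newIntervals] at h1
  have h2 : ∀ y : Σ ν, Fin (s.size ν),
      ∑ y' : Σ ν, Fin (s.size ν), iv (s.rel ⟨y.1, y.2.succ⟩ ⟨y'.1, y'.2.succ⟩) =
      ∑ y' ∈ s.newIntervals, iv (s.rel ⟨y.1, y.2.succ⟩ ⟨y'.1, y'.2.succ⟩) +
      ∑ y' ∈ s.oldIntervals, iv (s.rel ⟨y.1, y.2.succ⟩ ⟨y'.1, y'.2.succ⟩) := fun y =>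
    (Finset.sum_filter_add_sum_filter_not _ _ _).symm
  rw [Finset.sum_congr rfl fun y _ => congrArg (s.nw y * ·) (h2 y), ← h1, ← s.sum_newIntervals,
    Finset.sum_add_distrib, shuffleSign, Finset.card_filter, Finset.sum_product, Nat.cast_sum]
  simp only [Nat.cast_sum, Nat.cast_ite, Nat.cast_one, Nat.cast_zero]
  rw [add_right_comm, CharTwo.add_self_eq_zero, zero_add]
  rfl

open Classical in
lemma sum_W_whisker : ∑ w : Pts s.size, ((s.whisker.W w : ℕ) : ZMod 2) =
    ∑ y, s.nw y * (∑ c, iv (s.rel ⟨y.1, y.2.succ⟩ ⟨c, 0⟩) +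
      ∑ y' : Σ ν, Fin (s.size ν), iv (s.rel ⟨y.1, y.2.succ⟩ ⟨y'.1, y'.2.succ⟩)) := by
  have h1 : ∀ w : Pts s.size, ((s.whisker.W w : ℕ) : ZMod 2) =
      ∑ y, s.nw y * iv (s.rel ⟨y.1, y.2.succ⟩ w) := by
    intro w
    rw [← s.sum_newIntervals]
    change (((s.newIntervals.filter fun y => s.rel ⟨y.1, y.2.succ⟩ w).card : ℕ) : ZMod 2) = _
    simp [iv]
  rw [Finset.sum_congr rfl fun w _ => h1 w, Finset.sum_comm]
  refine Finset.sum_congr rfl fun y _ => ?_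
  rw [← Finset.mul_sum, sum_pts_succ]

open Classical in
lemma sum_pairSign : ((∑ a, ∑ b with U.π a < U.π b, s.pairSign a b : ℕ) : ZMod 2) =
    s.whisker.inversions + x.inversions +
      ∑ y, s.nw y * ∑ c, (iv (U.π y.1 < U.π c) * iv (s.rel ⟨c, 0⟩ ⟨y.1, y.2.succ⟩) +
        iv (U.π c < U.π y.1) * iv (s.rel ⟨y.1, y.2.succ⟩ ⟨c, 0⟩)) := by
  have h1 : s.whisker.inversions = _ := s.whisker.inversions_eq fun _ => 0
  have h2 : x.inversions = _ := x.inversions_eq fun a => s.p a 0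
  have h3 : ∑ y, s.nw y * ∑ c, (iv (U.π y.1 < U.π c) * iv (s.rel ⟨c, 0⟩ ⟨y.1, y.2.succ⟩) +
        iv (U.π c < U.π y.1) * iv (s.rel ⟨y.1, y.2.succ⟩ ⟨c, 0⟩)) =
      ∑ a, ∑ b, iv (U.π a < U.π b) *
        (iv (s.rel ⟨b, 0⟩ ⟨a, 0⟩) * s.nwSum a + s.nwBefore a b) := by
    have h4 : ∑ y, s.nw y * ∑ c, iv (U.π y.1 < U.π c) * iv (s.rel ⟨c, 0⟩ ⟨y.1, y.2.succ⟩) =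
        ∑ a, ∑ b, iv (U.π a < U.π b) * (iv (s.rel ⟨b, 0⟩ ⟨a, 0⟩) * s.nwSum a) := by
      rw [Fintype.sum_sigma]
      refine Finset.sum_congr rfl fun a _ => ?_
      simp only [Finset.mul_sum, nwSum]
      rw [Finset.sum_comm]
      refine Finset.sum_congr rfl fun b _ => Finset.sum_congr rfl fun c _ => ?_
      by_cases h : U.π a < U.π b
      · have e : s.rel ⟨b, 0⟩ ⟨a, c.succ⟩ ↔ s.rel ⟨b, 0⟩ ⟨a, 0⟩ := s.pulled.le_right_iff h 0 c.succ 0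
        rw [iv_congr e]
        ring
      · simp [iv, h]
    have h5 : ∑ y, s.nw y * ∑ c, iv (U.π c < U.π y.1) * iv (s.rel ⟨y.1, y.2.succ⟩ ⟨c, 0⟩) =
        ∑ a, ∑ b, iv (U.π a < U.π b) * s.nwBefore a b := by
      rw [Finset.sum_comm, Fintype.sum_sigma]
      refine Finset.sum_congr rfl fun b _ => ?_
      simp only [Finset.mul_sum, nwBefore]
      rw [Finset.sum_comm]
      refine Finset.sum_congr rfl fun a _ => Finset.sum_congr rfl fun c _ => ?_
      ring
    simp only [mul_add, Finset.sum_add_distrib]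
    rw [← h4, ← h5]
  rw [h1, h2, h3, ← Finset.sum_add_distrib, ← Finset.sum_add_distrib, Nat.cast_sum]
  refine Finset.sum_congr rfl fun a _ => ?_
  rw [← Finset.sum_add_distrib, ← Finset.sum_add_distrib, Nat.cast_sum, sum_filter_iv]
  refine Finset.sum_congr rfl fun b _ => ?_
  by_cases h : U.π a < U.π b
  · rw [s.pairSign_eq h, ← mul_add, ← mul_add]
    rfl
  · simp [iv, h]

/-- In `eta` the inversions account for the numbers `n_{a,b}` and the levels for `h_s`. The
remaining terms are linear in the new intervals, and the contribution of every single interval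
vanishes. -/
lemma sign_add_eta : (s.sign : ZMod 2) + s.whisker.eta = x.eta := by
  classical
  have h1 : ∑ w : Pts s.size, SeqElt.rank w.1 =
      ∑ z : Pts x.n, SeqElt.rank z.1 + ∑ y, s.nw y * SeqElt.rank y.1 := by
    rw [SeqElt.sum_pts_fst, SeqElt.sum_pts_fst, Fintype.sum_sigma, ← Finset.sum_add_distrib]
    refine Finset.sum_congr rfl fun a _ => ?_
    have e : ∑ c, s.nw ⟨a, c⟩ * SeqElt.rank a = s.nwSum a * SeqElt.rank a :=
      (Finset.sum_mul ..).symm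
    rw [s.size_cast, e]
    ring
  have h2 : ∑ w : Pts s.size, (SeqElt.rank w.1 + ((s.whisker.W w : ℕ) : ZMod 2)) =
      ∑ z : Pts x.n, SeqElt.rank z.1 + ∑ y, s.nw y * SeqElt.rank y.1 +
      ∑ y, s.nw y * (∑ c, iv (s.rel ⟨y.1, y.2.succ⟩ ⟨c, 0⟩) +
      ∑ y' : Σ ν, Fin (s.size ν), iv (s.rel ⟨y.1, y.2.succ⟩ ⟨y'.1, y'.2.succ⟩)) := by
    rw [Finset.sum_add_distrib, h1, s.sum_W_whisker]
  have h3 : ∑ z : Pts x.n, (SeqElt.rank z.1 + ((x.W z : ℕ) : ZMod 2)) =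
      ∑ z : Pts x.n, SeqElt.rank z.1 := by
    refine Finset.sum_congr rfl fun z _ => ?_
    have : (x.W z : ℕ) = 0 := by omega
    rw [this, Nat.cast_zero, add_zero]
  have h4 : s.whisker.eta = s.whisker.inversions +
      ∑ w : Pts s.size, (SeqElt.rank w.1 + ((s.whisker.W w : ℕ) : ZMod 2)) + (j.choose 2 : ℕ) +
      j * Fintype.card U.F := rfl
  -- For a fixed new interval the remaining terms form a sum over leaves `c`, and each leaf
  -- contributes zero, according to where its column and its first point lie relative to the
  -- interval. The final `1` belongs to the leaf of the interval itself.
  have key : ∀ y : Σ ν, Fin (s.size ν),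
      ∑ c, (iv (U.π y.1 < U.π c) * iv (s.rel ⟨c, 0⟩ ⟨y.1, y.2.succ⟩) +
        iv (U.π c < U.π y.1) * iv (s.rel ⟨y.1, y.2.succ⟩ ⟨c, 0⟩)) +
      ∑ c, iv (s.rel ⟨y.1, y.2.succ⟩ ⟨c, 0⟩) + SeqElt.rank y.1 + Fintype.card U.F + 1 = 0 := by
    rintro ⟨a, c'⟩
    have hone : ∑ c, iv (c = a) = 1 := by simp [iv]
    have hcard : (Fintype.card U.F : ZMod 2) = ∑ _c : U.F, 1 := by simp
    rw [← hone, hcard, SeqElt.rank, ← Finset.sum_add_distrib, ← Finset.sum_add_distrib,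
      ← Finset.sum_add_distrib, ← Finset.sum_add_distrib]
    refine Finset.sum_eq_zero fun c _ => ?_
    have f1 := s.rel_total ⟨c, 0⟩ ⟨a, c'.succ⟩
    have f2 : s.rel ⟨c, 0⟩ ⟨a, c'.succ⟩ → s.rel ⟨a, c'.succ⟩ ⟨c, 0⟩ → c = a := fun h h' =>
      congrArg Sigma.fst (s.rel_antisymm h h')
    have f3 : c = a → ¬ s.rel ⟨a, c'.succ⟩ ⟨c, 0⟩ := by
      rintro rfl
      rw [s.rel_color]
      exact not_le.2 (Fin.succ_pos _)
    have f4 : U.π c = U.π a → c < a → s.rel ⟨c, 0⟩ ⟨a, c'.succ⟩ := fun h h' =>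
      s.pulled.le_column c a h h' _ _
    have f5 : U.π c = U.π a → a < c → s.rel ⟨a, c'.succ⟩ ⟨c, 0⟩ := fun h h' =>
      s.pulled.le_column a c h.symm h' _ _
    have f6 : c < a → U.π c ≤ U.π a := fun h => U.mono h.le
    have f7 : a < c → U.π a ≤ U.π c := fun h => U.mono h.le
    have f8 := lt_trichotomy c a
    have f9 : c = a → U.π c = U.π a := fun h => congrArg U.π h
    change iv (U.π a < U.π c) * iv (s.rel ⟨c, 0⟩ ⟨a, c'.succ⟩) +
        iv (U.π c < U.π a) * iv (s.rel ⟨a, c'.succ⟩ ⟨c, 0⟩) +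
      iv (s.rel ⟨a, c'.succ⟩ ⟨c, 0⟩) + iv (c < a) + 1 + iv (c = a) = 0
    unfold iv
    generalize s.rel ⟨c, 0⟩ ⟨a, c'.succ⟩ = p at *
    generalize s.rel ⟨a, c'.succ⟩ ⟨c, 0⟩ = q at *
    generalize U.π c = u at *
    generalize U.π a = v at *
    clear h1 h2 h3 h4 hone hcard
    grind
  have hkey : ∑ y, s.nw y * (∑ c, (iv (U.π y.1 < U.π c) * iv (s.rel ⟨c, 0⟩ ⟨y.1, y.2.succ⟩) +
        iv (U.π c < U.π y.1) * iv (s.rel ⟨y.1, y.2.succ⟩ ⟨c, 0⟩)) +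
      ∑ c, iv (s.rel ⟨y.1, y.2.succ⟩ ⟨c, 0⟩) + SeqElt.rank y.1 + Fintype.card U.F + 1) = 0 :=
    Finset.sum_eq_zero fun y _ => by rw [key y, mul_zero]
  have h5 : (((j + 1).choose 2 : ℕ) : ZMod 2) = j + (j.choose 2 : ℕ) := by
    rw [Nat.choose_succ_succ', Nat.choose_one_right, Nat.cast_add]
  have e2 : (2 : ZMod 2) = 0 := by decide
  rw [h4, h2, sign, Nat.cast_add, s.sum_pairSign, s.shuffleSign_eq, SeqElt.eta, h3, h5]
  simp only [mul_add, Finset.sum_add_distrib, ← Finset.sum_mul, mul_one, s.sum_nw] at hkey ⊢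
  simp only [Nat.choose_zero_succ, Nat.cast_zero, zero_mul, add_zero]
  linear_combination hkey + (s.whisker.inversions + (j.choose 2 : ℕ) +
    ∑ y, s.nw y * ∑ y' : Σ ν, Fin (s.size ν), iv (s.rel ⟨y.1, y.2.succ⟩ ⟨y'.1, y'.2.succ⟩)) * e2

end Insertion
end Breq

namespace Breq

/-! ### Insertions and multiplicities -/

section monotone

variable {m : ℕ}

lemma card_lt_eq {n : ℕ} (p : Fin (n + 1) →o Fin (m + 1)) (i : Fin (m + 1)) :
    (Finset.univ.filter fun b => p b < i).card =
      ∑ i' ∈ Finset.Iio i, (Finset.univ.filter fun b => p b = i').card := by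
  rw [Finset.card_eq_sum_card_fiberwise (f := p) (t := Finset.Iio i) (fun b hb => by
    simpa using hb)]
  refine Finset.sum_congr rfl fun i' hi' => ?_
  rw [Finset.filter_filter]
  congr 1
  ext b
  simp only [Finset.mem_filter, Finset.mem_univ, true_and, and_iff_right_iff_imp]
  rintro rfl
  simpa using hi'

lemma card_eq_sum_fiber {n : ℕ} (p : Fin (n + 1) →o Fin (m + 1)) :
    n + 1 = ∑ i, (Finset.univ.filter fun b => p b = i).card := by
  have := Finset.card_eq_sum_card_fiberwise (f := p) (s := Finset.univ)
    (t := Finset.univ) (fun _ _ => by simp)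
  simpa using this

/-- If `p b < p' b`, then the points that `p'` sends below `p' b` form a proper subset of those that
`p` sends there, as `b` shows; but both sets have the size prescribed by the fibres. -/
lemma monotone_ext {n : ℕ} {p p' : Fin (n + 1) →o Fin (m + 1)}
    (h : ∀ i, (Finset.univ.filter fun b => p b = i).card =
      (Finset.univ.filter fun b => p' b = i).card) : p = p' := by
  have key : ∀ {p p' : Fin (n + 1) →o Fin (m + 1)}
      (_ : ∀ i, (Finset.univ.filter fun b => p b = i).card =
        (Finset.univ.filter fun b => p' b = i).card) (b), ¬ p b < p' b := by
    intro p p' h b hb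
    have h1 : (Finset.univ.filter fun c => p' c < p' b) ⊂ Finset.univ.filter fun c => p c < p' b := by
      rw [Finset.ssubset_iff_of_subset]
      · exact ⟨b, by simpa using hb, by simp⟩
      · intro c hc
        simp only [Finset.mem_filter, Finset.mem_univ, true_and] at hc ⊢
        have : c < b := by
          by_contra hcb
          exact absurd (p'.monotone (not_lt.1 hcb)) (not_le.2 hc)
        exact lt_of_le_of_lt (p.monotone this.le) hb
    have h2 := Finset.card_lt_card h1
    rw [card_lt_eq, card_lt_eq, Finset.sum_congr rfl fun i _ => h i] at h2
    exact lt_irrefl _ h2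
  ext b
  exact congrArg Fin.val
    (le_antisymm (not_lt.1 (key (fun i => (h i).symm) b)) (not_lt.1 (key h b)))

/-- The lexicographic sum of the ordinals `[M i]` is a finite linear order, hence isomorphic to an
ordinal `[n]`, and the map is the projection to the index. -/
lemma exists_fibers (M : Fin (m + 1) → ℕ) : ∃ (n : ℕ) (p : Fin (n + 1) →o Fin (m + 1)),
    ∀ i, (Finset.univ.filter fun b => p b = i).card = M i + 1 := by
  have hc : Fintype.card (Σₗ i : Fin (m + 1), Fin (M i + 1)) = (∑ i, M i + m) + 1 := by
    rw [Fintype.card_lex, Fintype.card_sigma]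
    simp [Finset.sum_add_distrib, add_assoc]
  let e := monoEquivOfFin (Σₗ i : Fin (m + 1), Fin (M i + 1)) hc
  refine ⟨_, ⟨fun b => (ofLex (e b)).1, fun b b' h => ?_⟩, fun i => ?_⟩
  · have h1 := e.monotone h
    rcases Sigma.Lex.le_def.1 h1 with h2 | ⟨h2, -⟩
    · exact h2.le
    · exact h2.le
  · change (Finset.univ.filter fun b => (ofLex (e b)).1 = i).card = _
    rw [Finset.card_filter]
    refine (Equiv.sum_comp (e.toEquiv.trans ofLex)
      (fun a : Σ i : Fin (m + 1), Fin (M i + 1) => if a.1 = i then 1 else 0)).trans ?_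
    rw [Fintype.sum_sigma, Finset.sum_eq_single i]
    · simp
    · intro i' _ hi
      simp [hi]
    · simp

end monotone

namespace Insertion

variable {U : Disk} {x : SeqElt U 0} {j : ℕ}

lemma card_fiber (s : Insertion x j) (ν : U.F) (i : Fin (x.n ν + 1)) :
    (Finset.univ.filter fun b => s.p ν b = i).card = s.mult ⟨ν, i⟩ + 1 := by
  obtain ⟨b, hb⟩ := s.surj ν i
  have : 0 < (Finset.univ.filter fun b => s.p ν b = i).card :=
    Finset.card_pos.2 ⟨b, by simpa using hb⟩
  change _ = (Finset.univ.filter fun b => s.p ν b = i).card - 1 + 1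
  omega

lemma size_eq (s : Insertion x j) (ν : U.F) : s.size ν = ∑ i, s.mult ⟨ν, i⟩ + x.n ν := by
  have h := card_eq_sum_fiber (s.p ν)
  rw [Finset.sum_congr rfl fun i _ => s.card_fiber ν i, Finset.sum_add_distrib] at h
  simp only [Finset.sum_const, Finset.card_univ, Fintype.card_fin, smul_eq_mul, mul_one] at h
  omega

lemma sum_mult_total (s : Insertion x j) : ∑ z, s.mult z = j := by
  rw [Fintype.sum_sigma]
  exact s.total

lemma deg_whisker (s : Insertion x j) : s.whisker.deg = x.deg := by
  have h : ∑ ν, s.size ν = j + ∑ ν, x.n ν := by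
    have h := s.sum_mult_total
    rw [Fintype.sum_sigma] at h
    rw [Finset.sum_congr rfl fun ν _ => s.size_eq ν, Finset.sum_add_distrib, h]
  have h' : ∑ ν, (s.size ν : ℤ) = j + ∑ ν, (x.n ν : ℤ) := by exact_mod_cast h
  change (j : ℤ) - ∑ ν, (s.size ν : ℤ) = ((0 : ℕ) : ℤ) - ∑ ν, (x.n ν : ℤ)
  rw [h']
  push_cast
  ring

lemma mult_injective : Function.Injective (mult : Insertion x j → Pts x.n → ℕ) := by
  intro s s' h
  have hs : s.size = s'.size := by
    funext ν
    rw [s.size_eq, s'.size_eq, h]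
  have hc : ∀ ν i, (Finset.univ.filter fun b => s.p ν b = i).card =
      (Finset.univ.filter fun b => s'.p ν b = i).card := fun ν i => by
    rw [s.card_fiber, s'.card_fiber, h]
  obtain ⟨size, p, hp, ht⟩ := s
  obtain ⟨size', p', hp', ht'⟩ := s'
  change size = size' at hs
  subst hs
  have hpp : p = p' := funext fun ν => monotone_ext fun i => hc ν i
  subst hpp
  rfl

lemma exists_mult {M : Pts x.n → ℕ} (h : ∑ z, M z = j) : ∃ s : Insertion x j, s.mult = M := by
  choose size p hp using fun ν => exists_fibers fun i => M ⟨ν, i⟩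
  refine ⟨⟨size, p, fun ν i => ?_, ?_⟩, ?_⟩
  · have h1 : 0 < (Finset.univ.filter fun b => p ν b = i).card := by
      rw [hp]
      omega
    obtain ⟨b, hb⟩ := Finset.card_pos.1 h1
    exact ⟨b, by simpa using hb⟩
  · rw [← h, Fintype.sum_sigma]
    refine Finset.sum_congr rfl fun ν _ => Finset.sum_congr rfl fun i _ => ?_
    rw [hp, Nat.add_sub_cancel]
  · funext z
    change (Finset.univ.filter fun b => p z.1 b = z.2).card - 1 = _
    rw [hp, Nat.add_sub_cancel]

/-- An insertion is the same thing as a function of total `j` on the points of `x`: the fibre sizes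
determine a monotone surjection and can be prescribed. -/
lemma sum_eq {N : Type*} [AddCommMonoid N] (g : (Pts x.n → ℕ) → N) :
    ∑ s : Insertion x j, g s.mult = ∑ M ∈ Finset.piAntidiag Finset.univ j, g M := by
  refine Finset.sum_bij (fun s _ => s.mult) (fun s _ => ?_) (fun s _ s' _ h => mult_injective h)
    (fun M hM => ?_) (fun _ _ => rfl)
  · rw [Finset.mem_piAntidiag]
    exact ⟨s.sum_mult_total, fun _ _ => Finset.mem_univ _⟩
  · obtain ⟨s, hs⟩ := exists_mult (Finset.mem_piAntidiag.1 hM).1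
    exact ⟨s, Finset.mem_univ _, hs⟩

end Insertion

/-! ### The whiskering map in terms of words -/

section whisker

variable {k : Type*} [Field k] {U V : Disk}

lemma whisker_single (x : SeqElt U 0) (j : ℕ) : whisker k U (Finsupp.single x 1) j =
    ∑ s : Insertion x j, Finsupp.single s.whisker (sg k s.sign) := by
  change Finsupp.linearCombination k (fun x : SeqElt U 0 =>
    ∑ s : Insertion x j, Finsupp.single s.whisker ((-1 : k) ^ s.sign)) (Finsupp.single x 1) = _
  rw [Finsupp.linearCombination_single, one_smul]
  simp only [neg_one_pow_eq_sg]

/-- The signs `N_s` disappear: by `sign_add_eta` each term carries the sign of `x` alone, and the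
words of the whiskerings are the summands of `stretch_map`. -/
lemma hat_whisker_single (x : SeqElt U 0) (j : ℕ) :
    hat k U j (whisker k U (Finsupp.single x 1) j) =
      sg k x.eta • stretch k (x.pts.map Sigma.fst) j := by
  classical
  rw [whisker_single, map_sum, stretch_map _ _ x.nodup_pts,
    Finset.eq_univ_of_forall fun z => List.mem_toFinset.2 (x.mem_pts z),
    ← Insertion.sum_eq fun m => Finsupp.single (withLevels (repeated Sigma.fst m x.pts)) 1,
    Finset.smul_sum]
  refine Finset.sum_congr rfl fun s _ => ?_
  rw [hat_single, ← sg_add, s.sign_add_eta, s.word_whisker, Finsupp.smul_single, smul_eq_mul,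
    mul_one]

lemma hat_whisker (f : SeqElt U 0 →₀ k) (j : ℕ) :
    hat k U j (whisker k U f j) = stretchL k j (lettersL k (hat k U 0 f)) := by
  let w : (SeqElt U 0 →₀ k) →ₗ[k] (SeqElt U j →₀ k) := (LinearMap.proj j).comp (whisker k U)
  refine linear_ext (L := (hat k U j).comp w)
    (L' := stretchL k j ∘ₗ lettersL k ∘ₗ hat k U 0) (S := Set.univ) (by simp) fun x _ => ?_
  change hat k U j (whisker k U (Finsupp.single x 1) j) = _
  simp only [LinearMap.comp_apply]
  rw [hat_whisker_single, hat_single, lettersL, Finsupp.lmapDomain_apply, Finsupp.mapDomain_single,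
    stretchL_single, x.word_fst, one_mul]

lemma whisker_mem {f : SeqElt U 0 →₀ k} {m : ℤ}
    (hf : f ∈ Finsupp.supported k k {x : SeqElt U 0 | x.deg = m}) (j : ℕ) :
    whisker k U f j ∈ Finsupp.supported k k {x : SeqElt U j | x.deg = m} := by
  change Finsupp.linearCombination k (fun x : SeqElt U 0 =>
    ∑ s : Insertion x j, Finsupp.single s.whisker ((-1 : k) ^ s.sign)) f ∈ _
  rw [Finsupp.linearCombination_apply]
  refine Submodule.sum_mem _ fun x hx => Submodule.smul_mem _ _ (Submodule.sum_mem _ fun s _ => ?_)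
  exact Finsupp.single_mem_supported k _ (s.deg_whisker.trans (hf hx))

lemma SeqElt.word_zero (x : SeqElt U 0) : x.word = (x.pts.map Sigma.fst).map fun a => (a, 0) := by
  rw [SeqElt.word, List.map_map]
  refine List.map_congr_left fun z _ => ?_
  rw [SeqElt.entry, Nat.zero_sub]
  rfl

lemma lettersL_wordDel {A : Type} (l : List A) :
    lettersL k (wordDel k (l.map fun a => (a, 0))) = listDel k l := by
  induction l with
  | nil => exact map_zero _
  | cons a l ih =>
    rw [List.map_cons, wordDel, map_sub, lettersL_consL, ih, listDel, lettersL,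
      Finsupp.lmapDomain_apply, Finsupp.mapDomain_single, List.map_map, Nat.cast_zero, sg_zero]
    congr 2
    exact List.map_id _

lemma lettersL_fullL {A : Type} (g : List (A × ℕ) →₀ k) :
    lettersL k (fullL k Prod.fst g) = fullL k id (lettersL k g) := by
  refine list_linear_ext (L := lettersL k ∘ₗ fullL k Prod.fst) (L' := fullL k id ∘ₗ lettersL k)
    (fun l => ?_) g
  simp only [LinearMap.comp_apply]
  rw [lettersL, Finsupp.lmapDomain_apply, Finsupp.lmapDomain_apply, Finsupp.mapDomain_single]
  by_cases h : ∀ a, a ∈ l.map Prod.fst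
  · rw [fullL_single_of_mem h, fullL_single_of_mem (by rwa [List.map_id]),
      Finsupp.mapDomain_single]
  · push Not at h
    obtain ⟨a, ha⟩ := h
    rw [fullL_single_of_notMem ha, fullL_single_of_notMem (by rwa [List.map_id]),
      Finsupp.mapDomain_zero]

/-- The whiskering map is a map of complexes. -/
lemma whisker_simplicialD (f : SeqElt U 0 →₀ k) :
    whisker k U (simplicialD k U 0 f) = condD k U (whisker k U f) := by
  refine linear_ext (L := whisker k U ∘ₗ simplicialD k U 0) (L' := condD k U ∘ₗ whisker k U)
    (S := Set.univ) (by simp) fun x _ => ?_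
  simp only [LinearMap.comp_apply]
  funext j
  apply hat_injective
  have hw : hat k U 0 (Finsupp.single x 1) =
      sg k x.eta • Finsupp.single ((x.pts.map Sigma.fst).map fun a => (a, 0)) 1 := by
    rw [hat_single, x.word_zero, one_mul, Finsupp.smul_single, smul_eq_mul, mul_one]
  have hl : hat k U j (whisker k U (simplicialD k U 0 (Finsupp.single x 1)) j) =
      sg k x.eta • fullL k Prod.fst (stretchL k j (listDel k (x.pts.map Sigma.fst))) := by
    rw [hat_whisker, hat_simplicialD, hw, Nat.cast_zero, sg_zero, one_smul, map_smul, map_smul,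
      map_smul, map_smul, delL_single, lettersL_fullL, lettersL_wordDel, fullL_stretchL]
  -- Repeating letters loses none of them, so the projection acts only on the terms with a deletion.
  have hs : ∀ d, fullL k Prod.fst (stretch k (x.pts.map Sigma.fst) d) =
      stretch k (x.pts.map Sigma.fst) d := by
    intro d
    refine fullL_of_mem (Finsupp.supported_mono ?_ (stretch_mem _ _))
    intro u hu a
    rw [hu.2.2 a, List.mem_map]
    exact ⟨⟨a, 0⟩, x.mem_pts _, rfl⟩
  have hd := fun j => delL_stretch (k := k) (x.pts.map Sigma.fst) j
  simp only [sub_eq_iff_eq_add] at hd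
  rw [hl]
  cases j with
  | zero =>
    rw [hat_condD_zero, hat_whisker_single, map_smul, hd, stretchCof, add_zero, Nat.cast_zero,
      sg_zero, one_smul, map_smul]
  | succ d =>
    rw [hat_condD_succ, hat_whisker_single, hat_whisker_single, map_smul, map_smul, hd, stretchCof,
      map_smul, map_add, fullL_cofL, hs, map_smul, Nat.cast_succ, sg_add, sg_one]
    have := sg_mul_self k (d : ZMod 2)
    rw [← smul_sub, smul_comm, ← sub_sub, sub_right_comm, sub_self, zero_sub, mul_neg_one, neg_smul,
      neg_neg, smul_smul (sg k (d : ZMod 2)), this, one_smul]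

end whisker
end Breq

namespace Breq

/-! ### The word of a composite -/

section comp

variable {U V : Disk} {j : ℕ} {P : U.Hom V}

/-- The words of the generators `x μ`, as words in the leaves of `U`. -/
noncomputable def fiberWord {c : V.F → ℕ} (x : ∀ μ, SeqElt (P.fiber μ) (c μ)) (μ : V.F) :
    List (U.F × ℕ) := (x μ).word.map fun p => (p.1.1, p.2)

variable (y : SeqElt V j) (x : ∀ μ, SeqElt (P.fiber μ) (y.n μ))

/-- The points of a composite over a point of the last factor. -/
noncomputable def ptsOver (Q : Pts y.n) : List (Pts (y.comp P x).n) :=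
  ((x Q.1).pts.filter fun w => (x Q.1).W w = Q.2).map fun w => SeqElt.compEquiv y x ⟨Q.1, w⟩

lemma mem_ptsOver (Q : Pts y.n) (z : Pts (y.comp P x).n) :
    z ∈ ptsOver y x Q ↔ SeqElt.compPt y x z = Q := by
  obtain ⟨⟨μ, w⟩, rfl⟩ := (SeqElt.compEquiv y x).surjective z
  rw [SeqElt.compPt_compEquiv, ptsOver, List.mem_map]
  obtain ⟨κ, i⟩ := Q
  constructor
  · rintro ⟨w', hw', e⟩
    have h1 := (SeqElt.compEquiv y x).injective e
    obtain rfl : κ = μ := congrArg Sigma.fst h1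
    obtain rfl : w' = w := eq_of_heq (Sigma.mk.inj h1).2
    rw [List.mem_filter, decide_eq_true_eq] at hw'
    exact congrArg (Sigma.mk κ) hw'.2
  · intro e
    obtain rfl : μ = κ := congrArg Sigma.fst e
    have h2 : (x μ).W w = i := eq_of_heq (Sigma.mk.inj e).2
    exact ⟨w, List.mem_filter.2 ⟨(x μ).mem_pts w, decide_eq_true h2⟩, rfl⟩

lemma flatMap_ptsOver : y.pts.flatMap (ptsOver y x) = (y.comp P x).pts := by
  refine SeqElt.eq_pts _ (List.pairwise_flatMap.2 ⟨fun Q _ => ?_, ?_⟩)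
    (List.nodup_flatMap.2 ⟨fun Q _ => ?_, ?_⟩) fun z => ?_
  · rw [ptsOver, List.pairwise_map]
    exact ((x Q.1).pairwise_pts.filter _).imp fun {w w'} h => (SeqElt.comp_le_same y x).2 h
  · refine (y.pairwise_pts.and y.nodup_pts).imp fun {Q Q'} h z hz z' hz' => ?_
    rw [mem_ptsOver] at hz hz'
    subst hz
    subst hz'
    exact Or.inl ⟨h.2, h.1⟩
  · rw [ptsOver]
    refine ((x Q.1).nodup_pts.filter _).map fun w w' e => ?_
    exact eq_of_heq (Sigma.mk.inj ((SeqElt.compEquiv y x).injective e)).2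
  · refine y.nodup_pts.imp fun {Q Q'} h z hz hz' => h ?_
    rw [mem_ptsOver] at hz hz'
    exact hz.symm.trans hz'
  · exact List.mem_flatMap.2 ⟨_, y.mem_pts _, (mem_ptsOver y x _ z).2 rfl⟩

/-- The later occurrences of the leaf of `Q` measure the distance of `Q` from the top of its
ordinal. This is the co-level in the inner word at which `compWord` cuts out the block of `Q`. -/
lemma cnt_entry {l₁ l₂ : List (Pts y.n)} {Q : Pts y.n} (h : y.pts = l₁ ++ Q :: l₂) :
    cnt Q.1 (l₂.map y.entry) = y.n Q.1 - Q.2 := by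
  rw [← y.count_after h, cnt, List.map_map]
  rfl

lemma filter_fiberWord (Q : Pts y.n) :
    (fiberWord x Q.1).filter (fun p => p.2 = y.n Q.1 - (Q.2 : ℕ)) =
      ((x Q.1).pts.filter fun w => (x Q.1).W w = Q.2).map
        fun w => (w.1.1, y.n Q.1 - ((x Q.1).W w : ℕ)) := by
  rw [fiberWord, SeqElt.word, List.map_map, List.filter_map]
  refine congrArg (List.map _) (List.filter_congr fun w _ => ?_)
  have h1 := ((x Q.1).W w).2
  have h2 := Q.2.2
  rw [Bool.eq_iff_iff, decide_eq_true_eq, Function.comp_apply, decide_eq_true_eq, Fin.ext_iff]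
  simp only [Function.comp_apply, SeqElt.entry]
  omega

/-- The word of a composite is the composite of the words. -/
lemma word_comp : (y.comp P x).word = compWord y.word (fiberWord x) := by
  have key : ∀ l₁ l₂, y.pts = l₁ ++ l₂ →
      (l₂.flatMap (ptsOver y x)).map (y.comp P x).entry =
        compWord (l₂.map y.entry) (fiberWord x) := by
    intro l₁ l₂
    induction l₂ generalizing l₁ with
    | nil => intro _; rfl
    | cons Q l₂ ih =>
      intro h
      rw [List.flatMap_cons, List.map_append, List.map_cons, compWord,
        ih (l₁ ++ [Q]) (by simpa using h)]
      congr 1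
      change _ = ((fiberWord x Q.1).filter
        fun p => p.2 = cnt Q.1 (l₂.map y.entry)).map fun p => (p.1, j - (y.W Q : ℕ))
      rw [cnt_entry y h, filter_fiberWord, ptsOver, List.map_map, List.map_map]
      refine List.map_congr_left fun w hw => ?_
      rw [List.mem_filter, decide_eq_true_eq] at hw
      simp only [Function.comp_apply, SeqElt.entry, SeqElt.comp_W, hw.2]
      rfl
  rw [SeqElt.word, ← flatMap_ptsOver, key [] y.pts rfl, SeqElt.word]

/-- The parity of one plus the number of points over a point of the last factor. -/
noncomputable def blockSize (Q : Pts y.n) : ZMod 2 := ∑ w, iv ((x Q.1).W w = Q.2) + 1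

lemma blk_fiberWord (Q : Pts y.n) : blk (fiberWord x Q.1) (y.n Q.1 - (Q.2 : ℕ)) = blockSize y x Q := by
  classical
  rw [blk, filter_fiberWord, List.length_map, blockSize,
    ← List.toFinset_card_of_nodup ((x Q.1).nodup_pts.filter _),
    show ((x Q.1).pts.filter fun w => (x Q.1).W w = Q.2).toFinset =
      Finset.univ.filter fun w => (x Q.1).W w = Q.2 by ext w; simp [SeqElt.mem_pts]]
  simp [iv]

open Classical in
lemma sum_after {l₁ l₂ : List (Pts y.n)} {Q : Pts y.n} (h : y.pts = l₁ ++ Q :: l₂)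
    (g : Pts y.n → ZMod 2) : (l₂.map g).sum = ∑ Q', iv (y.le Q Q' ∧ Q ≠ Q') * g Q' := by
  have hd := y.nodup_pts
  rw [h, List.nodup_append, List.nodup_cons] at hd
  rw [← List.sum_toFinset _ hd.2.1.2, show l₂.toFinset =
    Finset.univ.filter fun Q' => y.le Q Q' ∧ Q ≠ Q' by ext Q'; simp [y.mem_after h],
    sum_filter_iv]

lemma eSum_entry (c : V.F → ZMod 2) (l₁ l₂ : List (Pts y.n)) (h : y.pts = l₁ ++ l₂) :
    eSum c (l₂.map y.entry) (fiberWord x) = (l₂.map fun Q => c Q.1 * blockSize y x Q).sum := by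
  induction l₂ generalizing l₁ with
  | nil => rfl
  | cons Q l₂ ih =>
    rw [List.map_cons, eSum, ih (l₁ ++ [Q]) (by simpa using h), List.map_cons, List.sum_cons]
    congr 2
    change blk (fiberWord x Q.1) (cnt Q.1 (l₂.map y.entry)) = _
    rw [cnt_entry y h, blk_fiberWord]

open Classical in
-- The recursion is unrolled into sums over points and pairs of points; `j` plus a co-level is the
-- level `W` modulo 2.
lemma wSign_word : wSign j y.word (fiberWord x) =
    ∑ Q, blockSize y x Q * ((y.W Q : ℕ) : ZMod 2) +
      ∑ Q, ∑ Q', iv (y.le Q Q' ∧ Q ≠ Q') *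
        (blockSize y x Q' + iv (Q'.1 < Q.1) * (blockSize y x Q * blockSize y x Q')) := by
  have key : ∀ l₁ l₂, y.pts = l₁ ++ l₂ → wSign j (l₂.map y.entry) (fiberWord x) =
      (l₂.map fun Q => blockSize y x Q * ((y.W Q : ℕ) : ZMod 2) +
        ∑ Q', iv (y.le Q Q' ∧ Q ≠ Q') *
          (blockSize y x Q' + iv (Q'.1 < Q.1) * (blockSize y x Q * blockSize y x Q'))).sum := by
    intro l₁ l₂
    induction l₂ generalizing l₁ with
    | nil => intro _; rfl
    | cons Q l₂ ih =>
      intro h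
      have h' : y.pts = (l₁ ++ [Q]) ++ l₂ := by simpa using h
      rw [List.map_cons, List.map_cons, List.sum_cons, wSign, ih _ h',
        eSum_entry y x _ _ _ h', eSum_entry y x _ _ _ h', sum_after y h, sum_after y h]
      have h1 : blk (fiberWord x (y.entry Q).1) (cnt (y.entry Q).1 (l₂.map y.entry)) =
          blockSize y x Q := by
        change blk (fiberWord x Q.1) (cnt Q.1 (l₂.map y.entry)) = _
        rw [cnt_entry y h, blk_fiberWord]
      have h2 : (j : ZMod 2) + ((y.entry Q).2 : ZMod 2) = ((y.W Q : ℕ) : ZMod 2) := by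
        rw [SeqElt.entry, Nat.cast_sub (Nat.le_of_lt_succ (y.W Q).2), CharTwo.sub_eq_add,
          ← add_assoc, CharTwo.add_self_eq_zero, zero_add]
      rw [h1, ← h2]
      simp only [mul_add, Finset.sum_add_distrib, Finset.mul_sum]
      have h3 : ∀ Q', blockSize y x Q * (iv (y.le Q Q' ∧ Q ≠ Q') * (iv (Q'.1 < (y.entry Q).1) *
          blockSize y x Q')) = iv (y.le Q Q' ∧ Q ≠ Q') * (iv (Q'.1 < Q.1) *
            (blockSize y x Q * blockSize y x Q')) := fun Q' => by
        rw [SeqElt.entry]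
        ring
      rw [Finset.sum_congr rfl fun Q' _ => h3 Q']
      simp only [one_mul]
      ring
  rw [SeqElt.word, key [] y.pts rfl, ← List.sum_toFinset _ y.nodup_pts,
    Finset.eq_univ_of_forall fun Q => List.mem_toFinset.2 (y.mem_pts Q), Finset.sum_add_distrib]

end comp
end Breq

namespace Breq

/-! ### The sign of a composite -/

section sums

lemma sum_sum_eq_zero {I : Type*} [Fintype I] [DecidableEq I] (F : I → I → ZMod 2)
    (h : ∀ a b, F a b = F b a) (h0 : ∀ a, F a a = 0) : ∑ a, ∑ b, F a b = 0 := by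
  rw [← Fintype.sum_prod_type']
  refine Finset.sum_involution (fun p _ => p.swap) (fun p _ => ?_) (fun p _ hp e => hp ?_)
    (fun _ _ => Finset.mem_univ _) fun _ _ => rfl
  · rw [Prod.fst_swap, Prod.snd_swap, h p.2, CharTwo.add_self_eq_zero]
  · have e1 : p.2 = p.1 := congrArg Prod.fst e
    rw [e1, h0]

lemma sum_sum_swap {I : Type*} [Fintype I] (F : I → I → ZMod 2) (m : I → ZMod 2) :
    ∑ a, ∑ b, F a b * (m a + m b) = ∑ b, (∑ a, (F b a + F a b)) * m b := by
  simp only [mul_add, add_mul, Finset.sum_add_distrib, Finset.sum_mul]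
  congr 1
  rw [Finset.sum_comm]

lemma sum_trichotomy {S T : Type*} [Fintype S] [LinearOrder S] [Fintype T] (f : T → S)
    (m : S → ZMod 2) : ∑ t, m (f t) + ∑ t, ∑ s, iv (s < f t) * m s +
      ∑ s, (∑ t, iv (f t < s)) * m s = (∑ s, m s) * Fintype.card T := by
  have h1 : ∑ t, m (f t) = ∑ t, ∑ s, iv (f t = s) * m s := by
    refine Finset.sum_congr rfl fun t _ => ?_
    simp [iv_mul]
  have h2 : ∑ s, (∑ t, iv (f t < s)) * m s = ∑ t, ∑ s, iv (f t < s) * m s := by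
    simp only [Finset.sum_mul]
    exact Finset.sum_comm
  rw [h1, h2, ← Finset.sum_add_distrib, ← Finset.sum_add_distrib, mul_comm, ← nsmul_eq_mul,
    ← Finset.card_univ, ← Finset.sum_const]
  refine Finset.sum_congr rfl fun t _ => ?_
  rw [← Finset.sum_add_distrib, ← Finset.sum_add_distrib]
  refine Finset.sum_congr rfl fun s _ => ?_
  rcases lt_trichotomy s (f t) with h | h | h
  · simp [iv, h, h.ne', h.not_gt]
  · simp [iv, h]
  · simp [iv, h, h.ne, h.not_gt]

end sums

section comp

variable {U V : Disk} {j : ℕ} {P : U.Hom V} (y : SeqElt V j)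
  (x : ∀ μ, SeqElt (P.fiber μ) (y.n μ))

lemma sum_comp_pts (g : Pts (y.comp P x).n → ZMod 2) :
    ∑ z, g z = ∑ μ, ∑ w, g (SeqElt.compEquiv y x ⟨μ, w⟩) := by
  rw [← Equiv.sum_comp (SeqElt.compEquiv y x), Fintype.sum_sigma]

/-- The image of a point of a composite in the last factor. -/
def imagePt (z : Pts (y.comp P x).n) : Pts y.n := SeqElt.compPt y x z

lemma imagePt_compEquiv (μ : V.F) (w : Pts (x μ).n) :
    imagePt y x (SeqElt.compEquiv y x ⟨μ, w⟩) = ⟨μ, (x μ).W w⟩ := SeqElt.compPt_compEquiv y x μ w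

lemma comp_le_of_ne {z z' : Pts (y.comp P x).n} (h : imagePt y x z ≠ imagePt y x z') :
    (y.comp P x).le z z' ↔ y.le (imagePt y x z) (imagePt y x z') :=
  ⟨fun e => e.elim (fun e => e.2) fun e => absurd e.1 h, fun e => Or.inl ⟨h, e⟩⟩

/-- Modulo 2, `blockSize y x Q + 1` is the number of points of the composite over `Q`. -/
lemma sum_blockSize (g : Pts y.n → ZMod 2) : ∑ Q, blockSize y x Q * g Q =
    ∑ z, g (imagePt y x z) + ∑ Q, g Q := by
  simp only [blockSize, add_mul, one_mul, Finset.sum_add_distrib]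
  congr 1
  rw [sum_comp_pts, Fintype.sum_sigma]
  refine Finset.sum_congr rfl fun μ _ => ?_
  simp only [imagePt_compEquiv, Finset.sum_mul]
  change ∑ i : Fin (y.n μ + 1), ∑ w : Pts (x μ).n, iv ((x μ).W w = i) * g ⟨μ, i⟩ = _
  rw [Finset.sum_comm]
  refine Finset.sum_congr rfl fun w _ => ?_
  simp only [iv_mul]
  rw [Finset.sum_ite_eq, if_pos (Finset.mem_univ _)]

open Classical in
lemma sum_inversions : ∑ μ, (x μ).inversions = ∑ z, ∑ z',
    iv (P.f z.1 = P.f z'.1 ∧ (y.comp P x).le z z' ∧ z'.1 < z.1) := by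
  rw [sum_comp_pts]
  refine Finset.sum_congr rfl fun μ _ => Finset.sum_congr rfl fun w _ => ?_
  rw [sum_comp_pts, Finset.sum_eq_single μ]
  · refine Finset.sum_congr rfl fun w' _ => iv_congr ?_
    have h : P.f (SeqElt.compEquiv y x ⟨μ, w⟩).1 = P.f (SeqElt.compEquiv y x ⟨μ, w'⟩).1 :=
      w.1.2.trans w'.1.2.symm
    rw [SeqElt.comp_le_same]
    exact ⟨fun e => ⟨h, e⟩, fun e => e.2⟩
  · intro μ' _ hμ
    refine Finset.sum_eq_zero fun w' _ => ?_
    rw [iv, if_neg]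
    rintro ⟨e, -⟩
    exact hμ ((w'.1.2 : P.f w'.1.1 = μ').symm.trans (e.symm.trans w.1.2))
  · simp

open Classical in
-- All terms are sums over pairs of points of the composite. Their total is symmetric in the pair
-- and zero on the diagonal, so it vanishes modulo 2; the symmetry is a finite case analysis on the
-- order of the points, of their leaves and of their images.
lemma inversions_comp : (y.comp P x).inversions + ∑ μ, (x μ).inversions +
    ∑ ν, ∑ ν', iv (ν < ν' ∧ P.f ν' < P.f ν) *
      ((((y.comp P x).n ν : ZMod 2) + 1) * (((y.comp P x).n ν' : ZMod 2) + 1)) =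
    ∑ Q, ∑ Q', iv (y.le Q Q' ∧ Q'.1 < Q.1) *
      ((blockSize y x Q + 1) * (blockSize y x Q' + 1)) := by
  have h1 : ∑ ν, ∑ ν', iv (ν < ν' ∧ P.f ν' < P.f ν) *
      ((((y.comp P x).n ν : ZMod 2) + 1) * (((y.comp P x).n ν' : ZMod 2) + 1)) =
      ∑ z : Pts (y.comp P x).n, ∑ z' : Pts (y.comp P x).n,
        iv (z.1 < z'.1 ∧ P.f z'.1 < P.f z.1) := by
    rw [Finset.sum_congr rfl fun z _ => SeqElt.sum_pts_fst _ fun ν' =>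
        iv ((z : Pts (y.comp P x).n).1 < ν' ∧ P.f ν' < P.f z.1),
      SeqElt.sum_pts_fst _ fun ν => ∑ ν', iv (ν < ν' ∧ P.f ν' < P.f ν) *
        (((y.comp P x).n ν' : ZMod 2) + 1)]
    refine Finset.sum_congr rfl fun ν _ => ?_
    rw [Finset.sum_mul]
    exact Finset.sum_congr rfl fun ν' _ => by ring
  have hb : ∀ g : Pts y.n → ZMod 2, ∑ Q, (blockSize y x Q + 1) * g Q =
      ∑ z, g (imagePt y x z) := fun g => by
    simp only [add_mul, one_mul, Finset.sum_add_distrib, sum_blockSize]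
    rw [add_assoc, CharTwo.add_self_eq_zero, add_zero]
  have h2 : ∑ Q, ∑ Q', iv (y.le Q Q' ∧ Q'.1 < Q.1) *
      ((blockSize y x Q + 1) * (blockSize y x Q' + 1)) =
      ∑ z : Pts (y.comp P x).n, ∑ z' : Pts (y.comp P x).n,
        iv (y.le (imagePt y x z) (imagePt y x z') ∧ P.f z'.1 < P.f z.1) := by
    refine Eq.trans ?_ (hb fun Q => ∑ z' : Pts (y.comp P x).n, iv (y.le Q (imagePt y x z') ∧
      P.f z'.1 < Q.1))
    refine Finset.sum_congr rfl fun Q _ => ?_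
    refine Eq.trans ?_ (congrArg _ (hb fun Q' => iv (y.le Q Q' ∧ Q'.1 < Q.1)))
    rw [Finset.mul_sum]
    exact Finset.sum_congr rfl fun Q' _ => by ring
  rw [h1, h2, SeqElt.inversions, sum_inversions, ← sub_eq_zero, CharTwo.sub_eq_add]
  simp only [← Finset.sum_add_distrib]
  refine sum_sum_eq_zero _ (fun z z' => ?_) fun z => ?_
  · have a1 := (y.comp P x).le_total z z'
    have a2 := (y.comp P x).le_antisymm z z'
    have b1 := y.le_total (imagePt y x z) (imagePt y x z')
    have b2 := y.le_antisymm (imagePt y x z) (imagePt y x z')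
    have c1 := comp_le_of_ne y x (z := z) (z' := z')
    have c2 := comp_le_of_ne y x (z := z') (z' := z)
    have d1 : imagePt y x z = imagePt y x z' → P.f z.1 = P.f z'.1 := fun e => congrArg Sigma.fst e
    have a3 : z = z' → z.1 = z'.1 := fun e => congrArg Sigma.fst e
    have a4 := lt_trichotomy z.1 z'.1
    have a5 : z.1 < z'.1 → ¬ z'.1 < z.1 := fun h => h.asymm
    have a6 : z.1 = z'.1 → ¬ z.1 < z'.1 ∧ ¬ z'.1 < z.1 := fun h => ⟨h.not_lt, h.not_gt⟩
    have b4 := lt_trichotomy (P.f z.1) (P.f z'.1)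
    have b5 : P.f z.1 < P.f z'.1 → ¬ P.f z'.1 < P.f z.1 := fun h => h.asymm
    have b6 : P.f z.1 = P.f z'.1 → ¬ P.f z.1 < P.f z'.1 ∧ ¬ P.f z'.1 < P.f z.1 :=
      fun h => ⟨h.not_lt, h.not_gt⟩
    have b7 : z.1 = z'.1 → P.f z.1 = P.f z'.1 := fun h => congrArg P.f h
    have d2 : P.f z'.1 = P.f z.1 ↔ P.f z.1 = P.f z'.1 := eq_comm
    unfold iv
    generalize imagePt y x z = t at *
    generalize imagePt y x z' = t' at *
    generalize (y.comp P x).le z z' = p at *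
    generalize (y.comp P x).le z' z = q at *
    generalize y.le t t' = p' at *
    generalize y.le t' t = q' at *
    generalize P.f z.1 = A at *
    generalize P.f z'.1 = B at *
    generalize z.1 = C at *
    generalize z'.1 = D at *
    clear h1 h2 hb
    rcases b4 with b4 | b4 | b4 <;> rcases a4 with a4 | a4 | a4 <;> grind
  · simp [iv]

open Classical in
-- For fixed `Q` the conditions on `Q'` combine to: an earlier point of the same leaf, or a point of
-- a smaller leaf. Their number is the position of `Q` when the points are listed leaf by leaf.
lemma sum_lex : ∑ Q, ∑ Q', (iv (y.le Q Q' ∧ Q'.1 < Q.1) * (blockSize y x Q + blockSize y x Q') +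
      iv (y.le Q Q' ∧ Q ≠ Q') * blockSize y x Q') =
    ∑ Q, blockSize y x Q * ((Q.2 : ℕ) + ∑ κ, iv (κ < Q.1) * ((y.n κ : ZMod 2) + 1)) := by
  simp only [Finset.sum_add_distrib]
  rw [sum_sum_swap, Finset.sum_comm (γ := Pts y.n), ← Finset.sum_add_distrib]
  refine Finset.sum_congr rfl fun Q _ => ?_
  rw [← Finset.sum_mul, ← add_mul, mul_comm, ← y.sum_same_color Q, ← SeqElt.sum_pts_fst,
    ← Finset.sum_add_distrib, ← Finset.sum_add_distrib]
  congr 1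
  refine Finset.sum_congr rfl fun Q' _ => ?_
  have a1 := y.le_total Q Q'
  have a2 := y.le_antisymm Q Q'
  have a3 : Q' = Q → Q'.1 = Q.1 := fun e => congrArg Sigma.fst e
  have a4 := lt_trichotomy Q.1 Q'.1
  have a5 : Q.1 < Q'.1 → ¬ Q'.1 < Q.1 := fun h => h.asymm
  have a6 : Q'.1 = Q.1 → ¬ Q.1 < Q'.1 ∧ ¬ Q'.1 < Q.1 := fun h => ⟨h.not_gt, h.not_lt⟩
  have a7 : Q = Q' ↔ Q' = Q := eq_comm
  have a8 : Q.1 = Q'.1 ↔ Q'.1 = Q.1 := eq_comm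
  unfold iv
  generalize y.le Q Q' = p at *
  generalize y.le Q' Q = q at *
  grind

lemma sum_rank (N : U.F → ZMod 2) :
    ∑ ν, SeqElt.rank ν * N ν + ∑ ν, (∑ κ, iv (P.f κ = P.f ν ∧ κ < ν)) * N ν +
      ∑ ν, ∑ ν', iv (ν < ν' ∧ P.f ν' < P.f ν) * (N ν + N ν') =
    ∑ ν, (∑ κ, iv (P.f κ < P.f ν)) * N ν := by
  rw [sum_sum_swap, ← Finset.sum_add_distrib, ← Finset.sum_add_distrib]
  refine Finset.sum_congr rfl fun ν _ => ?_
  rw [SeqElt.rank, ← add_mul, ← add_mul, ← Finset.sum_add_distrib, ← Finset.sum_add_distrib]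
  congr 1
  refine Finset.sum_congr rfl fun κ _ => ?_
  have a4 := lt_trichotomy ν κ
  have a5 : ν < κ → ¬ κ < ν := fun h => h.asymm
  have a6 : ν = κ → ¬ ν < κ ∧ ¬ κ < ν := fun h => ⟨h.not_lt, h.not_gt⟩
  have b4 := lt_trichotomy (P.f ν) (P.f κ)
  have b5 : P.f ν < P.f κ → ¬ P.f κ < P.f ν := fun h => h.asymm
  have b6 : P.f ν = P.f κ → ¬ P.f ν < P.f κ ∧ ¬ P.f κ < P.f ν := fun h => ⟨h.not_lt, h.not_gt⟩
  have b7 : ν = κ → P.f ν = P.f κ := fun h => congrArg P.f h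
  have b8 : P.f κ = P.f ν ↔ P.f ν = P.f κ := eq_comm
  unfold iv
  generalize P.f ν = A at *
  generalize P.f κ = B at *
  grind

/-- The number of leaves, modulo 2, that are mapped before a leaf. -/
def before (P : U.Hom V) (μ : V.F) : ZMod 2 := ∑ ν, iv (P.f ν < μ)

/-- A part of the sign of a composite that depends on the map of disks only. -/
def homSign (P : U.Hom V) : ZMod 2 :=
  ∑ ν, (before P (P.f ν) + SeqElt.rank (P.f ν)) + ∑ ν, ∑ ν', iv (ν < ν' ∧ P.f ν' < P.f ν)

lemma sum_eta : ∑ μ, (x μ).eta = ∑ μ, (x μ).inversions +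
    ∑ ν, (∑ κ, iv (P.f κ = P.f ν ∧ κ < ν)) * (((y.comp P x).n ν : ZMod 2) + 1) +
    ∑ μ, ∑ w, (((x μ).W w : ℕ) : ZMod 2) + ∑ μ, (((y.n μ).choose 2 : ℕ) : ZMod 2) +
    ∑ ν, (y.n (P.f ν) : ZMod 2) := by
  have h1 : ∑ μ, ∑ w : Pts (x μ).n, SeqElt.rank w.1 =
      ∑ ν, (∑ κ, iv (P.f κ = P.f ν ∧ κ < ν)) * (((y.comp P x).n ν : ZMod 2) + 1) := by
    rw [← SeqElt.sum_pts_fst, sum_comp_pts]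
    refine Finset.sum_congr rfl fun μ _ => Finset.sum_congr rfl fun w _ => ?_
    refine (sum_fiber P μ fun κ => iv (κ < w.1.1)).trans (Finset.sum_congr rfl fun κ _ => ?_)
    have e : P.f (SeqElt.compEquiv y x ⟨μ, w⟩).1 = μ := w.1.2
    rw [e, SeqElt.compEquiv_fst]
    unfold iv
    split_ifs <;> grind
  have h2 : ∑ μ, (y.n μ : ZMod 2) * (Fintype.card (P.fiber μ).F : ZMod 2) =
      ∑ ν, (y.n (P.f ν) : ZMod 2) := by
    have h : ∀ μ, (y.n μ : ZMod 2) * (Fintype.card (P.fiber μ).F : ZMod 2) =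
        ∑ ν, iv (P.f ν = μ) * (y.n μ : ZMod 2) := by
      intro μ
      rw [← sum_fiber P μ fun _ => (y.n μ : ZMod 2), Finset.sum_const, Finset.card_univ,
        nsmul_eq_mul, mul_comm]
    rw [Finset.sum_congr rfl fun μ _ => h μ, Finset.sum_comm]
    refine Finset.sum_congr rfl fun ν _ => ?_
    simp [iv_mul]
  rw [← h1, ← h2]
  simp only [SeqElt.eta, Finset.sum_add_distrib]
  ring

lemma sum_fin_val (n : ℕ) : ∑ i : Fin (n + 1), ((i : ℕ) : ZMod 2) = n + ((n.choose 2 : ℕ) : ZMod 2) := by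
  rw [Fin.sum_univ_eq_sum_range fun i => (i : ZMod 2), ← Nat.cast_sum, Finset.sum_range_id,
    ← Nat.choose_two_right, Nat.choose_succ_succ', Nat.choose_one_right, Nat.cast_add]

/-- The sign of a composite in terms of words. -/
lemma compSign_add_eta : (compSign P y x : ZMod 2) + (y.comp P x).eta + y.eta + ∑ μ, (x μ).eta =
    wSign j y.word (fiberWord x) +
      ∑ μ, (SeqElt.rank μ + before P μ) * ((x μ).deg : ZMod 2) +
      (y.deg : ZMod 2) * (Fintype.card U.F + Fintype.card V.F) + homSign P := by
  classical
  set N : U.F → ZMod 2 := fun ν => ((y.comp P x).n ν : ZMod 2) with hN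
  set m : V.F → ZMod 2 := fun μ => (y.n μ : ZMod 2) with hm
  set M : V.F → ZMod 2 := fun μ => ∑ κ, iv (κ < μ) * m κ with hM
  have c1 : (compSign P y x : ZMod 2) = ∑ μ, M μ * m μ + ∑ ν, M (P.f ν) * N ν +
      ∑ ν, ∑ ν', iv (ν < ν' ∧ P.f ν' < P.f ν) * (N ν * N ν') := by
    rw [compSign_cast, ← sum_comp_cast y x M]
    congr 1
    rw [Finset.sum_comm]
    refine Finset.sum_congr rfl fun μ _ => ?_
    rw [hM, Finset.sum_mul]
    exact Finset.sum_congr rfl fun κ _ => by ring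
  have c2 : (y.comp P x).eta = (y.comp P x).inversions + ∑ ν, SeqElt.rank ν * (N ν + 1) +
      ∑ z, ((y.W (imagePt y x z) : ℕ) : ZMod 2) + (j.choose 2 : ℕ) + j * Fintype.card U.F := by
    rw [SeqElt.eta, Finset.sum_add_distrib, SeqElt.sum_pts_fst, ← add_assoc]
    rfl
  have c3 : y.eta = y.inversions + ∑ μ, SeqElt.rank μ * (m μ + 1) +
      ∑ Q, ((y.W Q : ℕ) : ZMod 2) + (j.choose 2 : ℕ) + j * Fintype.card V.F := by
    rw [SeqElt.eta, Finset.sum_add_distrib, SeqElt.sum_pts_fst, ← add_assoc]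
  have c4 := sum_eta y x
  have c5 := sum_comp_cast y x fun μ => SeqElt.rank μ + before P μ
  have c6 := y.deg_cast
  have c7 := wSign_word y x
  have c8 := inversions_comp y x
  have c9 := sum_lex y x
  have c10 := sum_rank (P := P) fun ν => N ν + 1
  have c11 := sum_trichotomy P.f m
  have c12 := sum_trichotomy id m
  have c13 := sum_blockSize y x fun Q => ((y.W Q : ℕ) : ZMod 2)
  have c14 := sum_blockSize y x fun Q => (Q.2 : ℕ) + ∑ κ, iv (κ < Q.1) * ((y.n κ : ZMod 2) + 1)
  have c15 : ∑ z, (((imagePt y x z).2 : ℕ) : ZMod 2) = ∑ μ, ∑ w, (((x μ).W w : ℕ) : ZMod 2) := by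
    rw [sum_comp_pts]
    exact Finset.sum_congr rfl fun μ _ => Finset.sum_congr rfl fun w _ => by
      rw [imagePt_compEquiv]
  have c16 : ∑ z, ∑ κ, iv (κ < (imagePt y x z).1) * ((y.n κ : ZMod 2) + 1) =
      ∑ ν, (∑ κ, iv (κ < P.f ν) * (m κ + 1)) * (N ν + 1) :=
    SeqElt.sum_pts_fst (y.comp P x).n fun ν => ∑ κ, iv (κ < P.f ν) * (m κ + 1)
  have c17 : ∑ Q : Pts y.n, ∑ κ, iv (κ < Q.1) * ((y.n κ : ZMod 2) + 1) =
      ∑ μ, (∑ κ, iv (κ < μ) * (m κ + 1)) * (m μ + 1) :=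
    SeqElt.sum_pts_fst y.n fun μ => ∑ κ, iv (κ < μ) * (m κ + 1)
  have c18 : ∑ Q : Pts y.n, ((Q.2 : ℕ) : ZMod 2) =
      ∑ μ, m μ + ∑ μ, (((y.n μ).choose 2 : ℕ) : ZMod 2) := by
    rw [Fintype.sum_sigma, ← Finset.sum_add_distrib]
    exact Finset.sum_congr rfl fun μ _ => sum_fin_val _
  have c19 : y.inversions = ∑ Q, ∑ Q', iv (y.le Q Q' ∧ Q'.1 < Q.1) := rfl
  have c20 : ∀ Q Q', iv (y.le Q Q' ∧ Q ≠ Q') * (iv (Q'.1 < Q.1) * (blockSize y x Q * blockSize y x Q')) =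
      iv (y.le Q Q' ∧ Q'.1 < Q.1) * (blockSize y x Q * blockSize y x Q') := by
    intro Q Q'
    have : Q = Q' → Q.1 = Q'.1 := congrArg Sigma.fst
    unfold iv
    split_ifs <;> grind
  have e2 : (2 : ZMod 2) = 0 := by decide
  have hN' : ∀ ν, ((y.comp P x).n ν : ZMod 2) = N ν := fun _ => rfl
  have hm' : ∀ μ, (y.n μ : ZMod 2) = m μ := fun _ => rfl
  have hM' : ∀ μ, ∑ κ, iv (κ < μ) * m κ = M μ := fun _ => rfl
  have hr : ∀ μ : V.F, ∑ κ, iv (κ < μ) = SeqElt.rank μ := fun _ => rfl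
  have hb : ∀ μ, ∑ ν, iv (P.f ν < μ) = before P μ := fun _ => rfl
  rw [c1, c2, c3, c4, c5, c6, c7, homSign]
  simp only [mul_add, c20, Finset.sum_add_distrib, mul_one, add_mul, one_mul, hN', hm', hM', hr, hb,
    id_eq] at c8 c9 c10 c11 c12 c13 c14 c16 c17 ⊢
  clear c1 c2 c3 c4 c5 c6 c7 c20 hN' hm' hM' hr hb
  -- With the arities made opaque, the claim is the sum of the relations `c8` to `c19` in
  -- characteristic two.
  clear_value N m M
  linear_combination (norm := (ring_nf; reduce_mod_char)) c8 + c9 + c10 + c11 + c12 + c13 + c14 +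
    c15 + c16 + c17 + c18 + c19

end comp
end Breq

namespace Breq

/-! ### Isomorphisms of disks and units in terms of words -/

section natural

variable {k : Type*} [Field k]

lemma mapDomain_consL {A B : Type*} (g : A → B) (p : A) (f : List A →₀ k) :
    Finsupp.mapDomain (List.map g) (consL k p f) =
      consL k (g p) (Finsupp.mapDomain (List.map g) f) := by
  refine list_linear_ext (L := Finsupp.lmapDomain k k (List.map g) ∘ₗ consL k p)
    (L' := consL k (g p) ∘ₗ Finsupp.lmapDomain k k (List.map g)) (fun l => ?_) f
  simp

lemma stretch_map_letters {A B : Type*} (g : A → B) (l : List A) (j : ℕ) :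
    stretch k (l.map g) j = Finsupp.mapDomain (List.map (Prod.map g id)) (stretch k l j) := by
  induction l generalizing j with
  | nil =>
    cases j with
    | zero => simp [stretch]
    | succ j => simp [stretch]
  | cons a l ih =>
    induction j with
    | zero =>
      rw [List.map_cons, stretch, stretch, ih, mapDomain_consL]
      rfl
    | succ j ihj =>
      rw [List.map_cons] at ihj ⊢
      rw [stretch, stretch, ih, ihj, mapDomain_consL, Finsupp.mapDomain_add]
      rfl

end natural

namespace SeqElt

variable {U V : Disk} {j : ℕ}

lemma pts_relabel (e : U.Iso V) (x : SeqElt U j) :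
    (x.relabel e).pts.map Sigma.fst = (x.pts.map Sigma.fst).map e.e := by
  rw [← (relabel_emb e x).map_pts_of_surj (relabelPt_surjective e x), List.map_map, List.map_map]
  refine List.map_congr_left fun z _ => ?_
  exact (e.e.apply_symm_apply z.1).symm

lemma word_relabel (e : U.Iso V) (x : SeqElt U j) :
    (x.relabel e).word = x.word.map (Prod.map e.e id) := by
  rw [word, word, ← (relabel_emb e x).map_pts_of_surj (relabelPt_surjective e x), List.map_map,
    List.map_map]
  refine List.map_congr_left fun z _ => ?_
  exact Prod.ext (e.e.apply_symm_apply z.1).symm rfl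

lemma rank_symm (e : U.Iso V) (a : V.F) : rank (e.e.symm a) = rank a := by
  rw [rank, rank, ← Equiv.sum_comp e.e.toEquiv]
  refine Finset.sum_congr rfl fun κ _ => iv_congr ?_
  exact e.e.lt_symm_apply

lemma eta_relabel (e : U.Iso V) (x : SeqElt U j) : (x.relabel e).eta = x.eta := by
  classical
  have hb : Function.Bijective (relabelPt e x) :=
    ⟨(relabel_emb e x).inj, relabelPt_surjective e x⟩
  have h1 : (x.relabel e).inversions = x.inversions := by
    rw [inversions, inversions, ← hb.sum_comp]
    refine Finset.sum_congr rfl fun z _ => ?_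
    rw [← hb.sum_comp]
    refine Finset.sum_congr rfl fun z' _ => iv_congr ?_
    exact and_congr Iff.rfl e.e.symm.lt_iff_lt.symm
  have h2 : ∑ z : Pts (x.relabel e).n, (rank z.1 + (((x.relabel e).W z : ℕ) : ZMod 2)) =
      ∑ z : Pts x.n, (rank z.1 + ((x.W z : ℕ) : ZMod 2)) := by
    rw [← hb.sum_comp]
    refine Finset.sum_congr rfl fun z _ => ?_
    congr 1
    exact (rank_symm e z.1).symm
  rw [eta, eta, h1, h2, Fintype.card_congr e.e.toEquiv]

lemma pts_unit : (unit j).pts = (List.finRange (j + 1)).map fun i => ⟨(), i⟩ := by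
  refine ((unit j).eq_pts ?_ ?_ ?_).symm
  · rw [List.pairwise_map]
    exact (List.pairwise_lt_finRange _).imp fun h => le_of_lt h
  · exact (List.nodup_finRange _).map fun i i' h => eq_of_heq (Sigma.mk.inj h).2
  · rintro ⟨⟨⟩, i⟩
    exact List.mem_map.2 ⟨i, List.mem_finRange i, rfl⟩

/-- For one leaf the normalisation `j.choose 2 + j` in `eta` cancels the sum of the levels `0, ...,
j`. -/
lemma eta_unit : (unit j).eta = 0 := by
  classical
  have h0 : ∀ a b : Disk.pt.F, ¬ a < b := fun a b h => absurd h (lt_irrefl _)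
  have h1 : (unit j).inversions = 0 :=
    Finset.sum_eq_zero fun z _ => Finset.sum_eq_zero fun z' _ => by simp [iv, h0]
  have h2 : ∑ z : Pts (unit j).n, (rank z.1 + (((unit j).W z : ℕ) : ZMod 2)) =
      j + ((j.choose 2 : ℕ) : ZMod 2) := by
    rw [Fintype.sum_sigma, ← sum_fin_val]
    have h3 : ∀ a : Disk.pt.F, rank a = 0 := fun a => Finset.sum_eq_zero fun κ _ => by simp [iv, h0]
    simp only [h3, zero_add]
    exact Fintype.sum_unique (ι := Unit) fun _ => ∑ i : Fin (j + 1), ((i : ℕ) : ZMod 2)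
  have h3 : Fintype.card Disk.pt.F = 1 := rfl
  have e2 : (2 : ZMod 2) = 0 := by decide
  rw [eta, h1, h2, h3]
  push_cast
  linear_combination ((j : ZMod 2) + (j.choose 2 : ℕ)) * e2

end SeqElt

section whisker

variable {k : Type*} [Field k] {U V : Disk}

lemma hat_relabel (e : U.Iso V) (j : ℕ) (f : SeqElt U j →₀ k) :
    hat k V j (Finsupp.mapDomain (SeqElt.relabel e) f) =
      Finsupp.mapDomain (List.map (Prod.map e.e id)) (hat k U j f) := by
  refine linear_ext (L := hat k V j ∘ₗ Finsupp.lmapDomain k k (SeqElt.relabel e))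
    (L' := Finsupp.lmapDomain k k (List.map (Prod.map e.e id)) ∘ₗ hat k U j) (S := Set.univ)
    (by simp) fun x _ => ?_
  simp only [LinearMap.comp_apply, Finsupp.lmapDomain_apply, Finsupp.mapDomain_single]
  rw [hat_single, hat_single, Finsupp.mapDomain_single, x.eta_relabel, x.word_relabel]

/-- The `j`-th component of the whiskering map. -/
noncomputable def whiskerAt (k : Type*) [Field k] (U : Disk) (j : ℕ) :
    (SeqElt U 0 →₀ k) →ₗ[k] (SeqElt U j →₀ k) := (LinearMap.proj j).comp (whisker k U)

lemma whisker_relabel (e : U.Iso V) (f : SeqElt U 0 →₀ k) (j : ℕ) :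
    whisker k V (Finsupp.mapDomain (SeqElt.relabel e) f) j =
      Finsupp.mapDomain (SeqElt.relabel e) (whisker k U f j) := by
  refine linear_ext (L := whiskerAt k V j ∘ₗ Finsupp.lmapDomain k k (SeqElt.relabel e))
    (L' := Finsupp.lmapDomain k k (SeqElt.relabel e) ∘ₗ whiskerAt k U j) (S := Set.univ)
    (by simp) fun x _ => ?_
  rw [LinearMap.comp_apply, LinearMap.comp_apply, Finsupp.lmapDomain_apply,
    Finsupp.lmapDomain_apply, Finsupp.mapDomain_single]
  apply hat_injective
  rw [hat_relabel]
  change hat k V j (whisker k V (Finsupp.single (x.relabel e) 1) j) =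
    Finsupp.mapDomain _ (hat k U j (whisker k U (Finsupp.single x 1) j))
  rw [hat_whisker_single, hat_whisker_single, Finsupp.mapDomain_smul, x.eta_relabel, x.pts_relabel,
    stretch_map_letters]

lemma stretch_singleton {A : Type*} (a : A) (j : ℕ) : stretch k [a] j =
    Finsupp.single ((List.finRange (j + 1)).map fun i : Fin (j + 1) => (a, j - (i : ℕ))) 1 := by
  induction j with
  | zero =>
    rw [stretch, stretch, consL_single]
    rfl
  | succ j ih =>
    rw [stretch, stretch, ih, zero_add, consL_single, List.finRange_succ (n := j + 1),
      List.map_cons, List.map_map]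
    congr 2
    refine List.map_congr_left fun i _ => ?_
    simp

lemma whisker_unit : whisker k Disk.pt (Finsupp.single (SeqElt.unit 0) 1) =
    fun j => Finsupp.single (SeqElt.unit j) 1 := by
  funext j
  apply hat_injective
  rw [hat_whisker_single, hat_single, SeqElt.eta_unit, SeqElt.eta_unit, sg_zero, one_smul, one_mul,
    SeqElt.pts_unit, List.map_map]
  refine (stretch_singleton () j).trans ?_
  rw [SeqElt.word, SeqElt.pts_unit, List.map_map]
  rfl

end whisker
end Breq

namespace Breq

/-! ### Whiskering and compositions -/

section comp

variable {k : Type*} [Field k] {U V : Disk} {j : ℕ} (P : U.Hom V)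

/-- A leaf of a fibre, as a leaf of the source. -/
def fiberVal (P : U.Hom V) (μ : V.F) (ν : (P.fiber μ).F) : U.F := ν.1

/-- The signed words of combinations of generators of a fibre, as words in the leaves of `U`. -/
noncomputable def fiberHat (k : Type*) [Field k] (P : U.Hom V) (μ : V.F) (j : ℕ) :
    (SeqElt (P.fiber μ) j →₀ k) →ₗ[k] (List (U.F × ℕ) →₀ k) :=
  Finsupp.lmapDomain k k (List.map (Prod.map (fiberVal P μ) id)) ∘ₗ hat k (P.fiber μ) j

lemma fiberHat_single (μ : V.F) (x : SeqElt (P.fiber μ) j) :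
    fiberHat k P μ j (Finsupp.single x 1) = sg k x.eta •
      Finsupp.single (x.word.map fun p => (p.1.1, p.2)) 1 := by
  rw [fiberHat, LinearMap.comp_apply, hat_single, Finsupp.lmapDomain_apply,
    Finsupp.mapDomain_single, one_mul, Finsupp.smul_single, smul_eq_mul, mul_one]
  rfl

/-- The sign that relates compositions of elements of given degrees to compositions of words. -/
def degSign (P : U.Hom V) (a : V.F → ℤ) (b : ℤ) : ZMod 2 :=
  ∑ μ, (SeqElt.rank μ + before P μ) * (a μ : ZMod 2) +
    (b : ZMod 2) * (Fintype.card U.F + Fintype.card V.F) + homSign P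

/-- On homogeneous arguments the sign between the composition of generators and that of words is
global: besides the sign of `y`, only degrees and the map of disks enter. -/
lemma hat_multi (y : SeqElt V j) (F : ∀ μ, SeqElt (P.fiber μ) (y.n μ) →₀ k) (a : V.F → ℤ)
    (hF : ∀ μ, F μ ∈ Finsupp.supported k k {x | x.deg = a μ}) :
    hat k U j (multi (compTerm k P y) F) = sg k (degSign P a y.deg + y.eta) •
      compM k j y.word fun μ => fiberHat k P μ (y.n μ) (F μ) := by
  refine multilinear_ext (L := (hat k U j).compMultilinearMap (multi (compTerm k P y)))
    (L' := sg k (degSign P a y.deg + y.eta) • (compM k j y.word).compLinearMap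
      fun μ => fiberHat k P μ (y.n μ)) _ hF fun x hx => ?_
  rw [LinearMap.compMultilinearMap_apply, multi_single, smul_apply,
    MultilinearMap.compLinearMap_apply, compTerm, hat_single]
  simp only [fiberHat_single]
  rw [MultilinearMap.map_smul_univ, prod_sg, sg_smul_smul, word_comp, ← sg_add]
  have h := compSign_add_eta y x
  have h1 : compM k j y.word (fun μ => Finsupp.single ((x μ).word.map fun p => (p.1.1, p.2)) 1) =
      Finsupp.single (compWord y.word (fiberWord x)) (sg k (wSign j y.word (fiberWord x))) :=
    multi_single _ _
  have h2 : ∑ μ, (SeqElt.rank μ + before P μ) * ((x μ).deg : ZMod 2) =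
      ∑ μ, (SeqElt.rank μ + before P μ) * (a μ : ZMod 2) :=
    Finset.sum_congr rfl fun μ _ => by rw [show (x μ).deg = a μ from hx μ]
  rw [h1, Finsupp.smul_single, smul_eq_mul, ← sg_add]
  congr 2
  rw [h2] at h
  rw [degSign]
  have e2 : (2 : ZMod 2) = 0 := by decide
  linear_combination h - (y.eta + ∑ μ, (x μ).eta) * e2

lemma fiberHat_whisker (μ : V.F) (x : SeqElt (P.fiber μ) 0) :
    fiberHat k P μ j (whisker k _ (Finsupp.single x 1) j) =
      sg k x.eta • stretch k (x.pts.map fun z => z.1.1) j := by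
  rw [fiberHat, LinearMap.comp_apply, hat_whisker_single, map_smul, Finsupp.lmapDomain_apply,
    ← stretch_map_letters, List.map_map]
  rfl

lemma hat_condComp_whisker (x : ∀ μ, SeqElt (P.fiber μ) 0) (g : SeqElt V j →₀ k) (b : ℤ)
    (hg : g ∈ Finsupp.supported k k {y | y.deg = b}) :
    hat k U j (condComp P (fun μ => whisker k _ (Finsupp.single (x μ) 1)) g) =
      sg k (degSign P (fun μ => (x μ).deg) b + ∑ μ, (x μ).eta) •
        compStretchL k j (fun μ => (x μ).pts.map fun z => z.1.1) (hat k V j g) := by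
  rw [← condCompL_apply]
  refine linear_ext (L := hat k U j ∘ₗ condCompL P _ j) (L' := sg k _ • compStretchL k j _ ∘ₗ
    hat k V j) hg fun y hy => ?_
  rw [LinearMap.comp_apply, LinearMap.smul_apply, LinearMap.comp_apply, condCompL_apply,
    condComp_single, one_smul, hat_multi P y _ (fun μ => (x μ).deg) fun μ =>
      whisker_mem (Finsupp.single_mem_supported k _ rfl) _]
  simp only [fiberHat_whisker]
  rw [MultilinearMap.map_smul_univ, prod_sg, hat_single, one_mul, ← mul_one (sg k y.eta),
    ← smul_eq_mul, ← Finsupp.smul_single, map_smul, compStretchL_single, sg_smul_smul,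
    sg_smul_smul, show y.deg = b from hy, compStretch]
  have h : inputs k (fun μ => (x μ).pts.map fun z => z.1.1) y.word =
      fun μ => stretch k ((x μ).pts.map fun z => z.1.1) (y.n μ) := by
    funext μ
    rw [inputs, cnt, y.count_word, Nat.add_sub_cancel]
  rw [h, add_right_comm]

/-- The composition as a multilinear map of the factors on the fibres. -/
noncomputable def condCompM (P : U.Hom V) (g : SeqElt V j →₀ k) :
    MultilinearMap k (fun μ : V.F => ∀ j, SeqElt (P.fiber μ) j →₀ k) (SeqElt U j →₀ k) :=
  MultilinearMap.mk' (fun f => condComp P f g) (fun f μ X Y => condComp_update_add P f μ X Y g)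
    fun f μ c X => condComp_update_smul P f μ c X g

/-- The whiskering map respects compositions. -/
lemma whisker_condComp (α : ∀ μ, SeqElt (P.fiber μ) 0 →₀ k) (β : SeqElt V 0 →₀ k) (b : ℤ)
    (hβ : β ∈ Finsupp.supported k k {y | y.deg = b}) (j : ℕ) :
    whisker k U (condComp P (fun μ => whisker k _ (α μ)) β) j =
      condComp P (fun μ => whisker k _ (α μ)) (whisker k V β j) := by
  refine multilinear_ext
    (L := (whiskerAt k U j).compMultilinearMap ((condCompM P β).compLinearMap
      fun μ => whisker k (P.fiber μ)))
    (L' := (condCompM P (whisker k V β j)).compLinearMap fun μ => whisker k (P.fiber μ))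
    (fun _ => Set.univ) (fun μ => by simp) fun x _ => ?_
  change whisker k U (condComp P (fun μ => whisker k _ (Finsupp.single (x μ) 1)) β) j =
    condComp P (fun μ => whisker k _ (Finsupp.single (x μ) 1)) (whisker k V β j)
  apply hat_injective
  rw [hat_whisker, hat_condComp_whisker P x β b hβ,
    hat_condComp_whisker P x _ b (whisker_mem hβ j), map_smul, map_smul, hat_whisker]
  -- `w` preserves degrees, so both sides carry the same sign; what remains is the statement about
  -- words.
  congr 1
  refine linear_ext
    (L := stretchL k j ∘ₗ lettersL k ∘ₗ compStretchL k 0 _ ∘ₗ hat k V 0)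
    (L' := compStretchL k j _ ∘ₗ stretchL k j ∘ₗ lettersL k ∘ₗ hat k V 0)
    (S := Set.univ) (f := β) (by simp) fun y _ => ?_
  simp only [LinearMap.comp_apply]
  rw [hat_single, one_mul, ← mul_one (sg k y.eta), ← smul_eq_mul, ← Finsupp.smul_single]
  simp only [map_smul]
  rw [compStretchL_single, y.word_zero, stretchL_compStretch, lettersL, Finsupp.lmapDomain_apply,
    Finsupp.mapDomain_single, List.map_map, stretchL_single, one_smul]
  congr 3
  exact (List.map_id _).symm

end comp
end Breq

namespace Breq

/-! ### The operads and the map between them -/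

section final

variable {k : Type*} [Field k] {U V : Disk} {j : ℕ}

lemma simplicialD_mem {f : SeqElt U j →₀ k} {m : ℤ}
    (hf : f ∈ Finsupp.supported k k {x : SeqElt U j | x.deg = m}) :
    simplicialD k U j f ∈ Finsupp.supported k k {x : SeqElt U j | x.deg = m + 1} := by
  rw [simplicialD, Finsupp.linearCombination_apply]
  refine Submodule.sum_mem _ fun x hx => Submodule.smul_mem _ _ (Submodule.sum_mem _ fun ν _ =>
    Submodule.sum_mem _ fun i _ => ?_)
  split_ifs with h
  · refine Finsupp.single_mem_supported k _ ?_
    change (x.face ν i h).deg = m + 1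
    rw [x.deg_face, show x.deg = m from hf hx]
  · exact Submodule.zero_mem _

lemma cosimplicialD_mem {f : SeqElt U j →₀ k} {m : ℤ}
    (hf : f ∈ Finsupp.supported k k {x : SeqElt U j | x.deg = m}) :
    cosimplicialD k U j f ∈ Finsupp.supported k k {x : SeqElt U (j + 1) | x.deg = m + 1} := by
  rw [cosimplicialD, Finsupp.linearCombination_apply]
  refine Submodule.sum_mem _ fun x hx => Submodule.smul_mem _ _ (Submodule.sum_mem _ fun i _ => ?_)
  refine Finsupp.single_mem_supported k _ ?_
  change (x.coface i).deg = m + 1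
  rw [x.deg_coface, show x.deg = m from hf hx]

lemma condD_mem {f : ∀ j, SeqElt U j →₀ k} {m : ℤ}
    (hf : ∀ j, f j ∈ Finsupp.supported k k {x | x.deg = m}) (j : ℕ) :
    condD k U f j ∈ Finsupp.supported k k {x | x.deg = m + 1} := by
  rw [condD_apply]
  refine Submodule.add_mem _ (simplicialD_mem (hf j)) ?_
  cases j with
  | zero => exact Submodule.zero_mem _
  | succ j => exact cosimplicialD_mem (hf j)

lemma relabel_mem (e : U.Iso V) {f : SeqElt U j →₀ k} {m : ℤ}
    (hf : f ∈ Finsupp.supported k k {x : SeqElt U j | x.deg = m}) :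
    Finsupp.mapDomain (SeqElt.relabel e) f ∈
      Finsupp.supported k k {x : SeqElt V j | x.deg = m} := by
  rw [Finsupp.mapDomain]
  refine Submodule.sum_mem _ fun x hx => Finsupp.single_mem_supported k _ ?_
  exact (SeqElt.deg_relabel e x).trans (hf hx)

/-- Over `[0]` nothing is inserted. Therefore an identity in `Breq` can be read off from the
component in `[0]` of an identity between whiskered elements. -/
lemma whisker_zero (f : SeqElt U 0 →₀ k) : whisker k U f 0 = f := by
  apply hat_injective
  rw [hat_whisker]
  refine linear_ext (L := stretchL k 0 ∘ₗ lettersL k ∘ₗ hat k U 0) (L' := hat k U 0)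
    (S := Set.univ) (by simp) fun x _ => ?_
  rw [LinearMap.comp_apply, LinearMap.comp_apply, hat_single, lettersL, Finsupp.lmapDomain_apply,
    Finsupp.mapDomain_single, stretchL_single, x.word_fst, stretch_zero, x.word_zero,
    Finsupp.smul_single, smul_eq_mul, mul_one]

lemma mem_pi_supported {f : ∀ j, SeqElt U j →₀ k} {m : ℤ} :
    f ∈ (condSeq k).gr U m ↔ ∀ j, f j ∈ Finsupp.supported k k {x : SeqElt U j | x.deg = m} :=
  ⟨fun h j => h j (Set.mem_univ _), fun h j _ => h j⟩

lemma sg_sum_intCast {I : Type*} (s : Finset I) (a : I → ℤ) :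
    (-1 : k) ^ (∑ i ∈ s, a i) = sg k (∑ i ∈ s, (a i : ZMod 2)) := by
  rw [neg_one_zpow_eq_sg, Int.cast_sum]

lemma neg_one_zpow_assoc {S Q : Disk} (ρ : S.Hom Q) (a : S.F → ℤ) (b : Q.F → ℤ) :
    (-1 : k) ^ (∑ s, ∑ s' with s < s' ∧ ρ.f s' < ρ.f s, a s * a s'
        + ∑ q, ∑ s with q < ρ.f s, b q * a s) =
      sg k (∑ s, ∑ s', iv (s < s' ∧ ρ.f s' < ρ.f s) * ((a s : ZMod 2) * (a s' : ZMod 2)) +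
        ∑ q, ∑ s, iv (q < ρ.f s) * ((b q : ZMod 2) * (a s : ZMod 2))) := by
  rw [neg_one_zpow_eq_sg]
  simp only [Int.cast_add, Int.cast_sum, Int.cast_mul, sum_filter_iv]

lemma mapDomain_relabel_trans {W : Disk} (e : U.Iso V) (f : V.Iso W) (x : SeqElt U j →₀ k) :
    Finsupp.mapDomain (SeqElt.relabel (e.trans f)) x =
      Finsupp.mapDomain (SeqElt.relabel f) (Finsupp.mapDomain (SeqElt.relabel e) x) :=
  Finsupp.mapDomain_comp (f := SeqElt.relabel (j := j) e) (g := SeqElt.relabel f)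

section condSeq

variable (P : U.Hom V) (α : ∀ μ, ∀ j, SeqElt (P.fiber μ) j →₀ k)

lemma condComp_update_smul_self (μ : V.F) (c : k) (g : SeqElt V j →₀ k) :
    condComp P (Function.update α μ (c • α μ)) g = c • condComp P α g := by
  rw [condComp_update_smul, Function.update_eq_self]

lemma condComp_add (g g' : SeqElt V j →₀ k) :
    condComp P α (g + g') = condComp P α g + condComp P α g' := by
  simp only [← condCompL_apply, map_add]

lemma condComp_smul (c : k) (g : SeqElt V j →₀ k) :
    condComp P α (c • g) = c • condComp P α g := by
  simp only [← condCompL_apply, map_smul]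

/-- The composition of the condensation is a map of complexes. -/
lemma condD_comp (β : ∀ j, SeqElt V j →₀ k) (a : V.F → ℤ) (b : ℤ)
    (hα : ∀ μ j, α μ j ∈ Finsupp.supported k k {x | x.deg = a μ})
    (hβ : ∀ j, β j ∈ Finsupp.supported k k {x | x.deg = b}) :
    condD k U (fun j => condComp P α (β j)) =
      ∑ μ, ((-1 : k) ^ (∑ μ' with μ' < μ, a μ')) •
          (fun j => condComp P (Function.update α μ (condD k _ (α μ))) (β j))
        + ((-1 : k) ^ (∑ μ, a μ)) • fun j => condComp P α (condD k V β j) := by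
  funext j
  rw [condD_condComp P α β a b hα hβ j, Pi.add_apply, Finset.sum_apply]
  simp only [sg_sum_intCast, Pi.smul_apply]

lemma condComp_condComp {T S Q : Disk} (σ : T.Hom S) (ρ : S.Hom Q)
    (α : ∀ s, ∀ j, SeqElt (σ.fiber s) j →₀ k) (β : ∀ q, ∀ j, SeqElt (ρ.fiber q) j →₀ k)
    (γ : ∀ j, SeqElt Q j →₀ k) (a : S.F → ℤ) (b : Q.F → ℤ)
    (hα : ∀ s j, α s j ∈ Finsupp.supported k k {x | x.deg = a s})
    (hβ : ∀ q j, β q j ∈ Finsupp.supported k k {x | x.deg = b q}) :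
    (fun j => condComp σ α (condComp ρ β (γ j))) =
      ((-1 : k) ^ (∑ s, ∑ s' with s < s' ∧ ρ.f s' < ρ.f s, a s * a s'
          + ∑ q, ∑ s with q < ρ.f s, b q * a s)) •
      fun j => condComp (σ.comp ρ) (fun q j => condComp (σ.restrict ρ q)
        (fun s j => Finsupp.mapDomain (SeqElt.relabel (σ.restrictFiberIso ρ q s)) (α s.1 j))
        (β q j)) (γ j) := by
  funext j
  rw [neg_one_zpow_assoc]
  exact condComp_assoc σ ρ α β (γ j) a b hα hβ

end condSeq

section breq

variable (P : U.Hom V) (α : ∀ μ, SeqElt (P.fiber μ) 0 →₀ k)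

/-- The composition of `Breq`. -/
noncomputable def breqComp (β : SeqElt V 0 →₀ k) : SeqElt U 0 →₀ k :=
  condComp P (fun μ => whisker k _ (α μ)) β

lemma whisker_update (μ : V.F) (x : SeqElt (P.fiber μ) 0 →₀ k) :
    (fun κ => whisker k _ (Function.update α μ x κ)) =
      Function.update (fun κ => whisker k _ (α κ)) μ (whisker k _ x) := by
  funext κ
  by_cases h : κ = μ
  · subst h
    simp
  · simp [h]

lemma breqComp_update_add (β : SeqElt V 0 →₀ k) (μ : V.F) (x y : SeqElt (P.fiber μ) 0 →₀ k) :
    breqComp P (Function.update α μ (x + y)) β = breqComp P (Function.update α μ x) β +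
      breqComp P (Function.update α μ y) β := by
  rw [breqComp, breqComp, breqComp, whisker_update, whisker_update, whisker_update, map_add,
    condComp_update_add]

lemma breqComp_update_smul (β : SeqElt V 0 →₀ k) (μ : V.F) (c : k) :
    breqComp P (Function.update α μ (c • α μ)) β = c • breqComp P α β := by
  rw [breqComp, whisker_update, map_smul, condComp_update_smul, Function.update_eq_self, breqComp]

/-- The composition of `Breq` is a map of complexes. -/
lemma simplicialD_breqComp (β : SeqElt V 0 →₀ k) (a : V.F → ℤ) (b : ℤ)
    (hα : ∀ μ, α μ ∈ Finsupp.supported k k {x : SeqElt (P.fiber μ) 0 | x.deg = a μ})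
    (hβ : β ∈ Finsupp.supported k k {x : SeqElt V 0 | x.deg = b}) :
    simplicialD k U 0 (breqComp P α β) =
      ∑ μ, ((-1 : k) ^ (∑ μ' with μ' < μ, a μ')) •
          breqComp P (Function.update α μ (simplicialD k _ 0 (α μ))) β
        + ((-1 : k) ^ (∑ μ, a μ)) • breqComp P α (simplicialD k V 0 β) := by
  -- The component in `[0]` of the Leibniz rule of the condensation for whiskered elements: there
  -- the cosimplicial part is absent and `w` is the identity.
  have h := condD_condComp P (fun μ => whisker k _ (α μ)) (whisker k _ β) a b
    (fun μ => whisker_mem (hα μ)) (whisker_mem hβ) 0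
  simp only [condD_apply _ 0, cosPart, add_zero, whisker_zero] at h
  rw [breqComp, h]
  simp only [sg_sum_intCast, breqComp, whisker_update, whisker_simplicialD]

lemma breqComp_relabel {U' V' : Disk} (e : U.Iso U') (f : V.Iso V') (P : U.Hom V) (P' : U'.Hom V')
    (h : ∀ x, P'.f (e.e x) = f.e (P.f x)) (α : ∀ μ, SeqElt (P.fiber μ) 0 →₀ k)
    (α' : ∀ μ, SeqElt (P'.fiber μ) 0 →₀ k) (hα : ∀ μ, α' (f.e μ) =
      Finsupp.mapDomain (SeqElt.relabel (Disk.Iso.fiberIso e f P P' h μ)) (α μ))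
    (β : SeqElt V 0 →₀ k) : breqComp P' α' (Finsupp.mapDomain (SeqElt.relabel f) β) =
      Finsupp.mapDomain (SeqElt.relabel e) (breqComp P α β) := by
  refine condComp_relabel e f P P' h _ _ (fun μ j => ?_) β
  rw [hα, whisker_relabel]

lemma breqComp_unit (β : SeqElt V 0 →₀ k) : breqComp (Disk.Hom.id V) (fun μ =>
    Finsupp.mapDomain (SeqElt.relabel (V.idFiberIso μ)) (Finsupp.single (SeqElt.unit 0) 1)) β =
      β := by
  rw [breqComp]
  have h : (fun μ => whisker k _ (Finsupp.mapDomain (SeqElt.relabel (V.idFiberIso μ))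
      (Finsupp.single (SeqElt.unit 0) 1))) = fun μ j => Finsupp.mapDomain
        (SeqElt.relabel (V.idFiberIso μ)) (Finsupp.single (SeqElt.unit j) 1) := by
    funext μ j
    rw [whisker_relabel, whisker_unit]
  rw [h, condComp_unit]

lemma unit_breqComp (α : SeqElt U 0 →₀ k) : breqComp (Disk.Hom.toPt U) (fun μ =>
    Finsupp.mapDomain (SeqElt.relabel (U.toPtFiberIso μ)) α)
      (Finsupp.single (SeqElt.unit 0) 1) = α := by
  rw [breqComp]
  have h : (fun μ => whisker k _ (Finsupp.mapDomain (SeqElt.relabel (U.toPtFiberIso μ)) α)) =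
      fun μ j => Finsupp.mapDomain (SeqElt.relabel (U.toPtFiberIso μ)) (whisker k U α j) := by
    funext μ j
    rw [whisker_relabel]
  rw [h, unit_condComp, whisker_zero]

/-- This is associativity in the condensation for whiskered elements. The inner composites on the
right are whiskered once more, and by `whisker_condComp` the whiskering of a composite is the
composite of the whiskered factors. -/
lemma breqComp_breqComp {T S Q : Disk} (σ : T.Hom S) (ρ : S.Hom Q)
    (α : ∀ s, SeqElt (σ.fiber s) 0 →₀ k) (β : ∀ q, SeqElt (ρ.fiber q) 0 →₀ k)
    (γ : SeqElt Q 0 →₀ k) (a : S.F → ℤ) (b : Q.F → ℤ)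
    (hα : ∀ s, α s ∈ Finsupp.supported k k {x : SeqElt (σ.fiber s) 0 | x.deg = a s})
    (hβ : ∀ q, β q ∈ Finsupp.supported k k {x : SeqElt (ρ.fiber q) 0 | x.deg = b q}) :
    breqComp σ α (breqComp ρ β γ) =
      ((-1 : k) ^ (∑ s, ∑ s' with s < s' ∧ ρ.f s' < ρ.f s, a s * a s'
          + ∑ q, ∑ s with q < ρ.f s, b q * a s)) •
      breqComp (σ.comp ρ) (fun q => breqComp (σ.restrict ρ q)
        (fun s => Finsupp.mapDomain (SeqElt.relabel (σ.restrictFiberIso ρ q s)) (α s.1))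
        (β q)) γ := by
  rw [neg_one_zpow_assoc, breqComp, breqComp, condComp_assoc σ ρ (fun s => whisker k _ (α s))
    (fun q => whisker k _ (β q)) γ a b (fun s => whisker_mem (hα s)) fun q => whisker_mem (hβ q),
    breqComp]
  have h : (fun q => whisker k _ (breqComp (σ.restrict ρ q)
      (fun s => Finsupp.mapDomain (SeqElt.relabel (σ.restrictFiberIso ρ q s)) (α s.1)) (β q))) =
      fun q j => condComp (σ.restrict ρ q) (fun s j => Finsupp.mapDomain
        (SeqElt.relabel (σ.restrictFiberIso ρ q s)) (whisker k _ (α s.1) j))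
        (whisker k _ (β q) j) := by
    funext q j
    rw [breqComp, whisker_condComp _ _ _ (b q) (hβ q) j]
    congr 1
    funext s i
    exact whisker_relabel _ _ _
  rw [h]

end breq

variable (k)

/-- The condensation `|seq|` is a dg 2-operad. -/
theorem condSeq_isDGTwoOperad : (condSeq k).IsDGTwoOperad where
  d_mem U m x hx := mem_pi_supported.2 (condD_mem (mem_pi_supported.1 hx))
  d_d U m x _ := condD_condD x
  relabel_mem e m x hx := mem_pi_supported.2 fun j => relabel_mem e (mem_pi_supported.1 hx j)
  relabel_d e m x _ := funext (condD_relabel e x)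
  relabel_refl U m x _ := funext fun j => Finsupp.mapDomain_id
  relabel_trans e f m x _ := funext fun j => mapDomain_relabel_trans e f (x j)
  one_mem := mem_pi_supported.2 fun j => Finsupp.single_mem_supported k _ (SeqElt.deg_unit j)
  d_one := funext condD_one
  comp_mem P α β a b hα hβ := mem_pi_supported.2 fun j => condComp_mem P α (β j) a b
    (fun μ => mem_pi_supported.1 (hα μ)) (mem_pi_supported.1 hβ j)
  comp_add_left P α β a b _ _ μ x _ y _ := funext fun j => condComp_update_add P α μ x y (β j)
  comp_smul_left P α β a b _ _ μ c := funext fun j => condComp_update_smul_self P α μ c (β j)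
  comp_add_right P α β β' a b _ _ _ := funext fun j => condComp_add P α (β j) (β' j)
  comp_smul_right P α β a b _ _ c := funext fun j => condComp_smul P α c (β j)
  d_comp P α β a b hα hβ := condD_comp P α β a b (fun μ => mem_pi_supported.1 (hα μ))
    (mem_pi_supported.1 hβ)
  comp_relabel e f P P' h α α' β a b _ _ hα := funext fun j =>
    condComp_relabel e f P P' h α α' (fun μ j => congrFun (hα μ) j) (β j)
  comp_one V b β _ := funext fun j => condComp_unit (β j)
  one_comp U a α _ := funext fun j => unit_condComp α j
  comp_assoc σ ρ α β γ a b c hα hβ _ := condComp_condComp σ ρ α β γ a b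
    (fun s => mem_pi_supported.1 (hα s)) fun q => mem_pi_supported.1 (hβ q)

/-- The complexes `Breq(U)` form a dg 2-operad. -/
theorem breq_isDGTwoOperad : (breq k).IsDGTwoOperad where
  d_mem U m x hx := simplicialD_mem hx
  d_d U m x _ := simplicialD_simplicialD x
  relabel_mem e m x hx := relabel_mem e hx
  relabel_d e m x _ := simplicialD_relabel e x
  relabel_refl U m x _ := Finsupp.mapDomain_id
  relabel_trans e f m x _ := mapDomain_relabel_trans e f x
  one_mem := Finsupp.single_mem_supported k _ (SeqElt.deg_unit 0)
  d_one := by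
    have h := condD_one (k := k) 0
    rwa [condD_apply, cosPart, add_zero] at h
  comp_mem P α β a b hα hβ := condComp_mem P _ β a b (fun μ => whisker_mem (hα μ)) hβ
  comp_add_left P α β a b _ _ μ x _ y _ := breqComp_update_add P α β μ x y
  comp_smul_left P α β a b _ _ μ c := breqComp_update_smul P α β μ c
  comp_add_right P α β β' a b _ _ _ := condComp_add P _ β β'
  comp_smul_right P α β a b _ _ c := condComp_smul P _ c β
  d_comp P α β a b hα hβ := simplicialD_breqComp P α β a b hα hβ
  comp_relabel e f P P' h α α' β a b _ _ hα := breqComp_relabel e f P P' h α α' hα β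
  comp_one V b β _ := breqComp_unit β
  one_comp U a α _ := unit_breqComp α
  comp_assoc σ ρ α β γ a b c hα hβ _ := breqComp_breqComp σ ρ α β γ a b hα hβ

/-- The whiskering map is a map of dg 2-operads. -/
theorem whisker_isDGTwoOperadMap : IsDGTwoOperadMap (breq k) (condSeq k) (whisker k) where
  map_mem U m x hx := mem_pi_supported.2 (whisker_mem hx)
  map_d U m x _ := whisker_simplicialD x
  map_relabel e m x _ := funext (whisker_relabel e x)
  map_one := whisker_unit
  map_comp P α β a b _ hβ := funext (whisker_condComp P α β b hβ)

end final
end Breq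

/-- The complexes `|seq|(U)` and `Breq(U)` with their units and compositions are dg 2-operads, and
the whiskering map is a map of dg 2-operads: on every disk it is a map of complexes, and it is
compatible with units and with the operadic compositions. -/
theorem mainTheorem4 (k : Type*) [Field k] [CharZero k] :
    (Breq.condSeq k).IsDGTwoOperad ∧ (Breq.breq k).IsDGTwoOperad ∧
      Breq.IsDGTwoOperadMap (Breq.breq k) (Breq.condSeq k) (Breq.whisker k) :=
  ⟨Breq.condSeq_isDGTwoOperad k, Breq.breq_isDGTwoOperad k, Breq.whisker_isDGTwoOperadMap k⟩
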